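/- Let $d\ge 3$ be an integer, $a_c=\frac{d-2}2$, and let $\Theta=\{(a,b)\in\mathbb R^2:\ a\le b\le a+1,\ a<a_c\}$. For $(a,b)\in\Theta$ put $$p=\frac{2d}{d-2+2(b-a)},\qquad n=\frac{d}{1+a-b},\qquad \alpha=1+a-\frac{pb}2,$$ and assume $\alpha>0$ (equivalently $b<a+1$). On $\mathbb R^d\setminus\{0\}$ consider the finite measure and the carré du champ operator of the spherical Caffarelli–Kohn–Nirenberg space, $$d\bar\mu=2^n\frac{|x|^{-bp}}{(1+|x|^{2\alpha})^n}\,dx,\qquad \bar\Gamma(f)=|x|^{2(1-\alpha)}\frac{(1+|x|^{2\alpha})^2}{4}|\nabla f|^2,$$ let $\mu$ be $\bar\mu$ normalized to a probability measure, and let $H^1$ be the space of $f\in L^2(\mu)$ having a weak gradient on $\mathbb R^d\setminus\{0\}$ with $\int\bar\Gamma(f)\,d\mu<\infty$. Let $b_{FS}(a)=\frac{d(a_c-a)}{2\sqrt{(a_c-a)^2+d-1}}-(a_c-a)$; one says that $(a,b)\in\Theta$ satisfies the Felli–Schneider condition if $b\ge b_{FS}(a)$ whenever $b\le 0$. Then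 the Felli–Schneider condition is equivalent to $\alpha^2\le\frac{d-1}{n-1}$, and the Poincaré inequality $$\int f^2\,d\mu-\Big(\int f\,d\mu\Big)^2\le \frac1{n\alpha^2}\int\bar\Gamma(f)\,d\mu\qquad\text{for all } f\in H^1\qquad(\ast)$$ holds if and only if the Felli–Schneider condition holds; in that case $\frac1{n\alpha^2}$ is the optimal (smallest possible) constant. In addition, for $f\in H^1$: * if $\alpha^2<\frac{d-1}{n-1}$, equality holds in $(\ast)$ if and only if, for some constants $\lambda,\kappa\in\mathbb R$, $f(x)=\lambda+\kappa\tanh(\alpha\ln|x|)$ for almost every $x$; * if $\alpha^2=\frac{d-1}{n-1}$, equality holds in $(\ast)$ if and only if, for some constants $\lambda,\kappa,\nu\in\mathbb R$ and some eigenfunction $\varphi_2$ of $-\Delta_{\mathbb S^{d-1}}$ with eigenvalue $d-1$, $f(x)=\lambda+\kappa\tanh(\alpha\ln|x|)+\nu\,\frac{\varphi_2(x/|x|)}{\cosh(\alpha\ln|x|)}$ for almost every $x$. All these functions belong to $H^1$. -/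

import Mathlib

open scoped ContDiff

noncomputable section

namespace CKN

/-- The Euclidean space of dimension `d`. -/
abbrev E (d : ℕ) : Type := EuclideanSpace ℝ (Fin d)

/-! ### Parameters -/

/-- The critical value `a_c = (d - 2) / 2`. -/
def aCrit (d : ℕ) : ℝ := ((d : ℝ) - 2) / 2

/-- The parameter region `Θ`: pairs with `a ≤ b ≤ a + 1` and `a < a_c`. -/
def Theta (d : ℕ) : Set (ℝ × ℝ) :=
  {q | q.1 ≤ q.2 ∧ q.2 ≤ q.1 + 1 ∧ q.1 < aCrit d}

/-- The critical exponent `p = 2d / (d - 2 + 2(b - a))`. -/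
def pExp (d : ℕ) (a b : ℝ) : ℝ := 2 * (d : ℝ) / ((d : ℝ) - 2 + 2 * (b - a))

/-- The intrinsic dimension `n = d / (1 + a - b)`. -/
def nDim (d : ℕ) (a b : ℝ) : ℝ := (d : ℝ) / (1 + a - b)

/-- The parameter `α = 1 + a - p b / 2`. -/
def alpha (d : ℕ) (a b : ℝ) : ℝ := 1 + a - pExp d a b * b / 2

/-- The Felli-Schneider curve `b_FS`. -/
def bFS (d : ℕ) (a : ℝ) : ℝ :=
  (d : ℝ) * (aCrit d - a) / (2 * Real.sqrt ((aCrit d - a) ^ 2 + (d : ℝ) - 1)) - (aCrit d - a)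

/-- The Felli-Schneider region: the pairs of `Θ` such that `b ≥ b_FS(a)` whenever `b ≤ 0`. -/
def ThetaFS (d : ℕ) : Set (ℝ × ℝ) :=
  {q | q ∈ Theta d ∧ (q.2 ≤ 0 → bFS d q.1 ≤ q.2)}

/-! ### The spherical CKN space

The underlying manifold is `ℝ^d` without the origin. The origin is a null set, so that the measures
are taken on the whole of `ℝ^d`. -/

/-- The density of the reference measure with respect to Lebesgue measure. -/
def density (d : ℕ) (a b : ℝ) (x : E d) : ℝ :=
  2 ^ nDim d a b * (‖x‖ ^ (-(b * pExp d a b)) / (1 + ‖x‖ ^ (2 * alpha d a b)) ^ nDim d a b)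

/-- The reference measure of the spherical CKN space. -/
def muBar (d : ℕ) (a b : ℝ) : MeasureTheory.Measure (E d) :=
  MeasureTheory.volume.withDensity fun x => ENNReal.ofReal (density d a b x)

/-- The normalized reference measure. -/
def mu (d : ℕ) (a b : ℝ) : MeasureTheory.Measure (E d) :=
  (muBar d a b Set.univ)⁻¹ • muBar d a b

/-- The carré du champ of a function with (Euclidean) gradient field `G`, at the point `x`:
`|x|^(2(1-α)) (1+|x|^(2α))² / 4 * |G x|²`. -/
def carre (d : ℕ) (a b : ℝ) (G : E d → E d) (x : E d) : ℝ :=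
  ‖x‖ ^ (2 * (1 - alpha d a b)) * ((1 + ‖x‖ ^ (2 * alpha d a b)) ^ 2 / 4) * ‖G x‖ ^ 2

/-- `G` is the weak (distributional) gradient of `f` on `ℝ^d` without the origin. -/
structure IsWeakGradient {d : ℕ} (f : E d → ℝ) (G : E d → E d) : Prop where
  locInt : MeasureTheory.LocallyIntegrableOn f {0}ᶜ
  locInt_grad : MeasureTheory.LocallyIntegrableOn G {0}ᶜ
  by_parts : ∀ ψ : E d → ℝ, ContDiff ℝ ∞ ψ → HasCompactSupport ψ → tsupport ψ ⊆ {0}ᶜ →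
    ∀ v : E d, ∫ x, f x * fderiv ℝ ψ x v = -∫ x, inner ℝ (G x) v * ψ x

/-- `f` belongs to the Sobolev space `H¹` of the spherical CKN space, with gradient `G`. -/
structure IsH1 (d : ℕ) (a b : ℝ) (f : E d → ℝ) (G : E d → E d) : Prop where
  memLp : MeasureTheory.MemLp f 2 (mu d a b)
  weakGradient : IsWeakGradient f G
  integrable_carre : MeasureTheory.Integrable (carre d a b G) (mu d a b)

/-- The variance `∫ f² dμ - (∫ f dμ)²`. -/
def var (d : ℕ) (a b : ℝ) (f : E d → ℝ) : ℝ :=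
  (∫ x, f x ^ 2 ∂(mu d a b)) - (∫ x, f x ∂(mu d a b)) ^ 2

/-- The Poincaré inequality with constant `C`, on `H¹`. -/
def Poincare (d : ℕ) (a b C : ℝ) : Prop :=
  ∀ (f : E d → ℝ) (G : E d → E d), IsH1 d a b f G →
    var d a b f ≤ C * ∫ x, carre d a b G x ∂(mu d a b)

/-- `f` is an element of `H¹` for which the Poincaré inequality with constant `C` is an equality. -/
def IsExtremal (d : ℕ) (a b C : ℝ) (f : E d → ℝ) : Prop :=
  ∃ G : E d → E d, IsH1 d a b f G ∧
    var d a b f = C * ∫ x, carre d a b G x ∂(mu d a b)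

/-! ### Eigenfunctions of the Laplace-Beltrami operator of the unit sphere -/

/-- The function `x ↦ φ (x / |x|)` (with the value `0` at the origin). -/
def homExt {d : ℕ} (φ : Metric.sphere (0 : E d) 1 → ℝ) (x : E d) : ℝ :=
  open Classical in
  if h : x ≠ 0 then φ ⟨‖x‖⁻¹ • x, by simp [norm_smul, h]⟩ else 0

/-- The Laplace-Beltrami operator of the round unit sphere: the restriction to the sphere of the
Euclidean Laplacian of the extension that is constant along rays. -/
def sphereLaplacian {d : ℕ} (φ : Metric.sphere (0 : E d) 1 → ℝ) (y : Metric.sphere (0 : E d) 1) :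
    ℝ :=
  Laplacian.laplacian (homExt φ) (y : E d)

/-- `φ` is a (smooth, nonzero) eigenfunction of `-Δ` on the unit sphere, with eigenvalue `l`. -/
structure IsSphereEigenfunction {d : ℕ} (φ : Metric.sphere (0 : E d) 1 → ℝ) (l : ℝ) : Prop where
  smooth : ContDiffOn ℝ ∞ (homExt φ) {0}ᶜ
  ne_zero : φ ≠ 0
  eigen : ∀ y, -sphereLaplacian φ y = l * φ y

end CKN

end

open scoped ContDiff

noncomputable section

namespace CKN

/-! ### Algebra of the parameters and of the Felli–Schneider curve. -/

open MeasureTheory Filter Topology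

/-! In the coordinates t = α ln |x|, y = x/|x| the space becomes the cylinder ℝ × S^(d-1). Because α
n = d - b p, the measure μ is proportional to cosh^(-n) t dt dσ(y), and the carré du champ becomes
cosh² t (α² f_t² + |∇_y f|²); see `integral_mu` and `carre_polarPt`. What must be understood is the
quadratic form `deficit`, the energy minus n α² times the variance, on the spherical mean, on the
degree-one harmonics and on the rest.

On the spherical mean, the form ∫ cosh^(2-n) u'² relative to ∫ cosh^(-n) u² has eigenvalues 0, n and
2(n+1), with eigenfunctions 1, tanh and tanh² - 1/(n+1). `line_spectral_gap` proves the gap above n: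
after subtraction of a combination of 1 and tanh, u vanishes at the two zeros of the third
eigenfunction, and completing the square with that function gives the constant 2(n+1)
(`groundState_le`).

On the part of mean zero over the spheres, completing the square with 1/cosh turns the deficit into
α² ∫ cosh^(2-n) (f_t + tanh t f)² plus the weighted spherical energy minus α²(n-1) times the
weighted spherical norm. The spherical Poincaré constant is d-1, so this is nonnegative as soon as
α²(n-1) ≤ d-1. In the limiting case it vanishes exactly on φ/cosh with φ of degree one.

The spherical inequality comes with a remainder that measures the distance to affine functions
(`sphere_poincare`). It is the Gaussian Poincaré inequality for the 1-homogeneous extension of a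
function of the sphere. The Gaussian inequality is obtained by rotating one of two independent
Gaussian vectors into the other, and its remainder from comparing complementary angles. The
remainder constant d/8 is not sharp; only its positivity matters.

Put together in `cylinder_gap`, these bound the deficit below by a nonnegative multiple of the
squared distance to the expected extremals. The multiple is positive in the case where it is used,
so inequality and equality cases follow at once, and the bound is stable under limits. It extends
from test functions to H¹ by logarithmic cutoffs and mollification. The cutoff error is controlled
by a Hardy inequality, available because n > 2 (`IsH1.exists_approx`).

Conversely, `deficit_extremalFn` evaluates the deficit on the explicit candidates. The function
tanh(α ln |x|) has deficit zero, hence no smaller constant is possible. The functions ⟨q,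
x/|x|⟩/cosh(α ln |x|) have a deficit with the sign of d - 1 - α²(n-1), hence the inequality fails
outside the Felli–Schneider region. Finally, the remainder on the sphere also identifies the
eigenfunctions with eigenvalue d-1 as the linear functions. -/

/-- On the edge b = a + 1 one has p = 2, hence α = 0, which is excluded; the other bound is a ≤ b.
-/
lemma Theta.basic {d : ℕ} (hd : 3 ≤ d) {a b : ℝ} (hab : (a, b) ∈ Theta d)
    (hα : 0 < alpha d a b) : 0 < 1 + a - b ∧ 1 + a - b ≤ 1 := by
  obtain ⟨h1, h2, h3⟩ := hab
  simp only [aCrit] at h1 h2 h3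
  have hd' : (3 : ℝ) ≤ d := by exact_mod_cast hd
  refine ⟨?_, by linarith⟩
  rcases h2.lt_or_eq with h | h
  · linarith
  · exfalso
    subst h
    have : pExp d a (a + 1) = 2 := by
      unfold pExp
      rw [show (d : ℝ) - 2 + 2 * (a + 1 - a) = d by ring]
      field_simp
    simp only [alpha, this] at hα
    linarith

/-- Writes α in the variables c = 1 + a - b and A = a_c - a, in which the comparison with the
Felli–Schneider curve is polynomial. -/
lemma alpha_eq {d : ℕ} (hd : 3 ≤ d) {a b : ℝ} (hab : (a, b) ∈ Theta d) :
    alpha d a b = 2 * (1 + a - b) * (aCrit d - a) / (d - 2 * (1 + a - b)) := by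
  obtain ⟨h1, h2, h3⟩ := hab
  simp only [aCrit] at h1 h2 h3
  have hd' : (3 : ℝ) ≤ d := by exact_mod_cast hd
  have h4 : (d : ℝ) - 2 + 2 * (b - a) ≠ 0 := by
    apply ne_of_gt; linarith
  have h5 : (d : ℝ) - 2 * (1 + a - b) ≠ 0 := by
    apply ne_of_gt; linarith
  have h6 : (d : ℝ) - 2 * (1 + a - b) = (d : ℝ) - 2 + 2 * (b - a) := by ring
  unfold alpha pExp aCrit
  rw [h6]
  field_simp
  ring

/-- Dividing d by a number in (0, 1] can only increase it. The consequence n > 2 is what makes the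
weights integrable and the Hardy inequality available. -/
lemma nDim_ge {d : ℕ} (hd : 3 ≤ d) {a b : ℝ} (hab : (a, b) ∈ Theta d)
    (hα : 0 < alpha d a b) : (3 : ℝ) ≤ nDim d a b := by
  obtain ⟨h1, h2⟩ := Theta.basic hd hab hα
  have hd' : (3 : ℝ) ≤ d := by exact_mod_cast hd
  unfold nDim
  rw [le_div_iff₀ h1]
  nlinarith

/-- This balance of exponents is what makes the density even in t = α ln |x|: the powers of |x|
combine to e^(n t), which cancels against (1 + e^(2t))^n = (2 e^t cosh t)^n. -/
lemma alpha_mul_nDim {d : ℕ} (hd : 3 ≤ d) {a b : ℝ} (hab : (a, b) ∈ Theta d)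
    (hα : 0 < alpha d a b) : alpha d a b * nDim d a b = d - b * pExp d a b := by
  obtain ⟨hc, hc'⟩ := Theta.basic hd hab hα
  obtain ⟨h1, h2, h3⟩ := hab
  simp only [aCrit] at h1 h2 h3
  have hd' : (3 : ℝ) ≤ d := by exact_mod_cast hd
  have h4 : (d : ℝ) - 2 + 2 * (b - a) ≠ 0 := by
    apply ne_of_gt; linarith
  unfold alpha nDim pExp
  field_simp
  ring

/-- Below the curve `b = a + 1`, the Felli-Schneider curve is the level set
`α² = (d - 1) / (n - 1)`. -/
lemma bFS_le_iff {d : ℕ} (hd : 3 ≤ d) {a b : ℝ} (hab : (a, b) ∈ Theta d)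
    (hα : 0 < alpha d a b) :
    bFS d a ≤ b ↔ alpha d a b ^ 2 ≤ ((d : ℝ) - 1) / (nDim d a b - 1) := by
  obtain ⟨hc, hc'⟩ := Theta.basic hd hab hα
  rw [alpha_eq hd hab]
  obtain ⟨h1, h2, h3⟩ := hab
  simp only at h1 h2 h3
  have hd' : (3 : ℝ) ≤ d := by exact_mod_cast hd
  have hA : 0 < aCrit d - a := by linarith
  have hbA : b = (d : ℝ) / 2 - (1 + a - b) - (aCrit d - a) := by unfold aCrit; ring
  have hn : nDim d a b = d / (1 + a - b) := rfl
  unfold bFS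
  rw [hn]
  generalize aCrit d - a = A at *
  generalize 1 + a - b = c at *
  rw [hbA]
  clear hbA hn h1 h2 h3 hα
  have hX : 0 < A ^ 2 + (d : ℝ) - 1 := by nlinarith
  have hs : 0 < Real.sqrt (A ^ 2 + (d : ℝ) - 1) := Real.sqrt_pos.2 hX
  have hss := Real.sq_sqrt hX.le
  generalize Real.sqrt (A ^ 2 + (d : ℝ) - 1) = s at *
  have hdc : (0 : ℝ) < d - 2 * c := by linarith
  have h1 : (d : ℝ) * A / (2 * s) - A ≤ d / 2 - c - A ↔ d * A ≤ (d - 2 * c) * s := by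
    rw [sub_le_sub_iff_right, div_le_iff₀ (by positivity)]
    constructor <;> intro h <;> nlinarith
  have h2 : (d : ℝ) * A ≤ (d - 2 * c) * s ↔ (d * A) ^ 2 ≤ ((d - 2 * c) * s) ^ 2 :=
    (sq_le_sq₀ (by positivity) (by positivity)).symm
  have h3 : (d : ℝ) / c - 1 = (d - c) / c := by field_simp
  rw [h1, h2, h3, div_pow, div_div_eq_mul_div, div_le_div_iff₀ (by positivity) (by linarith),
    mul_pow (_ - _) s, hss]
  -- After squaring, the two conditions differ by the positive factor c only.
  have key : ((d : ℝ) - 1) * c * (d - 2 * c) ^ 2 - (2 * c * A) ^ 2 * (d - c)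
      = c * ((d - 2 * c) ^ 2 * (A ^ 2 + d - 1) - (d * A) ^ 2) := by ring
  constructor
  · intro h
    have := mul_nonneg hc.le (sub_nonneg.2 h)
    linarith
  · intro h
    have : 0 ≤ c * ((d - 2 * c) ^ 2 * (A ^ 2 + (d : ℝ) - 1) - (d * A) ^ 2) := by linarith
    have := nonneg_of_mul_nonneg_right this hc
    linarith

/-- The curve lies below max(a, 0), and b > 0 lies above it. For a ≤ 0 this is A² + d - 1 ≥ (d/2)²,
valid since A = a_c - a ≥ (d-2)/2. For a ≥ 0 it amounts to A ≤ (d-2)/2. This is why the condition is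
only imposed for b ≤ 0. -/
lemma bFS_le_of_pos {d : ℕ} (hd : 3 ≤ d) {a b : ℝ} (hab : (a, b) ∈ Theta d) (hb : 0 < b) :
    bFS d a ≤ b := by
  obtain ⟨h1, h2, h3⟩ := hab
  simp only at h1 h2 h3
  have hd' : (3 : ℝ) ≤ d := by exact_mod_cast hd
  have hA : 0 < aCrit d - a := by linarith
  have hbd : max a 0 ≤ b := max_le h1 hb.le
  refine le_trans ?_ hbd
  have hX : 0 < (aCrit d - a) ^ 2 + (d : ℝ) - 1 := by nlinarith
  have hs : 0 < Real.sqrt ((aCrit d - a) ^ 2 + (d : ℝ) - 1) := Real.sqrt_pos.2 hX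
  have hss := Real.sq_sqrt hX.le
  unfold bFS
  rw [tsub_le_iff_right, div_le_iff₀ (by positivity)]
  have hac : aCrit d = ((d : ℝ) - 2) / 2 := rfl
  rcases le_total a 0 with ha | ha
  · rw [max_eq_right ha, zero_add]
    have : (d : ℝ) / 2 ≤ Real.sqrt ((aCrit d - a) ^ 2 + (d : ℝ) - 1) := by
      apply Real.le_sqrt_of_sq_le
      rw [hac]; nlinarith
    nlinarith
  · rw [max_eq_left ha]
    have : (d : ℝ) * (aCrit d - a) ≤ (d - 2) * Real.sqrt ((aCrit d - a) ^ 2 + (d : ℝ) - 1) := by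
      refine le_of_sq_le_sq ?_ (by nlinarith)
      rw [mul_pow, mul_pow, hss, hac]
      have h5 : (((d : ℝ) - 2) / 2 - a) ^ 2 ≤ (((d : ℝ) - 2) / 2) ^ 2 := by
        apply pow_le_pow_left₀ <;> linarith
      nlinarith
    rw [hac] at *
    nlinarith

lemma mem_ThetaFS_iff {d : ℕ} (hd : 3 ≤ d) {a b : ℝ} (hab : (a, b) ∈ Theta d)
    (hα : 0 < alpha d a b) :
    (a, b) ∈ ThetaFS d ↔ alpha d a b ^ 2 ≤ ((d : ℝ) - 1) / (nDim d a b - 1) := by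
  rw [← bFS_le_iff hd hab hα]
  constructor
  · rintro ⟨-, h⟩
    rcases le_or_gt b 0 with hb | hb
    · exact h hb
    · exact bFS_le_of_pos hd hab hb
  · exact fun h => ⟨hab, fun _ => h⟩

/-! ### Weighted inequalities on the line -/

/-- The weight `cosh ^ (-N)`. -/
def wt (N t : ℝ) : ℝ := Real.cosh t ^ (-N)

lemma wt_pos (N t : ℝ) : 0 < wt N t := Real.rpow_pos_of_pos (Real.cosh_pos t) _

lemma hasDerivAt_tanh (t : ℝ) : HasDerivAt Real.tanh (1 - Real.tanh t ^ 2) t := by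
  have h := (Real.hasDerivAt_sinh t).div (Real.hasDerivAt_cosh t) (Real.cosh_pos t).ne'
  have h2 : Real.tanh = fun x => Real.sinh x / Real.cosh x := by
    funext x; exact Real.tanh_eq_sinh_div_cosh x
  rw [h2]
  refine h.congr_deriv ?_
  have := (Real.cosh_pos t).ne'
  field_simp

lemma hasDerivAt_wt (N t : ℝ) : HasDerivAt (wt N) (-N * Real.tanh t * wt N t) t := by
  have h := (Real.hasDerivAt_cosh t).rpow_const (p := -N) (Or.inl (Real.cosh_pos t).ne')
  refine h.congr_deriv ?_
  unfold wt
  rw [Real.rpow_sub (Real.cosh_pos t), Real.rpow_one, Real.tanh_eq_sinh_div_cosh]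
  field_simp

lemma continuous_wt (N : ℝ) : Continuous (wt N) :=
  continuous_iff_continuousAt.2 fun t => (hasDerivAt_wt N t).continuousAt

lemma continuous_tanh : Continuous Real.tanh :=
  continuous_iff_continuousAt.2 fun t => (hasDerivAt_tanh t).continuousAt

lemma one_sub_tanh_sq (t : ℝ) : 1 - Real.tanh t ^ 2 = (Real.cosh t ^ 2)⁻¹ := by
  rw [Real.tanh_eq_sinh_div_cosh]
  have := (Real.cosh_pos t).ne'
  have := Real.cosh_sq t
  field_simp
  linarith

lemma tanh_sq_le (t : ℝ) : Real.tanh t ^ 2 ≤ 1 := by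
  have := one_sub_tanh_sq t
  have h : 0 < (Real.cosh t ^ 2)⁻¹ := inv_pos.2 (pow_pos (Real.cosh_pos t) 2)
  linarith

lemma abs_tanh_le (t : ℝ) : |Real.tanh t| ≤ 1 := by
  have := tanh_sq_le t
  rwa [← sq_le_one_iff_abs_le_one]

lemma wt_add (N M t : ℝ) : wt (N + M) t = wt N t * wt M t := by
  unfold wt
  rw [← Real.rpow_add (Real.cosh_pos t)]
  congr 1; ring

lemma wt_two (t : ℝ) : wt 2 t = 1 - Real.tanh t ^ 2 := by
  rw [one_sub_tanh_sq, wt, Real.rpow_neg (Real.cosh_pos t).le]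
  norm_cast

lemma wt_le_of_le {N M : ℝ} (h : M ≤ N) (t : ℝ) : wt N t ≤ wt M t :=
  Real.rpow_le_rpow_of_exponent_le (Real.one_le_cosh t) (neg_le_neg h)

lemma wt_add_two (N t : ℝ) : wt (N + 2) t = wt N t * (1 - Real.tanh t ^ 2) := by
  rw [wt_add, wt_two]

lemma wt_eq_sub_two (N t : ℝ) : wt N t = wt (N - 2) t * (1 - Real.tanh t ^ 2) := by
  rw [← wt_add_two]; congr 1; ring

lemma integrable_wt {N : ℝ} (hN : 2 ≤ N) : Integrable (wt N) := by
  refine integrable_inv_one_add_sq.mono' (continuous_wt N).aestronglyMeasurable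
    (Eventually.of_forall fun t => ?_)
  rw [Real.norm_of_nonneg (wt_pos N t).le]
  refine (wt_le_of_le hN t).trans ?_
  rw [wt_two, one_sub_tanh_sq]
  apply inv_anti₀ (by positivity)
  rw [Real.cosh_sq]
  have : |t| ≤ |Real.sinh t| := Real.abs_sinh t ▸ Real.self_le_sinh_iff.2 (abs_nonneg t)
  have := sq_le_sq.2 this
  linarith

lemma integrable_wt_mul {N : ℝ} (hN : 2 ≤ N) {f : ℝ → ℝ} (hf : Continuous f) {B : ℝ}
    (hB : ∀ t, |f t| ≤ B) : Integrable (fun t => wt N t * f t) := by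
  refine ((integrable_wt hN).mul_const B).mono' ((continuous_wt N).mul hf).aestronglyMeasurable
    (Eventually.of_forall fun t => ?_)
  rw [Real.norm_eq_abs, abs_mul, abs_of_pos (wt_pos N t)]
  exact mul_le_mul_of_nonneg_left (hB t) (wt_pos N t).le

lemma tendsto_wt {N : ℝ} (hN : 0 < N) : Tendsto (wt N) (cocompact ℝ) (𝓝 0) := by
  have h : Tendsto Real.cosh (cocompact ℝ) atTop := by
    have h1 : ∀ t : ℝ, |t| ≤ Real.cosh t := fun t => by
      have : |t| ≤ |Real.sinh t| := Real.abs_sinh t ▸ Real.self_le_sinh_iff.2 (abs_nonneg t)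
      refine this.trans (abs_le_of_sq_le_sq ?_ (Real.cosh_pos t).le)
      rw [Real.cosh_sq]; linarith
    exact tendsto_atTop_mono h1 tendsto_norm_cocompact_atTop
  exact (tendsto_rpow_neg_atTop hN).comp h

/-- Near a point where it vanishes with nonzero derivative, a function controls every
differentiable function that vanishes there. -/
lemma isBigO_of_vanish {v h : ℝ → ℝ} {v' h' s : ℝ} (hv : HasDerivAt v v' s)
    (hh : HasDerivAt h h' s) (h0 : h s = 0 → v s = 0 ∧ h' ≠ 0) : v =O[𝓝 s] h := by
  by_cases hs : h s = 0
  · obtain ⟨hvs, hh'⟩ := h0 hs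
    have h1 := hv.isBigO_sub
    have h2 : (fun x => x - s) =O[𝓝 s] fun x => h x - h s :=
      (HasDerivAtFilter.isTheta_sub hh hh').isBigO_symm.comp_tendsto
        (tendsto_id.prodMk (tendsto_pure.2 (Eventually.of_forall fun _ => rfl)))
    simp only [hs, hvs, sub_zero] at h1 h2
    exact h1.trans h2
  · have h1 : v =O[𝓝 s] fun _ => (1 : ℝ) := hv.continuousAt.isBigO_one ℝ
    refine h1.trans ?_
    rw [Asymptotics.isBigO_const_left_iff_pos_le_norm one_ne_zero]
    refine ⟨‖h s‖ / 2, by positivity, ?_⟩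
    have h2 : ∀ᶠ x in 𝓝 s, ‖h s‖ / 2 < ‖h x‖ :=
      hh.continuousAt.norm.eventually (lt_mem_nhds (half_lt_self (norm_pos_iff.2 hs)))
    exact h2.mono fun x hx => hx.le

/-- The local comparisons are patched over a compact set; outside it h is bounded below and v
bounded above. -/
lemma exists_abs_le_mul_of_isBigO {v h : ℝ → ℝ} {B k : ℝ} (hloc : ∀ s, v =O[𝓝 s] h)
    (hB : ∀ t, |v t| ≤ B) (hk : 0 < k) (hh : ∀ᶠ t in cocompact ℝ, k ≤ |h t|) :
    ∃ C, ∀ t, v t ^ 2 ≤ C * h t ^ 2 := by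
  obtain ⟨K, hK, hKh⟩ := mem_cocompact.1 hh
  have hB0 : 0 ≤ B := (abs_nonneg _).trans (hB 0)
  have h1 : ∃ C, 0 ≤ C ∧ ∀ t ∈ K, |v t| ≤ C * |h t| := by
    refine hK.induction_on (p := fun S => ∃ C, 0 ≤ C ∧ ∀ t ∈ S, |v t| ≤ C * |h t|)
      ⟨0, le_rfl, by simp⟩ ?_ ?_ ?_
    · rintro s t hst ⟨C, hC0, hC⟩
      exact ⟨C, hC0, fun x hx => hC x (hst hx)⟩
    · rintro s t ⟨C, hC0, hC⟩ ⟨D, hD0, hD⟩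
      refine ⟨max C D, le_max_of_le_left hC0, ?_⟩
      rintro x (hx | hx)
      · exact (hC x hx).trans (mul_le_mul_of_nonneg_right (le_max_left _ _) (abs_nonneg _))
      · exact (hD x hx).trans (mul_le_mul_of_nonneg_right (le_max_right _ _) (abs_nonneg _))
    · intro x _
      obtain ⟨C, hC0, hC⟩ := (hloc x).exists_nonneg
      exact ⟨_, mem_nhdsWithin_of_mem_nhds hC.bound, C, hC0, fun t ht => ht⟩
  obtain ⟨C, hC0, hC⟩ := h1
  refine ⟨(C + B / k) ^ 2, fun t => ?_⟩
  have h2 : |v t| ≤ (C + B / k) * |h t| := by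
    by_cases ht : t ∈ K
    · refine (hC t ht).trans (mul_le_mul_of_nonneg_right ?_ (abs_nonneg _))
      have : 0 ≤ B / k := by positivity
      linarith
    · have h3 : k ≤ |h t| := hKh ht
      refine (hB t).trans ?_
      have h4 : B = B / k * k := by field_simp
      calc B = B / k * k := h4
        _ ≤ B / k * |h t| := by gcongr
        _ ≤ (C + B / k) * |h t| := by gcongr; linarith
  rw [← mul_pow, ← sq_abs (v t), ← sq_abs (_ * h t), abs_mul, abs_of_nonneg (by positivity : 0 ≤ C + B / k)]
  gcongr

/-- The pointwise identity behind `groundState_le`: for the regularized logarithmic derivative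
`p = h h' / (h² + ε)` of `h = tanh² - 1 / (N + 1)`, completing the square leaves a total
derivative. -/
lemma hasDerivAt_regularized {N ε : ℝ} (hN : 2 < N) (hε : 0 < ε) {v v' : ℝ → ℝ} {t : ℝ}
    (hv : HasDerivAt v (v' t) t) (h : ℝ → ℝ) (hh : h = fun t => Real.tanh t ^ 2 - 1 / (N + 1)) :
    HasDerivAt (fun t => wt N t * (2 * Real.tanh t) * (h t * v t ^ 2 / (h t ^ 2 + ε)))
      (wt (N - 2) t * v' t ^ 2
        - wt (N - 2) t * (v' t - v t * (2 * Real.tanh t * (1 - Real.tanh t ^ 2) * h t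
            / (h t ^ 2 + ε))) ^ 2
        - (2 * (N + 1) * (wt N t * (v t ^ 2 * h t ^ 2 / (h t ^ 2 + ε)))
          - wt N t * (4 * Real.tanh t ^ 2 * (1 - Real.tanh t ^ 2)
            * (ε * v t ^ 2 / (h t ^ 2 + ε) ^ 2)))) t := by
  have hT := hasDerivAt_tanh t
  have hh1 : HasDerivAt h (2 * Real.tanh t * (1 - Real.tanh t ^ 2)) t := by
    rw [hh]
    refine ((hT.pow 2).sub_const _).congr_deriv ?_
    simp
  have hpos : h t ^ 2 + ε ≠ 0 := by positivity
  have h1 := ((hasDerivAt_wt N t).mul (hT.const_mul 2)).mul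
    ((hh1.mul (hv.pow 2)).div ((hh1.pow 2).add_const ε) hpos)
  refine h1.congr_deriv ?_
  have hht : Real.tanh t ^ 2 = h t + 1 / (N + 1) := by rw [hh]; ring
  have hN1 : N + 1 ≠ 0 := by linarith
  simp only [Pi.mul_apply, Pi.pow_apply, Pi.div_apply]
  rw [wt_eq_sub_two N t]
  generalize wt (N - 2) t = w
  generalize h t = H at *
  generalize v t = V
  generalize v' t = V'
  have e : 1 / (N + 1) = Real.tanh t ^ 2 - H := by linarith
  -- Encodes N/(N+1) = 1 - 1/(N+1) without division.
  have hN' : N * (Real.tanh t ^ 2 - H) = 1 - (Real.tanh t ^ 2 - H) := by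
    rw [← e]; field_simp; ring
  generalize Real.tanh t = T at *
  clear h1 hT hh1 hh hht e
  -- The eigenvalue equation of h: the flux cosh^(2-N) h' equals 2 tanh cosh^(-N), and its
  -- derivative is -2(N+1) cosh^(-N) h.
  have key : -N * T * (w * (1 - T ^ 2)) * (2 * T) + w * (1 - T ^ 2) * (2 * (1 - T ^ 2))
      = - (2 * (N + 1) * (w * (1 - T ^ 2) * H)) := by
    linear_combination (-2 * w * (1 - T ^ 2)) * hN'
  rw [key]
  field_simp
  ring

/-- Jacobi's argument with the eigenfunction h = tanh² - 1/(N+1), of eigenvalue 2(N+1): formally v'²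
exceeds (v' - v h'/h)² by the eigenvalue term plus a total derivative. The quotient h'/h is singular
at the zeros of h, hence the hypothesis that v vanishes there and the regularization by ε. -/
lemma groundState_le {N B : ℝ} (hN : 2 < N) {v v' : ℝ → ℝ} (hv : ∀ t, HasDerivAt v (v' t) t)
    (hv' : Continuous v') (hB : ∀ t, |v t| ≤ B)
    (hint : Integrable fun t => wt (N - 2) t * v' t ^ 2)
    (hvan : ∀ t, Real.tanh t ^ 2 = 1 / (N + 1) → v t = 0) :
    2 * (N + 1) * ∫ t, wt N t * v t ^ 2 ≤ ∫ t, wt (N - 2) t * v' t ^ 2 := by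
  set h : ℝ → ℝ := fun t => Real.tanh t ^ 2 - 1 / (N + 1) with hh
  have hcv : Continuous v := continuous_iff_continuousAt.2 fun t => (hv t).continuousAt
  have hT := continuous_tanh
  have hch : Continuous h := by fun_prop
  have hB0 : 0 ≤ B := (abs_nonneg _).trans (hB 0)
  have hN1 : 0 < N + 1 := by linarith
  have hN2 : 1 / (N + 1) < 1 := by rw [div_lt_one hN1]; linarith
  have hN0 : 0 < 1 / (N + 1) := by positivity
  have hv2 : ∀ t, v t ^ 2 ≤ B ^ 2 := fun t => sq_le_sq' (abs_le.1 (hB t)).1 (abs_le.1 (hB t)).2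
  have hh1 : ∀ t, h t ^ 2 ≤ 1 := fun t => by
    have := tanh_sq_le t
    have := sq_nonneg (Real.tanh t)
    rw [sq_le_one_iff_abs_le_one, abs_le]
    constructor <;> simp only [hh] <;> linarith
  -- The zeros of h are simple and shared by v, and |h| stays away from 0 at infinity.
  obtain ⟨C, hC⟩ : ∃ C, ∀ t, v t ^ 2 ≤ C * h t ^ 2 := by
    refine exists_abs_le_mul_of_isBigO (k := (1 - 1 / (N + 1)) / 2) (fun s => ?_) hB
      (by linarith) ?_
    · have hh2 : HasDerivAt h (2 * Real.tanh s * (1 - Real.tanh s ^ 2)) s := by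
        refine (((hasDerivAt_tanh s).pow 2).sub_const _).congr_deriv ?_
        simp
      refine isBigO_of_vanish (hv s) hh2 fun hs => ?_
      have hs' : Real.tanh s ^ 2 = 1 / (N + 1) := by simp only [hh] at hs; linarith
      refine ⟨hvan s hs', mul_ne_zero (mul_ne_zero two_ne_zero fun h0 => ?_) ?_⟩
      · rw [h0] at hs'; norm_num at hs'; linarith
      · rw [hs']; linarith
    · have := (tendsto_wt (N := 2) two_pos).eventually
        (gt_mem_nhds (show (0 : ℝ) < (1 - 1 / (N + 1)) / 2 by linarith))
      refine this.mono fun t ht => le_trans ?_ (le_abs_self _)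
      rw [wt_two] at ht
      simp only [hh]
      linarith
  have hCnn : 0 ≤ C := by
    have h0 := hC 0
    have h1 : 0 < h 0 ^ 2 := by
      have : h 0 ≠ 0 := by simp only [hh, Real.tanh_zero]; apply ne_of_lt; linarith
      positivity
    exact nonneg_of_mul_nonneg_left ((sq_nonneg _).trans h0) h1
  -- the inequality for the regularized problem
  set J : ℝ → ℝ → ℝ := fun ε t => 2 * (N + 1) * (wt N t * (v t ^ 2 * h t ^ 2 / (h t ^ 2 + ε)))
          - wt N t * (4 * Real.tanh t ^ 2 * (1 - Real.tanh t ^ 2)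
            * (ε * v t ^ 2 / (h t ^ 2 + ε) ^ 2)) with hJ
  have hcw := continuous_wt N
  have hcw2 := continuous_wt (N - 2)
  have hJc : ∀ ε, 0 < ε → Continuous (J ε) := by
    intro ε hε
    have : ∀ t, h t ^ 2 + ε ≠ 0 := fun t => by positivity
    have : ∀ t, (h t ^ 2 + ε) ^ 2 ≠ 0 := fun t => by positivity
    simp only [hJ]
    fun_prop (disch := assumption)
  -- The bound does not depend on ε: ε v² ≤ C ε h² ≤ C (h² + ε)², so even the error term has a fixed
  -- integrable majorant.
  have hJb : ∀ ε, 0 < ε → ∀ t, ‖J ε t‖ ≤ (2 * (N + 1) * B ^ 2 + 4 * C) * wt N t := by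
    intro ε hε t
    have e1 : v t ^ 2 * h t ^ 2 / (h t ^ 2 + ε) ≤ B ^ 2 := by
      rw [div_le_iff₀ (by positivity)]
      have := hv2 t
      have := mul_nonneg (sq_nonneg B) hε.le
      nlinarith [sq_nonneg (h t)]
    have e2 : ε * v t ^ 2 / (h t ^ 2 + ε) ^ 2 ≤ C := by
      rw [div_le_iff₀ (by positivity)]
      have e3 : ε * v t ^ 2 ≤ ε * (C * h t ^ 2) := by gcongr; exact hC t
      have e4 : ε * (C * h t ^ 2) = C * (ε * h t ^ 2) := by ring
      have e5 : C * (ε * h t ^ 2) ≤ C * (h t ^ 2 + ε) ^ 2 := by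
        gcongr
        nlinarith [sq_nonneg (h t), mul_nonneg hε.le (sq_nonneg (h t)), sq_nonneg (h t ^ 2)]
      linarith
    have e6 : 0 ≤ v t ^ 2 * h t ^ 2 / (h t ^ 2 + ε) := by positivity
    have e7 : 0 ≤ ε * v t ^ 2 / (h t ^ 2 + ε) ^ 2 := by positivity
    have e8 := tanh_sq_le t
    have e9 := sq_nonneg (Real.tanh t)
    have e10 : 4 * Real.tanh t ^ 2 * (1 - Real.tanh t ^ 2) * (ε * v t ^ 2 / (h t ^ 2 + ε) ^ 2)
        ≤ 4 * C := by
      have : 4 * Real.tanh t ^ 2 * (1 - Real.tanh t ^ 2) ≤ 4 := by nlinarith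
      calc _ ≤ 4 * (ε * v t ^ 2 / (h t ^ 2 + ε) ^ 2) := by gcongr
        _ ≤ 4 * C := by gcongr
    have e11 : 0 ≤ 4 * Real.tanh t ^ 2 * (1 - Real.tanh t ^ 2)
        * (ε * v t ^ 2 / (h t ^ 2 + ε) ^ 2) :=
      mul_nonneg (mul_nonneg (by positivity) (by linarith)) e7
    have ew := wt_pos N t
    simp only [hJ]
    rw [Real.norm_eq_abs, abs_le]
    constructor
    · have := mul_le_mul_of_nonneg_left e10 ew.le
      have : 0 ≤ 2 * (N + 1) * (wt N t * (v t ^ 2 * h t ^ 2 / (h t ^ 2 + ε))) := by positivity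
      have : 0 ≤ 2 * (N + 1) * B ^ 2 * wt N t := by positivity
      linarith
    · have := mul_le_mul_of_nonneg_left e1 ew.le
      have := mul_le_mul_of_nonneg_left this (by positivity : 0 ≤ 2 * (N + 1))
      have := mul_nonneg ew.le e11
      have : 0 ≤ 4 * C * wt N t := by positivity
      linarith
  have hdom : Integrable fun t => (2 * (N + 1) * B ^ 2 + 4 * C) * wt N t :=
    (integrable_wt hN.le).const_mul _
  have hJi : ∀ ε, 0 < ε → Integrable (J ε) := fun ε hε =>
    hdom.mono' (hJc ε hε).aestronglyMeasurable (Eventually.of_forall (hJb ε hε))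
  have hreg : ∀ ε, 0 < ε → ∫ t, J ε t ≤ ∫ t, wt (N - 2) t * v' t ^ 2 := by
    intro ε hε
    have hne : ∀ t, h t ^ 2 + ε ≠ 0 := fun t => by positivity
    set r : ℝ → ℝ := fun t => v t * (2 * Real.tanh t * (1 - Real.tanh t ^ 2) * h t
            / (h t ^ 2 + ε)) with hr
    have hrc : Continuous r := by
      simp only [hr]
      fun_prop (disch := assumption)
    have hri : Integrable fun t => wt (N - 2) t * r t ^ 2 := by
      have : (fun t => wt (N - 2) t * r t ^ 2) = fun t => wt N t *
          (4 * Real.tanh t ^ 2 * (1 - Real.tanh t ^ 2) * (v t ^ 2 * h t ^ 2 / (h t ^ 2 + ε) ^ 2)) := by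
        funext t
        rw [wt_eq_sub_two N t]
        simp only [hr]
        field_simp [hne t]
        ring
      rw [this]
      have hne2 : ∀ t, (h t ^ 2 + ε) ^ 2 ≠ 0 := fun t => by positivity
      refine integrable_wt_mul hN.le (by fun_prop (disch := assumption)) (B := 4 * (B ^ 2 / ε ^ 2))
        fun t => ?_
      have e8 := tanh_sq_le t
      have e9 := sq_nonneg (Real.tanh t)
      have e7 : 0 ≤ v t ^ 2 * h t ^ 2 / (h t ^ 2 + ε) ^ 2 := by positivity
      rw [abs_of_nonneg (mul_nonneg (mul_nonneg (by positivity) (by linarith)) e7)]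
      have e10 : 4 * Real.tanh t ^ 2 * (1 - Real.tanh t ^ 2) ≤ 4 := by nlinarith
      have e11 : v t ^ 2 * h t ^ 2 / (h t ^ 2 + ε) ^ 2 ≤ B ^ 2 / ε ^ 2 := by
        rw [div_le_div_iff₀ (by positivity) (by positivity)]
        have : v t ^ 2 * h t ^ 2 ≤ B ^ 2 * 1 :=
          mul_le_mul (hv2 t) (hh1 t) (sq_nonneg _) (sq_nonneg _)
        have e12 : ε ^ 2 ≤ (h t ^ 2 + ε) ^ 2 := by
          apply pow_le_pow_left₀ hε.le
          nlinarith [sq_nonneg (h t)]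
        have := mul_le_mul this e12 (by positivity) (by positivity)
        linarith
      calc _ ≤ 4 * (v t ^ 2 * h t ^ 2 / (h t ^ 2 + ε) ^ 2) := by gcongr
        _ ≤ _ := by gcongr
    have hsq : Integrable fun t => wt (N - 2) t * (v' t - r t) ^ 2 := by
      refine ((hint.const_mul 2).add (hri.const_mul 2)).mono'
        (by fun_prop) (Eventually.of_forall fun t => ?_)
      have ew := wt_pos (N - 2) t
      rw [Real.norm_of_nonneg (by positivity)]
      simp only [Pi.add_apply]
      nlinarith [mul_nonneg ew.le (sq_nonneg (v' t + r t))]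
    have hΨ := fun t => hasDerivAt_regularized hN hε (hv t) h hh
    have hlim : Tendsto (fun t => wt N t * (2 * Real.tanh t) * (h t * v t ^ 2 / (h t ^ 2 + ε)))
        (cocompact ℝ) (𝓝 0) := by
      have : Tendsto (fun t => wt N t * (2 * B ^ 2 / ε)) (cocompact ℝ) (𝓝 0) := by
        simpa using (tendsto_wt (N := N) (by linarith)).mul_const (2 * B ^ 2 / ε)
      refine squeeze_zero_norm (fun t => ?_) this
      rw [Real.norm_eq_abs, mul_assoc, abs_mul, abs_of_pos (wt_pos N t)]
      refine mul_le_mul_of_nonneg_left ?_ (wt_pos N t).le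
      have e1 := abs_tanh_le t
      have e2 : |h t| ≤ 1 := (sq_le_one_iff_abs_le_one _).1 (hh1 t)
      rw [abs_mul, abs_mul, abs_div, abs_mul, abs_two, abs_of_nonneg (sq_nonneg (v t)),
        abs_of_pos (by positivity : 0 < h t ^ 2 + ε)]
      have e3 : |h t| * v t ^ 2 / (h t ^ 2 + ε) ≤ B ^ 2 / ε := by
        rw [div_le_div_iff₀ (by positivity) hε]
        have : |h t| * v t ^ 2 ≤ 1 * B ^ 2 := mul_le_mul e2 (hv2 t) (sq_nonneg _) zero_le_one
        have e12 : ε ≤ h t ^ 2 + ε := by nlinarith [sq_nonneg (h t)]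
        have := mul_le_mul this e12 hε.le (by positivity)
        linarith
      have := mul_le_mul e1 e3 (by positivity) zero_le_one
      rw [mul_div_assoc 2]
      linarith
    have hzero := integral_of_hasDerivAt_of_tendsto hΨ ((hint.sub hsq).sub (hJi ε hε))
      (hlim.mono_left atBot_le_cocompact) (hlim.mono_left atTop_le_cocompact)
    have e1 := integral_sub (hint.sub hsq) (hJi ε hε)
    have e2 := integral_sub hint hsq
    have e3 : 0 ≤ ∫ t, wt (N - 2) t * (v' t - r t) ^ 2 :=
      integral_nonneg fun t => mul_nonneg (wt_pos _ t).le (sq_nonneg _)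
    simp only [Pi.sub_apply] at e1 e2
    rw [e2] at e1
    linarith [hzero.symm.trans e1]
  -- the limit
  have hlim : Tendsto (fun k : ℕ => ∫ t, J (1 / ((k : ℝ) + 1)) t) atTop
      (𝓝 (∫ t, 2 * (N + 1) * (wt N t * v t ^ 2))) := by
    refine tendsto_integral_of_dominated_convergence _
      (fun k => (hJc _ Nat.one_div_pos_of_nat).aestronglyMeasurable) hdom
      (fun k => Eventually.of_forall (hJb _ Nat.one_div_pos_of_nat))
      (Eventually.of_forall fun t => ?_)
    -- Where h vanishes so does v, and all terms are zero; elsewhere the regularization disappears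
    -- continuously.
    by_cases ht : h t = 0
    · have : v t = 0 := hvan t (by simp only [hh] at ht; linarith)
      simp [hJ, this]
    · have hk : Tendsto (fun k : ℕ => 1 / ((k : ℝ) + 1)) atTop (𝓝 0) :=
        tendsto_one_div_add_atTop_nhds_zero_nat
      have hc : ContinuousAt (fun ε => J ε t) 0 := by
        have e1 : h t ^ 2 + 0 ≠ 0 := by positivity
        have e2 : (h t ^ 2 + 0) ^ 2 ≠ 0 := by positivity
        simp only [hJ]
        fun_prop (disch := assumption)
      have := hc.tendsto.comp hk
      have e0 : J 0 t = 2 * (N + 1) * (wt N t * v t ^ 2) := by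
        simp only [hJ]
        field_simp
        ring
      rwa [e0] at this
  rw [integral_const_mul] at hlim
  exact le_of_tendsto' hlim fun k => hreg _ Nat.one_div_pos_of_nat

/-! ### Moments of the powers of cosh. -/

lemma integral_deriv_eq_zero {g g' : ℝ → ℝ} (hg : ∀ t, HasDerivAt g (g' t) t)
    (hg' : Integrable g') (h0 : Tendsto g (cocompact ℝ) (𝓝 0)) : ∫ t, g' t = 0 := by
  simpa using integral_of_hasDerivAt_of_tendsto hg hg' (h0.mono_left atBot_le_cocompact)
    (h0.mono_left atTop_le_cocompact)

lemma integral_deriv_eq_zero_of_hasCompactSupport {g g' : ℝ → ℝ}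
    (hg : ∀ t, HasDerivAt g (g' t) t) (hc : Continuous g') (h0 : HasCompactSupport g) :
    ∫ t, g' t = 0 := by
  have e : deriv g = g' := funext fun t => (hg t).deriv
  have hs : HasCompactSupport g' := e ▸ h0.deriv
  exact integral_deriv_eq_zero hg (hc.integrable_of_hasCompactSupport hs) h0.is_zero_at_infty

lemma integral_wt_mul_tanh {N : ℝ} (hN : 2 ≤ N) : ∫ t, wt N t * Real.tanh t = 0 := by
  have h := integral_deriv_eq_zero (hasDerivAt_wt N)
    (by simpa [mul_comm, mul_left_comm, mul_assoc] using
      (integrable_wt_mul hN continuous_tanh abs_tanh_le).const_mul (-N))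
    (tendsto_wt (by linarith))
  have e : (fun t => -N * Real.tanh t * wt N t) = fun t => -N * (wt N t * Real.tanh t) := by
    funext t; ring
  rw [e, integral_const_mul] at h
  have : -N ≠ 0 := by linarith
  exact (mul_eq_zero.1 h).resolve_left this

lemma integrable_wt_tanh_sq {N : ℝ} (hN : 2 ≤ N) :
    Integrable fun t => wt N t * Real.tanh t ^ 2 :=
  integrable_wt_mul hN (continuous_tanh.pow 2) (B := 1) fun t => by
    rw [abs_of_nonneg (sq_nonneg _)]; exact tanh_sq_le t

/-- Integrates the derivative of cosh^(-N) tanh. As cosh^(-N-2) = cosh^(2-N) (tanh')², it says that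
the Rayleigh quotient of tanh is N. -/
lemma integral_wt_add_two {N : ℝ} (hN : 2 ≤ N) :
    ∫ t, wt (N + 2) t = N * ∫ t, wt N t * Real.tanh t ^ 2 := by
  have hi := integrable_wt_tanh_sq hN
  have hi2 : Integrable (wt (N + 2)) := integrable_wt (by linarith)
  have h1 : ∀ t, HasDerivAt (fun t => wt N t * Real.tanh t)
      (wt (N + 2) t - N * (wt N t * Real.tanh t ^ 2)) t := fun t => by
    refine ((hasDerivAt_wt N t).mul (hasDerivAt_tanh t)).congr_deriv ?_
    rw [wt_add_two]; ring
  have h := integral_deriv_eq_zero h1 (hi2.sub (hi.const_mul N)) ?_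
  · rw [integral_sub hi2 (hi.const_mul N), integral_const_mul] at h
    linarith
  · refine squeeze_zero_norm (fun t => ?_) (tendsto_wt (N := N) (by linarith))
    rw [Real.norm_eq_abs, abs_mul, abs_of_pos (wt_pos N t)]
    exact mul_le_of_le_one_right (wt_pos N t).le (abs_tanh_le t)

lemma integral_wt_tanh_sq_eq {N : ℝ} (hN : 2 ≤ N) :
    ∫ t, wt N t * Real.tanh t ^ 2 = (∫ t, wt N t) - ∫ t, wt (N + 2) t := by
  rw [← integral_sub (integrable_wt hN) (integrable_wt (by linarith))]
  congr 1; funext t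
  rw [wt_add_two]; ring

lemma integral_wt_pos {N : ℝ} (hN : 2 ≤ N) : 0 < ∫ t, wt N t := by
  rw [integral_pos_iff_support_of_nonneg (fun t => (wt_pos N t).le) (integrable_wt hN)]
  have : Function.support (wt N) = Set.univ :=
    Set.eq_univ_of_forall fun t => (wt_pos N t).ne'
  rw [this]; simp

lemma integral_wt_tanh_sq_pos {N : ℝ} (hN : 2 ≤ N) : 0 < ∫ t, wt N t * Real.tanh t ^ 2 := by
  have h1 := integral_wt_add_two hN
  have h2 := integral_wt_pos (N := N + 2) (by linarith)
  rw [h1] at h2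
  exact pos_of_mul_pos_right h2 (by linarith)

/-! ### Spectral gaps on the line for compactly supported functions. -/

section compact

variable {N : ℝ} {u : ℝ → ℝ}

lemma _root_.HasCompactSupport.integrable_wt_mul (hc : HasCompactSupport u) (hu : Continuous u)
    {g : ℝ → ℝ} (hg : Continuous g) : Integrable fun t => g t * u t :=
  (hg.mul hu).integrable_of_hasCompactSupport hc.mul_left

/-- The weak eigenvalue equation of tanh, with eigenvalue N: cosh^(-N) is cosh^(2-N) tanh', so the
left side is the energy pairing of u with tanh. -/
lemma integral_wt_mul_deriv (hu : ContDiff ℝ 1 u) (hc : HasCompactSupport u) :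
    ∫ t, wt N t * deriv u t = N * ∫ t, wt N t * Real.tanh t * u t := by
  have hd : ∀ t, HasDerivAt u (deriv u t) t := fun t =>
    (hu.differentiable one_ne_zero t).hasDerivAt
  have hcu := hu.continuous
  have hcd := hu.continuous_deriv le_rfl
  have hcw := continuous_wt N
  have hT := continuous_tanh
  have h1 : ∀ t, HasDerivAt (fun t => wt N t * u t)
      (wt N t * deriv u t - N * (wt N t * Real.tanh t * u t)) t := fun t => by
    refine ((hasDerivAt_wt N t).mul (hd t)).congr_deriv ?_
    ring
  have h := integral_deriv_eq_zero_of_hasCompactSupport h1 (by fun_prop) hc.mul_left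
  rw [integral_sub (hc.deriv.integrable_wt_mul hcd hcw)
    (by exact (hc.integrable_wt_mul hcu (hcw.mul hT)).const_mul N), integral_const_mul] at h
  linarith

lemma integral_wt_sub_sq (hN : 2 ≤ N) (hcu : Continuous u) (hc : HasCompactSupport u) (c κ : ℝ) :
    ∫ t, wt N t * (u t - c - κ * Real.tanh t) ^ 2
      = (∫ t, wt N t * u t ^ 2) + c ^ 2 * (∫ t, wt N t) + κ ^ 2 * (∫ t, wt N t * Real.tanh t ^ 2)
        + (-2 * c) * (∫ t, wt N t * u t) + (-2 * κ) * (∫ t, wt N t * Real.tanh t * u t) := by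
  have hcw := continuous_wt N
  have hT := continuous_tanh
  have iu2 : Integrable fun t => wt N t * u t ^ 2 :=
    (hc.comp_left (g := fun x : ℝ => x ^ 2) (by simp)).integrable_wt_mul (by fun_prop) hcw
  have j1 := (integrable_wt hN).const_mul (c ^ 2)
  have j2 := (integrable_wt_tanh_sq hN).const_mul (κ ^ 2)
  have j3 := (hc.integrable_wt_mul hcu hcw).const_mul (-2 * c)
  have j4 := (hc.integrable_wt_mul hcu (hcw.mul hT)).const_mul (-2 * κ)
  have j5 := (integrable_wt_mul hN hT abs_tanh_le).const_mul (2 * c * κ)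
  have e2 : (fun t => wt N t * (u t - c - κ * Real.tanh t) ^ 2)
      = fun t => wt N t * u t ^ 2 + c ^ 2 * wt N t + κ ^ 2 * (wt N t * Real.tanh t ^ 2)
        + (-2 * c) * (wt N t * u t) + (-2 * κ) * (wt N t * Real.tanh t * u t)
        + (2 * c * κ) * (wt N t * Real.tanh t) := by
    funext t; ring
  rw [e2, integral_add (by exact (((iu2.add j1).add j2).add j3).add j4) j5,
    integral_add (by exact ((iu2.add j1).add j2).add j3) (by exact j4),
    integral_add (by exact (iu2.add j1).add j2) j3, integral_add (by exact iu2.add j1) j2,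
    integral_add iu2 j1]
  simp only [integral_const_mul]
  rw [integral_wt_mul_tanh hN]
  ring

/-- Both the cross term and the square of tanh in the energy are N times their L² counterparts,
since tanh is an eigenfunction. -/
lemma integral_wt_deriv_sub_sq (hN : 2 < N) (hu : ContDiff ℝ 1 u) (hc : HasCompactSupport u)
    (κ : ℝ) :
    Integrable (fun t => wt (N - 2) t * (deriv u t - κ * (1 - Real.tanh t ^ 2)) ^ 2) ∧
    ∫ t, wt (N - 2) t * (deriv u t - κ * (1 - Real.tanh t ^ 2)) ^ 2
      = (∫ t, wt (N - 2) t * deriv u t ^ 2)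
        + (-2 * κ) * (N * ∫ t, wt N t * Real.tanh t * u t)
        + κ ^ 2 * (N * ∫ t, wt N t * Real.tanh t ^ 2) := by
  have hcd := hu.continuous_deriv le_rfl
  have hcw := continuous_wt N
  have hcw2 := continuous_wt (N - 2)
  have id2 : Integrable fun t => wt (N - 2) t * deriv u t ^ 2 :=
    (hc.deriv.comp_left (g := fun x : ℝ => x ^ 2) (by simp)).integrable_wt_mul (by fun_prop) hcw2
  have id1 := (hc.deriv.integrable_wt_mul hcd hcw).const_mul (-2 * κ)
  have iw2 := (integrable_wt (N := N + 2) (by linarith)).const_mul (κ ^ 2)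
  have e1 : (fun t => wt (N - 2) t * (deriv u t - κ * (1 - Real.tanh t ^ 2)) ^ 2)
      = fun t => wt (N - 2) t * deriv u t ^ 2 + (-2 * κ) * (wt N t * deriv u t)
        + κ ^ 2 * wt (N + 2) t := by
    funext t
    rw [wt_add_two, wt_eq_sub_two N]; ring
  rw [e1]
  refine ⟨(id2.add id1).add iw2, ?_⟩
  rw [integral_add (by exact id2.add id1) iw2, integral_add id2 id1, integral_const_mul,
    integral_const_mul, integral_wt_mul_deriv hu hc, integral_wt_add_two hN.le]

/-- Bessel's inequality for 1 and tanh, orthogonal for the even weight cosh^(-N). -/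
lemma integral_wt_variance_nonneg (hN : 2 ≤ N) (hcu : Continuous u) (hc : HasCompactSupport u) :
    0 ≤ (∫ t, wt N t * u t ^ 2) - (∫ t, wt N t * u t) ^ 2 / (∫ t, wt N t)
        - (∫ t, wt N t * Real.tanh t * u t) ^ 2 / ∫ t, wt N t * Real.tanh t ^ 2 := by
  have hZ := integral_wt_pos hN
  have hY := integral_wt_tanh_sq_pos hN
  have h := integral_wt_sub_sq hN hcu hc ((∫ t, wt N t * u t) / (∫ t, wt N t))
    ((∫ t, wt N t * Real.tanh t * u t) / ∫ t, wt N t * Real.tanh t ^ 2)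
  have h0 : 0 ≤ ∫ t, wt N t * (u t - (∫ t, wt N t * u t) / (∫ t, wt N t)
      - (∫ t, wt N t * Real.tanh t * u t) / (∫ t, wt N t * Real.tanh t ^ 2) * Real.tanh t) ^ 2 :=
    integral_nonneg fun t => mul_nonneg (wt_pos N t).le (sq_nonneg _)
  rw [h] at h0
  refine h0.trans (le_of_eq ?_)
  field_simp
  ring

lemma exists_tanh_sq_eq {y : ℝ} (hy : y ∈ Set.Ioo (0 : ℝ) 1) : ∃ t, Real.tanh t ^ 2 = y := by
  have hlim : Tendsto (fun t => Real.tanh t ^ 2) atTop (𝓝 1) := by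
    have := ((tendsto_wt (N := 2) two_pos).mono_left atTop_le_cocompact).const_sub 1
    simpa [wt_two] using this
  obtain ⟨T, hT'⟩ := ((hlim.eventually (lt_mem_nhds hy.2)).and (eventually_ge_atTop 0)).exists
  have := intermediate_value_Icc hT'.2 (continuous_tanh.pow 2).continuousOn
  obtain ⟨x, -, hx⟩ := this (show y ∈ Set.Icc _ _ from ⟨by simp [hy.1.le], hT'.1.le⟩)
  exact ⟨x, hx⟩

/-- The spectral gap of the weighted energy `∫ cosh^(2-N) u'²` on the line: the eigenvalues are
`0` (constants), `N` (the function `tanh`), and the remaining ones are at least `2 (N + 1)`. -/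
theorem line_spectral_gap (hN : 2 < N) (hu : ContDiff ℝ 1 u) (hc : HasCompactSupport u) :
    (N + 2) * ((∫ t, wt N t * u t ^ 2) - (∫ t, wt N t * u t) ^ 2 / (∫ t, wt N t)
        - (∫ t, wt N t * Real.tanh t * u t) ^ 2 / ∫ t, wt N t * Real.tanh t ^ 2)
      ≤ (∫ t, wt (N - 2) t * deriv u t ^ 2)
        - N * ((∫ t, wt N t * u t ^ 2) - (∫ t, wt N t * u t) ^ 2 / ∫ t, wt N t) := by
  have hd : ∀ t, HasDerivAt u (deriv u t) t := fun t =>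
    (hu.differentiable one_ne_zero t).hasDerivAt
  have hcu := hu.continuous
  have hcd := hu.continuous_deriv le_rfl
  have hT := continuous_tanh
  have hN1 : 0 < N + 1 := by linarith
  obtain ⟨t₀, ht₀⟩ : ∃ t₀, Real.tanh t₀ ^ 2 = 1 / (N + 1) :=
    exists_tanh_sq_eq ⟨by positivity, by rw [div_lt_one hN1]; linarith⟩
  have hT0 : Real.tanh t₀ ≠ 0 := by
    intro h
    rw [h] at ht₀
    have : (0 : ℝ) < 1 / (N + 1) := by positivity
    norm_num at ht₀; linarith
  -- subtract the combination of `1` and `tanh` that agrees with `u` at `± t₀`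
  obtain ⟨c, κ, h1, h2⟩ : ∃ c κ : ℝ, u t₀ - c - κ * Real.tanh t₀ = 0 ∧
      u (-t₀) - c - κ * Real.tanh (-t₀) = 0 := by
    refine ⟨(u t₀ + u (-t₀)) / 2, (u t₀ - u (-t₀)) / (2 * Real.tanh t₀), ?_, ?_⟩
    · field_simp; ring
    · rw [Real.tanh_neg]; field_simp; ring
  obtain ⟨B, hB⟩ : ∃ B, ∀ t, |u t| ≤ B := hcu.bounded_above_of_compact_support hc
  have key := groundState_le (N := N) (B := B + |c| + |κ|) hN
    (v := fun t => u t - c - κ * Real.tanh t)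
    (v' := fun t => deriv u t - κ * (1 - Real.tanh t ^ 2))
    (fun t => ((hd t).sub_const c).sub ((hasDerivAt_tanh t).const_mul κ)) (by fun_prop)
    (fun t => by
      have h1 : |κ * Real.tanh t| ≤ |κ| := by
        rw [abs_mul]; exact mul_le_of_le_one_right (abs_nonneg _) (abs_tanh_le t)
      have h2 := abs_sub (u t - c) (κ * Real.tanh t)
      have h3 := abs_sub (u t) c
      linarith [hB t]) (integral_wt_deriv_sub_sq hN hu hc κ).1
    (fun t ht => by
      rw [← ht₀, sq_eq_sq_iff_eq_or_eq_neg] at ht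
      rcases ht with ht | ht
      · rw [Real.tanh_injective ht]; exact h1
      · rw [← Real.tanh_neg] at ht
        rw [Real.tanh_injective ht]; exact h2)
  rw [(integral_wt_deriv_sub_sq hN hu hc κ).2, integral_wt_sub_sq hN.le hcu hc] at key
  have hZ := integral_wt_pos hN.le
  have hY := integral_wt_tanh_sq_pos hN.le
  generalize (∫ t, wt N t) = Z at *
  generalize (∫ t, wt N t * Real.tanh t ^ 2) = Y at *
  generalize (∫ t, wt N t * u t ^ 2) = M at *
  generalize (∫ t, wt N t * u t) = A at *
  generalize (∫ t, wt N t * Real.tanh t * u t) = D at *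
  generalize (∫ t, wt (N - 2) t * deriv u t ^ 2) = F at *
  clear hd hB h1 h2 hcu hcd hu hc ht₀ hT0
  -- The interpolating c and κ need not be the L² projections. Completing the squares shows that
  -- they only help: the excess in c enters with weight 2(N+1), the one in κ with weight 2(N+1) - N
  -- = N + 2, both nonnegative.
  have k1 : c ^ 2 * Z - 2 * c * A = Z * (c - A / Z) ^ 2 - A ^ 2 / Z := by field_simp; ring
  have k2 : κ ^ 2 * Y - 2 * κ * D = Y * (κ - D / Y) ^ 2 - D ^ 2 / Y := by field_simp; ring
  have k3 : 0 ≤ 2 * (N + 1) * (Z * (c - A / Z) ^ 2) := by positivity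
  have k4 : 0 ≤ (N + 2) * (Y * (κ - D / Y) ^ 2) := mul_nonneg (by linarith) (by positivity)
  have k5 : 2 * (N + 1) * (M + (c ^ 2 * Z - 2 * c * A) + (κ ^ 2 * Y - 2 * κ * D))
      ≤ F + N * (κ ^ 2 * Y - 2 * κ * D) := by linarith
  rw [k1, k2] at k5
  linarith

/-- The ground state representation with respect to `1 / cosh`. -/
lemma integral_wt_deriv_add_tanh (hu : ContDiff ℝ 1 u) (hc : HasCompactSupport u) :
    ∫ t, wt (N - 2) t * (deriv u t + Real.tanh t * u t) ^ 2
      = (∫ t, wt (N - 2) t * deriv u t ^ 2)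
        + ∫ t, ((N - 1) * wt (N - 2) t - N * wt N t) * u t ^ 2 := by
  have hd : ∀ t, HasDerivAt u (deriv u t) t := fun t =>
    (hu.differentiable one_ne_zero t).hasDerivAt
  have hcu := hu.continuous
  have hcd := hu.continuous_deriv le_rfl
  have hcw := continuous_wt N
  have hcw2 := continuous_wt (N - 2)
  have hT := continuous_tanh
  have h1 : ∀ t, HasDerivAt (fun t => wt (N - 2) t * Real.tanh t * u t ^ 2)
      (wt (N - 2) t * (deriv u t + Real.tanh t * u t) ^ 2 - (wt (N - 2) t * deriv u t ^ 2
        + ((N - 1) * wt (N - 2) t - N * wt N t) * u t ^ 2)) t := fun t => by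
    refine (((hasDerivAt_wt (N - 2) t).mul (hasDerivAt_tanh t)).mul ((hd t).pow 2)).congr_deriv ?_
    simp only [Pi.mul_apply, Pi.pow_apply]
    rw [wt_eq_sub_two N]
    ring
  have hs2 : HasCompactSupport fun t => u t ^ 2 :=
    hc.comp_left (g := fun x : ℝ => x ^ 2) (by simp)
  have hds2 : HasCompactSupport fun t => deriv u t ^ 2 :=
    hc.deriv.comp_left (g := fun x : ℝ => x ^ 2) (by simp)
  have hs3 : HasCompactSupport fun t => (deriv u t + Real.tanh t * u t) ^ 2 :=
    (hc.deriv.add (hc.mul_left (f := Real.tanh))).comp_left (g := fun x : ℝ => x ^ 2) (by simp)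
  have i1 : Integrable fun t => wt (N - 2) t * (deriv u t + Real.tanh t * u t) ^ 2 :=
    hs3.integrable_wt_mul (by fun_prop) hcw2
  have i2 : Integrable fun t => wt (N - 2) t * deriv u t ^ 2 :=
    hds2.integrable_wt_mul (by fun_prop) hcw2
  have i3 : Integrable fun t => ((N - 1) * wt (N - 2) t - N * wt N t) * u t ^ 2 :=
    hs2.integrable_wt_mul (by fun_prop) (by fun_prop)
  have h := integral_deriv_eq_zero_of_hasCompactSupport h1 (by fun_prop) hs2.mul_left
  rw [integral_sub i1 (by exact i2.add i3), integral_add i2 i3] at h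
  linarith

/-- The distance to the span of the ground state `1 / cosh` is controlled by the energy in the
ground state representation. -/
lemma ground_state_gap (hN : 2 < N) (hu : ContDiff ℝ 1 u) (hc : HasCompactSupport u) :
    (N + 2) * ((∫ t, wt N t * u t ^ 2)
        - (∫ t, wt N t * (Real.cosh t)⁻¹ * u t) ^ 2 / (∫ t, wt (N + 2) t))
      ≤ ∫ t, wt (N - 2) t * (deriv u t + Real.tanh t * u t) ^ 2 := by
  have hd : ∀ t, HasDerivAt u (deriv u t) t := fun t =>
    (hu.differentiable one_ne_zero t).hasDerivAt
  have hy : ContDiff ℝ 1 fun t => Real.cosh t * u t := (Real.contDiff_cosh).mul hu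
  have hyc : HasCompactSupport fun t => Real.cosh t * u t := hc.mul_left
  have hyd : ∀ t, deriv (fun t => Real.cosh t * u t) t
      = Real.cosh t * (deriv u t + Real.tanh t * u t) := fun t => by
    rw [(show HasDerivAt (fun t => Real.cosh t * u t) _ t from
      (Real.hasDerivAt_cosh t).mul (hd t)).deriv, Real.tanh_eq_sinh_div_cosh]
    have := (Real.cosh_pos t).ne'
    field_simp
    ring
  -- With y = cosh · u the weights shift by two: cosh^(-N-2) y² = cosh^(-N) u² and cosh^(-N) y'² =
  -- cosh^(2-N) (u' + tanh u)². Hence 1/cosh corresponds to the constants, and the first nonzero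
  -- eigenvalue is N + 2.
  have h := line_spectral_gap (N := N + 2) (by linarith) hy hyc
  have hnn : 0 ≤ (N + 2 + 2) * ((∫ t, wt (N + 2) t * (Real.cosh t * u t) ^ 2)
      - (∫ t, wt (N + 2) t * (Real.cosh t * u t)) ^ 2 / (∫ t, wt (N + 2) t)
        - (∫ t, wt (N + 2) t * Real.tanh t * (Real.cosh t * u t)) ^ 2
          / ∫ t, wt (N + 2) t * Real.tanh t ^ 2) :=
    mul_nonneg (by linarith) (integral_wt_variance_nonneg (by linarith) hy.continuous hyc)
  have hw : ∀ t, wt (N + 2) t * Real.cosh t ^ 2 = wt N t := fun t => by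
    rw [wt_add_two, one_sub_tanh_sq]
    have := (Real.cosh_pos t).ne'
    field_simp
  have hw2 : ∀ t, wt N t * Real.cosh t ^ 2 = wt (N - 2) t := fun t => by
    rw [wt_eq_sub_two N, one_sub_tanh_sq]
    have := (Real.cosh_pos t).ne'
    field_simp
  have e1 : ∀ t, wt (N + 2) t * (Real.cosh t * u t) ^ 2 = wt N t * u t ^ 2 := fun t => by
    rw [← hw t]; ring
  have e2 : ∀ t, wt (N + 2) t * (Real.cosh t * u t) = wt N t * (Real.cosh t)⁻¹ * u t := fun t => by
    rw [← hw t]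
    have := (Real.cosh_pos t).ne'
    field_simp
  have e3 : ∀ t, wt (N + 2 - 2) t * deriv (fun t => Real.cosh t * u t) t ^ 2
      = wt (N - 2) t * (deriv u t + Real.tanh t * u t) ^ 2 := fun t => by
    rw [hyd t, ← hw2 t, add_sub_cancel_right]; ring
  have h' := hnn.trans h
  simp only [e1, e2, e3] at h'
  linarith

end compact

/-! ### A Gaussian Poincaré inequality with remainder -/

section Gauss

set_option linter.unusedSectionVars false

variable {V : Type*} [NormedAddCommGroup V] [InnerProductSpace ℝ V] [FiniteDimensional ℝ V]
  [MeasurableSpace V] [BorelSpace V]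

/-- The Gaussian weight. -/
def gaussWt (x : V) : ℝ := Real.exp (-(1 / 2) * ‖x‖ ^ 2)

variable (V) in
/-- The (unnormalized) Gaussian measure. -/
def gauss : Measure V := volume.withDensity fun x => ENNReal.ofReal (gaussWt x)

lemma gaussWt_pos (x : V) : 0 < gaussWt x := Real.exp_pos _

lemma continuous_gaussWt : Continuous (gaussWt : V → ℝ) := by
  unfold gaussWt; fun_prop

lemma integrable_exp_neg_mul_sq_norm {b : ℝ} (hb : 0 < b) :
    Integrable fun x : V => Real.exp (-b * ‖x‖ ^ 2) := by
  refine Integrable.of_integral_ne_zero ?_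
  rw [GaussianFourier.integral_rexp_neg_mul_sq_norm hb]
  positivity

lemma integral_gauss {F : Type*} [NormedAddCommGroup F] [NormedSpace ℝ F] (f : V → F) :
    ∫ x, f x ∂(gauss V) = ∫ x, gaussWt x • f x := by
  rw [gauss, integral_withDensity_eq_integral_toReal_smul
    (continuous_gaussWt.measurable.ennreal_ofReal) (by simp)]
  simp only [ENNReal.toReal_ofReal (gaussWt_pos _).le]

lemma integrable_gauss_iff {F : Type*} [NormedAddCommGroup F] [NormedSpace ℝ F] {f : V → F} :
    Integrable f (gauss V) ↔ Integrable fun x => gaussWt x • f x := by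
  rw [gauss, integrable_withDensity_iff_integrable_smul'
    (continuous_gaussWt.measurable.ennreal_ofReal) (by simp)]
  simp only [ENNReal.toReal_ofReal (gaussWt_pos _).le]

instance : IsFiniteMeasure (gauss V) := by
  have : Integrable (fun _ => (1 : ℝ)) (gauss V) := by
    rw [integrable_gauss_iff]
    simpa [gaussWt] using integrable_exp_neg_mul_sq_norm (V := V) (b := 1 / 2) (by norm_num)
  simpa [integrable_const_iff] using this

lemma integrable_norm_sq_gauss : Integrable (fun x : V => ‖x‖ ^ 2) (gauss V) := by
  rw [integrable_gauss_iff]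
  refine ((integrable_exp_neg_mul_sq_norm (V := V) (b := 1 / 4) (by norm_num)).const_mul 4).mono'
    (continuous_gaussWt.smul (by fun_prop)).aestronglyMeasurable (Eventually.of_forall fun x => ?_)
  rw [smul_eq_mul, Real.norm_of_nonneg (mul_nonneg (gaussWt_pos x).le (sq_nonneg _))]
  have h1 : gaussWt x = Real.exp (-(1 / 4) * ‖x‖ ^ 2) * Real.exp (-(1 / 4 * ‖x‖ ^ 2)) := by
    rw [gaussWt, ← Real.exp_add]; congr 1; ring
  have h2 : (1 / 4 * ‖x‖ ^ 2) * Real.exp (-(1 / 4 * ‖x‖ ^ 2)) ≤ 1 := by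
    rw [Real.exp_neg, ← div_eq_mul_inv, div_le_one (Real.exp_pos _)]
    linarith [Real.add_one_le_exp (1 / 4 * ‖x‖ ^ 2)]
  rw [h1]
  have := mul_le_mul_of_nonneg_left h2 (Real.exp_pos (-(1 / 4) * ‖x‖ ^ 2)).le
  linarith

lemma integrable_norm_gauss : Integrable (fun x : V => ‖x‖) (gauss V) := by
  refine ((integrable_const (1 : ℝ)).add integrable_norm_sq_gauss).mono'
    continuous_norm.aestronglyMeasurable (Eventually.of_forall fun x => ?_)
  rw [norm_norm, Pi.add_apply]
  nlinarith [sq_nonneg (‖x‖ - 1), sq_nonneg ‖x‖]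

lemma _root_.Continuous.integrable_gauss {F : Type*} [NormedAddCommGroup F] [NormedSpace ℝ F]
    {f : V → F} (hf : Continuous f) {B : ℝ} (hB : ∀ x, ‖f x‖ ≤ B) : Integrable f (gauss V) :=
  Integrable.of_bound hf.aestronglyMeasurable B (Eventually.of_forall hB)

/-- The plane rotation `(x, y) ↦ (c x - s y, s x + c y)` of the product of two copies of `V`. -/
def rotate {c s : ℝ} (h : c ^ 2 + s ^ 2 = 1) : V × V ≃ₜ V × V where
  toFun p := (c • p.1 - s • p.2, s • p.1 + c • p.2)
  invFun p := (c • p.1 + s • p.2, c • p.2 - s • p.1)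
  left_inv p := by
    ext1
    · have : p.1 = (c ^ 2 + s ^ 2) • p.1 := by rw [h, one_smul]
      conv_rhs => rw [this]
      simp only; module
    · have : p.2 = (c ^ 2 + s ^ 2) • p.2 := by rw [h, one_smul]
      conv_rhs => rw [this]
      simp only; module
  right_inv p := by
    ext1
    · have : p.1 = (c ^ 2 + s ^ 2) • p.1 := by rw [h, one_smul]
      conv_rhs => rw [this]
      simp only; module
    · have : p.2 = (c ^ 2 + s ^ 2) • p.2 := by rw [h, one_smul]
      conv_rhs => rw [this]
      simp only; module
  continuous_toFun := by fun_prop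
  continuous_invFun := by fun_prop

lemma measurePreserving_shear_right (t : ℝ) :
    MeasurePreserving (fun p : V × V => (p.1, p.2 + t • p.1)) := by
  refine (MeasurePreserving.id (volume : Measure V)).skew_product
    (g := fun a b => b + t • a) (by fun_prop) (Eventually.of_forall fun a => ?_)
  exact (measurePreserving_add_right volume (t • a)).map_eq

lemma measurePreserving_shear_left (t : ℝ) :
    MeasurePreserving (fun p : V × V => (p.1 + t • p.2, p.2)) :=
  Measure.measurePreserving_swap.comp
    ((measurePreserving_shear_right t).comp Measure.measurePreserving_swap)

/-- A plane rotation is a product of three shears, each of which preserves Lebesgue measure by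
translation invariance on the fibres. -/
lemma measurePreserving_rotate {c s : ℝ} (h : c ^ 2 + s ^ 2 = 1) (hc : 0 ≤ c) :
    MeasurePreserving (rotate (V := V) h) := by
  -- The coefficient s/(1+c) is tan(θ/2); the assumption c ≥ 0 keeps the denominator away from zero.
  have h1 := (measurePreserving_shear_left (V := V) (-(s / (1 + c)))).comp
    ((measurePreserving_shear_right s).comp (measurePreserving_shear_left (-(s / (1 + c)))))
  have hne : 1 + c ≠ 0 := by positivity
  have e0 : 1 - s * (s / (1 + c)) = c := by field_simp; linarith
  have e1 : c + s * (s / (1 + c)) = 1 := by linarith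
  have e2 : s / (1 + c) * (1 + c) = s := by field_simp
  convert! h1 using 1
  funext p
  generalize s / (1 + c) = t at *
  change (c • p.1 - s • p.2, s • p.1 + c • p.2) = (p.1 + -t • p.2 + -t • (p.2 + s • (p.1 + -t • p.2)),
    p.2 + s • (p.1 + -t • p.2))
  ext1
  · have h3 : c = 1 - s * t := by linarith
    have h4 : s = 2 * t - t * (s * t) := by
      rw [h3] at e2; linarith
    simp only
    rw [show s • p.2 = (2 * t - t * (s * t)) • p.2 by rw [← h4], h3]
    module
  · have h3 : c = 1 - s * t := by linarith
    simp only
    rw [h3]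
    module

/-- The product Gaussian density depends on ‖x‖² + ‖y‖² only, which the rotation preserves. -/
lemma integral_rotate {F : Type*} [NormedAddCommGroup F] [NormedSpace ℝ F] {c s : ℝ}
    (h : c ^ 2 + s ^ 2 = 1) (hc : 0 ≤ c) (f : V × V → F) :
    ∫ p, f (c • p.1 - s • p.2, s • p.1 + c • p.2) ∂((gauss V).prod (gauss V))
      = ∫ p, f p ∂((gauss V).prod (gauss V)) := by
  have e : (gauss V).prod (gauss V) = (volume : Measure (V × V)).withDensity
      fun p => ENNReal.ofReal (gaussWt p.1 * gaussWt p.2) := by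
    rw [gauss, prod_withDensity continuous_gaussWt.measurable.ennreal_ofReal
      continuous_gaussWt.measurable.ennreal_ofReal]
    simp only [ENNReal.ofReal_mul (gaussWt_pos _).le]
    rfl
  have hm : Measurable fun p : V × V => ENNReal.ofReal (gaussWt p.1 * gaussWt p.2) :=
    ((continuous_gaussWt.comp continuous_fst).mul
      (continuous_gaussWt.comp continuous_snd)).measurable.ennreal_ofReal
  rw [e, integral_withDensity_eq_integral_toReal_smul hm (by simp),
    integral_withDensity_eq_integral_toReal_smul hm (by simp)]
  have key := (measurePreserving_rotate (V := V) h hc).integral_comp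
    (rotate h).measurableEmbedding
    (fun p => (ENNReal.ofReal (gaussWt p.1 * gaussWt p.2)).toReal • f p)
  refine Eq.trans ?_ key
  congr 1
  funext p
  have : gaussWt p.1 * gaussWt p.2 = gaussWt (rotate h p).1 * gaussWt (rotate h p).2 := by
    simp only [gaussWt, ← Real.exp_add]
    congr 1
    have e1 : ‖c • p.1 - s • p.2‖ ^ 2 = c ^ 2 * ‖p.1‖ ^ 2 - 2 * (c * (s * inner ℝ p.1 p.2))
        + s ^ 2 * ‖p.2‖ ^ 2 := by
      rw [norm_sub_sq_real, norm_smul, norm_smul, inner_smul_left, inner_smul_right, mul_pow,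
        mul_pow, Real.norm_eq_abs, Real.norm_eq_abs, sq_abs, sq_abs]
      simp
    have e2 : ‖s • p.1 + c • p.2‖ ^ 2 = s ^ 2 * ‖p.1‖ ^ 2 + 2 * (c * (s * inner ℝ p.1 p.2))
        + c ^ 2 * ‖p.2‖ ^ 2 := by
      rw [norm_add_sq_real, norm_smul, norm_smul, inner_smul_left, inner_smul_right, mul_pow,
        mul_pow, Real.norm_eq_abs, Real.norm_eq_abs, sq_abs, sq_abs]
      simp
      ring
    change _ = -(1 / 2) * ‖c • p.1 - s • p.2‖ ^ 2 + -(1 / 2) * ‖s • p.1 + c • p.2‖ ^ 2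
    rw [e1, e2]
    linear_combination (1 / 2 * ‖p.1‖ ^ 2 + 1 / 2 * ‖p.2‖ ^ 2) * h
  rw [this]
  rfl

lemma hasFDerivAt_gaussWt (v : V) : HasFDerivAt gaussWt (-(gaussWt v) • innerSL ℝ v) v := by
  have h1 : HasFDerivAt (fun x : V => -(1 / 2) * ‖x‖ ^ 2) (-(innerSL ℝ v)) v := by
    refine ((hasStrictFDerivAt_norm_sq v).hasFDerivAt.const_mul (-(1 / 2))).congr_fderiv ?_
    ext w; simp
  refine h1.exp.congr_fderiv ?_
  ext w; simp [gaussWt]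

/-- Gaussian integration by parts. -/
lemma integral_gauss_mul_inner {h : V → ℝ} (hh : Differentiable ℝ h) {w : V}
    (i1 : Integrable (fun v => fderiv ℝ h v w) (gauss V))
    (i2 : Integrable (fun v => h v * inner ℝ v w) (gauss V)) (i3 : Integrable h (gauss V)) :
    ∫ v, h v * inner ℝ v w ∂(gauss V) = ∫ v, fderiv ℝ h v w ∂(gauss V) := by
  have hd' : ∀ v, fderiv ℝ gaussWt v w = -(gaussWt v * inner ℝ v w) := fun v => by
    rw [(hasFDerivAt_gaussWt v).fderiv]; simp
  rw [integrable_gauss_iff] at i1 i2 i3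
  simp only [smul_eq_mul] at i1 i2 i3
  rw [integral_gauss, integral_gauss]
  have key := integral_mul_fderiv_eq_neg_fderiv_mul_of_integrable (μ := (volume : Measure V))
    (f := h) (g := gaussWt) (v := w) (by simpa only [mul_comm] using i1)
    (by
      simp only [hd']
      refine i2.neg.congr (Eventually.of_forall fun v => ?_)
      simp only [Pi.neg_apply]; ring)
    (by simpa only [mul_comm] using i3)
    (fun x _ => hh x) (fun x _ => (hasFDerivAt_gaussWt x).differentiableAt)
  simp only [hd'] at key
  have e1 : ∫ v, h v * -(gaussWt v * inner ℝ v w) = -∫ v, gaussWt v • (h v * inner ℝ v w) := by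
    rw [← integral_neg]; congr 1; funext v; simp only [smul_eq_mul]; ring
  have e2 : ∫ v, fderiv ℝ h v w * gaussWt v = ∫ v, gaussWt v • fderiv ℝ h v w := by
    congr 1; funext v; simp only [smul_eq_mul]; ring
  rw [e1, e2] at key
  linarith

lemma integral_gauss_mul_inner_of_bounded {h : V → ℝ} (hh : ContDiff ℝ 1 h) {B B' : ℝ}
    (hB : ∀ x, ‖h x‖ ≤ B) (hB' : ∀ x, ‖fderiv ℝ h x‖ ≤ B') (w : V) :
    ∫ v, h v * inner ℝ v w ∂(gauss V) = ∫ v, fderiv ℝ h v w ∂(gauss V) := by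
  have hcd : Continuous fun v => fderiv ℝ h v w :=
    (hh.continuous_fderiv one_ne_zero).clm_apply continuous_const
  refine integral_gauss_mul_inner (hh.differentiable one_ne_zero) ?_ ?_
    (hh.continuous.integrable_gauss hB)
  · exact hcd.integrable_gauss (B := B' * ‖w‖) fun x =>
      ((fderiv ℝ h x).le_opNorm w).trans (mul_le_mul_of_nonneg_right (hB' x) (norm_nonneg _))
  · refine (integrable_norm_gauss.const_mul (B * ‖w‖)).mono'
      (hh.continuous.mul (by fun_prop)).aestronglyMeasurable (Eventually.of_forall fun v => ?_)
    rw [norm_mul]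
    have h1 := norm_inner_le_norm (𝕜 := ℝ) v w
    have h0 : 0 ≤ B := (norm_nonneg _).trans (hB 0)
    calc _ ≤ B * (‖v‖ * ‖w‖) := mul_le_mul (hB v) h1 (norm_nonneg _) h0
      _ = _ := by ring

end Gauss

/-! ### Rotation coupling and the Gaussian variance. -/

section Gauss

set_option linter.unusedSectionVars false

variable {V : Type*} [NormedAddCommGroup V] [InnerProductSpace ℝ V] [FiniteDimensional ℝ V]
  [MeasurableSpace V] [BorelSpace V]

lemma continuous_gradient {g : V → ℝ} (hg : ContDiff ℝ 1 g) : Continuous (gradient g) :=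
  (InnerProductSpace.toDual ℝ V).symm.continuous.comp (hg.continuous_fderiv one_ne_zero)

lemma norm_gradient (g : V → ℝ) (x : V) : ‖gradient g x‖ = ‖fderiv ℝ g x‖ :=
  (InnerProductSpace.toDual ℝ V).symm.norm_map _

variable {g : V → ℝ} {B B' : ℝ}

lemma _root_.Continuous.integrable_gauss_prod {F : Type*} [NormedAddCommGroup F] [NormedSpace ℝ F]
    {f : V × V → F} (hf : Continuous f) {B : ℝ} (hB : ∀ x, ‖f x‖ ≤ B) :
    Integrable f ((gauss V).prod (gauss V)) :=
  Integrable.of_bound hf.aestronglyMeasurable B (Eventually.of_forall hB)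

/-- The correlation of the gradients of `g` at two rotated Gaussian variables. -/
def gradCorr (g : V → ℝ) (θ : ℝ) : ℝ :=
  ∫ p : V × V, inner ℝ (gradient g p.1) (gradient g (Real.cos θ • p.1 + Real.sin θ • p.2))
    ∂((gauss V).prod (gauss V))

lemma continuous_gradCorr (hg : ContDiff ℝ 1 g) (hB' : ∀ x, ‖fderiv ℝ g x‖ ≤ B') :
    Continuous (gradCorr g) := by
  have hc := continuous_gradient hg
  have h0 : 0 ≤ B' := (norm_nonneg _).trans (hB' 0)
  refine continuous_of_dominated (bound := fun _ => B' * B') (fun θ => ?_)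
    (fun θ => Eventually.of_forall fun p => ?_) (integrable_const _)
    (Eventually.of_forall fun p => by fun_prop)
  · exact Continuous.aestronglyMeasurable (by fun_prop)
  · refine (norm_inner_le_norm _ _).trans ?_
    rw [norm_gradient, norm_gradient]
    exact mul_le_mul (hB' _) (hB' _) (norm_nonneg _) h0

/-- Differentiating in θ produces the gradient at the rotated point in the direction of the
complementary rotated vector. Seen in rotated variables that direction is an independent Gaussian,
and integration by parts in it moves a derivative onto the other factor, with the factor -sin θ. -/
lemma hasDerivAt_coupling (hg : ContDiff ℝ 1 g) (hB : ∀ x, ‖g x‖ ≤ B)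
    (hB' : ∀ x, ‖fderiv ℝ g x‖ ≤ B') {θ : ℝ} (hθ : 0 ≤ Real.cos θ) :
    HasDerivAt (fun θ => ∫ p : V × V, g p.1 * g (Real.cos θ • p.1 + Real.sin θ • p.2)
      ∂((gauss V).prod (gauss V))) (-(Real.sin θ * gradCorr g θ)) θ := by
  have hc := continuous_gradient hg
  have hcg := hg.continuous
  have hcf := hg.continuous_fderiv one_ne_zero
  have h0 : 0 ≤ B := (norm_nonneg _).trans (hB 0)
  have h0' : 0 ≤ B' := (norm_nonneg _).trans (hB' 0)
  have hcs : Real.cos θ ^ 2 + Real.sin θ ^ 2 = 1 := Real.cos_sq_add_sin_sq θ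
  have i1 : Integrable (fun p : V × V => B * (B' * (‖p.1‖ + ‖p.2‖)))
      ((gauss V).prod (gauss V)) := by
    refine ((Integrable.add ?_ ?_).const_mul _).const_mul _
    · exact integrable_norm_gauss.comp_fst _
    · exact integrable_norm_gauss.comp_snd _
  have hbd : ∀ (p : V × V) (t : ℝ), ‖g p.1 * fderiv ℝ g (Real.cos t • p.1 + Real.sin t • p.2)
      (-Real.sin t • p.1 + Real.cos t • p.2)‖ ≤ B * (B' * (‖p.1‖ + ‖p.2‖)) := fun p t => by
    rw [norm_mul]
    refine mul_le_mul (hB _) ?_ (norm_nonneg _) h0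
    refine (ContinuousLinearMap.le_opNorm _ _).trans ?_
    refine mul_le_mul (hB' _) ?_ (norm_nonneg _) h0'
    refine (norm_add_le _ _).trans (add_le_add ?_ ?_)
    · rw [norm_smul, norm_neg]
      exact mul_le_of_le_one_left (norm_nonneg _) (Real.abs_sin_le_one t)
    · rw [norm_smul]
      exact mul_le_of_le_one_left (norm_nonneg _) (Real.abs_cos_le_one t)
  have key := hasDerivAt_integral_of_dominated_loc_of_deriv_le
    (μ := (gauss V).prod (gauss V)) (x₀ := θ) (s := Set.univ) Filter.univ_mem
    (F := fun θ p => g p.1 * g (Real.cos θ • p.1 + Real.sin θ • p.2))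
    (F' := fun θ p => g p.1 * fderiv ℝ g (Real.cos θ • p.1 + Real.sin θ • p.2)
      (-Real.sin θ • p.1 + Real.cos θ • p.2))
    (bound := fun p => B * (B' * (‖p.1‖ + ‖p.2‖)))
    (Eventually.of_forall fun t => Continuous.aestronglyMeasurable (by fun_prop))
    (Continuous.integrable_gauss_prod (B := B * B) (by fun_prop) fun p => by
      rw [norm_mul]; exact mul_le_mul (hB _) (hB _) (norm_nonneg _) h0)
    (Continuous.aestronglyMeasurable (by fun_prop))
    (Eventually.of_forall fun p t _ => hbd p t) i1
    (Eventually.of_forall fun p t _ => by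
      refine HasDerivAt.const_mul _ ?_
      have h1 : HasDerivAt (fun t => Real.cos t • p.1 + Real.sin t • p.2)
          (-Real.sin t • p.1 + Real.cos t • p.2) t :=
        ((Real.hasDerivAt_cos t).smul_const _).add ((Real.hasDerivAt_sin t).smul_const _)
      exact ((hg.differentiable one_ne_zero _).hasFDerivAt).comp_hasDerivAt t h1)
  refine key.2.congr_deriv ?_
  -- The inverse rotation is substituted, after which the second copy of `g` depends on the first
  -- variable only and the direction of differentiation is the second variable.
  have r1 := integral_rotate (V := V) hcs hθ
    (fun p => g p.1 * fderiv ℝ g (Real.cos θ • p.1 + Real.sin θ • p.2)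
      (-Real.sin θ • p.1 + Real.cos θ • p.2))
  have r2 := integral_rotate (V := V) hcs hθ
    (fun p => inner ℝ (gradient g p.1) (gradient g (Real.cos θ • p.1 + Real.sin θ • p.2)))
  rw [gradCorr, ← r1, ← r2]
  clear r1 r2
  have e1 : ∀ p : V × V, Real.cos θ • (Real.cos θ • p.1 - Real.sin θ • p.2)
      + Real.sin θ • (Real.sin θ • p.1 + Real.cos θ • p.2) = p.1 := fun p => by
    have : p.1 = (Real.cos θ ^ 2 + Real.sin θ ^ 2) • p.1 := by rw [hcs, one_smul]
    conv_rhs => rw [this]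
    module
  have e2 : ∀ p : V × V, -Real.sin θ • (Real.cos θ • p.1 - Real.sin θ • p.2)
      + Real.cos θ • (Real.sin θ • p.1 + Real.cos θ • p.2) = p.2 := fun p => by
    have : p.2 = (Real.cos θ ^ 2 + Real.sin θ ^ 2) • p.2 := by rw [hcs, one_smul]
    conv_rhs => rw [this]
    module
  simp only [e1, e2]
  have i2 : Integrable (fun p : V × V => g (Real.cos θ • p.1 - Real.sin θ • p.2)
      * fderiv ℝ g p.1 p.2) ((gauss V).prod (gauss V)) := by
    refine ((integrable_norm_gauss.comp_snd (gauss V)).const_mul (B * B')).mono'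
      (Continuous.aestronglyMeasurable (by fun_prop)) (Eventually.of_forall fun p => ?_)
    rw [norm_mul, mul_assoc]
    refine mul_le_mul (hB _) ?_ (norm_nonneg _) h0
    exact (ContinuousLinearMap.le_opNorm _ _).trans
      (mul_le_mul_of_nonneg_right (hB' _) (norm_nonneg _))
  have i3 : Integrable (fun p : V × V => inner ℝ (gradient g (Real.cos θ • p.1 - Real.sin θ • p.2))
      (gradient g p.1)) ((gauss V).prod (gauss V)) := by
    refine Continuous.integrable_gauss_prod (B := B' * B') (by fun_prop) fun p => ?_
    refine (norm_inner_le_norm _ _).trans ?_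
    rw [norm_gradient, norm_gradient]
    exact mul_le_mul (hB' _) (hB' _) (norm_nonneg _) h0'
  rw [integral_prod _ i2, integral_prod _ i3, ← integral_const_mul, ← integral_neg]
  congr 1
  funext u
  set h : V → ℝ := fun v => g (Real.cos θ • u - Real.sin θ • v) with hh
  have hd : ∀ v, HasFDerivAt h (-Real.sin θ • fderiv ℝ g (Real.cos θ • u - Real.sin θ • v)) v :=
    fun v => by
      have h1 : HasFDerivAt (fun v => Real.cos θ • u - Real.sin θ • v)
          (-(Real.sin θ • ContinuousLinearMap.id ℝ V)) v := by
        simpa using ((hasFDerivAt_id v).const_smul (Real.sin θ)).const_sub (Real.cos θ • u)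
      refine (((hg.differentiable one_ne_zero _).hasFDerivAt).comp v h1).congr_fderiv ?_
      ext w; simp
  have hib := integral_gauss_mul_inner_of_bounded (h := h) (B := B) (B' := B') (by fun_prop)
    (fun v => hB _) (fun v => by
      rw [(hd v).fderiv, norm_smul, norm_neg]
      exact (mul_le_of_le_one_left (norm_nonneg _) (Real.abs_sin_le_one θ)).trans (hB' _))
    (gradient g u)
  have e3 : ∀ v, inner ℝ v (gradient g u) = fderiv ℝ g u v := fun v => by
    rw [real_inner_comm, inner_gradient_left]
  simp only [e3] at hib
  simp only [hh] at hib ⊢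
  rw [hib, ← integral_const_mul, ← integral_neg]
  congr 1
  funext v
  rw [(hd v).fderiv, inner_gradient_left]
  simp

/-- The Gaussian Poincaré inequality in the form of an identity. -/
lemma gauss_variance_eq (hg : ContDiff ℝ 1 g) (hB : ∀ x, ‖g x‖ ≤ B)
    (hB' : ∀ x, ‖fderiv ℝ g x‖ ≤ B') :
    (gauss V).real Set.univ * (∫ x, g x ^ 2 ∂(gauss V)) - (∫ x, g x ∂(gauss V)) ^ 2
      = ∫ θ in (0 : ℝ)..(Real.pi / 2), Real.sin θ * gradCorr g θ := by
  have hcg := hg.continuous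
  have hcont := continuous_gradCorr hg hB'
  have h0 : 0 ≤ B := (norm_nonneg _).trans (hB 0)
  have hpi := Real.pi_pos
  have h := intervalIntegral.integral_eq_sub_of_hasDerivAt (a := 0) (b := Real.pi / 2)
    (f' := fun θ => -(Real.sin θ * gradCorr g θ))
    (fun θ hθ => hasDerivAt_coupling hg hB hB' (by
      rw [Set.uIcc_of_le (by positivity)] at hθ
      exact Real.cos_nonneg_of_mem_Icc ⟨by linarith [hθ.1], hθ.2⟩))
    ((Real.continuous_sin.mul hcont).neg.intervalIntegrable _ _)
  simp only [Real.cos_zero, Real.sin_zero, one_smul, zero_smul, add_zero, Real.cos_pi_div_two,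
    Real.sin_pi_div_two, zero_add, intervalIntegral.integral_neg] at h
  rw [integral_prod_mul] at h
  have e : ∫ p : V × V, g p.1 * g p.1 ∂((gauss V).prod (gauss V))
      = (gauss V).real Set.univ * ∫ x, g x ^ 2 ∂(gauss V) := by
    have := integral_prod_mul (μ := gauss V) (ν := gauss V) (fun x => g x ^ 2) (fun _ => (1 : ℝ))
    simp only [mul_one, integral_const, smul_eq_mul] at this
    rw [mul_comm, ← this]
    congr 1; funext p; ring
  rw [e] at h
  linarith

/-- The Gaussian Poincaré inequality with a remainder, that measures the distance to affine
functions. -/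
theorem gauss_poincare (hg : ContDiff ℝ 1 g) (hB : ∀ x, ‖g x‖ ≤ B)
    (hB' : ∀ x, ‖fderiv ℝ g x‖ ≤ B') :
    (1 / 8) * ((gauss V).real Set.univ * (∫ x, g x ^ 2 ∂(gauss V)) - (∫ x, g x ∂(gauss V)) ^ 2
        - ‖∫ x, g x • x ∂(gauss V)‖ ^ 2)
      ≤ (gauss V).real Set.univ * (∫ x, ‖gradient g x‖ ^ 2 ∂(gauss V))
        - ((gauss V).real Set.univ * (∫ x, g x ^ 2 ∂(gauss V)) - (∫ x, g x ∂(gauss V)) ^ 2) := by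
  have hc := continuous_gradient hg
  have hcont := continuous_gradCorr hg hB'
  have h0' : 0 ≤ B' := (norm_nonneg _).trans (hB' 0)
  have hmean : ∫ x, g x • x ∂(gauss V) = ∫ x, gradient g x ∂(gauss V) := by
    have hi : Integrable (fun x => g x • x) (gauss V) := by
      refine (integrable_norm_gauss.const_mul B).mono'
        (hg.continuous.smul continuous_id).aestronglyMeasurable (Eventually.of_forall fun x => ?_)
      rw [norm_smul]
      exact mul_le_mul_of_nonneg_right (hB x) (norm_nonneg _)
    have hi' : Integrable (gradient g) (gauss V) :=
      hc.integrable_gauss (B := B') fun x => by rw [norm_gradient]; exact hB' x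
    refine ext_inner_left ℝ fun w => ?_
    rw [← integral_inner hi, ← integral_inner hi']
    have := integral_gauss_mul_inner_of_bounded hg hB hB' w
    simp only [real_inner_comm _ w, inner_gradient_left, real_inner_smul_left] at this ⊢
    exact this
  rw [hmean]
  have hpi := Real.pi_pos
  set D := (gauss V).real Set.univ * ∫ x, ‖gradient g x‖ ^ 2 ∂(gauss V) with hD
  set μ2 := (gauss V).prod (gauss V) with hμ2
  have hgb : ∀ x, ‖gradient g x‖ ≤ B' := fun x => by rw [norm_gradient]; exact hB' x
  have hsq : ∀ x, ‖‖gradient g x‖ ^ 2‖ ≤ B' ^ 2 := fun x => by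
    rw [Real.norm_of_nonneg (sq_nonneg _)]
    exact pow_le_pow_left₀ (norm_nonneg _) (hgb x) 2
  have hin : ∀ x y, ‖inner ℝ (gradient g x) (gradient g y)‖ ≤ B' * B' := fun x y =>
    (norm_inner_le_norm _ _).trans (mul_le_mul (hgb x) (hgb y) (norm_nonneg _) h0')
  have hD1 : ∫ p : V × V, ‖gradient g p.1‖ ^ 2 ∂μ2 = D := by
    have := integral_prod_mul (μ := gauss V) (ν := gauss V) (fun x => ‖gradient g x‖ ^ 2)
      (fun _ => (1 : ℝ))
    simp only [mul_one, integral_const, smul_eq_mul] at this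
    rw [hμ2, this, hD, mul_comm]
  have hD2 : ∫ p : V × V, ‖gradient g p.2‖ ^ 2 ∂μ2 = D := by
    have := integral_prod_mul (μ := gauss V) (ν := gauss V) (fun _ => (1 : ℝ))
      (fun x => ‖gradient g x‖ ^ 2)
    simp only [mul_one, one_mul, integral_const, smul_eq_mul] at this
    rw [hμ2, this, hD]
  have hDθ : ∀ θ : ℝ, 0 ≤ Real.cos θ →
      ∫ p : V × V, ‖gradient g (Real.cos θ • p.1 + Real.sin θ • p.2)‖ ^ 2 ∂μ2 = D := by
    intro θ hθ
    have hcs : Real.cos θ ^ 2 + Real.sin θ ^ 2 = 1 := Real.cos_sq_add_sin_sq θ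
    rw [hμ2, ← integral_rotate hcs hθ, ← hD1]
    congr 1; funext p
    congr 3
    have : p.1 = (Real.cos θ ^ 2 + Real.sin θ ^ 2) • p.1 := by rw [hcs, one_smul]
    conv_rhs => rw [this]
    simp only; module
  set M := ‖∫ x, gradient g x ∂(gauss V)‖ ^ 2 with hM
  have hM1 : ∫ p : V × V, inner ℝ (gradient g p.1) (gradient g p.2) ∂μ2 = M := by
    have hi : Integrable (gradient g) (gauss V) := hc.integrable_gauss hgb
    rw [hμ2, integral_prod _ (Continuous.integrable_gauss_prod (by fun_prop) fun p => hin _ _)]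
    have e1 : ∀ x, ∫ y, inner ℝ (gradient g x) (gradient g y) ∂(gauss V)
        = inner ℝ (gradient g x) (∫ y, gradient g y ∂(gauss V)) := fun x =>
      integral_inner hi _
    simp only [e1]
    have e2 : ∀ x, inner ℝ (gradient g x) (∫ y, gradient g y ∂(gauss V))
        = inner ℝ (∫ y, gradient g y ∂(gauss V)) (gradient g x) := fun x => real_inner_comm _ _
    simp only [e2]
    rw [integral_inner hi, real_inner_self_eq_norm_sq]
  -- the correlation at a given angle, and at the complementary angle
  have hpair : ∀ θ ∈ Set.Icc 0 (Real.pi / 2),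
      D - M ≤ 2 * ((D - gradCorr g θ) + (D - gradCorr g (Real.pi / 2 - θ))) ∧
      gradCorr g θ ≤ D := by
    intro θ hθ
    have hcθ : 0 ≤ Real.cos θ := Real.cos_nonneg_of_mem_Icc ⟨by linarith [hθ.1], hθ.2⟩
    set z : V × V → V := fun p => Real.cos θ • p.1 + Real.sin θ • p.2 with hz
    have hzc : Continuous z := by fun_prop
    have hsw : gradCorr g (Real.pi / 2 - θ)
        = ∫ p : V × V, inner ℝ (gradient g p.2) (gradient g (z p)) ∂μ2 := by
      rw [gradCorr, hμ2, ← integral_prod_swap]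
      congr 1; funext p
      rw [Real.cos_pi_div_two_sub, Real.sin_pi_div_two_sub]
      simp only [Prod.swap, hz]
      rw [add_comm]
    have hθ' : gradCorr g θ = ∫ p : V × V, inner ℝ (gradient g p.1) (gradient g (z p)) ∂μ2 := rfl
    have j1 : Integrable (fun p : V × V => ‖gradient g p.1‖ ^ 2) μ2 :=
      Continuous.integrable_gauss_prod (by fun_prop) fun p => hsq _
    have j2 : Integrable (fun p : V × V => ‖gradient g p.2‖ ^ 2) μ2 :=
      Continuous.integrable_gauss_prod (by fun_prop) fun p => hsq _
    have j3 : Integrable (fun p : V × V => ‖gradient g (z p)‖ ^ 2) μ2 :=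
      Continuous.integrable_gauss_prod (by fun_prop) fun p => hsq _
    have j4 : Integrable (fun p : V × V => inner ℝ (gradient g p.1) (gradient g p.2)) μ2 :=
      Continuous.integrable_gauss_prod (by fun_prop) fun p => hin _ _
    have j5 : Integrable (fun p : V × V => inner ℝ (gradient g p.1) (gradient g (z p))) μ2 :=
      Continuous.integrable_gauss_prod (by fun_prop) fun p => hin _ _
    have j6 : Integrable (fun p : V × V => inner ℝ (gradient g p.2) (gradient g (z p))) μ2 :=
      Continuous.integrable_gauss_prod (by fun_prop) fun p => hin _ _
    have hDz : ∫ p, ‖gradient g (z p)‖ ^ 2 ∂μ2 = D := hDθ θ hcθ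
    constructor
    -- The parallelogram law: ‖x - y‖² ≤ 2‖x - z‖² + 2‖y - z‖², the defect being ‖x + y - 2z‖². Here
    -- z is the gradient at the rotated point, and the distance from z to y is the correlation at
    -- the complementary angle.
    · have hp : 0 ≤ ∫ p : V × V, ((‖gradient g p.1‖ ^ 2 + ‖gradient g p.2‖ ^ 2)
          + 4 * ‖gradient g (z p)‖ ^ 2 + 2 * inner ℝ (gradient g p.1) (gradient g p.2)
          + (-4) * inner ℝ (gradient g p.1) (gradient g (z p))
          + (-4) * inner ℝ (gradient g p.2) (gradient g (z p))) ∂μ2 := by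
        refine integral_nonneg fun p => ?_
        have : 0 ≤ ‖gradient g p.1 + gradient g p.2 - (2 : ℝ) • gradient g (z p)‖ ^ 2 :=
          sq_nonneg _
        have e4 : ‖(2 : ℝ)‖ ^ 2 = 4 := by norm_num
        rw [norm_sub_sq_real, norm_add_sq_real, inner_smul_right, inner_add_left, norm_smul,
          mul_pow, e4] at this
        simp only [Pi.zero_apply]
        linarith
      have q1 := j3.const_mul 4
      have q2 := j4.const_mul 2
      have q3 := j5.const_mul (-4)
      have q4 := j6.const_mul (-4)
      rw [integral_add (by exact (((j1.add j2).add q1).add q2).add q3) q4,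
        integral_add (by exact ((j1.add j2).add q1).add q2) q3,
        integral_add (by exact (j1.add j2).add q1) q2,
        integral_add (by exact j1.add j2) q1, integral_add j1 j2] at hp
      simp only [integral_const_mul] at hp
      rw [hD1, hD2, hDz, hM1, ← hsw, ← hθ'] at hp
      linarith
    · have hp : 0 ≤ ∫ p : V × V, (‖gradient g p.1‖ ^ 2 + ‖gradient g (z p)‖ ^ 2
          + (-2) * inner ℝ (gradient g p.1) (gradient g (z p))) ∂μ2 := by
        refine integral_nonneg fun p => ?_
        have : 0 ≤ ‖gradient g p.1 - gradient g (z p)‖ ^ 2 := sq_nonneg _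
        rw [norm_sub_sq_real] at this
        simp only [Pi.zero_apply]
        linarith
      rw [integral_add (by exact j1.add j3) (by exact j5.const_mul (-2)), integral_add j1 j3,
        integral_const_mul, hD1, hDz, ← hθ'] at hp
      linarith
  -- integrate
  have hs : ∫ θ in (0 : ℝ)..(Real.pi / 2), Real.sin θ = 1 := by
    rw [integral_sin]; simp
  have hdef : D - (∫ θ in (0 : ℝ)..(Real.pi / 2), Real.sin θ * gradCorr g θ)
      = ∫ θ in (0 : ℝ)..(Real.pi / 2), Real.sin θ * (D - gradCorr g θ) := by
    have e : ∀ θ, Real.sin θ * (D - gradCorr g θ) = D * Real.sin θ - Real.sin θ * gradCorr g θ :=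
      fun θ => by ring
    simp only [e]
    rw [intervalIntegral.integral_sub
      (by exact (continuous_const.mul Real.continuous_sin).intervalIntegrable _ _)
      (by exact (Real.continuous_sin.mul hcont).intervalIntegrable _ _),
      intervalIntegral.integral_const_mul, hs, mul_one]
  have hrefl : ∫ θ in (0 : ℝ)..(Real.pi / 2), Real.sin θ * (D - gradCorr g θ)
      = ∫ θ in (0 : ℝ)..(Real.pi / 2), Real.cos θ * (D - gradCorr g (Real.pi / 2 - θ)) := by
    have := intervalIntegral.integral_comp_sub_left (a := 0) (b := Real.pi / 2)
      (fun θ => Real.sin θ * (D - gradCorr g θ)) (Real.pi / 2)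
    simp only [Real.sin_pi_div_two_sub, sub_self, sub_zero] at this
    exact this.symm
  have k1 : IntervalIntegrable (fun θ => Real.sin θ * (D - gradCorr g θ)) volume 0 (Real.pi / 2) :=
    Continuous.intervalIntegrable (by fun_prop) _ _
  have k2 : IntervalIntegrable (fun θ => Real.cos θ * (D - gradCorr g (Real.pi / 2 - θ))) volume 0
      (Real.pi / 2) := Continuous.intervalIntegrable (by fun_prop) _ _
  -- Both weights sin θ and cos θ dominate sin θ cos θ, so complementary angles can be paired. Since
  -- ∫ sin θ cos θ dθ = 1/2 on the quarter turn, twice the deficit is at least (D - M)/4, whence the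
  -- constant 1/8.
  have hmono : ∫ θ in (0 : ℝ)..(Real.pi / 2), (D - M) / 2 * (Real.sin θ * Real.cos θ)
      ≤ ∫ θ in (0 : ℝ)..(Real.pi / 2), (Real.sin θ * (D - gradCorr g θ)
        + Real.cos θ * (D - gradCorr g (Real.pi / 2 - θ))) := by
    refine intervalIntegral.integral_mono_on (by positivity)
      (Continuous.intervalIntegrable (by fun_prop) _ _) (k1.add k2) fun θ hθ => ?_
    have hcθ : 0 ≤ Real.cos θ := Real.cos_nonneg_of_mem_Icc ⟨by linarith [hθ.1], hθ.2⟩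
    have hsθ : 0 ≤ Real.sin θ := Real.sin_nonneg_of_nonneg_of_le_pi hθ.1 (by linarith [hθ.2])
    obtain ⟨h1, h2⟩ := hpair θ hθ
    have h3 := (hpair (Real.pi / 2 - θ) ⟨by linarith [hθ.2], by linarith [hθ.1]⟩).2
    have h4 : Real.sin θ * Real.cos θ * (D - gradCorr g θ) ≤ Real.sin θ * (D - gradCorr g θ) := by
      refine mul_le_mul_of_nonneg_right ?_ (by linarith)
      exact mul_le_of_le_one_right hsθ (Real.cos_le_one θ)
    have h5 : Real.sin θ * Real.cos θ * (D - gradCorr g (Real.pi / 2 - θ))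
        ≤ Real.cos θ * (D - gradCorr g (Real.pi / 2 - θ)) := by
      refine mul_le_mul_of_nonneg_right ?_ (by linarith)
      exact mul_le_of_le_one_left hcθ (Real.sin_le_one θ)
    have h6 := mul_le_mul_of_nonneg_left h1 (mul_nonneg hsθ hcθ)
    linarith
  rw [intervalIntegral.integral_add k1 k2, ← hrefl, intervalIntegral.integral_const_mul,
    integral_sin_mul_cos₁] at hmono
  simp only [Real.sin_pi_div_two, Real.sin_zero] at hmono
  rw [gauss_variance_eq hg hB hB']
  rw [← hdef] at hmono
  -- The plain Poincaré inequality, used to replace D by the smaller variance in the remainder (D -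
  -- M)/8.
  have hnn : 0 ≤ D - ∫ θ in (0 : ℝ)..(Real.pi / 2), Real.sin θ * gradCorr g θ := by
    rw [hdef]
    refine intervalIntegral.integral_nonneg (by positivity) fun θ hθ => ?_
    have hsθ : 0 ≤ Real.sin θ := Real.sin_nonneg_of_nonneg_of_le_pi hθ.1 (by linarith [hθ.2])
    exact mul_nonneg hsθ (by linarith [(hpair θ hθ).2])
  linarith

end Gauss

/-! ### Logarithmic polar coordinates -/

/-- The unit sphere of `ℝ^d`. -/
abbrev Sph (d : ℕ) : Type := Metric.sphere (0 : E d) 1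

/-- The surface measure of the unit sphere. -/
def surf (d : ℕ) : Measure (Sph d) := (volume : Measure (E d)).toSphere

instance (d : ℕ) : IsFiniteMeasure (surf d) := by unfold surf; infer_instance

lemma Sph.norm_eq {d : ℕ} (y : Sph d) : ‖(y : E d)‖ = 1 := by simp

/-- The point with logarithmic polar coordinates `(t, y)`. -/
def polarPt {d : ℕ} (α : ℝ) (p : ℝ × Sph d) : E d := Real.exp (p.1 / α) • (p.2 : E d)

lemma norm_polarPt {d : ℕ} (α : ℝ) (p : ℝ × Sph d) : ‖polarPt α p‖ = Real.exp (p.1 / α) := by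
  rw [polarPt, norm_smul, Sph.norm_eq, mul_one, Real.norm_of_nonneg (Real.exp_pos _).le]

lemma polarPt_ne_zero {d : ℕ} (α : ℝ) (p : ℝ × Sph d) : polarPt α p ≠ 0 := by
  rw [← norm_pos_iff, norm_polarPt]; exact Real.exp_pos _

lemma continuous_polarPt {d : ℕ} (α : ℝ) : Continuous (polarPt (d := d) α) := by
  unfold polarPt; fun_prop

lemma normalize_polarPt {d : ℕ} (α : ℝ) (p : ℝ × Sph d) :
    ‖polarPt α p‖⁻¹ • polarPt α p = (p.2 : E d) := by
  rw [norm_polarPt, polarPt, smul_smul, inv_mul_cancel₀ (Real.exp_pos _).ne', one_smul]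

/-- The logarithmic coordinate on the half-line. -/
def expHomeo {α : ℝ} (hα : 0 < α) : ℝ ≃ₜ Set.Ioi (0 : ℝ) where
  toFun t := ⟨Real.exp (t / α), Real.exp_pos _⟩
  invFun r := α * Real.log r
  left_inv t := by simp only [Real.log_exp]; field_simp
  right_inv r := by
    ext
    simp only
    rw [mul_div_cancel_left₀ _ hα.ne', Real.exp_log r.2]
  continuous_toFun := by fun_prop
  continuous_invFun := by
    refine continuous_const.mul (Continuous.log continuous_subtype_val fun r => (ne_of_gt r.2))

/-- The substitution r = e^(t/α), for which r^n dr = α⁻¹ r^(n+1) dt. -/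
lemma volumeIoiPow_eq_map {α : ℝ} (hα : 0 < α) (n : ℕ) :
    Measure.volumeIoiPow n = ((volume : Measure ℝ).withDensity fun t =>
      ENNReal.ofReal (α⁻¹ * Real.exp (((n : ℝ) + 1) * (t / α)))).map (expHomeo hα) := by
  ext s hs
  rw [Measure.map_apply (expHomeo hα).measurable hs, Measure.volumeIoiPow,
    withDensity_apply _ hs, withDensity_apply _ ((expHomeo hα).measurable hs),
    setLIntegral_subtype measurableSet_Ioi _ fun a : ℝ => ENNReal.ofReal (a ^ n)]
  have himg : (Subtype.val '' s : Set ℝ) = (fun t => Real.exp (t / α)) '' (expHomeo hα ⁻¹' s) := by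
    ext r
    constructor
    · rintro ⟨x, hx, rfl⟩
      refine ⟨(expHomeo hα).symm x, by simpa using hx, ?_⟩
      have := (expHomeo hα).apply_symm_apply x
      exact congrArg Subtype.val this
    · rintro ⟨t, ht, rfl⟩
      exact ⟨expHomeo hα t, ht, rfl⟩
  have hd : ∀ t, HasDerivAt (fun t => Real.exp (t / α)) (Real.exp (t / α) * (1 / α)) t := fun t =>
    ((hasDerivAt_id t).div_const α).exp
  rw [himg, lintegral_image_eq_lintegral_abs_deriv_mul ((expHomeo hα).measurable hs)
    (fun t _ => (hd t).hasDerivWithinAt)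
    (fun x _ y _ hxy => by
      have := Real.exp_injective hxy
      field_simp at this
      exact this)]
  refine lintegral_congr fun t => ?_
  rw [← ENNReal.ofReal_mul (abs_nonneg _), abs_of_nonneg (by positivity), ← Real.exp_nat_mul,
    add_mul, Real.exp_add, one_mul]
  congr 1
  ring

variable {F : Type*} [NormedAddCommGroup F] [NormedSpace ℝ F]

lemma expHomeo_measurePreserving {α : ℝ} (hα : 0 < α) (n : ℕ) :
    MeasurePreserving (expHomeo hα) ((volume : Measure ℝ).withDensity fun t =>
      ENNReal.ofReal (α⁻¹ * Real.exp (((n : ℝ) + 1) * (t / α)))) (Measure.volumeIoiPow n) :=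
  ⟨(expHomeo hα).measurable, (volumeIoiPow_eq_map hα n).symm⟩

/-- The polar parametrization, as a homeomorphism onto the complement of the origin. -/
def polarHomeo {α : ℝ} (hα : 0 < α) (d : ℕ) : ℝ × Sph d ≃ₜ ({0}ᶜ : Set (E d)) :=
  ((Homeomorph.prodComm _ _).trans ((Homeomorph.refl _).prodCongr (expHomeo hα))).trans
    (homeomorphUnitSphereProd (E d)).symm

lemma polarHomeo_apply {α : ℝ} (hα : 0 < α) (d : ℕ) (p : ℝ × Sph d) :
    (polarHomeo hα d p : E d) = polarPt α p := rfl

lemma polarHomeo_measurePreserving {α : ℝ} (hα : 0 < α) {d : ℕ} (hd : 0 < d) :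
    MeasurePreserving (polarHomeo hα d)
      (((volume : Measure ℝ).prod (surf d)).withDensity fun p =>
        ENNReal.ofReal (α⁻¹ * Real.exp (d * (p.1 / α))))
      ((volume : Measure (E d)).comap (↑)) := by
  have h1 := (volume : Measure (E d)).measurePreserving_homeomorphUnitSphereProd
  have h1' := h1.symm (homeomorphUnitSphereProd (E d)).toMeasurableEquiv
  have hdim : Module.finrank ℝ (E d) - 1 = d - 1 := by simp
  rw [hdim] at h1'
  have h2 := (MeasurePreserving.id (surf d)).prod (expHomeo_measurePreserving hα (d - 1))
  have h3 : MeasurePreserving (Prod.swap : ℝ × Sph d → Sph d × ℝ)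
      (((volume : Measure ℝ).withDensity fun t =>
        ENNReal.ofReal (α⁻¹ * Real.exp ((((d - 1 : ℕ) : ℝ) + 1) * (t / α)))).prod (surf d)) _ :=
    Measure.measurePreserving_swap
  have h4 := h1'.comp (h2.comp h3)
  -- The exponent d - 1 of the polar Jacobian gains one from dr = α⁻¹ r dt.
  have e : ((d - 1 : ℕ) : ℝ) + 1 = d := by
    rw [Nat.cast_sub hd]; simp
  rw [e, prod_withDensity_left (by fun_prop)] at h4
  exact h4

theorem integral_polar {α : ℝ} (hα : 0 < α) {d : ℕ} (hd : 0 < d) (f : E d → F) :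
    ∫ x, f x = ∫ p : ℝ × Sph d, (α⁻¹ * Real.exp (d * (p.1 / α))) • f (polarPt α p)
      ∂((volume : Measure ℝ).prod (surf d)) := by
  have : Nonempty (Fin d) := ⟨⟨0, hd⟩⟩
  have h0 : ∫ x, f x = ∫ x in ({0}ᶜ : Set (E d)), f x := by
    rw [Measure.restrict_eq_self_of_ae_mem]
    exact compl_mem_ae_iff.2 (by simp)
  rw [h0, ← integral_subtype_comap (measurableSet_singleton _).compl,
    ← (polarHomeo_measurePreserving hα hd).integral_comp
      (polarHomeo hα d).measurableEmbedding,
    integral_withDensity_eq_integral_toReal_smul (by fun_prop) (by simp)]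
  congr 1
  funext p
  rw [ENNReal.toReal_ofReal (by positivity), polarHomeo_apply]

theorem integrable_polar_iff {α : ℝ} (hα : 0 < α) {d : ℕ} (hd : 0 < d) (f : E d → F) :
    Integrable f ↔ Integrable (fun p : ℝ × Sph d =>
      (α⁻¹ * Real.exp (d * (p.1 / α))) • f (polarPt α p))
      ((volume : Measure ℝ).prod (surf d)) := by
  have : Nonempty (Fin d) := ⟨⟨0, hd⟩⟩
  have h0 : Integrable f ↔ IntegrableOn f ({0}ᶜ : Set (E d)) := by
    rw [IntegrableOn, Measure.restrict_eq_self_of_ae_mem]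
    exact compl_mem_ae_iff.2 (by simp)
  rw [h0, integrableOn_iff_comap_subtypeVal (measurableSet_singleton _).compl,
    ← (polarHomeo_measurePreserving hα hd).integrable_comp_emb
      (polarHomeo hα d).measurableEmbedding,
    integrable_withDensity_iff_integrable_smul' (by fun_prop) (by simp)]
  refine integrable_congr (Eventually.of_forall fun p => ?_)
  simp only [Function.comp]
  rw [ENNReal.toReal_ofReal (by positivity), polarHomeo_apply]

/-! ### Logarithmic cutoff functions -/

section Cut

set_option linter.unusedSectionVars false

variable {V : Type*} [NormedAddCommGroup V] [InnerProductSpace ℝ V]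

/-- A bump function on the line. -/
def logBump : ContDiffBump (0 : ℝ) := ⟨1, 2, one_pos, one_lt_two⟩

open Classical in
/-- The logarithmic cutoff function, equal to `1` for `|ln |x|| ≤ j + 1` and to `0` for
`|ln |x|| ≥ 2 (j + 1)`. -/
def cut (j : ℕ) (x : V) : ℝ :=
  if x = 0 then 0 else logBump (Real.log ‖x‖ / (j + 1))

/-- The closed annulus `e^(-R) ≤ |x| ≤ e^R`. -/
def annulus (V : Type*) [NormedAddCommGroup V] (R : ℝ) : Set V :=
  {x | Real.exp (-R) ≤ ‖x‖ ∧ ‖x‖ ≤ Real.exp R}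

lemma annulus_subset (R : ℝ) : annulus V R ⊆ {0}ᶜ := fun x hx => by
  simpa using norm_pos_iff.1 ((Real.exp_pos _).trans_le hx.1)

lemma isClosed_annulus (R : ℝ) : IsClosed (annulus V R) :=
  (isClosed_le continuous_const continuous_norm).inter
    (isClosed_le continuous_norm continuous_const)

lemma isCompact_annulus [FiniteDimensional ℝ V] (R : ℝ) : IsCompact (annulus V R) := by
  have : ProperSpace V := FiniteDimensional.proper ℝ V
  refine (isCompact_closedBall (0 : V) (Real.exp R)).of_isClosed_subset (isClosed_annulus R) ?_
  intro x hx
  simpa using hx.2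

lemma mem_annulus_iff {x : V} (hx : x ≠ 0) {R : ℝ} : x ∈ annulus V R ↔ |Real.log ‖x‖| ≤ R := by
  have h := norm_pos_iff.2 hx
  rw [abs_le, Real.le_log_iff_exp_le h, Real.log_le_iff_le_exp h]
  rfl

lemma cut_nonneg (j : ℕ) (x : V) : 0 ≤ cut j x := by
  unfold cut; split_ifs
  · exact le_rfl
  · exact logBump.nonneg

lemma cut_le_one (j : ℕ) (x : V) : cut j x ≤ 1 := by
  unfold cut; split_ifs
  · exact zero_le_one
  · exact logBump.le_one

lemma cut_eq_one {j : ℕ} {x : V} (hx : x ∈ annulus V (j + 1)) : cut j x = 1 := by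
  have h0 : x ≠ 0 := annulus_subset _ hx
  rw [mem_annulus_iff h0] at hx
  rw [cut, if_neg h0]
  apply logBump.one_of_mem_closedBall
  have : (0 : ℝ) < (j : ℝ) + 1 := by positivity
  rw [mem_closedBall_zero_iff, Real.norm_eq_abs, abs_div, abs_of_pos this]
  exact (div_le_one this).2 hx

lemma cut_eq_zero {j : ℕ} {x : V} (hx : x ∉ annulus V (2 * (j + 1))) : cut j x = 0 := by
  unfold cut; split_ifs with h0
  · rfl
  · rw [mem_annulus_iff h0, not_le] at hx
    apply logBump.zero_of_le_dist
    have : (0 : ℝ) < (j : ℝ) + 1 := by positivity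
    rw [dist_zero_right, Real.norm_eq_abs, abs_div, abs_of_pos this]
    exact (le_div_iff₀ this).2 hx.le

lemma tsupport_cut_subset (j : ℕ) : tsupport (cut (V := V) j) ⊆ annulus V (2 * (j + 1)) := by
  refine closure_minimal (fun x hx => ?_) (isClosed_annulus _)
  by_contra h
  exact hx (cut_eq_zero h)

lemma hasCompactSupport_cut [FiniteDimensional ℝ V] (j : ℕ) : HasCompactSupport (cut (V := V) j) :=
  (isCompact_annulus _).of_isClosed_subset (isClosed_tsupport _) (tsupport_cut_subset j)

lemma eventually_cut_eq_one {x : V} (hx : x ≠ 0) : ∀ᶠ j in atTop, cut j x = 1 := by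
  obtain ⟨N, hN⟩ := exists_nat_ge |Real.log ‖x‖|
  filter_upwards [eventually_ge_atTop N] with j hj
  apply cut_eq_one
  rw [mem_annulus_iff hx]
  have : (N : ℝ) ≤ j := by exact_mod_cast hj
  linarith

lemma cut_eventuallyEq {j : ℕ} {x : V} (hx : x ≠ 0) :
    cut j =ᶠ[𝓝 x] fun x => logBump (Real.log ‖x‖ / (j + 1)) := by
  filter_upwards [isOpen_compl_singleton.mem_nhds hx] with y hy
  rw [cut, if_neg (by simpa using hy)]

lemma contDiff_cut (j : ℕ) : ContDiff ℝ ∞ (cut (V := V) j) := by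
  rw [contDiff_iff_contDiffAt]
  intro x
  by_cases hx : x = 0
  · have : cut j =ᶠ[𝓝 x] fun _ => (0 : ℝ) := by
      have h1 : (annulus V (2 * (j + 1)))ᶜ ∈ 𝓝 x :=
        (isClosed_annulus _).isOpen_compl.mem_nhds fun h => annulus_subset _ h hx
      filter_upwards [h1] with y hy using cut_eq_zero hy
    exact contDiffAt_const.congr_of_eventuallyEq this
  · refine ContDiffAt.congr_of_eventuallyEq ?_ (cut_eventuallyEq hx)
    have h1 : ContDiffAt ℝ ∞ (fun x : V => Real.log ‖x‖ / (j + 1)) x :=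
      ((contDiffAt_norm ℝ hx).log (norm_ne_zero_iff.2 hx)).div_const _
    exact logBump.contDiff.contDiffAt.comp x h1

lemma hasFDerivAt_log_norm {x : V} (hx : x ≠ 0) :
    HasFDerivAt (fun x : V => Real.log ‖x‖) ((‖x‖ ^ 2)⁻¹ • innerSL ℝ x) x := by
  have h1 : (fun x : V => Real.log ‖x‖) = fun x => (1 / 2) * Real.log (‖x‖ ^ 2) := by
    funext y; rw [Real.log_pow]; push_cast; ring
  rw [h1]
  refine (((hasStrictFDerivAt_norm_sq x).hasFDerivAt.log (by positivity)).const_mul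
    (1 / 2)).congr_fderiv ?_
  ext w
  simp
  ring

/-- The cutoff is a fixed profile of ln |x| / (j+1), so its gradient is at most a constant over |x|
(j+1). This scale-invariant decay lets the cutoff errors vanish at the origin and at infinity
simultaneously. -/
lemma exists_norm_fderiv_cut_le : ∃ C, 0 ≤ C ∧ ∀ (j : ℕ) (x : V),
    ‖x‖ * ‖fderiv ℝ (cut j) x‖ ≤ C / (j + 1) := by
  have hc : Continuous (deriv logBump) := logBump.contDiff.continuous_deriv (n := 1) le_rfl
  obtain ⟨C, hC⟩ := hc.bounded_above_of_compact_support logBump.hasCompactSupport.deriv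
  have hC0 : 0 ≤ C := (norm_nonneg _).trans (hC 0)
  refine ⟨C, hC0, fun j x => ?_⟩
  have hj : (0 : ℝ) < (j : ℝ) + 1 := by positivity
  by_cases hx : x = 0
  · rw [hx, norm_zero, zero_mul]; positivity
  have h1 : HasFDerivAt (fun x : V => Real.log ‖x‖ / (j + 1))
      (((j : ℝ) + 1)⁻¹ • ((‖x‖ ^ 2)⁻¹ • innerSL ℝ x)) x := by
    simpa only [div_eq_inv_mul] using (hasFDerivAt_log_norm hx).const_mul ((j : ℝ) + 1)⁻¹
  have h2 : HasDerivAt logBump (deriv logBump (Real.log ‖x‖ / (j + 1))) (Real.log ‖x‖ / (j + 1)) :=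
    ((logBump.contDiff (n := 1)).differentiable one_ne_zero _).hasDerivAt
  have h3 := h2.comp_hasFDerivAt x h1
  have h4 : HasFDerivAt (cut j) _ x := h3.congr_of_eventuallyEq (cut_eventuallyEq hx)
  rw [h4.fderiv, norm_smul, norm_smul, norm_smul, innerSL_apply_norm, norm_inv, norm_inv,
    norm_pow, norm_norm, Real.norm_of_nonneg hj.le]
  have hn := norm_pos_iff.2 hx
  have e : ‖x‖ * (‖deriv logBump (Real.log ‖x‖ / (j + 1))‖ * (((j : ℝ) + 1)⁻¹
      * ((‖x‖ ^ 2)⁻¹ * ‖x‖))) = ‖deriv logBump (Real.log ‖x‖ / (j + 1))‖ / (j + 1) := by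
    field_simp
  rw [e]
  gcongr
  exact hC _

end Cut

/-! ### The Gaussian inequality for conical singularities. -/

section Gauss

set_option linter.unusedSectionVars false

variable {V : Type*} [NormedAddCommGroup V] [InnerProductSpace ℝ V] [FiniteDimensional ℝ V]
  [MeasurableSpace V] [BorelSpace V]

variable (V) in
lemma ae_ne_zero [Nontrivial V] : ∀ᵐ x ∂(volume : Measure V), x ≠ 0 := by
  have h : ({0}ᶜ : Set V) ∈ ae (volume : Measure V) := compl_mem_ae_iff.2 (measure_singleton _)
  filter_upwards [h] with x hx using by simpa using hx

lemma gauss_absolutelyContinuous : gauss V ≪ volume := withDensity_absolutelyContinuous _ _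

/-- A function that is smooth away from the origin, multiplied by a smooth function supported away
from the origin, is smooth. -/
lemma contDiff_mul_of_tsupport {W : Type*} [NormedAddCommGroup W] [NormedSpace ℝ W]
    {n : WithTop ℕ∞} {χ g : W → ℝ} {s : Set W} (hs : IsOpen s) (hχ : ContDiff ℝ n χ)
    (hsupp : tsupport χ ⊆ s) (hg : ContDiffOn ℝ n g s) : ContDiff ℝ n fun x => χ x * g x := by
  rw [contDiff_iff_contDiffAt]
  intro x
  by_cases hx : x ∈ tsupport χ
  · exact hχ.contDiffAt.mul (hg.contDiffAt (hs.mem_nhds (hsupp hx)))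
  · have : (fun x => χ x * g x) =ᶠ[𝓝 x] fun _ => (0 : ℝ) := by
      filter_upwards [(isClosed_tsupport χ).isOpen_compl.mem_nhds hx] with y hy
      rw [image_eq_zero_of_notMem_tsupport hy, zero_mul]
    exact contDiffAt_const.congr_of_eventuallyEq this

/-- The Gaussian Poincaré inequality for functions with a conical singularity at the origin. -/
theorem gauss_poincare_conical [Nontrivial V] {g : V → ℝ} (hg : ContDiffOn ℝ 1 g {0}ᶜ) {C : ℝ}
    (hC : ∀ x, |g x| ≤ C * ‖x‖) (hC' : ∀ x ≠ 0, ‖fderiv ℝ g x‖ ≤ C) :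
    (1 / 8) * ((gauss V).real Set.univ * (∫ x, g x ^ 2 ∂(gauss V)) - (∫ x, g x ∂(gauss V)) ^ 2
        - ‖∫ x, g x • x ∂(gauss V)‖ ^ 2)
      ≤ (gauss V).real Set.univ * (∫ x, ‖gradient g x‖ ^ 2 ∂(gauss V))
        - ((gauss V).real Set.univ * (∫ x, g x ^ 2 ∂(gauss V)) - (∫ x, g x ∂(gauss V)) ^ 2) := by
  obtain ⟨K, hK0, hK⟩ := exists_norm_fderiv_cut_le (V := V)
  have hopen : IsOpen ({0}ᶜ : Set V) := isOpen_compl_singleton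
  have hC0 : 0 ≤ C := by
    obtain ⟨x, hx⟩ := exists_ne (0 : V)
    exact (norm_nonneg _).trans (hC' x hx)
  set G : ℕ → V → ℝ := fun j x => cut j x * g x with hG
  have hGc : ∀ j, ContDiff ℝ 1 (G j) := fun j =>
    contDiff_mul_of_tsupport hopen ((contDiff_cut j).of_le (by norm_cast))
      ((tsupport_cut_subset j).trans (annulus_subset _)) hg
  have hGs : ∀ j, HasCompactSupport (G j) := fun j => (hasCompactSupport_cut j).mul_right
  have hae : ∀ᵐ x ∂(gauss V), x ≠ 0 := gauss_absolutelyContinuous.ae_le (ae_ne_zero V)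
  have hGb : ∀ j x, |G j x| ≤ C * ‖x‖ := fun j x => by
    rw [hG, abs_mul, abs_of_nonneg (cut_nonneg j x)]
    exact (mul_le_of_le_one_left (abs_nonneg _) (cut_le_one j x)).trans (hC x)
  have hd : ∀ x ≠ 0, DifferentiableAt ℝ g x := fun x hx =>
    (hg.contDiffAt (hopen.mem_nhds hx)).differentiableAt one_ne_zero
  have hcd : ∀ (j : ℕ) (x : V), DifferentiableAt ℝ (cut j) x := fun j x =>
    (contDiff_cut j).differentiable (by simp) x
  have hGd : ∀ j, ∀ x ≠ 0, fderiv ℝ (G j) x = cut j x • fderiv ℝ g x + g x • fderiv ℝ (cut j) x :=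
    fun j x hx => fderiv_fun_mul (hcd j x) (hd x hx)
  have hgrad : ∀ j, ∀ x ≠ 0, gradient (G j) x = cut j x • gradient g x + g x • gradient (cut j) x :=
    fun j x hx => by
      simp only [gradient, hGd j x hx, map_add, map_smul]
  -- Linear growth of g compensates exactly the 1/|x| in the gradient of the cutoff, leaving
  -- O(1/(j+1)) uniformly in x.
  have hbd1 : ∀ j, ∀ x ≠ 0, ‖g x • fderiv ℝ (cut j) x‖ ≤ C * K / (j + 1) := fun j x hx => by
    rw [norm_smul, Real.norm_eq_abs]
    calc |g x| * ‖fderiv ℝ (cut j) x‖ ≤ C * ‖x‖ * ‖fderiv ℝ (cut j) x‖ := by gcongr; exact hC x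
      _ = C * (‖x‖ * ‖fderiv ℝ (cut j) x‖) := by ring
      _ ≤ C * (K / (j + 1)) := by gcongr; exact hK j x
      _ = _ := by ring
  have hGdb : ∀ j, ∀ x ≠ 0, ‖gradient (G j) x‖ ≤ C + C * K := fun j x hx => by
    rw [norm_gradient, hGd j x hx]
    refine (norm_add_le _ _).trans (add_le_add ?_ ((hbd1 j x hx).trans ?_))
    · rw [norm_smul, Real.norm_of_nonneg (cut_nonneg j x)]
      exact (mul_le_of_le_one_left (norm_nonneg _) (cut_le_one j x)).trans (hC' x hx)
    · exact div_le_self (by positivity) (by linarith [(Nat.cast_nonneg j : (0 : ℝ) ≤ j)])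
  have hGlim : ∀ x ≠ 0, Tendsto (fun j => G j x) atTop (𝓝 (g x)) := fun x hx =>
    tendsto_const_nhds.congr' ((eventually_cut_eq_one hx).mono fun j hj => by simp [hG, hj])
  have hGdlim : ∀ x ≠ 0, Tendsto (fun j => gradient (G j) x) atTop (𝓝 (gradient g x)) := by
    intro x hx
    have h1 : Tendsto (fun j => g x • gradient (cut j) x) atTop (𝓝 0) := by
      have h2 : Tendsto (fun j : ℕ => C * K / ((j : ℝ) + 1)) atTop (𝓝 0) := by
        simpa [div_eq_mul_inv] using
          (tendsto_one_div_add_atTop_nhds_zero_nat (𝕜 := ℝ)).const_mul (C * K)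
      refine squeeze_zero_norm (fun j => ?_) h2
      have := hbd1 j x hx
      rwa [norm_smul, ← norm_gradient, ← norm_smul] at this
    have h3 : Tendsto (fun j => cut j x • gradient g x) atTop (𝓝 (gradient g x)) :=
      tendsto_const_nhds.congr' ((eventually_cut_eq_one hx).mono fun j hj => by simp [hj])
    have := h3.add h1
    rw [add_zero] at this
    exact this.congr fun j => (hgrad j x hx).symm
  have hineq : ∀ j, (1 / 8) * ((gauss V).real Set.univ * (∫ x, G j x ^ 2 ∂(gauss V))
        - (∫ x, G j x ∂(gauss V)) ^ 2 - ‖∫ x, G j x • x ∂(gauss V)‖ ^ 2)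
      ≤ (gauss V).real Set.univ * (∫ x, ‖gradient (G j) x‖ ^ 2 ∂(gauss V))
        - ((gauss V).real Set.univ * (∫ x, G j x ^ 2 ∂(gauss V))
          - (∫ x, G j x ∂(gauss V)) ^ 2) := fun j => by
    obtain ⟨B, hB⟩ := (hGc j).continuous.bounded_above_of_compact_support (hGs j)
    obtain ⟨B', hB'⟩ := ((hGc j).continuous_fderiv one_ne_zero).bounded_above_of_compact_support
      ((hGs j).fderiv ℝ)
    exact gauss_poincare (hGc j) hB hB'
  have l1 : Tendsto (fun j => ∫ x, G j x ^ 2 ∂(gauss V)) atTop (𝓝 (∫ x, g x ^ 2 ∂(gauss V))) := by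
    refine tendsto_integral_of_dominated_convergence (fun x => C ^ 2 * ‖x‖ ^ 2)
      (fun j => ((hGc j).continuous.pow 2).aestronglyMeasurable)
      (integrable_norm_sq_gauss.const_mul _) (fun j => Eventually.of_forall fun x => ?_)
      (hae.mono fun x hx => (hGlim x hx).pow 2)
    rw [norm_pow, Real.norm_eq_abs, ← mul_pow]
    exact pow_le_pow_left₀ (abs_nonneg _) (hGb j x) 2
  have l2 : Tendsto (fun j => ∫ x, G j x ∂(gauss V)) atTop (𝓝 (∫ x, g x ∂(gauss V))) :=
    tendsto_integral_of_dominated_convergence (fun x => C * ‖x‖)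
      (fun j => (hGc j).continuous.aestronglyMeasurable)
      (integrable_norm_gauss.const_mul _) (fun j => Eventually.of_forall (hGb j))
      (hae.mono hGlim)
  have l3 : Tendsto (fun j => ∫ x, G j x • x ∂(gauss V)) atTop
      (𝓝 (∫ x, g x • x ∂(gauss V))) := by
    refine tendsto_integral_of_dominated_convergence (fun x => C * ‖x‖ ^ 2)
      (fun j => ((hGc j).continuous.smul continuous_id).aestronglyMeasurable)
      (integrable_norm_sq_gauss.const_mul _) (fun j => Eventually.of_forall fun x => ?_)
      (hae.mono fun x hx => (hGlim x hx).smul_const x)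
    rw [norm_smul, sq, ← mul_assoc]
    exact mul_le_mul_of_nonneg_right (hGb j x) (norm_nonneg _)
  have l4 : Tendsto (fun j => ∫ x, ‖gradient (G j) x‖ ^ 2 ∂(gauss V)) atTop
      (𝓝 (∫ x, ‖gradient g x‖ ^ 2 ∂(gauss V))) := by
    refine tendsto_integral_of_dominated_convergence (fun x => (C + C * K) ^ 2)
      (fun j => ((continuous_gradient (hGc j)).norm.pow 2).aestronglyMeasurable)
      (integrable_const _) (fun j => hae.mono fun x hx => ?_)
      (hae.mono fun x hx => (hGdlim x hx).norm.pow 2)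
    rw [norm_pow, norm_norm]
    exact pow_le_pow_left₀ (norm_nonneg _) (hGdb j x hx) 2
  exact le_of_tendsto_of_tendsto'
    ((((l1.const_mul _).sub (l2.pow 2)).sub (l3.norm.pow 2)).const_mul _)
    ((l4.const_mul _).sub ((l1.const_mul _).sub (l2.pow 2))) hineq

end Gauss

/-! ### The Poincaré inequality on the sphere -/

/-- The radial factor of the Gaussian integral of a `k`-homogeneous function. -/
def radialMoment (d : ℕ) (k : ℝ) : ℝ :=
  ∫ t : ℝ, Real.exp (d * t) * Real.exp (-(1 / 2) * Real.exp t ^ 2) * Real.exp (k * t)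

/-- The area of the unit sphere. -/
def area (d : ℕ) : ℝ := (surf d).real Set.univ

section Sphere

variable {d : ℕ}

lemma Continuous.integrable_surf {F : Type*} [NormedAddCommGroup F] {k : Sph d → F}
    (hk : Continuous k) : Integrable k (surf d) := by
  have : CompactSpace (Sph d) := isCompact_iff_compactSpace.1 (isCompact_sphere _ _)
  exact hk.integrable_of_hasCompactSupport (HasCompactSupport.of_compactSpace k)

/-- In polar coordinates the Gaussian weight is radial, so a homogeneous integrand separates into a
radial moment and a spherical integral. This is how Gaussian identities are transferred to the
sphere. -/
lemma integral_gauss_homogeneous (hd : 0 < d) {F : Type*} [NormedAddCommGroup F] [NormedSpace ℝ F]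
    {H : E d → F} {h : Sph d → F} {k : ℝ}
    (hH : ∀ p, H (polarPt 1 p) = Real.exp (k * p.1) • h p.2) :
    ∫ x, H x ∂(gauss (E d)) = radialMoment d k • ∫ y, h y ∂(surf d) := by
  rw [integral_gauss, integral_polar one_pos hd, radialMoment, ← integral_prod_smul]
  congr 1
  funext p
  rw [hH, gaussWt, norm_polarPt, smul_smul, smul_smul]
  simp

lemma gauss_univ_eq (hd : 0 < d) : (gauss (E d)).real Set.univ = radialMoment d 0 * area d := by
  have := integral_gauss_homogeneous hd (H := fun _ : E d => (1 : ℝ)) (h := fun _ => 1) (k := 0)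
    (by simp)
  simpa [area] using this

lemma nontrivial_euclidean (hd : 0 < d) : Nontrivial (E d) := by
  have : Nonempty (Fin d) := ⟨⟨0, hd⟩⟩
  infer_instance

lemma radialMoment_nonneg (k : ℝ) : 0 ≤ radialMoment d k :=
  integral_nonneg fun t => by positivity

lemma gauss_univ_pos : 0 < (gauss (E d)).real Set.univ := by
  have : ∫ x : E d, (1 : ℝ) ∂(gauss (E d)) = (gauss (E d)).real Set.univ := by simp
  rw [← this, integral_pos_iff_support_of_nonneg (fun _ => zero_le_one) (integrable_const _)]
  have h : Function.support (fun _ : E d => (1 : ℝ)) = Set.univ := by ext; simp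
  rw [h]
  refine pos_iff_ne_zero.2 fun h0 => ?_
  have h1 : gauss (E d) = 0 := Measure.measure_univ_eq_zero.1 h0
  have h2 : (volume : Measure (E d)) Set.univ = 0 := by
    have := (withDensity_apply_eq_zero (μ := (volume : Measure (E d)))
      (s := Set.univ) (continuous_gaussWt (V := E d)).measurable.ennreal_ofReal).1 h0
    have e : {x : E d | ENNReal.ofReal (gaussWt x) ≠ 0} = Set.univ := by
      ext x; simp [gaussWt_pos x]
    rwa [e, Set.univ_inter] at this
  exact NeZero.ne _ (Measure.measure_univ_eq_zero.1 h2)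

lemma area_pos (hd : 0 < d) : 0 < area d := by
  have h := gauss_univ_pos (d := d)
  rw [gauss_univ_eq hd] at h
  exact pos_of_mul_pos_right h (radialMoment_nonneg _)

lemma radialMoment_zero_pos (hd : 0 < d) : 0 < radialMoment d 0 := by
  have h := gauss_univ_pos (d := d)
  rw [gauss_univ_eq hd] at h
  exact pos_of_mul_pos_left h (area_pos hd).le

lemma radialMoment_one_pos (hd : 0 < d) : 0 < radialMoment d 1 := by
  refine (radialMoment_nonneg _).lt_of_ne' fun h0 => ?_
  have := nontrivial_euclidean hd
  have h1 := integral_gauss_homogeneous hd (H := fun x : E d => ‖x‖) (h := fun _ => (1 : ℝ))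
    (k := 1) (by simp [norm_polarPt])
  rw [h0, zero_smul, integral_eq_zero_iff_of_nonneg (fun x => norm_nonneg x) integrable_norm_gauss]
    at h1
  have h2 : ∀ᵐ x ∂(gauss (E d)), x ≠ 0 := gauss_absolutelyContinuous.ae_le (ae_ne_zero _)
  have h3 : ∀ᵐ x ∂(gauss (E d)), False := by
    filter_upwards [h1, h2] with x a b using b (norm_eq_zero.1 a)
  have h4 : gauss (E d) = 0 := ae_eq_bot.1 (eventually_false_iff_eq_bot.1 h3)
  have := gauss_univ_pos (d := d)
  simp [h4] at this

/-- Gaussian integration by parts against a constant function gives zero, and the radial moment is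
positive. -/
lemma integral_surf_inner (hd : 0 < d) (w : E d) : ∫ y : Sph d, inner ℝ (y : E d) w ∂(surf d) = 0 := by
  have h1 := integral_gauss_homogeneous hd (H := fun x : E d => inner ℝ x w)
    (h := fun y => inner ℝ (y : E d) w) (k := 1) (fun p => by
      rw [polarPt, real_inner_smul_left]; simp)
  have h2 := integral_gauss_mul_inner_of_bounded (h := fun _ : E d => (1 : ℝ)) contDiff_const
    (B := 1) (B' := 0) (by simp) (by simp) w
  simp only [one_mul, fderiv_const_apply, zero_apply,
    integral_zero] at h2
  rw [h2] at h1
  exact (smul_eq_zero.1 h1.symm).resolve_left (radialMoment_one_pos hd).ne'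

lemma integral_surf_coe (hd : 0 < d) : ∫ y : Sph d, (y : E d) ∂(surf d) = 0 := by
  refine ext_inner_left ℝ fun w => ?_
  rw [← integral_inner (Continuous.integrable_surf (by fun_prop)), inner_zero_right]
  simp only [real_inner_comm _ w, integral_surf_inner hd]

/-- Gaussian integration by parts applied to the linear function ⟨·, q⟩, read in polar coordinates.
-/
lemma radialMoment_two_mul (hd : 0 < d) (q w : E d) :
    radialMoment d 2 * ∫ y : Sph d, inner ℝ (y : E d) q * inner ℝ (y : E d) w ∂(surf d)
      = radialMoment d 0 * area d * inner ℝ q w := by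
  have h1 := integral_gauss_homogeneous hd (H := fun x : E d => inner ℝ x q * inner ℝ x w)
    (h := fun y => inner ℝ (y : E d) q * inner ℝ (y : E d) w) (k := 2) (fun p => by
      rw [polarPt, real_inner_smul_left, real_inner_smul_left, two_mul, Real.exp_add]
      simp; ring)
  rw [smul_eq_mul] at h1
  have hd' : ∀ v : E d, HasFDerivAt (fun x : E d => inner ℝ x q) (innerSL ℝ q) v := fun v => by
    have := (innerSL ℝ q).hasFDerivAt (x := v)
    simpa [real_inner_comm] using this
  have h2 := integral_gauss_mul_inner (h := fun x : E d => inner ℝ x q) (w := w)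
    (fun v => (hd' v).differentiableAt)
    (by simp only [(hd' _).fderiv]; exact integrable_const _)
    ((integrable_norm_sq_gauss.const_mul (‖q‖ * ‖w‖)).mono' (by fun_prop)
      (Eventually.of_forall fun x => by
        rw [norm_mul]
        calc _ ≤ (‖x‖ * ‖q‖) * (‖x‖ * ‖w‖) :=
              mul_le_mul (norm_inner_le_norm _ _) (norm_inner_le_norm _ _) (norm_nonneg _)
                (by positivity)
          _ = _ := by ring))
    ((integrable_norm_gauss.const_mul ‖q‖).mono' (by fun_prop)
      (Eventually.of_forall fun x => by
        rw [mul_comm]; exact norm_inner_le_norm _ _))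
  rw [← h1, h2]
  simp only [(hd' _).fderiv, integral_const, smul_eq_mul, gauss_univ_eq hd, innerSL_apply_apply]

/-- Taking the trace of `radialMoment_two_mul` over the standard basis, where Σ y_i² = 1 on the
sphere. -/
lemma radialMoment_two (hd : 0 < d) : radialMoment d 2 = d * radialMoment d 0 := by
  have h : ∑ i : Fin d, radialMoment d 2 * ∫ y : Sph d,
      inner ℝ (y : E d) (EuclideanSpace.single i (1 : ℝ))
        * inner ℝ (y : E d) (EuclideanSpace.single i (1 : ℝ)) ∂(surf d)
      = ∑ i : Fin d, radialMoment d 0 * area d := by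
    refine Finset.sum_congr rfl fun i _ => ?_
    rw [radialMoment_two_mul hd]; simp
  rw [← Finset.mul_sum, ← integral_finsetSum _ fun i _ => Continuous.integrable_surf (by fun_prop)]
    at h
  have e : ∀ y : Sph d, ∑ i : Fin d, inner ℝ (y : E d) (EuclideanSpace.single i (1 : ℝ))
        * inner ℝ (y : E d) (EuclideanSpace.single i (1 : ℝ)) = 1 := fun y => by
    have := EuclideanSpace.norm_sq_eq (y : E d)
    rw [Sph.norm_eq] at this
    simp only [EuclideanSpace.inner_single_right, one_mul]
    simp [← sq] at this ⊢
    exact this.symm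
  simp only [e, integral_const, smul_eq_mul, mul_one, Finset.sum_const, Finset.card_univ,
    Fintype.card_fin, nsmul_eq_mul] at h
  have ha := area_pos hd
  have : (radialMoment d 2) * area d = (d * radialMoment d 0) * area d := by
    rw [mul_assoc (d : ℝ)]; exact h
  exact mul_right_cancel₀ ha.ne' this

lemma integral_surf_inner_mul_inner (hd : 0 < d) (q w : E d) :
    ∫ y : Sph d, inner ℝ (y : E d) q * inner ℝ (y : E d) w ∂(surf d) = area d / d * inner ℝ q w := by
  have h := radialMoment_two_mul hd q w
  rw [radialMoment_two hd] at h
  have h0 := radialMoment_zero_pos hd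
  have hd' : (0 : ℝ) < d := by exact_mod_cast hd
  rw [div_mul_eq_mul_div, eq_div_iff hd'.ne']
  refine mul_left_cancel₀ h0.ne' ?_
  linear_combination h

/-- The Bessel inequality on the sphere, for the projection onto affine functions. -/
lemma bessel_surf (hd : 0 < d) {k : Sph d → ℝ} (hk : Continuous k) :
    (∫ y, k y ∂(surf d)) ^ 2 / area d + d / area d * ‖∫ y : Sph d, k y • (y : E d) ∂(surf d)‖ ^ 2
      ≤ ∫ y, k y ^ 2 ∂(surf d) := by
  set A := ∫ y, k y ∂(surf d) with hA
  set P := ∫ y : Sph d, k y • (y : E d) ∂(surf d) with hP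
  have ha := area_pos hd
  have hd' : (0 : ℝ) < d := by exact_mod_cast hd
  -- The factor d / area normalizes the coordinate functions, whose squared norm on the sphere is
  -- area / d.
  have key : ∫ y : Sph d, (k y - (A / area d + inner ℝ (y : E d) ((d / area d) • P))) ^ 2 ∂(surf d)
      = ∫ y, k y ^ 2 ∂(surf d) - (A ^ 2 / area d + d / area d * ‖P‖ ^ 2) := by
    set c := A / area d with hc
    set q := (d / area d) • P with hq
    have e : ∀ y : Sph d, (k y - (c + inner ℝ (y : E d) q)) ^ 2
        = k y ^ 2 - 2 * c * k y - 2 * inner ℝ (k y • (y : E d)) q + c ^ 2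
          + 2 * c * inner ℝ (y : E d) q + inner ℝ (y : E d) q * inner ℝ (y : E d) q := fun y => by
      rw [real_inner_smul_left]; ring
    simp only [e]
    have I : ∀ {g : Sph d → ℝ}, Continuous g → Integrable g (surf d) := fun h =>
      Continuous.integrable_surf h
    rw [integral_add (I (by fun_prop)) (I (by fun_prop)),
      integral_add (I (by fun_prop)) (I (by fun_prop)),
      integral_add (I (by fun_prop)) (I (by fun_prop)),
      integral_sub (I (by fun_prop)) (I (by fun_prop)),
      integral_sub (I (by fun_prop)) (I (by fun_prop)),
      integral_const_mul, integral_const_mul, integral_const_mul, integral_surf_inner hd,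
      integral_surf_inner_mul_inner hd]
    have e2 : ∫ y : Sph d, inner ℝ (k y • (y : E d)) q ∂(surf d) = inner ℝ P q := by
      simp only [real_inner_comm q]
      rw [integral_inner (Continuous.integrable_surf (by fun_prop))]
    rw [e2, hq, inner_smul_right, inner_smul_right, real_inner_smul_left,
      real_inner_self_eq_norm_sq]
    simp only [integral_const, smul_eq_mul]
    rw [← hA, hc]
    change _ - _ - _ + area d * _ + _ + _ = _
    field_simp
    ring
  have : 0 ≤ ∫ y : Sph d, (k y - (A / area d + inner ℝ (y : E d) ((d / area d) • P))) ^ 2 ∂(surf d) :=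
    integral_nonneg fun y => sq_nonneg _
  linarith

end Sphere

/-! ### Zero-homogeneous functions and the passage to the sphere. -/

section Homogeneous

variable {d : ℕ} {u : E d → ℝ}

lemma fderiv_smul_of_homogeneous (hom : ∀ r : ℝ, 0 < r → ∀ x, u (r • x) = u x) {r : ℝ} (hr : 0 < r)
    {x : E d} (hu : DifferentiableAt ℝ u (r • x)) :
    fderiv ℝ u x = r • fderiv ℝ u (r • x) := by
  have h1 : HasFDerivAt (fun z : E d => r • z) (r • ContinuousLinearMap.id ℝ (E d)) x :=
    (hasFDerivAt_id x).const_smul r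
  have h2 := hu.hasFDerivAt.comp x h1
  have h3 : u ∘ (fun z : E d => r • z) = u := funext fun z => hom r hr z
  rw [h3] at h2
  rw [h2.fderiv]
  ext v
  simp

lemma fderiv_apply_self_of_homogeneous (hom : ∀ r : ℝ, 0 < r → ∀ x, u (r • x) = u x)
    {x : E d} (hu : DifferentiableAt ℝ u x) : fderiv ℝ u x x = 0 := by
  have h1 : HasDerivAt (fun r : ℝ => r • x) x 1 := by
    simpa using (hasDerivAt_id (1 : ℝ)).smul_const x
  have h2 : HasDerivAt (fun r : ℝ => u (r • x)) (fderiv ℝ u x x) 1 := by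
    have h := hu.hasFDerivAt
    rw [← one_smul ℝ x] at h
    have := h.comp_hasDerivAt (1 : ℝ) h1
    rwa [one_smul] at this
  have h3 : HasDerivAt (fun r : ℝ => u (r • x)) 0 1 := by
    refine (hasDerivAt_const (1 : ℝ) (u x)).congr_of_eventuallyEq ?_
    filter_upwards [lt_mem_nhds (zero_lt_one (α := ℝ))] with r hr using hom r hr x
  exact h2.unique h3

lemma hasFDerivAt_norm {x : E d} (hx : x ≠ 0) :
    HasFDerivAt (fun z : E d => ‖z‖) (‖x‖⁻¹ • innerSL ℝ x) x := by
  have h := ((hasFDerivAt_log_norm hx).exp)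
  have e : (fun z : E d => Real.exp (Real.log ‖z‖)) =ᶠ[𝓝 x] fun z => ‖z‖ := by
    filter_upwards [isOpen_compl_singleton.mem_nhds hx] with z hz
      using Real.exp_log (norm_pos_iff.2 hz)
  refine (h.congr_of_eventuallyEq e.symm).congr_fderiv ?_
  rw [Real.exp_log (norm_pos_iff.2 hx), smul_smul]
  congr 1
  have := norm_ne_zero_iff.2 hx
  field_simp

lemma eq_of_homogeneous (hom : ∀ r : ℝ, 0 < r → ∀ x, u (r • x) = u x) {x : E d} (hx : x ≠ 0) :
    u (‖x‖⁻¹ • x) = u x :=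
  hom _ (inv_pos.2 (norm_pos_iff.2 hx)) x

lemma exists_sphere_eq {x : E d} (hx : x ≠ 0) : ∃ y : Sph d, (y : E d) = ‖x‖⁻¹ • x :=
  ⟨⟨‖x‖⁻¹ • x, by simp [norm_smul, hx]⟩, rfl⟩

lemma sphere_ne_zero (y : Sph d) : (y : E d) ≠ 0 := by
  rw [← norm_pos_iff, Sph.norm_eq]; exact one_pos

lemma _root_.ContinuousOn.comp_sphere {F : Type*} [TopologicalSpace F] {f : E d → F}
    (hf : ContinuousOn f {0}ᶜ) : Continuous fun y : Sph d => f y :=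
  hf.comp_continuous continuous_subtype_val fun y => sphere_ne_zero y

lemma continuousOn_gradient (hu : ContDiffOn ℝ 1 u {0}ᶜ) : ContinuousOn (gradient u) {0}ᶜ :=
  (InnerProductSpace.toDual ℝ (E d)).symm.continuous.comp_continuousOn
    (hu.continuousOn_fderiv_of_isOpen isOpen_compl_singleton le_rfl)

lemma integral_surf_sub_mean (hd : 0 < d) {k : Sph d → ℝ} (hk : Continuous k) :
    ∫ y, (k y - (∫ y, k y ∂(surf d)) / area d) ∂(surf d) = 0 := by
  have ha := area_pos hd
  rw [integral_sub (Continuous.integrable_surf hk) (integrable_const _), integral_const, smul_eq_mul]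
  change _ - area d * _ = 0
  field_simp
  ring

lemma integral_surf_sub_mean_sq (hd : 0 < d) {k : Sph d → ℝ} (hk : Continuous k) :
    ∫ y, (k y - (∫ y, k y ∂(surf d)) / area d) ^ 2 ∂(surf d)
      = (∫ y, k y ^ 2 ∂(surf d)) - (∫ y, k y ∂(surf d)) ^ 2 / area d := by
  have ha := area_pos hd
  set c := (∫ y, k y ∂(surf d)) / area d with hc
  have e : ∀ y : Sph d, (k y - c) ^ 2 = k y ^ 2 - 2 * c * k y + c ^ 2 := fun y => by ring
  simp only [e]
  rw [integral_add (Continuous.integrable_surf (by fun_prop)) (integrable_const _),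
    integral_sub (Continuous.integrable_surf (by fun_prop))
      (Continuous.integrable_surf (by fun_prop)), integral_const_mul, integral_const, smul_eq_mul, hc]
  change _ - _ + area d * _ = _
  field_simp
  ring

lemma integral_surf_sub_const_smul (hd : 0 < d) {k : Sph d → ℝ} (hk : Continuous k) (c : ℝ) :
    ∫ y : Sph d, (k y - c) • (y : E d) ∂(surf d) = ∫ y : Sph d, k y • (y : E d) ∂(surf d) := by
  simp only [sub_smul]
  rw [integral_sub (Continuous.integrable_surf (by fun_prop))
    (Continuous.integrable_surf (by fun_prop)), integral_smul, integral_surf_coe hd,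
    smul_zero, sub_zero]

/-- The Poincaré inequality on the unit sphere, with a remainder term. -/
theorem sphere_poincare (hd : 0 < d) (hu : ContDiffOn ℝ 1 u {0}ᶜ)
    (hom : ∀ r : ℝ, 0 < r → ∀ x, u (r • x) = u x) :
    ((d : ℝ) - 1) * ((∫ y : Sph d, u y ^ 2 ∂(surf d)) - (∫ y : Sph d, u y ∂(surf d)) ^ 2 / area d)
      + d / 8 * ((∫ y : Sph d, u y ^ 2 ∂(surf d)) - (∫ y : Sph d, u y ∂(surf d)) ^ 2 / area d
        - d / area d * ‖∫ y : Sph d, u y • (y : E d) ∂(surf d)‖ ^ 2)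
      ≤ ∫ y : Sph d, ‖gradient u y‖ ^ 2 ∂(surf d) := by
  have := nontrivial_euclidean hd
  have hcs : CompactSpace (Sph d) := isCompact_iff_compactSpace.1 (isCompact_sphere _ _)
  have hopen : IsOpen ({0}ᶜ : Set (E d)) := isOpen_compl_singleton
  have I : ∀ {F : Type} [NormedAddCommGroup F] {g : Sph d → F}, Continuous g →
    Integrable g (surf d) := fun h => Continuous.integrable_surf h
  have hdiff : ∀ x ≠ 0, DifferentiableAt ℝ u x := fun x hx =>
    (hu.contDiffAt (hopen.mem_nhds hx)).differentiableAt one_ne_zero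
  have hus : Continuous fun y : Sph d => u y := hu.continuousOn.comp_sphere
  have hgs : Continuous fun y : Sph d => gradient u y := (continuousOn_gradient hu).comp_sphere
  have ha := area_pos hd
  have hd' : (0 : ℝ) < d := by exact_mod_cast hd
  set A := ∫ y : Sph d, u y ∂(surf d) with hA
  set U := ∫ y : Sph d, u y ^ 2 ∂(surf d) with hU
  set P := ∫ y : Sph d, u y • (y : E d) ∂(surf d) with hP
  set D := ∫ y : Sph d, ‖gradient u y‖ ^ 2 ∂(surf d) with hD
  set c := A / area d with hc
  -- The 1-homogeneous extension turns the linear functions, the extremals on the sphere, into the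
  -- linear extremals of the Gaussian inequality. Subtracting the mean `c` makes the Gaussian mean
  -- of `g` vanish. The gradient of `u` is tangential, so |∇g|² splits into spherical energy plus (u
  -- - c)².
  set g : E d → ℝ := fun x => ‖x‖ * (u x - c) with hg
  have hgd : ∀ x ≠ 0, HasFDerivAt g (‖x‖ • fderiv ℝ u x + (u x - c) • (‖x‖⁻¹ • innerSL ℝ x)) x := by
    intro x hx
    have h1 : HasFDerivAt (fun z : E d => ‖z‖) (‖x‖⁻¹ • innerSL ℝ x) x :=
      hasFDerivAt_norm hx
    exact h1.mul ((hdiff x hx).hasFDerivAt.sub_const c)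
  have hgrad : ∀ x ≠ 0, gradient g x = ‖x‖ • gradient u x + (u x - c) • (‖x‖⁻¹ • x) := by
    intro x hx
    rw [gradient, (hgd x hx).fderiv]
    simp only [map_add, map_smul, gradient]
    congr 3
    rw [LinearIsometryEquiv.symm_apply_eq]
    rfl
  have horth : ∀ x ≠ 0, inner ℝ (gradient u x) x = 0 := fun x hx => by
    rw [inner_gradient_left]
    exact fderiv_apply_self_of_homogeneous hom (hdiff x hx)
  have hsq : ∀ x ≠ 0, ‖gradient g x‖ ^ 2 = ‖x‖ ^ 2 * ‖gradient u x‖ ^ 2 + (u x - c) ^ 2 := by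
    intro x hx
    rw [hgrad x hx, norm_add_sq_real, real_inner_smul_left, real_inner_smul_right,
      real_inner_smul_right, horth x hx, norm_smul, norm_smul, norm_smul, norm_norm, norm_inv,
      norm_norm, inv_mul_cancel₀ (norm_ne_zero_iff.2 hx), Real.norm_eq_abs]
    simp only [mul_zero, add_zero, mul_one, sq_abs]
    ring
  have hscale : ∀ x ≠ 0, ‖x‖ ^ 2 * ‖gradient u x‖ ^ 2 = ‖gradient u (‖x‖⁻¹ • x)‖ ^ 2 := by
    intro x hx
    have hr := inv_pos.2 (norm_pos_iff.2 hx)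
    rw [norm_gradient, norm_gradient, fderiv_smul_of_homogeneous hom hr
      (hdiff _ (smul_ne_zero hr.ne' hx)), norm_smul, mul_pow, Real.norm_of_nonneg hr.le, ← mul_assoc,
      ← mul_pow, mul_inv_cancel₀ (norm_ne_zero_iff.2 hx), one_pow, one_mul]
  have hgC : ContDiffOn ℝ 1 g {0}ᶜ := fun x hx => by
    exact ((contDiffAt_norm ℝ hx).contDiffWithinAt).mul ((hu x hx).sub contDiffWithinAt_const)
  obtain ⟨C1, hC1⟩ := (isCompact_univ (X := Sph d)).exists_bound_of_continuousOn
    (f := fun y : Sph d => u y - c) (hus.sub continuous_const).continuousOn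
  obtain ⟨C2, hC2⟩ := (isCompact_univ (X := Sph d)).exists_bound_of_continuousOn hgs.continuousOn
  have hb1 : ∀ x ≠ 0, |u x - c| ≤ |C1| := fun x hx => by
    obtain ⟨y, hy⟩ := exists_sphere_eq hx
    rw [← eq_of_homogeneous hom hx, ← hy]
    exact (hC1 y trivial).trans (le_abs_self _)
  have hb2 : ∀ x ≠ 0, ‖gradient g x‖ ≤ |C1| + |C2| := fun x hx => by
    refine abs_le_of_sq_le_sq' ?_ (by positivity) |>.2
    rw [hsq x hx, hscale x hx]
    obtain ⟨y, hy⟩ := exists_sphere_eq hx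
    rw [← hy]
    have h1 := pow_le_pow_left₀ (abs_nonneg _) (hb1 x hx) 2
    have h2 := pow_le_pow_left₀ (norm_nonneg _) ((hC2 y trivial).trans (le_abs_self _)) 2
    rw [sq_abs] at h1
    nlinarith [mul_nonneg (abs_nonneg C1) (abs_nonneg C2)]
  have hmain := gauss_poincare_conical hgC (C := |C1| + |C2|)
    (fun x => by
      by_cases hx : x = 0
      · simp [hg, hx]
      rw [hg, abs_mul, abs_of_nonneg (norm_nonneg x), mul_comm]
      exact mul_le_mul_of_nonneg_right ((hb1 x hx).trans (by linarith [abs_nonneg C2]))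
        (norm_nonneg x))
    (fun x hx => by rw [← norm_gradient]; exact hb2 x hx)
  have hpol : ∀ p : ℝ × Sph d, u (polarPt 1 p) = u p.2 := fun p => hom _ (Real.exp_pos _) _
  have e1 : ∫ x, g x ∂(gauss (E d)) = radialMoment d 1 • ∫ y : Sph d, (u y - c) ∂(surf d) :=
    integral_gauss_homogeneous hd fun p => by
      simp [hg, norm_polarPt, hpol]
  have e2 : ∫ x, g x ^ 2 ∂(gauss (E d)) = radialMoment d 2 • ∫ y : Sph d, (u y - c) ^ 2 ∂(surf d) :=
    integral_gauss_homogeneous hd fun p => by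
      simp only [hg, norm_polarPt, hpol, two_mul, Real.exp_add, smul_eq_mul, div_one]; ring
  have e3 : ∫ x, g x • x ∂(gauss (E d))
      = radialMoment d 2 • ∫ y : Sph d, (u y - c) • (y : E d) ∂(surf d) :=
    integral_gauss_homogeneous hd fun p => by
      simp only [hg, norm_polarPt, hpol, two_mul, Real.exp_add, div_one]
      rw [polarPt, smul_smul, smul_smul]
      congr 1
      simp; ring
  have e4 : ∫ x, ‖gradient g x‖ ^ 2 ∂(gauss (E d))
      = radialMoment d 0 • ∫ y : Sph d, (‖gradient u y‖ ^ 2 + (u y - c) ^ 2) ∂(surf d) :=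
    integral_gauss_homogeneous hd fun p => by
      rw [hsq _ (polarPt_ne_zero 1 p), hscale _ (polarPt_ne_zero 1 p), normalize_polarPt, hpol]
      simp
  have m1 : ∫ y : Sph d, (u y - c) ∂(surf d) = 0 := integral_surf_sub_mean hd hus
  have m2 : ∫ y : Sph d, (u y - c) ^ 2 ∂(surf d) = U - A ^ 2 / area d :=
    integral_surf_sub_mean_sq hd hus
  have m3 : ∫ y : Sph d, (u y - c) • (y : E d) ∂(surf d) = P := integral_surf_sub_const_smul hd hus c
  have m4 : ∫ y : Sph d, (‖gradient u y‖ ^ 2 + (u y - c) ^ 2) ∂(surf d) = D + (U - A ^ 2 / area d) := by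
    rw [integral_add (by exact I (hgs.norm.pow 2)) (by exact I ((hus.sub continuous_const).pow 2)), m2]
  rw [e1, e2, e3, e4, m1, m2, m3, m4, gauss_univ_eq hd, radialMoment_two hd, norm_smul, mul_pow]
    at hmain
  have h0 := radialMoment_zero_pos hd
  simp only [smul_eq_mul, Real.norm_eq_abs, sq_abs] at hmain
  set I0 := radialMoment d 0
  set W := U - A ^ 2 / area d
  -- As the second radial moment is d times the zeroth, every term carries the factor I0²; the
  -- constant d - 1 is the d of the Gaussian variance minus the 1 from (u - c)² in the energy.
  have hfin : 0 ≤ I0 ^ 2 * area d * (D - (((d : ℝ) - 1) * W + d / 8 * (W - d / area d * ‖P‖ ^ 2))) := by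
    have e : I0 ^ 2 * area d * (D - (((d : ℝ) - 1) * W + d / 8 * (W - d / area d * ‖P‖ ^ 2)))
        = I0 ^ 2 * area d * (D - ((d : ℝ) - 1) * W - d / 8 * W) + I0 ^ 2 * d ^ 2 / 8 * ‖P‖ ^ 2 := by
      field_simp
      ring
    rw [e]
    nlinarith [hmain]
  have := nonneg_of_mul_nonneg_right hfin (by positivity)
  linarith

end Homogeneous

/-! ### Functions on the cylinder -/

/-- Bessel's inequality for 1/cosh, obtained from the one for constants with weight exponent N + 2
by the substitution y = cosh · u. -/
lemma integral_wt_inv_cosh_bessel {N : ℝ} (hN : 2 ≤ N) {u : ℝ → ℝ} (hcu : Continuous u)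
    (hc : HasCompactSupport u) :
    0 ≤ (∫ t, wt N t * u t ^ 2)
      - (∫ t, wt N t * (Real.cosh t)⁻¹ * u t) ^ 2 / (∫ t, wt (N + 2) t) := by
  have h := integral_wt_variance_nonneg (N := N + 2) (u := fun t => Real.cosh t * u t)
    (by linarith) (Real.continuous_cosh.mul hcu) hc.mul_left
  have hw : ∀ t, wt (N + 2) t * Real.cosh t ^ 2 = wt N t := fun t => by
    rw [wt_add_two, one_sub_tanh_sq]
    have := (Real.cosh_pos t).ne'
    field_simp
  have e1 : ∀ t, wt (N + 2) t * (Real.cosh t * u t) ^ 2 = wt N t * u t ^ 2 := fun t => by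
    rw [← hw t]; ring
  have e2 : ∀ t, wt (N + 2) t * (Real.cosh t * u t) = wt N t * (Real.cosh t)⁻¹ * u t := fun t => by
    rw [← hw t]
    have := (Real.cosh_pos t).ne'
    field_simp
  simp only [e1, e2] at h
  have h2 := integral_wt_tanh_sq_pos (N := N + 2) (by linarith)
  have h3 : 0 ≤ (∫ t, wt (N + 2) t * Real.tanh t * (Real.cosh t * u t)) ^ 2
          / ∫ t, wt (N + 2) t * Real.tanh t ^ 2 := by positivity
  linarith

/-- The product measure on the cylinder `ℝ × S^(d-1)`. -/
def cyl (d : ℕ) : Measure (ℝ × Sph d) := (volume : Measure ℝ).prod (surf d)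

section Cylinder

variable {d : ℕ}

instance compactSpace_sph : CompactSpace (Sph d) :=
  isCompact_iff_compactSpace.1 (isCompact_sphere _ _)

/-- `H` is continuous on the cylinder, and vanishes for `|t| > R`. -/
structure IsCc (R : ℝ) (H : ℝ × Sph d → ℝ) : Prop where
  cont : Continuous H
  vanish : ∀ p, R < |p.1| → H p = 0

namespace IsCc

variable {R : ℝ} {H K : ℝ × Sph d → ℝ}

lemma hasCompactSupport (h : IsCc R H) : HasCompactSupport H := by
  refine HasCompactSupport.intro (K := Set.Icc (-R) R ×ˢ Set.univ)
    (isCompact_Icc.prod isCompact_univ) fun p hp => h.vanish p ?_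
  simp only [Set.mem_prod, Set.mem_univ, and_true, Set.mem_Icc, ← abs_le] at hp
  exact not_le.1 hp

lemma integrable (h : IsCc R H) : Integrable H (cyl d) := by
  have : IsFiniteMeasureOnCompacts (cyl d) := by unfold cyl; infer_instance
  exact h.cont.integrable_of_hasCompactSupport h.hasCompactSupport

lemma mul_left (h : IsCc R H) (hK : Continuous K) : IsCc R fun p => K p * H p :=
  ⟨hK.mul h.cont, fun p hp => by rw [h.vanish p hp, mul_zero]⟩

lemma mul_right (h : IsCc R H) (hK : Continuous K) : IsCc R fun p => H p * K p :=
  ⟨h.cont.mul hK, fun p hp => by rw [h.vanish p hp, zero_mul]⟩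

lemma add (h : IsCc R H) (h' : IsCc R K) : IsCc R fun p => H p + K p :=
  ⟨h.cont.add h'.cont, fun p hp => by rw [h.vanish p hp, h'.vanish p hp, zero_add]⟩

lemma sq (h : IsCc R H) : IsCc R fun p => H p ^ 2 :=
  ⟨h.cont.pow 2, fun p hp => by rw [h.vanish p hp]; simp⟩

lemma slice_hasCompactSupport (h : IsCc R H) (y : Sph d) : HasCompactSupport fun t => H (t, y) := by
  refine HasCompactSupport.intro (K := Set.Icc (-R) R) isCompact_Icc fun t ht =>
    h.vanish _ ?_
  rw [Set.mem_Icc, ← abs_le] at ht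
  exact not_le.1 ht

lemma slice_cont (h : IsCc R H) (t : ℝ) : Continuous fun y => H (t, y) := by
  have := h.cont; fun_prop

lemma mean_cont (h : IsCc R H) : Continuous fun t => ∫ y, H (t, y) ∂(surf d) := by
  have := continuous_parametric_integral_of_continuous (μ := surf d) (f := fun t y => H (t, y))
    (by simpa [Function.uncurry_def] using h.cont) isCompact_univ
  simpa using this

lemma mean_hasCompactSupport (h : IsCc R H) :
    HasCompactSupport fun t => ∫ y, H (t, y) ∂(surf d) := by
  refine HasCompactSupport.intro (K := Set.Icc (-R) R) isCompact_Icc fun t ht => ?_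
  rw [Set.mem_Icc, ← abs_le] at ht
  rw [integral_congr_ae (g := fun _ => (0 : ℝ)) (Eventually.of_forall fun y =>
    h.vanish (t, y) (not_le.1 ht)), integral_zero]

lemma hasDerivAt_mean (h : IsCc R H) (h' : IsCc R K)
    (hd : ∀ t y, HasDerivAt (fun s => H (s, y)) (K (t, y)) t) (t : ℝ) :
    HasDerivAt (fun s => ∫ y, H (s, y) ∂(surf d)) (∫ y, K (t, y) ∂(surf d)) t := by
  obtain ⟨B, hB⟩ := h'.cont.bounded_above_of_compact_support h'.hasCompactSupport
  refine (hasDerivAt_integral_of_dominated_loc_of_deriv_le (F := fun s y => H (s, y))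
    (F' := fun s y => K (s, y)) (bound := fun _ => B) (s := Set.univ) Filter.univ_mem
    (Eventually.of_forall fun s => (h.slice_cont s).aestronglyMeasurable)
    (Continuous.integrable_surf (h.slice_cont t)) (h'.slice_cont t).aestronglyMeasurable
    (Eventually.of_forall fun y s _ => hB _) (integrable_const _)
    (Eventually.of_forall fun y s _ => hd s y)).2

lemma contDiff_mean (h : IsCc R H) (h' : IsCc R K)
    (hd : ∀ t y, HasDerivAt (fun s => H (s, y)) (K (t, y)) t) :
    ContDiff ℝ 1 fun t => ∫ y, H (t, y) ∂(surf d) := by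
  rw [contDiff_one_iff_deriv]
  refine ⟨fun t => (h.hasDerivAt_mean h' hd t).differentiableAt, ?_⟩
  rw [show deriv (fun t => ∫ y, H (t, y) ∂(surf d)) = fun t => ∫ y, K (t, y) ∂(surf d) from
    funext fun t => (h.hasDerivAt_mean h' hd t).deriv]
  exact h'.mean_cont

lemma integral_eq (h : IsCc R H) : ∫ p, H p ∂(cyl d) = ∫ t, ∫ y, H (t, y) ∂(surf d) :=
  integral_prod _ h.integrable

lemma integral_eq' (h : IsCc R H) : ∫ p, H p ∂(cyl d) = ∫ y, (∫ t, H (t, y)) ∂(surf d) :=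
  integral_prod_symm _ h.integrable

lemma integral_mul_eq (h : IsCc R H) {g : ℝ → ℝ} (hg : Continuous g) :
    ∫ p, g p.1 * H p ∂(cyl d) = ∫ t, g t * ∫ y, H (t, y) ∂(surf d) := by
  rw [(h.mul_left (K := fun p => g p.1) (by fun_prop)).integral_eq]
  simp only [integral_const_mul]

end IsCc

lemma norm_sq_integral_smul_coe {k : Sph d → ℝ} (hk : Continuous k) :
    ‖∫ y : Sph d, k y • (y : E d) ∂(surf d)‖ ^ 2 = ∑ i, (∫ y : Sph d, k y * (y : E d) i ∂(surf d)) ^ 2 := by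
  rw [EuclideanSpace.norm_sq_eq]
  refine Finset.sum_congr rfl fun i _ => ?_
  have h := (EuclideanSpace.proj (𝕜 := ℝ) i : E d →L[ℝ] ℝ).integral_comp_comm
    (μ := surf d) (φ := fun y : Sph d => k y • (y : E d)) (Continuous.integrable_surf (by fun_prop))
  change ∫ y : Sph d, k y * (y : E d) i ∂(surf d) = _ at h
  rw [h, EuclideanSpace.coe_proj, Real.norm_eq_abs, sq_abs]

end Cylinder

/-! ### Combination of the line and the sphere. -/

section Cylinder

variable {d : ℕ}

/-- The spectral gap on the cylinder. The functional on the right is the deficit of the Poincaré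
inequality, and the brackets on the left are squared distances to spans of candidates for
equality. -/
theorem cylinder_gap (hd : 0 < d) {N α : ℝ} (hN : 2 < N) (hα : α ^ 2 * (N - 1) ≤ d - 1) {R : ℝ}
    {F Ft D : ℝ × Sph d → ℝ} (hF : IsCc R F) (hFt : IsCc R Ft) (hD : IsCc R D)
    (hder : ∀ t y, HasDerivAt (fun s => F (s, y)) (Ft (t, y)) t)
    (hsph : ∀ t, ((d : ℝ) - 1) * ((∫ y, F (t, y) ^ 2 ∂(surf d))
          - (∫ y, F (t, y) ∂(surf d)) ^ 2 / area d)
        + d / 8 * ((∫ y, F (t, y) ^ 2 ∂(surf d)) - (∫ y, F (t, y) ∂(surf d)) ^ 2 / area d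
          - d / area d * ‖∫ y, F (t, y) • (y : E d) ∂(surf d)‖ ^ 2)
      ≤ ∫ y, D (t, y) ∂(surf d)) :
    min (α ^ 2 * (N + 2)) ((d : ℝ) / 8) * ((∫ p, wt N p.1 * F p ^ 2 ∂(cyl d))
        - (∫ p, wt N p.1 * F p ∂(cyl d)) ^ 2 / (area d * ∫ t, wt N t)
        - (∫ p, wt N p.1 * Real.tanh p.1 * F p ∂(cyl d)) ^ 2
          / (area d * ∫ t, wt N t * Real.tanh t ^ 2)
        - d / (area d * ∫ t, wt (N + 2) t)
          * ∑ i, (∫ p, wt N p.1 * (Real.cosh p.1)⁻¹ * (F p * (p.2 : E d) i) ∂(cyl d)) ^ 2)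
      ≤ (∫ p, wt (N - 2) p.1 * (α ^ 2 * Ft p ^ 2 + D p) ∂(cyl d))
        - N * α ^ 2 * ((∫ p, wt N p.1 * F p ^ 2 ∂(cyl d))
          - (∫ p, wt N p.1 * F p ∂(cyl d)) ^ 2 / (area d * ∫ t, wt N t)) ∧
    min (α ^ 2 * (N + 2)) ((d : ℝ) - 1 - α ^ 2 * (N - 1)) * ((∫ p, wt N p.1 * F p ^ 2 ∂(cyl d))
        - (∫ p, wt N p.1 * F p ∂(cyl d)) ^ 2 / (area d * ∫ t, wt N t)
        - (∫ p, wt N p.1 * Real.tanh p.1 * F p ∂(cyl d)) ^ 2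
          / (area d * ∫ t, wt N t * Real.tanh t ^ 2))
      ≤ (∫ p, wt (N - 2) p.1 * (α ^ 2 * Ft p ^ 2 + D p) ∂(cyl d))
        - N * α ^ 2 * ((∫ p, wt N p.1 * F p ^ 2 ∂(cyl d))
          - (∫ p, wt N p.1 * F p ∂(cyl d)) ^ 2 / (area d * ∫ t, wt N t)) := by
  have hS := area_pos hd
  have hd0 : (0 : ℝ) < d := by exact_mod_cast hd
  have hcw := continuous_wt N
  have hcw2 := continuous_wt (N - 2)
  have hT := continuous_tanh
  have hch : Continuous fun t => (Real.cosh t)⁻¹ :=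
    Real.continuous_cosh.inv₀ fun t => (Real.cosh_pos t).ne'
  have hle : ∀ t, wt N t ≤ wt (N - 2) t := wt_le_of_le (by linarith)
  set S := area d with hSdef
  -- the moments on the spheres
  have hFi : ∀ i, IsCc R fun p => F p * (p.2 : E d) i := fun i => hF.mul_right (by fun_prop)
  have hFti : ∀ i, IsCc R fun p => Ft p * (p.2 : E d) i := fun i => hFt.mul_right (by fun_prop)
  set a : ℝ → ℝ := fun t => ∫ y, F (t, y) ∂(surf d) with ha
  set q : Fin d → ℝ → ℝ := fun i t => ∫ y, F (t, y) * (y : E d) i ∂(surf d) with hq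
  set U : ℝ → ℝ := fun t => ∫ y, F (t, y) ^ 2 ∂(surf d) with hU
  have hac : ContDiff ℝ 1 a := hF.contDiff_mean hFt hder
  have has : HasCompactSupport a := hF.mean_hasCompactSupport
  have had : ∀ t, deriv a t = ∫ y, Ft (t, y) ∂(surf d) := fun t =>
    (hF.hasDerivAt_mean hFt hder t).deriv
  have hqc : ∀ i, ContDiff ℝ 1 (q i) := fun i => (hFi i).contDiff_mean (hFti i) fun t y =>
    (hder t y).mul_const ((y : E d) i)
  have hqs : ∀ i, HasCompactSupport (q i) := fun i => (hFi i).mean_hasCompactSupport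
  have hqd : ∀ i t, deriv (q i) t = ∫ y, Ft (t, y) * (y : E d) i ∂(surf d) := fun i t =>
    ((hFi i).hasDerivAt_mean (hFti i) (fun t y => (hder t y).mul_const ((y : E d) i)) t).deriv
  have hUc : Continuous U := hF.sq.mean_cont
  have hUs : HasCompactSupport U := hF.sq.mean_hasCompactSupport
  have sqs : ∀ {u : ℝ → ℝ}, HasCompactSupport u → HasCompactSupport fun t => u t ^ 2 := fun h =>
    h.comp_left (g := fun x : ℝ => x ^ 2) (by simp)
  -- the ground state representation
  have hK : IsCc R fun p => Ft p + Real.tanh p.1 * F p :=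
    hFt.add (hF.mul_left (K := fun p => Real.tanh p.1) (by fun_prop))
  have e1 : ∫ p, wt (N - 2) p.1 * (Ft p + Real.tanh p.1 * F p) ^ 2 ∂(cyl d)
      = (∫ p, wt (N - 2) p.1 * Ft p ^ 2 ∂(cyl d)) + (N - 1) * (∫ t, wt (N - 2) t * U t)
        - N * ∫ t, wt N t * U t := by
    have h1 := (hK.sq.mul_left (K := fun p => wt (N - 2) p.1) (by fun_prop)).integral_eq'
    have h2 := (hFt.sq.mul_left (K := fun p => wt (N - 2) p.1) (by fun_prop)).integral_eq'
    have h3' := hF.sq.mul_left (K := fun p => (N - 1) * wt (N - 2) p.1 - N * wt N p.1)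
      (by fun_prop)
    have h3 := h3'.integral_eq'
    have h4 := hF.sq.integral_mul_eq (g := fun t => (N - 1) * wt (N - 2) t - N * wt N t)
      (by fun_prop)
    have h5 : ∫ t, ((N - 1) * wt (N - 2) t - N * wt N t) * U t
        = (N - 1) * (∫ t, wt (N - 2) t * U t) - N * ∫ t, wt N t * U t := by
      rw [← integral_const_mul, ← integral_const_mul, ← integral_sub
        ((hUs.integrable_wt_mul hUc hcw2).const_mul _) ((hUs.integrable_wt_mul hUc hcw).const_mul _)]
      congr 1; funext t; ring
    have h6 : ∀ y : Sph d, ∫ t, wt (N - 2) t * (Ft (t, y) + Real.tanh t * F (t, y)) ^ 2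
        = (∫ t, wt (N - 2) t * Ft (t, y) ^ 2)
          + ∫ t, ((N - 1) * wt (N - 2) t - N * wt N t) * F (t, y) ^ 2 := fun y => by
      have hd1 : deriv (fun s => F (s, y)) = fun t => Ft (t, y) := funext fun t => (hder t y).deriv
      have hc1 : ContDiff ℝ 1 fun s => F (s, y) := by
        rw [contDiff_one_iff_deriv, hd1]
        exact ⟨fun t => (hder t y).differentiableAt, by have := hFt.cont; fun_prop⟩
      have := integral_wt_deriv_add_tanh (N := N) hc1 (hF.slice_hasCompactSupport y)
      rwa [hd1] at this
    rw [h1, h2]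
    simp only [h6]
    rw [integral_add]
    · rw [← h3, h4, h5]; ring
    · exact (hFt.sq.mul_left (K := fun p => wt (N - 2) p.1) (by fun_prop)).integrable.integral_prod_right
    · exact h3'.integrable.integral_prod_right
  have iw : ∀ {g u : ℝ → ℝ}, Continuous g → Continuous u → HasCompactSupport u →
      Integrable fun t => g t * u t := fun hg hu hc => hc.integrable_wt_mul hu hg
  have hacc := hac.continuous
  have hadc := hac.continuous_deriv le_rfl
  have hqcc : ∀ i, Continuous (q i) := fun i => (hqc i).continuous
  have hqdc : ∀ i, Continuous (deriv (q i)) := fun i => (hqc i).continuous_deriv le_rfl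
  have sa : Continuous (fun t => a t ^ 2) := hacc.pow 2
  have sq' : ∀ i, Continuous (fun t => q i t ^ 2) := fun i => (hqcc i).pow 2
  have ka : Continuous (fun t => (deriv a t + Real.tanh t * a t) ^ 2) := by fun_prop
  have kas : HasCompactSupport (fun t => (deriv a t + Real.tanh t * a t) ^ 2) :=
    sqs (has.deriv.add (has.mul_left (f := Real.tanh)))
  have kq : ∀ i, Continuous (fun t => (deriv (q i) t + Real.tanh t * q i t) ^ 2) := fun i =>
    ((hqdc i).add (hT.mul (hqcc i))).pow 2
  have kqs : ∀ i, HasCompactSupport (fun t => (deriv (q i) t + Real.tanh t * q i t) ^ 2) := fun i =>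
    sqs ((hqs i).deriv.add ((hqs i).mul_left (f := Real.tanh)))
  -- Bessel on each sphere for F_t + tanh t F. Its mean and first moments are the same expressions
  -- in `a` and `q i`, because tanh depends on t only.
  have e2 : 1 / S * (∫ t, wt (N - 2) t * (deriv a t + Real.tanh t * a t) ^ 2)
      + d / S * ∑ i, ∫ t, wt (N - 2) t * (deriv (q i) t + Real.tanh t * q i t) ^ 2
      ≤ ∫ p, wt (N - 2) p.1 * (Ft p + Real.tanh p.1 * F p) ^ 2 ∂(cyl d) := by
    rw [hK.sq.integral_mul_eq hcw2, ← integral_finsetSum _ fun i _ => iw hcw2 (kq i) (kqs i),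
      ← integral_const_mul, ← integral_const_mul, ← integral_add ((iw hcw2 ka kas).const_mul _)
      ((integrable_finsetSum _ fun i _ => iw hcw2 (kq i) (kqs i)).const_mul _)]
    refine integral_mono (((iw hcw2 ka kas).const_mul _).add
      ((integrable_finsetSum _ fun i _ => iw hcw2 (kq i) (kqs i)).const_mul _))
      (iw hcw2 hK.sq.mean_cont hK.sq.mean_hasCompactSupport) fun t => ?_
    have hb := bessel_surf hd (hK.slice_cont t)
    rw [norm_sq_integral_smul_coe (hK.slice_cont t)] at hb
    have m1 : ∫ y, (Ft (t, y) + Real.tanh t * F (t, y)) ∂(surf d)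
        = deriv a t + Real.tanh t * a t := by
      rw [integral_add (Continuous.integrable_surf (hFt.slice_cont t))
        ((Continuous.integrable_surf (hF.slice_cont t)).const_mul _), integral_const_mul, had]
    have m2 : ∀ i, ∫ y : Sph d, (Ft (t, y) + Real.tanh t * F (t, y)) * (y : E d) i ∂(surf d)
        = deriv (q i) t + Real.tanh t * q i t := fun i => by
      rw [hqd, hq]
      simp only
      rw [← integral_const_mul, ← integral_add (Continuous.integrable_surf ((hFti i).slice_cont t))
        ((Continuous.integrable_surf ((hFi i).slice_cont t)).const_mul _)]
      congr 1; funext y; ring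
    simp only [m1, m2] at hb
    have := mul_le_mul_of_nonneg_left hb (wt_pos (N - 2) t).le
    simp only [← Finset.mul_sum]
    calc _ = wt (N - 2) t * ((deriv a t + Real.tanh t * a t) ^ 2 / S
          + d / S * ∑ i, (deriv (q i) t + Real.tanh t * q i t) ^ 2) := by ring
      _ ≤ _ := this
  -- The mean is converted back to its own energy: its gap is relative to 1 and tanh, not to 1/cosh.
  have e3 : ∫ t, wt (N - 2) t * (deriv a t + Real.tanh t * a t) ^ 2
      = (∫ t, wt (N - 2) t * deriv a t ^ 2) + ((N - 1) * (∫ t, wt (N - 2) t * a t ^ 2)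
        - N * ∫ t, wt N t * a t ^ 2) := by
    rw [integral_wt_deriv_add_tanh hac has, ← integral_const_mul, ← integral_const_mul,
      ← integral_sub ((iw hcw2 sa (sqs has)).const_mul _) ((iw hcw sa (sqs has)).const_mul _)]
    congr 2; funext t; ring
  have L1 := line_spectral_gap hN hac has
  have L2 := fun i => ground_state_gap hN (hqc i) (hqs i)
  have L1' := integral_wt_variance_nonneg hN.le hacc has
  have L2' := fun i => integral_wt_inv_cosh_bessel hN.le (hqcc i) (hqs i)
  -- the spherical part
  set V : ℝ → ℝ := fun t => U t - a t ^ 2 / S with hV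
  -- On the sphere at height t, `V` is the squared distance of F to constants and `X` the one to
  -- affine functions.
  set X : ℝ → ℝ := fun t => V t - d / S * ∑ i, q i t ^ 2 with hX
  have hX0 : ∀ t, 0 ≤ X t := fun t => by
    have hb := bessel_surf hd (hF.slice_cont t)
    rw [norm_sq_integral_smul_coe (hF.slice_cont t)] at hb
    simp only [hX, hV]
    linarith
  have hV0 : ∀ t, 0 ≤ V t := fun t => by
    have h1 : 0 ≤ d / S * ∑ i, q i t ^ 2 :=
      mul_nonneg (by positivity) (Finset.sum_nonneg fun i _ => sq_nonneg _)
    have := hX0 t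
    simp only [hX] at this
    linarith
  have iV : ∀ {g : ℝ → ℝ}, Continuous g → Integrable (fun t => g t * V t) ∧
      ∫ t, g t * V t = (∫ t, g t * U t) - (∫ t, g t * a t ^ 2) / S := fun {g} hg => by
    have e : (fun t => g t * V t) = fun t => g t * U t - g t * a t ^ 2 / S := by
      funext t; simp only [hV]; ring
    have i1 := iw hg hUc hUs
    have i2 := (iw hg sa (sqs has)).div_const S
    rw [e]
    exact ⟨i1.sub i2, by rw [integral_sub i1 i2, integral_div]⟩
  have iX : ∀ {g : ℝ → ℝ}, Continuous g → Integrable (fun t => g t * X t) ∧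
      ∫ t, g t * X t = (∫ t, g t * U t) - (∫ t, g t * a t ^ 2) / S
        - d / S * ∑ i, ∫ t, g t * q i t ^ 2 := fun {g} hg => by
    have e : (fun t => g t * X t) = fun t => g t * V t - d / S * ∑ i, g t * q i t ^ 2 := by
      funext t; simp only [hX]; rw [← Finset.mul_sum]; ring
    obtain ⟨i1, h1⟩ := iV hg
    have i2 := (integrable_finsetSum Finset.univ
      fun i _ => iw hg (sq' i) (sqs (hqs i))).const_mul (d / S)
    rw [e]
    exact ⟨i1.sub i2, by rw [integral_sub i1 i2, integral_const_mul, h1,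
      integral_finsetSum _ fun i _ => iw hg (sq' i) (sqs (hqs i))]⟩
  have e6 : ((d : ℝ) - 1) * (∫ t, wt (N - 2) t * V t) + d / 8 * (∫ t, wt (N - 2) t * X t)
      ≤ ∫ p, wt (N - 2) p.1 * D p ∂(cyl d) := by
    rw [hD.integral_mul_eq hcw2, ← integral_const_mul, ← integral_const_mul,
      ← integral_add ((iV hcw2).1.const_mul _) ((iX hcw2).1.const_mul _)]
    refine integral_mono (((iV hcw2).1.const_mul _).add ((iX hcw2).1.const_mul _))
      (iw hcw2 hD.mean_cont hD.mean_hasCompactSupport) fun t => ?_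
    have hb := hsph t
    rw [norm_sq_integral_smul_coe (hF.slice_cont t)] at hb
    have := mul_le_mul_of_nonneg_left hb (wt_pos (N - 2) t).le
    calc _ = wt (N - 2) t * (((d : ℝ) - 1) * V t + d / 8 * X t) := by ring
      _ ≤ _ := this
  have mV : ∫ t, wt N t * V t ≤ ∫ t, wt (N - 2) t * V t :=
    integral_mono (iV hcw).1 (iV hcw2).1 fun t => mul_le_mul_of_nonneg_right (hle t) (hV0 t)
  have mX : ∫ t, wt N t * X t ≤ ∫ t, wt (N - 2) t * X t :=
    integral_mono (iX hcw).1 (iX hcw2).1 fun t => mul_le_mul_of_nonneg_right (hle t) (hX0 t)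
  have nV : 0 ≤ ∫ t, wt N t * V t := integral_nonneg fun t => mul_nonneg (wt_pos N t).le (hV0 t)
  have nX : 0 ≤ ∫ t, wt N t * X t := integral_nonneg fun t => mul_nonneg (wt_pos N t).le (hX0 t)
  -- rewriting of the integrals over the cylinder
  have c1 : ∫ p, wt N p.1 * F p ^ 2 ∂(cyl d) = ∫ t, wt N t * U t := hF.sq.integral_mul_eq hcw
  have c2 : ∫ p, wt N p.1 * F p ∂(cyl d) = ∫ t, wt N t * a t := hF.integral_mul_eq hcw
  have c3 : ∫ p, wt N p.1 * Real.tanh p.1 * F p ∂(cyl d) = ∫ t, wt N t * Real.tanh t * a t :=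
    hF.integral_mul_eq (hcw.mul hT)
  have c4 : ∀ i, ∫ p, wt N p.1 * (Real.cosh p.1)⁻¹ * (F p * (p.2 : E d) i) ∂(cyl d)
      = ∫ t, wt N t * (Real.cosh t)⁻¹ * q i t := fun i => (hFi i).integral_mul_eq (hcw.mul hch)
  have c5 : ∫ p, wt (N - 2) p.1 * (α ^ 2 * Ft p ^ 2 + D p) ∂(cyl d)
      = α ^ 2 * (∫ p, wt (N - 2) p.1 * Ft p ^ 2 ∂(cyl d))
        + ∫ p, wt (N - 2) p.1 * D p ∂(cyl d) := by
    have w2 : Continuous fun p : ℝ × Sph d => wt (N - 2) p.1 := by fun_prop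
    rw [← integral_const_mul, ← integral_add ((hFt.sq.mul_left w2).integrable.const_mul _)
      (hD.mul_left w2).integrable]
    congr 1; funext p; ring
  have eV1 := (iV hcw).2
  have eV2 := (iV hcw2).2
  have eX1 := (iX hcw).2
  have eX2 := (iX hcw2).2
  simp only [c4]
  rw [c1, c2, c3, c5]
  have hZ := integral_wt_pos hN.le
  have hY := integral_wt_tanh_sq_pos hN.le
  have hZ2 := integral_wt_pos (N := N + 2) (by linarith)
  have L2s : (N + 2) * ((∑ i, ∫ t, wt N t * q i t ^ 2)
      - (∑ i, (∫ t, wt N t * (Real.cosh t)⁻¹ * q i t) ^ 2) / (∫ t, wt (N + 2) t))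
      ≤ ∑ i, ∫ t, wt (N - 2) t * (deriv (q i) t + Real.tanh t * q i t) ^ 2 := by
    rw [Finset.sum_div, ← Finset.sum_sub_distrib, Finset.mul_sum]
    exact Finset.sum_le_sum fun i _ => L2 i
  have L2s' : 0 ≤ (∑ i, ∫ t, wt N t * q i t ^ 2)
      - (∑ i, (∫ t, wt N t * (Real.cosh t)⁻¹ * q i t) ^ 2) / (∫ t, wt (N + 2) t) := by
    rw [Finset.sum_div, ← Finset.sum_sub_distrib]
    exact Finset.sum_nonneg fun i _ => L2' i
  rw [e3] at e2
  clear hsph hder L2 L2' c4 hX0 hV0 iw iV iX c1 c2 c3 c5 had hqd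
  generalize (∫ t, wt N t) = Z at *
  generalize (∫ t, wt N t * Real.tanh t ^ 2) = Y at *
  generalize (∫ t, wt (N + 2) t) = Z2 at *
  generalize (∫ t, wt N t * V t) = v1 at *
  generalize (∫ t, wt (N - 2) t * V t) = v2 at *
  generalize (∫ t, wt N t * X t) = x1 at *
  generalize (∫ t, wt (N - 2) t * X t) = x2 at *
  generalize (∫ t, wt N t * U t) = mU at *
  generalize (∫ t, wt (N - 2) t * U t) = wU at *
  generalize (∫ t, wt N t * a t ^ 2) = ma at *
  generalize (∫ t, wt (N - 2) t * a t ^ 2) = wa at *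
  generalize (∫ t, wt N t * a t) = A at *
  generalize (∫ t, wt N t * Real.tanh t * a t) = B at *
  generalize (∫ t, wt (N - 2) t * deriv a t ^ 2) = wda at *
  generalize (∑ i, ∫ t, wt N t * q i t ^ 2) = mq at *
  generalize (∑ i, ∫ t, wt (N - 2) t * q i t ^ 2) = wq at *
  generalize (∑ i, (∫ t, wt N t * (Real.cosh t)⁻¹ * q i t) ^ 2) = C at *
  generalize (∑ i, ∫ t, wt (N - 2) t * (deriv (q i) t + Real.tanh t * q i t) ^ 2) = wk at *
  generalize (∫ p, wt (N - 2) p.1 * Ft p ^ 2 ∂(cyl d)) = T1 at *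
  generalize (∫ p, wt (N - 2) p.1 * D p ∂(cyl d)) = T2 at *
  generalize (∫ p, wt (N - 2) p.1 * (Ft p + Real.tanh p.1 * F p) ^ 2 ∂(cyl d)) = T3 at *
  have hα0 := sq_nonneg α
  set β := α ^ 2
  set B1 := ma - A ^ 2 / Z - B ^ 2 / Y with hB1
  set B2 := mq - C / Z2 with hB2
  have hN2 : 0 ≤ N + 2 := by linarith
  -- The whole gap in one line. `B1` is the distance of the mean to span(1, tanh) and `B2` the one
  -- of the first moments to 1/cosh; both come with the line gap N + 2. The term in `v2` is what
  -- remains of the spherical energy after the ground state representation has spent β(N-1), and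
  -- `x2` carries the spherical remainder.
  have lower : β * (N + 2) * (B1 / S + d / S * B2) + (d - 1 - β * (N - 1)) * v2 + d / 8 * x2
      ≤ β * T1 + T2 - N * β * (mU - A ^ 2 / (S * Z)) := by
    have s1 : (1 / S) * ((N + 2) * B1) + d / S * ((N + 2) * B2)
        ≤ T1 + (N - 1) * v2 - N * mU + N * (A ^ 2 / (S * Z)) := by
      have t1 := mul_le_mul_of_nonneg_left L1 (show (0 : ℝ) ≤ 1 / S by positivity)
      have t2 := mul_le_mul_of_nonneg_left L2s (show (0 : ℝ) ≤ d / S by positivity)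
      have t3 : (1 / S) * (wda - N * (ma - A ^ 2 / Z))
          = 1 / S * wda - N * ma / S + N * (A ^ 2 / (S * Z)) := by
        field_simp
        ring
      rw [eV2]
      rw [e1] at e2
      have t4 : (1 / S) * (wda + ((N - 1) * wa - N * ma))
          = 1 / S * wda + (N - 1) * (wa / S) - N * ma / S := by ring
      linarith
    have s2 := mul_le_mul_of_nonneg_left s1 hα0
    have s3 : β * (N + 2) * (B1 / S + d / S * B2)
        = β * ((1 / S) * ((N + 2) * B1) + d / S * ((N + 2) * B2)) := by ring
    rw [s3]
    linarith
  have key1 : mU - A ^ 2 / (S * Z) - B ^ 2 / (S * Y) - d / (S * Z2) * C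
      = B1 / S + d / S * B2 + x1 := by
    rw [eX1, hB1, hB2]; field_simp; ring
  have key2 : mU - A ^ 2 / (S * Z) - B ^ 2 / (S * Y) = B1 / S + v1 := by
    rw [eV1, hB1]; field_simp; ring
  have p1 : 0 ≤ B1 / S := by positivity
  have p2 : 0 ≤ d / S * B2 := by positivity
  have hδ : 0 ≤ d - 1 - β * (N - 1) := by linarith
  -- The first bound discards the `v2` term, whose coefficient vanishes in the limiting case, and
  -- keeps `x2`. The second keeps `v2` and discards `B2` and `x2`, which is informative in the
  -- strict case.
  constructor
  · rw [key1]
    refine le_trans ?_ lower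
    set c := min (β * (N + 2)) ((d : ℝ) / 8)
    have hc1 : c ≤ β * (N + 2) := min_le_left _ _
    have hc2 : c ≤ d / 8 := min_le_right _ _
    have q1 := mul_le_mul_of_nonneg_right hc1 (add_nonneg p1 p2)
    have q2 := mul_le_mul_of_nonneg_right hc2 nX
    have q3 : (d : ℝ) / 8 * x1 ≤ d / 8 * x2 := mul_le_mul_of_nonneg_left mX (by positivity)
    have q4 : 0 ≤ (d - 1 - β * (N - 1)) * v2 := mul_nonneg hδ (nV.trans mV)
    linarith
  · rw [key2]
    refine le_trans ?_ lower
    set c := min (β * (N + 2)) ((d : ℝ) - 1 - β * (N - 1))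
    have hc1 : c ≤ β * (N + 2) := min_le_left _ _
    have hc2 : c ≤ (d : ℝ) - 1 - β * (N - 1) := min_le_right _ _
    have q1 := mul_le_mul_of_nonneg_right hc1 p1
    have q2 := mul_le_mul_of_nonneg_right hc2 nV
    have q3 := mul_le_mul_of_nonneg_left mV hδ
    have q4 : 0 ≤ d / 8 * x2 := mul_nonneg (by positivity) (nX.trans mX)
    have q5 : 0 ≤ β * (N + 2) * (d / S * B2) := mul_nonneg (mul_nonneg hα0 hN2) p2
    linarith

end Cylinder

/-! ### The reference measure in logarithmic polar coordinates -/

section Params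

variable {d : ℕ} {a b : ℝ} {F : Type*} [NormedAddCommGroup F] [NormedSpace ℝ F]

lemma one_add_exp_two_mul (t : ℝ) : 1 + Real.exp (2 * t) = 2 * Real.exp t * Real.cosh t := by
  rw [Real.cosh_eq, two_mul, Real.exp_add, Real.exp_neg]
  have := (Real.exp_pos t).ne'
  field_simp
  ring

lemma norm_polarPt_rpow (α s : ℝ) (p : ℝ × Sph d) :
    ‖polarPt α p‖ ^ s = Real.exp (s * (p.1 / α)) := by
  rw [norm_polarPt, ← Real.exp_mul, mul_comm]

lemma norm_polarPt_rpow_two_mul (hα : 0 < alpha d a b) (p : ℝ × Sph d) :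
    ‖polarPt (alpha d a b) p‖ ^ (2 * alpha d a b) = Real.exp (2 * p.1) := by
  rw [norm_polarPt_rpow]
  congr 1
  field_simp

lemma density_nonneg (x : E d) : 0 ≤ density d a b x := by
  unfold density; positivity

lemma measurable_density : Measurable (density d a b) := by
  unfold density; fun_prop

/-- The Jacobian r^d times the density is e^(n t) (1 + e^(2t))^(-n) 2^n by `alpha_mul_nDim`, and the
factor 2^n in the definition is exactly what normalizes this to cosh^(-n) t. -/
lemma density_polarPt (hd : 3 ≤ d) (hab : (a, b) ∈ Theta d) (hα : 0 < alpha d a b)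
    (p : ℝ × Sph d) :
    Real.exp (d * (p.1 / alpha d a b)) * density d a b (polarPt (alpha d a b) p)
      = wt (nDim d a b) p.1 := by
  have h := alpha_mul_nDim hd hab hα
  rw [density, norm_polarPt_rpow_two_mul hα, norm_polarPt_rpow, one_add_exp_two_mul,
    Real.mul_rpow (by positivity) (Real.cosh_pos _).le, Real.mul_rpow (by positivity)
    (Real.exp_pos _).le, wt, Real.rpow_neg (Real.cosh_pos _).le, ← Real.exp_mul]
  have h2 : (2 : ℝ) ^ nDim d a b ≠ 0 := by positivity
  have h3 := (Real.rpow_pos_of_pos (Real.cosh_pos p.1) (nDim d a b)).ne'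
  have e : Real.exp (d * (p.1 / alpha d a b))
      * Real.exp (-(b * pExp d a b) * (p.1 / alpha d a b)) = Real.exp (p.1 * nDim d a b) := by
    rw [← Real.exp_add]
    congr 1
    rw [← add_mul, ← sub_eq_add_neg, ← h]
    field_simp
  have h4 := (Real.exp_pos (p.1 * nDim d a b)).ne'
  field_simp
  rw [← e]
  ring_nf

/-- The weight of the carré du champ is |x|² cosh² t: the cosh² lowers the exponent of the measure
by two, and |x|² makes the gradient scale invariant. -/
lemma carre_polarPt (hα : 0 < alpha d a b) (G : E d → E d) (p : ℝ × Sph d) :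
    wt (nDim d a b) p.1 * carre d a b G (polarPt (alpha d a b) p)
      = wt (nDim d a b - 2) p.1
        * (‖polarPt (alpha d a b) p‖ ^ 2 * ‖G (polarPt (alpha d a b) p)‖ ^ 2) := by
  have e1 : ‖polarPt (alpha d a b) p‖ ^ (2 * (1 - alpha d a b))
      = ‖polarPt (alpha d a b) p‖ ^ 2 * (Real.exp (2 * p.1))⁻¹ := by
    rw [← norm_polarPt_rpow_two_mul hα, ← Real.rpow_natCast, ← Real.rpow_neg (norm_nonneg _),
      ← Real.rpow_add (norm_pos_iff.2 (polarPt_ne_zero _ _))]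
    congr 1; push_cast; ring
  rw [carre, e1, norm_polarPt_rpow_two_mul hα, one_add_exp_two_mul, wt_eq_sub_two (nDim d a b),
    one_sub_tanh_sq, two_mul p.1, Real.exp_add]
  have := (Real.exp_pos p.1).ne'
  have := (Real.cosh_pos p.1).ne'
  field_simp
  ring

lemma integral_muBar (hd : 3 ≤ d) (hab : (a, b) ∈ Theta d) (hα : 0 < alpha d a b) (h : E d → F) :
    ∫ x, h x ∂(muBar d a b) = (alpha d a b)⁻¹ • ∫ p, wt (nDim d a b) p.1
      • h (polarPt (alpha d a b) p) ∂(cyl d) := by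
  rw [muBar, integral_withDensity_eq_integral_toReal_smul measurable_density.ennreal_ofReal
    (by simp), integral_polar hα (by omega), ← integral_smul]
  refine integral_congr_ae (Eventually.of_forall fun p => ?_)
  simp only
  rw [ENNReal.toReal_ofReal (density_nonneg _), smul_smul, smul_smul, mul_assoc,
    density_polarPt hd hab hα]

lemma integrable_muBar_iff (hd : 3 ≤ d) (hab : (a, b) ∈ Theta d) (hα : 0 < alpha d a b)
    (h : E d → F) :
    Integrable h (muBar d a b) ↔ Integrable (fun p => wt (nDim d a b) p.1
      • h (polarPt (alpha d a b) p)) (cyl d) := by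
  rw [muBar, integrable_withDensity_iff_integrable_smul' measurable_density.ennreal_ofReal
    (by simp), integrable_polar_iff hα (by omega),
    ← integrable_smul_iff (inv_ne_zero hα.ne') (fun p => wt (nDim d a b) p.1
      • h (polarPt (alpha d a b) p))]
  refine integrable_congr (Eventually.of_forall fun p => ?_)
  simp only [Pi.smul_apply]
  rw [ENNReal.toReal_ofReal (density_nonneg _), smul_smul, smul_smul, mul_assoc,
    density_polarPt hd hab hα]

lemma integrable_wt_cyl {N : ℝ} (hN : 2 ≤ N) : Integrable (fun p : ℝ × Sph d => wt N p.1) (cyl d) := by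
  have := (integrable_wt hN).mul_prod (ν := surf d) (integrable_const (1 : ℝ))
  rw [cyl]; simpa using this

lemma integral_cyl_fst (g : ℝ → ℝ) : ∫ p, g p.1 ∂(cyl d) = area d * ∫ t, g t := by
  have := integral_prod_smul (μ := (volume : Measure ℝ)) (ν := surf d) g (fun _ => (1 : ℝ))
  simp only [smul_eq_mul, mul_one, integral_const] at this
  rw [cyl, this, mul_comm]; rfl

lemma muBar_univ (hd : 3 ≤ d) (hab : (a, b) ∈ Theta d) (hα : 0 < alpha d a b) :
    muBar d a b Set.univ ≠ ⊤ ∧ (muBar d a b Set.univ).toReal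
      = (alpha d a b)⁻¹ * (area d * ∫ t, wt (nDim d a b) t) := by
  have hn : 2 ≤ nDim d a b := by linarith [nDim_ge hd hab hα]
  have hi : Integrable (fun _ : E d => (1 : ℝ)) (muBar d a b) := by
    rw [integrable_muBar_iff hd hab hα]
    simpa using integrable_wt_cyl hn
  have h1 : muBar d a b Set.univ ≠ ⊤ := by
    have := (integrable_const_iff_isFiniteMeasure (one_ne_zero (α := ℝ))).1 hi
    exact measure_ne_top _ _
  refine ⟨h1, ?_⟩
  have h2 := integral_muBar hd hab hα (fun _ : E d => (1 : ℝ))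
  simp only [integral_const, smul_eq_mul, mul_one, integral_cyl_fst] at h2
  exact h2

lemma area_mul_pos (hd : 3 ≤ d) (hab : (a, b) ∈ Theta d) (hα : 0 < alpha d a b) :
    0 < area d * ∫ t, wt (nDim d a b) t :=
  mul_pos (area_pos (by omega)) (integral_wt_pos (by linarith [nDim_ge hd hab hα]))

lemma muBar_univ_ne_zero (hd : 3 ≤ d) (hab : (a, b) ∈ Theta d) (hα : 0 < alpha d a b) :
    muBar d a b Set.univ ≠ 0 := fun h0 => by
  have h := (muBar_univ hd hab hα).2
  have := area_mul_pos hd hab hα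
  rw [h0] at h
  simp only [ENNReal.toReal_zero] at h
  have : 0 < (alpha d a b)⁻¹ * (area d * ∫ t, wt (nDim d a b) t) := by positivity
  linarith

lemma isProbabilityMeasure_mu (hd : 3 ≤ d) (hab : (a, b) ∈ Theta d) (hα : 0 < alpha d a b) :
    IsProbabilityMeasure (mu d a b) := ⟨by
  rw [mu, Measure.smul_apply, smul_eq_mul,
    ENNReal.inv_mul_cancel (muBar_univ_ne_zero hd hab hα) (muBar_univ hd hab hα).1]⟩

theorem integral_mu (hd : 3 ≤ d) (hab : (a, b) ∈ Theta d) (hα : 0 < alpha d a b) (h : E d → F) :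
    ∫ x, h x ∂(mu d a b) = (area d * ∫ t, wt (nDim d a b) t)⁻¹ • ∫ p, wt (nDim d a b) p.1
      • h (polarPt (alpha d a b) p) ∂(cyl d) := by
  rw [mu, integral_smul_measure, ENNReal.toReal_inv, (muBar_univ hd hab hα).2,
    integral_muBar hd hab hα, smul_smul]
  congr 1
  field_simp

lemma density_pos {x : E d} (hx : x ≠ 0) : 0 < density d a b x := by
  have := norm_pos_iff.2 hx
  unfold density; positivity

lemma mu_absolutelyContinuous : mu d a b ≪ volume :=
  (Measure.smul_absolutelyContinuous).trans (withDensity_absolutelyContinuous _ _)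

/-- The density is positive off the origin, a null set. It turns equalities obtained in L²(μ) into
Lebesgue almost everywhere ones. -/
lemma absolutelyContinuous_mu (hd : 3 ≤ d) (hab : (a, b) ∈ Theta d) (hα : 0 < alpha d a b) :
    (volume : Measure (E d)) ≪ mu d a b := by
  have := nontrivial_euclidean (d := d) (by omega)
  refine (withDensity_absolutelyContinuous' measurable_density.ennreal_ofReal.aemeasurable
    ?_).trans (Measure.absolutelyContinuous_smul
      (ENNReal.inv_ne_zero.2 (muBar_univ hd hab hα).1))
  filter_upwards [ae_ne_zero (E d)] with x hx
  exact (ENNReal.ofReal_pos.2 (density_pos hx)).ne'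

end Params

/-! ### The spectral gap for test functions -/

/-- The function `tanh (α ln |x|)`. -/
def tanhLog (d : ℕ) (a b : ℝ) (x : E d) : ℝ := Real.tanh (alpha d a b * Real.log ‖x‖)

/-- The function `1 / cosh (α ln |x|)`. -/
def sechLog (d : ℕ) (a b : ℝ) (x : E d) : ℝ := (Real.cosh (alpha d a b * Real.log ‖x‖))⁻¹

/-- The squared norm of `tanh (α ln |x|)` in `L²(μ)`. -/
def tanhNorm (d : ℕ) (a b : ℝ) : ℝ :=
  (∫ t, wt (nDim d a b) t * Real.tanh t ^ 2) / ∫ t, wt (nDim d a b) t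

/-- The squared norm of `⟨v, x / |x|⟩ / cosh (α ln |x|)` in `L²(μ)`, for a unit vector `v`. -/
def sechNorm (d : ℕ) (a b : ℝ) : ℝ :=
  (∫ t, wt (nDim d a b + 2) t) / (d * ∫ t, wt (nDim d a b) t)

/-- The scalar product in `L²(μ)` with `tanh (α ln |x|)`. -/
def tanhMoment (d : ℕ) (a b : ℝ) (f : E d → ℝ) : ℝ :=
  ∫ x, f x * tanhLog d a b x ∂(mu d a b)

/-- The scalar products in `L²(μ)` with `⟨v, x / |x|⟩ / cosh (α ln |x|)`, as a vector. -/
def sechMoment (d : ℕ) (a b : ℝ) (f : E d → ℝ) : E d :=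
  ∫ x, (f x * sechLog d a b x) • (‖x‖⁻¹ • x) ∂(mu d a b)

/-- The squared distance in `L²(μ)` to the span of `1` and `tanh (α ln |x|)`. -/
def residual (d : ℕ) (a b : ℝ) (f : E d → ℝ) : ℝ :=
  var d a b f - tanhMoment d a b f ^ 2 / tanhNorm d a b

/-- The squared distance in `L²(μ)` to the span of `1`, of `tanh (α ln |x|)` and of the functions
`⟨v, x / |x|⟩ / cosh (α ln |x|)`. -/
def residual' (d : ℕ) (a b : ℝ) (f : E d → ℝ) : ℝ :=
  residual d a b f - ‖sechMoment d a b f‖ ^ 2 / sechNorm d a b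

/-- The difference of the two sides of the Poincaré inequality. -/
def deficit (d : ℕ) (a b : ℝ) (f : E d → ℝ) (G : E d → E d) : ℝ :=
  (∫ x, carre d a b G x ∂(mu d a b)) - nDim d a b * alpha d a b ^ 2 * var d a b f

/-! ### Test functions read on the cylinder. -/

section Params

variable {d : ℕ} {a b : ℝ}

lemma exists_vanish_polarPt {W : Type*} [Zero W] {f : E d → W} (hs : HasCompactSupport f)
    (h0 : tsupport f ⊆ {0}ᶜ) {α : ℝ} (hα : 0 < α) :
    ∃ R, ∀ p : ℝ × Sph d, R < |p.1| → polarPt α p ∉ tsupport f := by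
  have hc : ContinuousOn (fun x : E d => α * Real.log ‖x‖) (tsupport f) :=
    continuousOn_const.mul (continuous_norm.continuousOn.log fun x hx =>
      norm_ne_zero_iff.2 (h0 hx))
  obtain ⟨C, hC⟩ := hs.isCompact.exists_bound_of_continuousOn hc
  refine ⟨C, fun p hp hm => ?_⟩
  have := hC _ hm
  rw [norm_polarPt, Real.log_exp, mul_div_cancel₀ _ hα.ne', Real.norm_eq_abs] at this
  linarith

lemma hasDerivAt_polarPt (α t : ℝ) (y : Sph d) :
    HasDerivAt (fun s => polarPt α (s, y)) (α⁻¹ • polarPt α (t, y)) t := by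
  have h : HasDerivAt (fun s : ℝ => Real.exp (s / α)) (Real.exp (t / α) * (1 / α)) t :=
    ((hasDerivAt_id t).div_const α).exp
  refine (h.smul_const (y : E d)).congr_deriv ?_
  rw [polarPt, smul_smul]
  congr 1
  ring

lemma alpha_mul_log_polarPt {α : ℝ} (hα : 0 < α) (p : ℝ × Sph d) :
    α * Real.log ‖polarPt α p‖ = p.1 := by
  rw [norm_polarPt, Real.log_exp, mul_div_cancel₀ _ hα.ne']

lemma hasFDerivAt_normalize {x : E d} (hx : ‖x‖ = 1) :
    HasFDerivAt (fun z : E d => ‖z‖⁻¹ • z)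
      (ContinuousLinearMap.id ℝ (E d) - (innerSL ℝ x).smulRight x) x := by
  have hx0 : x ≠ 0 := by rw [← norm_pos_iff, hx]; exact one_pos
  have h1 := (hasDerivAt_inv (norm_ne_zero_iff.2 hx0)).comp_hasFDerivAt x (hasFDerivAt_norm hx0)
  refine (HasFDerivAt.smul h1 (hasFDerivAt_id x)).congr_fderiv ?_
  ext v
  simp [hx, sub_eq_add_neg]

/-- `sphere_poincare` for x ↦ f(r x/|x|), whose gradient on the unit sphere is r times the
tangential part of ∇f. The right side is therefore r² times |∇f|² minus its radial part. -/
lemma sphere_poincare_restrict (hd : 0 < d) {f : E d → ℝ} (hf : ContDiff ℝ 1 f) {r : ℝ}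
    (hr : 0 < r) :
    ((d : ℝ) - 1) * ((∫ y : Sph d, f (r • (y : E d)) ^ 2 ∂(surf d))
          - (∫ y : Sph d, f (r • (y : E d)) ∂(surf d)) ^ 2 / area d)
        + d / 8 * ((∫ y : Sph d, f (r • (y : E d)) ^ 2 ∂(surf d))
          - (∫ y : Sph d, f (r • (y : E d)) ∂(surf d)) ^ 2 / area d
          - d / area d * ‖∫ y : Sph d, f (r • (y : E d)) • (y : E d) ∂(surf d)‖ ^ 2)
      ≤ ∫ y : Sph d, (‖r • (y : E d)‖ ^ 2 * ‖gradient f (r • (y : E d))‖ ^ 2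
        - inner ℝ (gradient f (r • (y : E d))) (r • (y : E d)) ^ 2) ∂(surf d) := by
  set u : E d → ℝ := fun x => f (r • (‖x‖⁻¹ • x)) with hu
  have huC : ContDiffOn ℝ 1 u {0}ᶜ := fun x hx => by
    have h1 : ContDiffAt ℝ 1 (fun z : E d => ‖z‖⁻¹) x :=
      (contDiffAt_norm ℝ hx).inv (norm_ne_zero_iff.2 hx)
    exact (hf.contDiffAt.comp x ((h1.smul contDiffAt_id).const_smul r)).contDiffWithinAt
  have hom : ∀ c : ℝ, 0 < c → ∀ x, u (c • x) = u x := fun c hc x => by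
    simp only [hu, norm_smul, smul_smul, Real.norm_of_nonneg hc.le, mul_inv]
    congr 2
    field_simp
  have h := sphere_poincare hd huC hom
  have e : ∀ y : Sph d, u y = f (r • (y : E d)) := fun y => by
    simp only [hu, Sph.norm_eq, inv_one, one_smul]
  have eg : ∀ y : Sph d, ‖gradient u y‖ ^ 2 = ‖r • (y : E d)‖ ^ 2 * ‖gradient f (r • (y : E d))‖ ^ 2
        - inner ℝ (gradient f (r • (y : E d))) (r • (y : E d)) ^ 2 := fun y => by
    have hy := Sph.norm_eq y
    have hfd : HasFDerivAt u ((fderiv ℝ f (r • (y : E d))).comp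
        (r • (ContinuousLinearMap.id ℝ (E d) - (innerSL ℝ (y : E d)).smulRight (y : E d)))) y := by
      have h1 := (hasFDerivAt_normalize hy).const_smul r
      have h2 := (hf.differentiable one_ne_zero (r • (y : E d))).hasFDerivAt
      have h3 : r • (‖(y : E d)‖⁻¹ • (y : E d)) = r • (y : E d) := by rw [hy, inv_one, one_smul]
      rw [← h3] at h2
      have := HasFDerivAt.comp (y : E d) h2 h1
      rw [h3] at this
      exact this
    set g := gradient f (r • (y : E d)) with hg
    have hgu : gradient u y = r • (g - (inner ℝ g (y : E d) : ℝ) • (y : E d)) := by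
      refine ext_inner_right ℝ fun v => ?_
      rw [inner_gradient_left, hfd.fderiv, real_inner_smul_left, inner_sub_left,
        real_inner_smul_left]
      simp only [ContinuousLinearMap.comp_apply, smul_apply, map_smul,
        sub_apply, map_sub, ContinuousLinearMap.smulRight_apply,
        innerSL_apply_apply, ContinuousLinearMap.id_apply, smul_eq_mul]
      rw [← inner_gradient_left, ← inner_gradient_left, ← hg]
      ring
    rw [hgu, norm_smul, norm_smul, hy, mul_pow, norm_sub_sq_real, norm_smul, hy,
      real_inner_smul_right, real_inner_smul_right, Real.norm_eq_abs, Real.norm_eq_abs]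
    simp only [mul_one, sq_abs]
    ring
  simp only [e, eg] at h
  exact h

end Params

section Params

variable {d : ℕ} {a b : ℝ}

/-- The spectral gap for smooth functions with compact support away from the origin. -/
theorem residual_le_deficit (hd : 3 ≤ d) (hab : (a, b) ∈ Theta d) (hα : 0 < alpha d a b)
    (hFS : alpha d a b ^ 2 * (nDim d a b - 1) ≤ d - 1) {f : E d → ℝ} (hf : ContDiff ℝ 1 f)
    (hs : HasCompactSupport f) (h0 : tsupport f ⊆ {0}ᶜ) :
    min (alpha d a b ^ 2 * (nDim d a b + 2)) ((d : ℝ) / 8) * residual' d a b f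
      ≤ deficit d a b f (gradient f) ∧
    min (alpha d a b ^ 2 * (nDim d a b + 2)) ((d : ℝ) - 1 - alpha d a b ^ 2 * (nDim d a b - 1))
        * residual d a b f
      ≤ deficit d a b f (gradient f) := by
  have hd0 : 0 < d := by omega
  have hn : 2 < nDim d a b := by linarith [nDim_ge hd hab hα]
  obtain ⟨R, hR⟩ := exists_vanish_polarPt hs h0 hα
  set α := alpha d a b with hαdef
  set n := nDim d a b with hndef
  set pt : ℝ × Sph d → E d := polarPt α with hpt
  have hptc : Continuous pt := continuous_polarPt α
  have hgc : Continuous (gradient f) := continuous_gradient hf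
  have hg0 : ∀ p : ℝ × Sph d, R < |p.1| → gradient f (pt p) = 0 := fun p hp => by
    rw [gradient, fderiv_of_notMem_tsupport ℝ (hR p hp), map_zero]
  have hF : IsCc R fun p => f (pt p) :=
    ⟨hf.continuous.comp hptc, fun p hp => image_eq_zero_of_notMem_tsupport (hR p hp)⟩
  have hFt : IsCc R fun p => α⁻¹ * inner ℝ (gradient f (pt p)) (pt p) :=
    ⟨by fun_prop, fun p hp => by rw [hg0 p hp, inner_zero_left, mul_zero]⟩
  have hD : IsCc R fun p => ‖pt p‖ ^ 2 * ‖gradient f (pt p)‖ ^ 2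
      - inner ℝ (gradient f (pt p)) (pt p) ^ 2 :=
    ⟨by fun_prop, fun p hp => by rw [hg0 p hp, inner_zero_left]; simp⟩
  have hder : ∀ t y, HasDerivAt (fun s => f (pt (s, y)))
      (α⁻¹ * inner ℝ (gradient f (pt (t, y))) (pt (t, y))) t := fun t y => by
    have h1 := (hf.differentiable one_ne_zero (pt (t, y))).hasFDerivAt
    have := h1.comp_hasDerivAt t (hasDerivAt_polarPt α t y)
    refine this.congr_deriv ?_
    rw [map_smul, inner_gradient_left, smul_eq_mul]
  -- The slice at height t is the sphere of radius e^(t/α), on which the spherical inequality with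
  -- remainder holds.
  have key := cylinder_gap hd0 hn hFS hF hFt hD hder fun t =>
    sphere_poincare_restrict hd0 hf (Real.exp_pos (t / α))
  have hZ := integral_wt_pos hn.le
  have hY := integral_wt_tanh_sq_pos hn.le
  have hJ := integral_wt_pos (N := n + 2) (by linarith)
  have hS := area_pos hd0
  have hdR : (0 : ℝ) < d := by exact_mod_cast hd0
  have hch : Continuous fun t => (Real.cosh t)⁻¹ :=
    Real.continuous_cosh.inv₀ fun t => (Real.cosh_pos t).ne'
  have hcw := continuous_wt n
  have hlog : ∀ p, α * Real.log ‖pt p‖ = p.1 := alpha_mul_log_polarPt hα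
  -- the integrals
  have m1 : ∫ x, f x ^ 2 ∂(mu d a b) = (area d * ∫ t, wt n t)⁻¹
      * ∫ p, wt n p.1 * f (pt p) ^ 2 ∂(cyl d) := integral_mu hd hab hα _
  have m2 : ∫ x, f x ∂(mu d a b) = (area d * ∫ t, wt n t)⁻¹
      * ∫ p, wt n p.1 * f (pt p) ∂(cyl d) := integral_mu hd hab hα _
  have m3 : tanhMoment d a b f = (area d * ∫ t, wt n t)⁻¹
      * ∫ p, wt n p.1 * Real.tanh p.1 * f (pt p) ∂(cyl d) := by
    rw [tanhMoment, integral_mu hd hab hα, smul_eq_mul]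
    congr 2
    funext p
    rw [tanhLog, ← hαdef, ← hpt, hlog, smul_eq_mul]; ring
  have m4 : ‖sechMoment d a b f‖ ^ 2 = (area d * ∫ t, wt n t)⁻¹ ^ 2
      * ∑ i, (∫ p, wt n p.1 * (Real.cosh p.1)⁻¹ * (f (pt p) * (p.2 : E d) i) ∂(cyl d)) ^ 2 := by
    rw [sechMoment, integral_mu hd hab hα, norm_smul, mul_pow, Real.norm_eq_abs, sq_abs]
    congr 1
    rw [EuclideanSpace.norm_sq_eq]
    refine Finset.sum_congr rfl fun i _ => ?_
    have e : ∀ p, wt n p.1 • (f (pt p) * sechLog d a b (pt p)) • (‖pt p‖⁻¹ • pt p)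
        = (wt n p.1 * (Real.cosh p.1)⁻¹ * f (pt p)) • (p.2 : E d) := fun p => by
      rw [hpt, normalize_polarPt, ← hpt, sechLog, ← hαdef, hlog, smul_smul]
      congr 1; ring
    simp only [← hndef, ← hαdef, ← hpt, e]
    have hi : Integrable (fun p : ℝ × Sph d =>
        (wt n p.1 * (Real.cosh p.1)⁻¹ * f (pt p)) • (p.2 : E d)) (cyl d) := by
      have h1 := hF.mul_left (K := fun p => wt n p.1 * (Real.cosh p.1)⁻¹)
        ((hcw.comp continuous_fst).mul (hch.comp continuous_fst))
      have : IsFiniteMeasureOnCompacts (cyl d) := by unfold cyl; infer_instance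
      have h1c := h1.cont
      exact (h1c.smul (by fun_prop)).integrable_of_hasCompactSupport
        (h1.hasCompactSupport.smul_right)
    have h := (EuclideanSpace.proj (𝕜 := ℝ) i : E d →L[ℝ] ℝ).integral_comp_comm hi
    change ∫ p : ℝ × Sph d, (wt n p.1 * (Real.cosh p.1)⁻¹ * f (pt p)) * (p.2 : E d) i ∂(cyl d) = _
      at h
    rw [EuclideanSpace.coe_proj] at h
    simp only at h
    rw [← h, Real.norm_eq_abs, sq_abs]
    congr 2
    funext p; ring
  have m5 : ∫ x, carre d a b (gradient f) x ∂(mu d a b) = (area d * ∫ t, wt n t)⁻¹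
      * ∫ p, wt (n - 2) p.1 * (α ^ 2 * (α⁻¹ * inner ℝ (gradient f (pt p)) (pt p)) ^ 2
        + (‖pt p‖ ^ 2 * ‖gradient f (pt p)‖ ^ 2 - inner ℝ (gradient f (pt p)) (pt p) ^ 2))
          ∂(cyl d) := by
    rw [integral_mu hd hab hα, smul_eq_mul]
    congr 2
    funext p
    -- The factor α² of the cylinder energy absorbs ∂_t = α⁻¹ r ∂_r, so radial and tangential parts
    -- add up to |x|² |∇f|².
    have e : α ^ 2 * (α⁻¹ * inner ℝ (gradient f (pt p)) (pt p)) ^ 2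
        = inner ℝ (gradient f (pt p)) (pt p) ^ 2 := by
      have := hα.ne'
      field_simp
    rw [e, smul_eq_mul, carre_polarPt hα, ← hαdef, ← hpt]
    ring
  simp only [deficit, residual', residual, var, tanhNorm, sechNorm, m1, m2, m3, m4, m5]
  simp only [← hndef, ← hαdef]
  generalize (∫ p, wt (n - 2) p.1 * (α ^ 2 * (α⁻¹ * inner ℝ (gradient f (pt p)) (pt p)) ^ 2
        + (‖pt p‖ ^ 2 * ‖gradient f (pt p)‖ ^ 2 - inner ℝ (gradient f (pt p)) (pt p) ^ 2))
          ∂(cyl d)) = T at *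
  generalize (∑ i, (∫ p, wt n p.1 * (Real.cosh p.1)⁻¹ * (f (pt p) * (p.2 : E d) i)
    ∂(cyl d)) ^ 2) = C at *
  generalize (∫ p, wt n p.1 * Real.tanh p.1 * f (pt p) ∂(cyl d)) = B at *
  generalize (∫ p, wt n p.1 * f (pt p) ∂(cyl d)) = A at *
  generalize (∫ p, wt n p.1 * f (pt p) ^ 2 ∂(cyl d)) = M at *
  generalize (∫ t, wt n t) = Z at *
  generalize (∫ t, wt n t * Real.tanh t ^ 2) = Y at *
  generalize (∫ t, wt (n + 2) t) = J at *
  generalize area d = S at *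
  have hSZ : 0 ≤ (S * Z)⁻¹ := by positivity
  obtain ⟨k1, k2⟩ := key
  have k1 := mul_le_mul_of_nonneg_left k1 hSZ
  have k2 := mul_le_mul_of_nonneg_left k2 hSZ
  generalize min (α ^ 2 * (n + 2)) ((d : ℝ) / 8) = c1 at *
  generalize min (α ^ 2 * (n + 2)) ((d : ℝ) - 1 - α ^ 2 * (n - 1)) = c2 at *
  clear m1 m2 m3 m4 m5 hF hFt hD hder hR
  have q1 : c1 * ((S * Z)⁻¹ * M - ((S * Z)⁻¹ * A) ^ 2 - ((S * Z)⁻¹ * B) ^ 2 / (Y / Z)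
      - (S * Z)⁻¹ ^ 2 * C / (J / (d * Z)))
      = (S * Z)⁻¹ * (c1 * (M - A ^ 2 / (S * Z) - B ^ 2 / (S * Y) - d / (S * J) * C)) := by
    field_simp
  have q2 : c2 * ((S * Z)⁻¹ * M - ((S * Z)⁻¹ * A) ^ 2 - ((S * Z)⁻¹ * B) ^ 2 / (Y / Z))
      = (S * Z)⁻¹ * (c2 * (M - A ^ 2 / (S * Z) - B ^ 2 / (S * Y))) := by
    field_simp
  have q3 : (S * Z)⁻¹ * T - n * α ^ 2 * ((S * Z)⁻¹ * M - ((S * Z)⁻¹ * A) ^ 2)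
      = (S * Z)⁻¹ * (T - n * α ^ 2 * (M - A ^ 2 / (S * Z))) := by
    field_simp
  rw [q3]
  exact ⟨q1.le.trans k1, q2.le.trans k2⟩

end Params

/-! ### Convergence in quadratic mean -/

section QuadraticMean

variable {X : Type*} [MeasurableSpace X] {ν : Measure X} {F : Type*} [NormedAddCommGroup F]

lemma _root_.MeasureTheory.MemLp.integrable_norm_sq {g : X → F} (hg : MemLp g 2 ν) :
    Integrable (fun x => ‖g x‖ ^ 2) ν := hg.integrable_norm_pow two_ne_zero

lemma abs_norm_sq_sub_le (u h : F) {ε : ℝ} (hε : 0 < ε) :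
    |‖u‖ ^ 2 - ‖h‖ ^ 2| ≤ (1 + 1 / ε) * ‖u - h‖ ^ 2 + ε * ‖h‖ ^ 2 := by
  have h1 := abs_norm_sub_norm_le u h
  have h2 : |‖u‖ ^ 2 - ‖h‖ ^ 2| = |‖u‖ - ‖h‖| * (‖u‖ + ‖h‖) := by
    rw [sq_sub_sq, abs_mul, abs_of_nonneg (by positivity : 0 ≤ ‖u‖ + ‖h‖), mul_comm]
  have h3 : ‖u‖ ≤ ‖u - h‖ + ‖h‖ := by
    have := norm_add_le (u - h) h
    rwa [sub_add_cancel] at this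
  have h4 : 2 * ‖u - h‖ * ‖h‖ ≤ 1 / ε * ‖u - h‖ ^ 2 + ε * ‖h‖ ^ 2 := by
    have : 1 / ε * ‖u - h‖ ^ 2 + ε * ‖h‖ ^ 2 - 2 * ‖u - h‖ * ‖h‖ = (‖u - h‖ - ε * ‖h‖) ^ 2 / ε := by
      field_simp; ring
    have h5 : 0 ≤ (‖u - h‖ - ε * ‖h‖) ^ 2 / ε := by positivity
    linarith
  rw [h2]
  calc |‖u‖ - ‖h‖| * (‖u‖ + ‖h‖) ≤ ‖u - h‖ * ((‖u - h‖ + ‖h‖) + ‖h‖) := by gcongr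
    _ ≤ _ := by nlinarith

/-- Young's inequality with a small ε separates the distance, which tends to 0, from ε times the
fixed norm of the limit. -/
theorem tendsto_integral_norm_sq {u : ℕ → X → F} {h : X → F} (hu : ∀ k, MemLp (u k) 2 ν)
    (hh : MemLp h 2 ν) (hlim : Tendsto (fun k => ∫ x, ‖u k x - h x‖ ^ 2 ∂ν) atTop (𝓝 0)) :
    Tendsto (fun k => ∫ x, ‖u k x‖ ^ 2 ∂ν) atTop (𝓝 (∫ x, ‖h x‖ ^ 2 ∂ν)) := by
  have hb : ∀ k, ∀ ε : ℝ, 0 < ε → |(∫ x, ‖u k x‖ ^ 2 ∂ν) - ∫ x, ‖h x‖ ^ 2 ∂ν|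
      ≤ (1 + 1 / ε) * (∫ x, ‖u k x - h x‖ ^ 2 ∂ν) + ε * ∫ x, ‖h x‖ ^ 2 ∂ν := fun k ε hε => by
    have i1 := (hu k).integrable_norm_sq
    have i2 := hh.integrable_norm_sq
    have i3 : Integrable (fun x => ‖u k x - h x‖ ^ 2) ν := ((hu k).sub hh).integrable_norm_sq
    rw [← integral_sub i1 i2, ← integral_const_mul, ← integral_const_mul,
      ← integral_add (i3.const_mul _) (i2.const_mul _)]
    refine abs_integral_le_integral_abs.trans (integral_mono (i1.sub i2).abs
      ((i3.const_mul _).add (i2.const_mul _)) fun x => abs_norm_sq_sub_le _ _ hε)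
  set H := ∫ x, ‖h x‖ ^ 2 ∂ν with hH
  have hH0 : 0 ≤ H := integral_nonneg fun x => by positivity
  rw [Metric.tendsto_atTop] at hlim ⊢
  intro δ hδ
  set ε := δ / (2 * (H + 1)) with hε
  have hε0 : 0 < ε := by positivity
  obtain ⟨N, hN⟩ := hlim (δ / (2 * (1 + 1 / ε))) (by positivity)
  refine ⟨N, fun k hk => ?_⟩
  have h1 := hN k hk
  rw [Real.dist_eq, sub_zero] at h1
  have h2 := (le_abs_self _).trans_lt h1
  rw [lt_div_iff₀ (by positivity)] at h2
  rw [Real.dist_eq]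
  have h3 : ε * H < δ / 2 := by
    rw [hε, div_mul_eq_mul_div, div_lt_div_iff₀ (by positivity) two_pos]
    nlinarith
  nlinarith [hb k ε hε0]

lemma sq_integral_norm_le [IsProbabilityMeasure ν] {g : X → F} (hg : MemLp g 2 ν) :
    (∫ x, ‖g x‖ ∂ν) ^ 2 ≤ ∫ x, ‖g x‖ ^ 2 ∂ν := by
  have i1 : Integrable (fun x => ‖g x‖) ν := (hg.integrable one_le_two).norm
  have i2 := hg.integrable_norm_sq
  set m := ∫ x, ‖g x‖ ∂ν with hm
  have h : 0 ≤ ∫ x, (‖g x‖ - m) ^ 2 ∂ν := integral_nonneg fun x => sq_nonneg _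
  have e : (fun x => (‖g x‖ - m) ^ 2) = fun x => ‖g x‖ ^ 2 - 2 * m * ‖g x‖ + m ^ 2 := by
    funext x; ring
  rw [e, integral_add (by exact i2.sub (i1.const_mul _)) (integrable_const _),
    integral_sub i2 (i1.const_mul _), integral_const_mul, integral_const] at h
  simp only [probReal_univ, smul_eq_mul, one_mul] at h
  rw [← hm] at h
  nlinarith

/-- On a probability space the L¹ norm is at most the L² norm, so pairing with a bounded function is
continuous. Vector values of `g` cover `sechMoment` along with the scalar moments. -/
theorem tendsto_integral_smul_of_norm_le_one [NormedSpace ℝ F] [IsProbabilityMeasure ν]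
    {u : ℕ → X → ℝ} {h : X → ℝ}
    (hu : ∀ k, MemLp (u k) 2 ν) (hh : MemLp h 2 ν)
    (hlim : Tendsto (fun k => ∫ x, (u k x - h x) ^ 2 ∂ν) atTop (𝓝 0)) {g : X → F}
    (hg : AEStronglyMeasurable g ν) (hg1 : ∀ x, ‖g x‖ ≤ 1) :
    Tendsto (fun k => ∫ x, u k x • g x ∂ν) atTop (𝓝 (∫ x, h x • g x ∂ν)) := by
  have hi : ∀ {w : X → ℝ}, MemLp w 2 ν → Integrable (fun x => w x • g x) ν := fun {w} hw =>
    (hw.integrable one_le_two).smul_bdd 1 hg (Eventually.of_forall hg1)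
  rw [tendsto_iff_norm_sub_tendsto_zero]
  have hb : ∀ k, ‖(∫ x, u k x • g x ∂ν) - ∫ x, h x • g x ∂ν‖
      ≤ Real.sqrt (∫ x, (u k x - h x) ^ 2 ∂ν) := fun k => by
    have hs : MemLp (fun x => u k x - h x) 2 ν := (hu k).sub hh
    refine Real.le_sqrt_of_sq_le ?_
    rw [← integral_sub (hi (hu k)) (hi hh)]
    simp only [← sub_smul]
    have h1 : ‖∫ x, (u k x - h x) • g x ∂ν‖ ≤ ∫ x, ‖u k x - h x‖ ∂ν :=
      norm_integral_le_of_norm_le (hs.integrable one_le_two).norm (Eventually.of_forall fun x => by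
        rw [norm_smul]; exact mul_le_of_le_one_right (norm_nonneg _) (hg1 x))
    have h2 := sq_integral_norm_le hs
    simp only [Real.norm_eq_abs, sq_abs] at h2 h1
    exact (pow_le_pow_left₀ (norm_nonneg _) h1 2).trans h2
  refine squeeze_zero (fun k => norm_nonneg _) hb ?_
  have := hlim.sqrt
  rwa [Real.sqrt_zero] at this

end QuadraticMean

/-! ### Mollification -/

section Mollification

set_option linter.unusedSectionVars false

open scoped Convolution

variable {d : ℕ} {F : Type*} [NormedAddCommGroup F] [NormedSpace ℝ F] [CompleteSpace F]

/-- The convolution with a normalized bump function. -/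
def mollify (φ : ContDiffBump (0 : E d)) (g : E d → F) : E d → F :=
  φ.normed volume ⋆[ContinuousLinearMap.lsmul ℝ ℝ, volume] g

variable (φ : ContDiffBump (0 : E d)) {g h : E d → F}

lemma mollify_eq (g : E d → F) (x : E d) : mollify φ g x = ∫ t, φ.normed volume t • g (x - t) := rfl

lemma mollify_eq_swap (g : E d → F) (x : E d) :
    mollify φ g x = ∫ t, φ.normed volume (x - t) • g t := convolution_lsmul_swap

lemma convolutionExists_mollify {L : ℝ →L[ℝ] F →L[ℝ] F} (hg : LocallyIntegrable g) :
    ConvolutionExists (φ.normed volume) g L volume :=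
  φ.hasCompactSupport_normed.convolutionExists_left _ φ.continuous_normed hg

lemma integrable_mollify_integrand (hg : LocallyIntegrable g) (x : E d) :
    Integrable fun t => φ.normed volume t • g (x - t) :=
  (convolutionExists_mollify φ (L := ContinuousLinearMap.lsmul ℝ ℝ) hg x)

lemma mollify_sub (hg : LocallyIntegrable g) (hh : LocallyIntegrable h) (x : E d) :
    mollify φ (fun x => g x - h x) x = mollify φ g x - mollify φ h x := by
  simp only [mollify_eq, smul_sub]
  exact integral_sub (integrable_mollify_integrand φ hg x) (integrable_mollify_integrand φ hh x)

/-- Jensen's inequality for the probability density `φ.normed`, proved as nonnegativity of a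
variance. -/
lemma norm_sq_mollify_le (hg : LocallyIntegrable g) (hg2 : Integrable fun x => ‖g x‖ ^ 2)
    (x : E d) : ‖mollify φ g x‖ ^ 2 ≤ mollify φ (fun x => ‖g x‖ ^ 2) x := by
  have hφ : ∀ t, 0 ≤ φ.normed volume t := φ.nonneg_normed
  have i1 : Integrable fun t => φ.normed volume t * ‖g (x - t)‖ := by
    refine (integrable_mollify_integrand φ hg x).norm.congr (Eventually.of_forall fun t => ?_)
    simp only [norm_smul, Real.norm_of_nonneg (hφ t)]
  have i2 : Integrable fun t => φ.normed volume t * ‖g (x - t)‖ ^ 2 :=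
    integrable_mollify_integrand φ hg2.locallyIntegrable x
  have i3 : Integrable (φ.normed (volume : Measure (E d))) := φ.integrable_normed
  set m := ∫ t, φ.normed volume t * ‖g (x - t)‖ with hm
  have h1 : ‖mollify φ g x‖ ≤ m := by
    rw [mollify_eq]
    refine (norm_integral_le_integral_norm _).trans (le_of_eq ?_)
    simp only [norm_smul, Real.norm_of_nonneg (hφ _), hm]
  have h2 : 0 ≤ ∫ t, φ.normed volume t * (‖g (x - t)‖ - m) ^ 2 :=
    integral_nonneg fun t => mul_nonneg (hφ t) (sq_nonneg _)
  have e : (fun t => φ.normed volume t * (‖g (x - t)‖ - m) ^ 2) = fun t =>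
      φ.normed volume t * ‖g (x - t)‖ ^ 2 - 2 * m * (φ.normed volume t * ‖g (x - t)‖)
        + m ^ 2 * φ.normed volume t := by funext t; ring
  rw [e, integral_add (by exact i2.sub (i1.const_mul _)) (i3.const_mul _),
    integral_sub i2 (i1.const_mul _), integral_const_mul, integral_const_mul, φ.integral_normed,
    ← hm] at h2
  have h3 := pow_le_pow_left₀ (norm_nonneg _) h1 2
  change _ ≤ ∫ t, φ.normed volume t * ‖g (x - t)‖ ^ 2
  nlinarith

lemma integrable_mollify (hg : Integrable g) : Integrable (mollify φ g) :=
  φ.integrable_normed.integrable_convolution _ hg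

lemma integral_mollify (hg : Integrable g) : ∫ x, mollify φ g x = ∫ x, g x := by
  have := integral_convolution (ContinuousLinearMap.lsmul ℝ ℝ)
    (φ.integrable_normed (μ := (volume : Measure (E d)))) hg
  rw [mollify, this, φ.integral_normed]
  simp

lemma contDiff_mollify (hg : LocallyIntegrable g) : ContDiff ℝ ∞ (mollify φ g) :=
  φ.hasCompactSupport_normed.contDiff_convolution_left _ φ.contDiff_normed hg

lemma _root_.MeasureTheory.MemLp.locallyIntegrable_two (hg : MemLp g 2 volume) :
    LocallyIntegrable g := hg.locallyIntegrable one_le_two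

lemma integrable_norm_sq_mollify (hg : MemLp g 2 volume) :
    Integrable fun x => ‖mollify φ g x‖ ^ 2 := by
  refine (integrable_mollify φ hg.integrable_norm_sq).mono'
    ((contDiff_mollify φ hg.locallyIntegrable_two).continuous.norm.pow 2).aestronglyMeasurable
    (Eventually.of_forall fun x => ?_)
  rw [Real.norm_of_nonneg (by positivity)]
  exact norm_sq_mollify_le φ hg.locallyIntegrable_two hg.integrable_norm_sq x

lemma memLp_mollify (hg : MemLp g 2 volume) : MemLp (mollify φ g) 2 volume := by
  rw [memLp_two_iff_integrable_sq_norm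
    (contDiff_mollify φ hg.locallyIntegrable_two).continuous.aestronglyMeasurable]
  exact integrable_norm_sq_mollify φ hg

lemma integral_norm_sq_mollify_le (hg : MemLp g 2 volume) :
    ∫ x, ‖mollify φ g x‖ ^ 2 ≤ ∫ x, ‖g x‖ ^ 2 := by
  rw [← integral_mollify φ hg.integrable_norm_sq]
  exact integral_mono (integrable_norm_sq_mollify φ hg) (integrable_mollify φ hg.integrable_norm_sq)
    fun x => norm_sq_mollify_le φ hg.locallyIntegrable_two hg.integrable_norm_sq x

lemma mollify_eq_zero {x : E d} (hx : ∀ z, dist z x < φ.rOut → g z = 0) : mollify φ g x = 0 := by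
  rw [mollify_eq_swap]
  refine integral_eq_zero_of_ae (Eventually.of_forall fun t => ?_)
  by_cases ht : dist t x < φ.rOut
  · simp [hx t ht]
  · have : x - t ∉ Function.support (φ.normed volume) := by
      rw [φ.support_normed_eq, mem_ball_zero_iff, ← dist_eq_norm, dist_comm]; exact ht
    simp [Function.notMem_support.1 this]

end Mollification

section Mollification

set_option linter.unusedSectionVars false

open scoped Convolution

variable {d : ℕ} {F : Type*} [NormedAddCommGroup F] [NormedSpace ℝ F] [CompleteSpace F]

/-- Pointwise convergence with a uniform bound, all supports lying in the closed 1-neighbourhood of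
the support of `h`. -/
lemma tendsto_mollify_of_continuous {φ : ℕ → ContDiffBump (0 : E d)}
    (hφ : Tendsto (fun k => (φ k).rOut) atTop (𝓝 0)) (hφ1 : ∀ k, (φ k).rOut ≤ 1) {h : E d → F}
    (hc : Continuous h) (hs : HasCompactSupport h) :
    Tendsto (fun k => ∫ x, ‖mollify (φ k) h x - h x‖ ^ 2) atTop (𝓝 0) := by
  obtain ⟨B, hB⟩ := hc.bounded_above_of_compact_support hs
  have hB0 : 0 ≤ B := (norm_nonneg _).trans (hB 0)
  set K := Metric.cthickening 1 (tsupport h) with hK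
  have hKc : IsCompact K := hs.isCompact.cthickening
  have hli : LocallyIntegrable h := hc.locallyIntegrable
  have hmc : ∀ k, Continuous (mollify (φ k) h) := fun k => (contDiff_mollify (φ k) hli).continuous
  have hmB : ∀ k x, ‖mollify (φ k) h x‖ ≤ B := fun k x => by
    have h1 : ∫ t, B * (φ k).normed volume t = B := by
      rw [integral_const_mul, (φ k).integral_normed, mul_one]
    rw [mollify_eq, ← h1]
    refine norm_integral_le_of_norm_le ((φ k).integrable_normed.const_mul B)
      (Eventually.of_forall fun t => ?_)
    rw [norm_smul, Real.norm_of_nonneg ((φ k).nonneg_normed t), mul_comm]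
    exact mul_le_mul_of_nonneg_right (hB _) ((φ k).nonneg_normed t)
  have hzero : ∀ k, ∀ x ∉ K, ‖mollify (φ k) h x - h x‖ ^ 2 = 0 := fun k x hx => by
    have h1 : ∀ z, dist z x < (φ k).rOut → h z = 0 := fun z hz => by
      by_contra hne
      refine hx (Metric.mem_cthickening_of_dist_le x z 1 _
        (subset_tsupport h (Function.mem_support.2 hne)) ?_)
      rw [dist_comm]
      exact hz.le.trans (hφ1 k)
    rw [mollify_eq_zero (φ k) h1, h1 x (by simpa using (φ k).rOut_pos)]
    simp
  have hlim : ∀ x, Tendsto (fun k => mollify (φ k) h x) atTop (𝓝 (h x)) := fun x =>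
    ContDiffBump.convolution_tendsto_right_of_continuous hφ hc x
  have : Tendsto (fun k => ∫ x, ‖mollify (φ k) h x - h x‖ ^ 2) atTop (𝓝 (∫ x : E d, (0 : ℝ))) := by
    refine tendsto_integral_of_dominated_convergence (K.indicator fun _ => (2 * B) ^ 2)
      (fun k => (((hmc k).sub hc).norm.pow 2).aestronglyMeasurable)
      ((integrable_indicator_iff hKc.isClosed.measurableSet).2
        (integrableOn_const hKc.measure_lt_top.ne)) (fun k => Eventually.of_forall fun x => ?_)
      (Eventually.of_forall fun x => ?_)
    · by_cases hx : x ∈ K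
      · rw [Set.indicator_of_mem hx, norm_pow, norm_norm]
        refine pow_le_pow_left₀ (norm_nonneg _) ((norm_sub_le _ _).trans ?_) 2
        linarith [hmB k x, hB x]
      · rw [Set.indicator_of_notMem hx, hzero k x hx, norm_zero]
    · have := ((hlim x).sub_const (h x)).norm.pow 2
      simpa using this
  simpa using this

lemma norm_add_add_sq_le (x y z : F) : ‖x + y + z‖ ^ 2 ≤ 3 * (‖x‖ ^ 2 + ‖y‖ ^ 2 + ‖z‖ ^ 2) := by
  have h := pow_le_pow_left₀ (norm_nonneg _) (norm_add₃_le (a := x) (b := y) (c := z)) 2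
  nlinarith [sq_nonneg (‖x‖ - ‖y‖), sq_nonneg (‖x‖ - ‖z‖), sq_nonneg (‖y‖ - ‖z‖)]

/-- The mollification of a square integrable function converges in quadratic mean. -/
theorem tendsto_mollify {φ : ℕ → ContDiffBump (0 : E d)}
    (hφ : Tendsto (fun k => (φ k).rOut) atTop (𝓝 0)) (hφ1 : ∀ k, (φ k).rOut ≤ 1) {g : E d → F}
    (hg : MemLp g 2 volume) :
    Tendsto (fun k => ∫ x, ‖mollify (φ k) g x - g x‖ ^ 2) atTop (𝓝 0) := by
  rw [Metric.tendsto_atTop]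
  intro δ hδ
  -- The error splits into three squares with a common factor 3, so δ/9 for each leaves at most δ/3.
  obtain ⟨h, hs, hgh, hc, hh⟩ := MemLp.exists_hasCompactSupport_integral_rpow_sub_le
    (p := 2) two_pos (by simpa using hg) (ε := δ / 9) (by positivity)
  simp only [ENNReal.ofReal_ofNat, Real.rpow_ofNat] at hgh hh
  obtain ⟨N, hN⟩ := (Metric.tendsto_atTop.1 (tendsto_mollify_of_continuous hφ hφ1 hc hs)) (δ / 9)
    (by positivity)
  refine ⟨N, fun k hk => ?_⟩
  have h1 := hN k hk
  rw [Real.dist_eq, sub_zero, abs_of_nonneg (integral_nonneg fun x => by positivity)] at h1 ⊢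
  have hgh' : MemLp (fun x => g x - h x) 2 volume := hg.sub hh
  have hi1 := integrable_norm_sq_mollify (φ k) hgh'
  have hi2 : Integrable fun x => ‖mollify (φ k) h x - h x‖ ^ 2 :=
    ((memLp_mollify (φ k) hh).sub hh).integrable_norm_sq
  have hi3 : Integrable fun x => ‖g x - h x‖ ^ 2 := hgh'.integrable_norm_sq
  have hi4 : Integrable fun x => ‖mollify (φ k) g x - g x‖ ^ 2 :=
    ((memLp_mollify (φ k) hg).sub hg).integrable_norm_sq
  have key : ∫ x, ‖mollify (φ k) g x - g x‖ ^ 2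
      ≤ 3 * ((∫ x, ‖mollify (φ k) (fun x => g x - h x) x‖ ^ 2)
        + (∫ x, ‖mollify (φ k) h x - h x‖ ^ 2) + ∫ x, ‖g x - h x‖ ^ 2) := by
    rw [← integral_add hi1 hi2, ← integral_add (by exact hi1.add hi2) hi3, ← integral_const_mul]
    refine integral_mono hi4 (((hi1.add hi2).add hi3).const_mul 3) fun x => ?_
    have e : mollify (φ k) g x - g x = mollify (φ k) (fun x => g x - h x) x
        + (mollify (φ k) h x - h x) + -(g x - h x) := by
      rw [mollify_sub (φ k) hg.locallyIntegrable_two hh.locallyIntegrable_two]; abel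
    simp only
    rw [e]
    refine (norm_add_add_sq_le _ _ _).trans (le_of_eq ?_)
    rw [norm_neg]
  have := integral_norm_sq_mollify_le (φ k) hgh'
  linarith

/-- The gradient of the mollification is the mollification of the weak gradient. -/
theorem gradient_mollify (φ : ContDiffBump (0 : E d)) {f : E d → ℝ} {G : E d → E d}
    (hf : LocallyIntegrable f) (hG : LocallyIntegrable G)
    (hfG : ∀ ψ : E d → ℝ, ContDiff ℝ ∞ ψ → HasCompactSupport ψ →
      ∀ v : E d, ∫ x, f x * fderiv ℝ ψ x v = -∫ x, inner ℝ (G x) v * ψ x) (x : E d) :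
    gradient (mollify φ f) x = mollify φ G x := by
  set Φ := φ.normed (volume : Measure (E d)) with hΦ
  have hΦc : ContDiff ℝ ∞ Φ := φ.contDiff_normed
  have hΦs : HasCompactSupport Φ := φ.hasCompactSupport_normed
  have hd := hΦs.hasFDerivAt_convolution_left (ContinuousLinearMap.lsmul ℝ ℝ) (μ := volume)
    (hΦc.of_le (by norm_cast)) hf x
  refine ext_inner_right ℝ fun v => ?_
  rw [inner_gradient_left]
  change fderiv ℝ (Φ ⋆[ContinuousLinearMap.lsmul ℝ ℝ, volume] f) x v = _
  rw [hd.fderiv, convolution_eq_swap]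
  have hex : Integrable fun t => ((ContinuousLinearMap.lsmul ℝ ℝ).precompL (E d) (fderiv ℝ Φ (x - t)))
      (f t) := by
    have h1 : ConvolutionExists (fderiv ℝ Φ) f ((ContinuousLinearMap.lsmul ℝ ℝ).precompL (E d))
      volume := (hΦs.fderiv ℝ).convolutionExists_left _ (hΦc.continuous_fderiv (by simp)) hf
    exact (h1 x).integrable_swap
  rw [ContinuousLinearMap.integral_apply hex]
  set ψ : E d → ℝ := fun t => Φ (x - t) with hψ
  have hψc : ContDiff ℝ ∞ ψ := hΦc.comp (contDiff_const.sub contDiff_id)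
  have hψs : HasCompactSupport ψ := hΦs.comp_homeomorph (Homeomorph.subLeft x)
  have hψd : ∀ t, fderiv ℝ ψ t v = -fderiv ℝ Φ (x - t) v := fun t => by
    have h1 : HasFDerivAt (fun t : E d => x - t) (-ContinuousLinearMap.id ℝ (E d)) t :=
      (hasFDerivAt_id t).const_sub x
    have h2 := ((hΦc.differentiable (by simp)) (x - t)).hasFDerivAt.comp t h1
    rw [show ψ = Φ ∘ fun t => x - t from rfl, h2.fderiv]
    simp
  have h := hfG ψ hψc hψs v
  simp only [hψd, mul_neg, integral_neg, neg_inj] at h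
  have e1 : ∫ t, ((ContinuousLinearMap.lsmul ℝ ℝ).precompL (E d) (fderiv ℝ Φ (x - t))) (f t) v
      = ∫ t, f t * fderiv ℝ Φ (x - t) v := by
    congr 1; funext t
    simp [ContinuousLinearMap.precompL_apply, mul_comm]
  rw [e1, h, mollify_eq_swap]
  have hi : Integrable fun t => Φ (x - t) • G t := by
    have := convolutionExists_mollify φ (L := ContinuousLinearMap.lsmul ℝ ℝ) hG
    exact (this x).integrable_swap
  rw [real_inner_comm, ← integral_inner hi]
  congr 1; funext t
  rw [real_inner_smul_right, real_inner_comm, mul_comm]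

end Mollification

/-! ### Comparison of measures on annuli -/

section Annulus

variable {d : ℕ} {a b : ℝ}

/-- The weight of the carré du champ. -/
def carreWt (d : ℕ) (a b : ℝ) (x : E d) : ℝ :=
  ‖x‖ ^ (2 * (1 - alpha d a b)) * ((1 + ‖x‖ ^ (2 * alpha d a b)) ^ 2 / 4)

lemma carre_eq (G : E d → E d) (x : E d) : carre d a b G x = carreWt d a b x * ‖G x‖ ^ 2 := rfl

lemma carreWt_nonneg (x : E d) : 0 ≤ carreWt d a b x := by unfold carreWt; positivity

lemma carreWt_pos {x : E d} (hx : x ≠ 0) : 0 < carreWt d a b x := by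
  have := norm_pos_iff.2 hx
  unfold carreWt; positivity

lemma carre_nonneg (G : E d → E d) (x : E d) : 0 ≤ carre d a b G x :=
  mul_nonneg (carreWt_nonneg x) (sq_nonneg _)

lemma continuousOn_norm_rpow (s : ℝ) : ContinuousOn (fun x : E d => ‖x‖ ^ s) {0}ᶜ :=
  continuous_norm.continuousOn.rpow_const fun _ hx => Or.inl (norm_ne_zero_iff.2 hx)

lemma continuousOn_carreWt : ContinuousOn (carreWt d a b) {0}ᶜ :=
  (continuousOn_norm_rpow _).mul
    (((continuousOn_const.add (continuousOn_norm_rpow _)).pow 2).div_const 4)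

lemma measurable_carreWt : Measurable (carreWt d a b) := by
  unfold carreWt; fun_prop

lemma continuousOn_density : ContinuousOn (density d a b) {0}ᶜ := by
  refine continuousOn_const.mul ((continuousOn_norm_rpow _).div
    ((continuousOn_const.add (continuousOn_norm_rpow _)).rpow_const fun x _ => Or.inl ?_)
    fun x _ => ?_)
  · change 1 + ‖x‖ ^ (2 * alpha d a b) ≠ 0
    positivity
  · change (1 + ‖x‖ ^ (2 * alpha d a b)) ^ nDim d a b ≠ 0
    positivity

lemma exists_bounds_annulus {ρ : E d → ℝ} (hc : ContinuousOn ρ {0}ᶜ) (hp : ∀ x ≠ 0, 0 < ρ x)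
    (R : ℝ) : ∃ C : ℝ, 0 < C ∧ ∀ x ∈ annulus (E d) R, ρ x ≤ C ∧ 1 ≤ C * ρ x := by
  have hA : IsCompact (annulus (E d) R) := isCompact_annulus R
  obtain ⟨C1, h1⟩ := hA.exists_bound_of_continuousOn (hc.mono (annulus_subset R))
  obtain ⟨C2, h2⟩ := hA.exists_bound_of_continuousOn
    (f := fun x => (ρ x)⁻¹) ((hc.mono (annulus_subset R)).inv₀ fun x hx =>
      (hp x (annulus_subset R hx)).ne')
  refine ⟨max 1 (max C1 C2), by positivity, fun x hx => ?_⟩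
  have hpx := hp x (annulus_subset R hx)
  have g1 := h1 x hx
  have g2 := h2 x hx
  rw [Real.norm_of_nonneg hpx.le] at g1
  rw [Real.norm_of_nonneg (inv_pos.2 hpx).le] at g2
  refine ⟨g1.trans ((le_max_left _ _).trans (le_max_right _ _)), ?_⟩
  rw [← inv_mul_cancel₀ hpx.ne']
  exact mul_le_mul_of_nonneg_right (g2.trans ((le_max_right _ _).trans (le_max_right _ _))) hpx.le

/-- On an annulus the density is bounded above and below by positive constants, so weighted and
Lebesgue norms are comparable there; mollification can then be done in Lebesgue spaces. -/
lemma exists_measure_le (hd : 3 ≤ d) (hab : (a, b) ∈ Theta d) (hα : 0 < alpha d a b) (R : ℝ) :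
    ∃ C : ENNReal, C ≠ ⊤ ∧ (volume : Measure (E d)).restrict (annulus (E d) R) ≤ C • mu d a b ∧
      (mu d a b).restrict (annulus (E d) R) ≤ C • volume := by
  obtain ⟨K, hK0, hK⟩ := exists_bounds_annulus (continuousOn_density (a := a) (b := b))
    (fun x hx => density_pos hx) R
  have hm : MeasurableSet (annulus (E d) R) := (isClosed_annulus R).measurableSet
  set c := muBar d a b Set.univ with hc
  have hct : c ≠ ⊤ := (muBar_univ hd hab hα).1
  have hc0 : c ≠ 0 := muBar_univ_ne_zero hd hab hα
  have hρ := (measurable_density (d := d) (a := a) (b := b)).ennreal_ofReal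
  have h1 : (volume : Measure (E d)).restrict (annulus (E d) R)
      ≤ ENNReal.ofReal K • muBar d a b := by
    rw [← withDensity_indicator_one hm, muBar, ← withDensity_smul _ hρ]
    refine withDensity_mono (Eventually.of_forall fun x => ?_)
    by_cases hx : x ∈ annulus (E d) R
    · rw [Set.indicator_of_mem hx, Pi.one_apply, Pi.smul_apply, smul_eq_mul,
        ← ENNReal.ofReal_mul hK0.le, ENNReal.one_le_ofReal]
      exact (hK x hx).2
    · rw [Set.indicator_of_notMem hx]; exact zero_le
  have h2 : (muBar d a b).restrict (annulus (E d) R) ≤ ENNReal.ofReal K • volume := by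
    rw [muBar, restrict_withDensity hm, ← withDensity_const, ← withDensity_indicator hm]
    refine withDensity_mono (Eventually.of_forall fun x => ?_)
    by_cases hx : x ∈ annulus (E d) R
    · rw [Set.indicator_of_mem hx]
      exact ENNReal.ofReal_le_ofReal (hK x hx).1
    · rw [Set.indicator_of_notMem hx]; exact zero_le
  refine ⟨max (ENNReal.ofReal K * c) (c⁻¹ * ENNReal.ofReal K), ?_, ?_, ?_⟩
  · exact (max_lt (ENNReal.mul_lt_top ENNReal.ofReal_lt_top hct.lt_top)
      (ENNReal.mul_lt_top (ENNReal.inv_lt_top.2 (pos_iff_ne_zero.2 hc0)) ENNReal.ofReal_lt_top)).ne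
  · refine h1.trans ?_
    have e : ENNReal.ofReal K • muBar d a b = (ENNReal.ofReal K * c) • mu d a b := by
      rw [mu, smul_smul, mul_assoc, ENNReal.mul_inv_cancel hc0 hct, mul_one]
    rw [e]
    exact fun s => by
      simp only [Measure.smul_apply, smul_eq_mul]; gcongr; exact le_max_left _ _
  · rw [mu, Measure.restrict_smul]
    intro s
    have := h2 s
    simp only [Measure.smul_apply, smul_eq_mul] at this ⊢
    calc c⁻¹ * _ ≤ c⁻¹ * (ENNReal.ofReal K * volume s) := by gcongr
      _ = (c⁻¹ * ENNReal.ofReal K) * volume s := by rw [mul_assoc]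
      _ ≤ _ := by gcongr; exact le_max_right _ _

variable {F : Type*} [NormedAddCommGroup F]

lemma memLp_volume_of_annulus (hd : 3 ≤ d) (hab : (a, b) ∈ Theta d) (hα : 0 < alpha d a b) {R : ℝ}
    {h : E d → F} (h0 : ∀ x ∉ annulus (E d) R, h x = 0) (hh : MemLp h 2 (mu d a b)) :
    MemLp h 2 volume := by
  obtain ⟨C, hC, hle, -⟩ := exists_measure_le hd hab hα R
  have h1 := (hh.smul_measure hC).mono_measure hle
  rw [← memLp_indicator_iff_restrict (isClosed_annulus R).measurableSet] at h1
  rwa [Set.indicator_eq_self.2 fun x hx => by by_contra hn; exact hx (h0 x hn)] at h1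

lemma memLp_mu_of_annulus (hd : 3 ≤ d) (hab : (a, b) ∈ Theta d) (hα : 0 < alpha d a b) {R : ℝ}
    {h : E d → F} (h0 : ∀ x ∉ annulus (E d) R, h x = 0) (hh : MemLp h 2 volume) :
    MemLp h 2 (mu d a b) := by
  obtain ⟨C, hC, -, hle⟩ := exists_measure_le hd hab hα R
  have h1 := (hh.smul_measure hC).mono_measure hle
  rw [← memLp_indicator_iff_restrict (isClosed_annulus R).measurableSet] at h1
  rwa [Set.indicator_eq_self.2 fun x hx => by by_contra hn; exact hx (h0 x hn)] at h1

lemma exists_integral_mu_le (hd : 3 ≤ d) (hab : (a, b) ∈ Theta d) (hα : 0 < alpha d a b) (R : ℝ) :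
    ∃ C : ℝ, ∀ h : E d → ℝ, (∀ x ∉ annulus (E d) R, h x = 0) → (∀ x, 0 ≤ h x) → Integrable h →
      Integrable h (mu d a b) ∧ ∫ x, h x ∂(mu d a b) ≤ C * ∫ x, h x := by
  obtain ⟨C, hC, -, hle⟩ := exists_measure_le hd hab hα R
  refine ⟨C.toReal, fun h h0 hnn hi => ?_⟩
  have hm : MeasurableSet (annulus (E d) R) := (isClosed_annulus R).measurableSet
  have h1 := (hi.smul_measure hC)
  have h2 := h1.mono_measure hle
  rw [← IntegrableOn, ← integrable_indicator_iff hm,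
    Set.indicator_eq_self.2 fun x hx => by by_contra hn; exact hx (h0 x hn)] at h2
  refine ⟨h2, ?_⟩
  rw [← setIntegral_eq_integral_of_forall_compl_eq_zero (s := annulus (E d) R) h0,
    ← smul_eq_mul, ← integral_smul_measure]
  exact integral_mono_measure hle (Eventually.of_forall hnn) h1

lemma exists_integral_carre_le (hd : 3 ≤ d) (hab : (a, b) ∈ Theta d) (hα : 0 < alpha d a b)
    (R : ℝ) :
    ∃ C : ℝ, ∀ G : E d → E d, (∀ x ∉ annulus (E d) R, G x = 0) → MemLp G 2 volume →
      Integrable (carre d a b G) (mu d a b) ∧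
      ∫ x, carre d a b G x ∂(mu d a b) ≤ C * ∫ x, ‖G x‖ ^ 2 := by
  obtain ⟨C, hC⟩ := exists_integral_mu_le hd hab hα R
  obtain ⟨K, hK0, hK⟩ := exists_bounds_annulus (continuousOn_carreWt (a := a) (b := b))
    (fun x hx => carreWt_pos hx) R
  refine ⟨K * C, fun G h0 hG => ?_⟩
  have h1 := hC (fun x => ‖G x‖ ^ 2) (fun x hx => by simp [h0 x hx]) (fun x => by positivity)
    hG.integrable_norm_sq
  have hb : ∀ x, carre d a b G x ≤ K * ‖G x‖ ^ 2 := fun x => by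
    by_cases hx : x ∈ annulus (E d) R
    · rw [carre_eq]; exact mul_le_mul_of_nonneg_right (hK x hx).1 (by positivity)
    · rw [carre_eq, h0 x hx]; simp
  have hi : Integrable (carre d a b G) (mu d a b) := by
    refine (h1.1.const_mul K).mono' ?_ (Eventually.of_forall fun x => ?_)
    · exact (measurable_carreWt.aestronglyMeasurable).mul
        ((hG.1.mono_ac mu_absolutelyContinuous).norm.pow 2)
    · rw [Real.norm_of_nonneg (carre_nonneg G x)]; exact hb x
  refine ⟨hi, ?_⟩
  calc _ ≤ ∫ x, K * ‖G x‖ ^ 2 ∂(mu d a b) := integral_mono hi (h1.1.const_mul K) hb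
    _ = K * ∫ x, ‖G x‖ ^ 2 ∂(mu d a b) := integral_const_mul _ _
    _ ≤ _ := by rw [mul_assoc]; exact mul_le_mul_of_nonneg_left h1.2 hK0.le

lemma memLp_volume_of_carre (hd : 3 ≤ d) (hab : (a, b) ∈ Theta d) (hα : 0 < alpha d a b) {R : ℝ}
    {G : E d → E d} (h0 : ∀ x ∉ annulus (E d) R, G x = 0)
    (hm : AEStronglyMeasurable G volume) (hi : Integrable (carre d a b G) (mu d a b)) :
    MemLp G 2 volume := by
  obtain ⟨K, hK0, hK⟩ := exists_bounds_annulus (continuousOn_carreWt (a := a) (b := b))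
    (fun x hx => carreWt_pos hx) R
  refine memLp_volume_of_annulus hd hab hα h0 ?_
  have hm' := hm.mono_ac (mu_absolutelyContinuous (d := d) (a := a) (b := b))
  rw [memLp_two_iff_integrable_sq_norm hm']
  refine (hi.const_mul K).mono' (hm'.norm.pow 2) (Eventually.of_forall fun x => ?_)
  rw [norm_pow, norm_norm]
  by_cases hx : x ∈ annulus (E d) R
  · rw [carre_eq, ← mul_assoc]
    exact le_mul_of_one_le_left (by positivity) (hK x hx).2
  · rw [h0 x hx, norm_zero]
    have := carre_nonneg (a := a) (b := b) G x
    simp; positivity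

end Annulus

/-! ### Localization of weak gradients -/

section Localization

variable {d : ℕ} {a b : ℝ}

lemma fderiv_cut_eq_zero {j : ℕ} {x : E d} (hx : x ∈ annulus (E d) (j + 1)) :
    fderiv ℝ (cut j) x = 0 := by
  refine IsLocalMax.fderiv_eq_zero (Eventually.of_forall fun z => ?_)
  rw [cut_eq_one hx]
  exact cut_le_one j z

lemma tsupport_cut_subset_compl (j : ℕ) : tsupport (cut (V := E d) j) ⊆ {0}ᶜ :=
  (tsupport_cut_subset j).trans (annulus_subset _)

lemma gradient_cut_eq_zero_of_notMem {j : ℕ} {x : E d}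
    (hx : x ∉ annulus (E d) (2 * (j + 1))) : gradient (cut j) x = 0 := by
  rw [gradient, fderiv_of_notMem_tsupport ℝ fun h => hx (tsupport_cut_subset j h), map_zero]

variable {F : Type*} [NormedAddCommGroup F] [NormedSpace ℝ F]

lemma integrable_smul_of_tsupport {f : E d → F} (hf : LocallyIntegrableOn f {0}ᶜ) {φ : E d → ℝ}
    (hφ : Continuous φ) (hs : HasCompactSupport φ) (h0 : tsupport φ ⊆ {0}ᶜ) :
    Integrable fun x => φ x • f x := by
  have h1 := (hf.integrableOn_compact_subset h0 hs.isCompact).continuousOn_smul hφ.continuousOn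
    hs.isCompact
  rwa [integrableOn_iff_integrable_of_support_subset] at h1
  intro x hx
  refine subset_tsupport φ fun h => hx ?_
  simp [h]

lemma integrable_smul_of_tsupport' {f : E d → ℝ} (hf : LocallyIntegrableOn f {0}ᶜ) {Φ : E d → F}
    (hΦ : Continuous Φ) (hs : HasCompactSupport Φ) (h0 : tsupport Φ ⊆ {0}ᶜ) :
    Integrable fun x => f x • Φ x := by
  have h1 := (hf.integrableOn_compact_subset h0 hs.isCompact).smul_continuousOn hΦ.continuousOn
    hs.isCompact
  rwa [integrableOn_iff_integrable_of_support_subset] at h1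
  intro x hx
  refine subset_tsupport Φ fun h => hx ?_
  simp [h]

lemma tsupport_gradient_subset (f : E d → ℝ) : tsupport (gradient f) ⊆ tsupport f := by
  refine closure_minimal (fun x hx => ?_) (isClosed_tsupport f)
  by_contra h
  refine hx ?_
  rw [gradient, fderiv_of_notMem_tsupport ℝ h, map_zero]

lemma hasCompactSupport_gradient {f : E d → ℝ} (hf : HasCompactSupport f) :
    HasCompactSupport (gradient f) :=
  hf.mono' fun _ hx => tsupport_gradient_subset f (subset_tsupport _ hx)

/-- The product rule for a weak gradient and a cutoff function. -/
theorem IsWeakGradient.cut_mul {f : E d → ℝ} {G : E d → E d} (h : IsWeakGradient f G) (j : ℕ) :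
    IsWeakGradient (fun x => cut j x * f x) fun x => cut j x • G x + f x • gradient (cut j) x := by
  have hc : ContDiff ℝ ∞ (cut (V := E d) j) := contDiff_cut j
  have hs := hasCompactSupport_cut (V := E d) j
  have h0 := tsupport_cut_subset_compl (d := d) j
  have hgc : Continuous (gradient (cut (V := E d) j)) :=
    continuous_gradient (hc.of_le (by norm_cast))
  have i1 : Integrable fun x => cut j x * f x := integrable_smul_of_tsupport h.locInt hc.continuous hs h0
  have i2 : Integrable fun x => cut j x • G x :=
    integrable_smul_of_tsupport h.locInt_grad hc.continuous hs h0
  have i3 : Integrable fun x => f x • gradient (cut j) x :=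
    integrable_smul_of_tsupport' h.locInt hgc (hasCompactSupport_gradient hs)
      ((tsupport_gradient_subset _).trans h0)
  refine ⟨i1.locallyIntegrable.locallyIntegrableOn _,
    (i2.add i3).locallyIntegrable.locallyIntegrableOn _, fun ψ hψ hψs hψ0 v => ?_⟩
  -- The weak gradient of f is tested against `cut j * ψ`, and the classical product rule is
  -- rearranged.
  have hp : ContDiff ℝ ∞ fun x => cut j x * ψ x := hc.mul hψ
  have hps : HasCompactSupport fun x => cut j x * ψ x := hs.mul_right
  have hp0 : tsupport (fun x => cut j x * ψ x) ⊆ {0}ᶜ := (tsupport_mul_subset_left).trans h0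
  have hd : ∀ x, fderiv ℝ (fun x => cut j x * ψ x) x v
      = cut j x * fderiv ℝ ψ x v + ψ x * fderiv ℝ (cut j) x v := fun x => by
    rw [fderiv_fun_mul (hc.differentiable (by simp) x) (hψ.differentiable (by simp) x)]
    simp
  have key := h.by_parts _ hp hps hp0 v
  simp only [hd] at key
  have hψd : Continuous fun x => fderiv ℝ ψ x v :=
    (hψ.continuous_fderiv (by simp)).clm_apply continuous_const
  have hψds : HasCompactSupport fun x => fderiv ℝ ψ x v := hψs.fderiv_apply ℝ v
  have hcd : Continuous fun x => fderiv ℝ (cut j) x v :=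
    (hc.continuous_fderiv (by simp)).clm_apply continuous_const
  have k1 : Integrable fun x => f x * (cut j x * fderiv ℝ ψ x v) := by
    have := integrable_smul_of_tsupport h.locInt (φ := fun x => cut j x * fderiv ℝ ψ x v)
      (hc.continuous.mul hψd) hs.mul_right ((tsupport_mul_subset_left).trans h0)
    simpa only [smul_eq_mul, mul_comm] using this
  have k2 : Integrable fun x => f x * (ψ x * fderiv ℝ (cut j) x v) := by
    have := integrable_smul_of_tsupport h.locInt (φ := fun x => ψ x * fderiv ℝ (cut j) x v)
      (hψ.continuous.mul hcd) hψs.mul_right ((tsupport_mul_subset_left).trans hψ0)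
    simpa only [smul_eq_mul, mul_comm] using this
  have k3 : Integrable fun x => inner ℝ (G x) v * (cut j x * ψ x) := by
    have := (integrable_smul_of_tsupport h.locInt_grad hp.continuous hps hp0).inner_const (𝕜 := ℝ) v
    refine this.congr (Eventually.of_forall fun x => ?_)
    simp only [real_inner_smul_left]; ring
  have e1 : ∫ x, f x * (cut j x * fderiv ℝ ψ x v + ψ x * fderiv ℝ (cut j) x v)
      = (∫ x, f x * (cut j x * fderiv ℝ ψ x v)) + ∫ x, f x * (ψ x * fderiv ℝ (cut j) x v) := by
    simp only [mul_add]
    exact integral_add k1 k2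
  have e2 : ∫ x, inner ℝ (cut j x • G x + f x • gradient (cut j) x) v * ψ x
      = (∫ x, inner ℝ (G x) v * (cut j x * ψ x)) + ∫ x, f x * (ψ x * fderiv ℝ (cut j) x v) := by
    rw [← integral_add k3 k2]
    congr 1; funext x
    rw [inner_add_left, real_inner_smul_left, real_inner_smul_left, inner_gradient_left]
    ring
  rw [e2]
  rw [e1] at key
  have e3 : ∫ x, cut j x * f x * fderiv ℝ ψ x v = ∫ x, f x * (cut j x * fderiv ℝ ψ x v) := by
    congr 1; funext x; ring
  rw [e3]
  linarith

/-- A weak gradient supported in an annulus is a weak gradient on the whole space. -/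
lemma IsWeakGradient.by_parts_of_annulus {f : E d → ℝ} {G : E d → E d} (h : IsWeakGradient f G)
    {R : ℝ} (hf0 : ∀ x ∉ annulus (E d) R, f x = 0) (hG0 : ∀ x ∉ annulus (E d) R, G x = 0)
    {ψ : E d → ℝ} (hψ : ContDiff ℝ ∞ ψ) (v : E d) :
    ∫ x, f x * fderiv ℝ ψ x v = -∫ x, inner ℝ (G x) v * ψ x := by
  obtain ⟨j, hj⟩ := exists_nat_ge R
  have hsub : annulus (E d) R ⊆ annulus (E d) (j + 1) := fun x hx =>
    ⟨(Real.exp_le_exp.2 (by linarith)).trans hx.1, hx.2.trans (Real.exp_le_exp.2 (by linarith))⟩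
  have hc : ContDiff ℝ ∞ (cut (V := E d) j) := contDiff_cut j
  have hs := hasCompactSupport_cut (V := E d) j
  have key := h.by_parts (fun x => cut j x * ψ x) (hc.mul hψ) hs.mul_right
    ((tsupport_mul_subset_left).trans (tsupport_cut_subset_compl j)) v
  have e1 : ∀ x, f x * fderiv ℝ (fun x => cut j x * ψ x) x v = f x * fderiv ℝ ψ x v := fun x => by
    by_cases hx : x ∈ annulus (E d) R
    · rw [fderiv_fun_mul (hc.differentiable (by simp) x) (hψ.differentiable (by simp) x),
        fderiv_cut_eq_zero (hsub hx), cut_eq_one (hsub hx)]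
      simp
    · rw [hf0 x hx]; simp
  have e2 : ∀ x, inner ℝ (G x) v * (cut j x * ψ x) = inner ℝ (G x) v * ψ x := fun x => by
    by_cases hx : x ∈ annulus (E d) R
    · rw [cut_eq_one (hsub hx), one_mul]
    · rw [hG0 x hx]; simp
  simpa only [e1, e2] using key

/-- Approximation by test functions of a function with a weak gradient, supported in an annulus. -/
theorem IsWeakGradient.exists_approx_of_annulus (hd : 3 ≤ d) (hab : (a, b) ∈ Theta d)
    (hα : 0 < alpha d a b) {f : E d → ℝ} {G : E d → E d} (h : IsWeakGradient f G)
    {R : ℝ} (hR : 0 ≤ R) (hf0 : ∀ x ∉ annulus (E d) R, f x = 0)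
    (hG0 : ∀ x ∉ annulus (E d) R, G x = 0) (hf : MemLp f 2 volume) (hG : MemLp G 2 volume) :
    ∃ u : ℕ → E d → ℝ, (∀ k, ContDiff ℝ ∞ (u k)) ∧
      (∀ k, tsupport (u k) ⊆ annulus (E d) (R + 1)) ∧
      Tendsto (fun k => ∫ x, (u k x - f x) ^ 2 ∂(mu d a b)) atTop (𝓝 0) ∧
      Tendsto (fun k => ∫ x, carre d a b (fun x => gradient (u k) x - G x) x ∂(mu d a b)) atTop
        (𝓝 0) := by
  -- The smaller of the two gaps between the annuli of parameters R and R + 1, e^(-R) - e^(-R-1) at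
  -- the inner boundary. Mollifying at a scale below it keeps supports in the larger annulus.
  set e := Real.exp (-(R + 1)) * (Real.exp 1 - 1) with he
  have he1 : 0 < Real.exp 1 - 1 := by
    have := Real.add_one_lt_exp (one_ne_zero (α := ℝ)); linarith
  have he0 : 0 < e := by positivity
  set r := min e 1 with hr
  have hr0 : 0 < r := lt_min he0 one_pos
  set φ : ℕ → ContDiffBump (0 : E d) := fun k =>
    ⟨r / (k + 1) / 2, r / (k + 1), by positivity, half_lt_self (by positivity)⟩ with hφ
  have hrk : ∀ k : ℕ, r / ((k : ℝ) + 1) ≤ r := fun k =>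
    div_le_self hr0.le (by linarith [(Nat.cast_nonneg k : (0 : ℝ) ≤ k)])
  have hφlim : Tendsto (fun k => (φ k).rOut) atTop (𝓝 0) := by
    have := (tendsto_one_div_add_atTop_nhds_zero_nat (𝕜 := ℝ)).const_mul r
    simpa [hφ, div_eq_mul_inv] using this
  have hφ1 : ∀ k, (φ k).rOut ≤ 1 := fun k => (hrk k).trans (min_le_right _ _)
  have hfl := hf.locallyIntegrable_two
  have hGl : LocallyIntegrable G := hG.locallyIntegrable_two
  have hgrad : ∀ k x, gradient (mollify (φ k) f) x = mollify (φ k) G x := fun k x =>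
    gradient_mollify (φ k) hfl hGl (fun ψ hψ _ v => h.by_parts_of_annulus hf0 hG0 hψ v) x
  have hdist : ∀ k, ∀ x ∉ annulus (E d) (R + 1), ∀ z, dist z x < (φ k).rOut →
      z ∉ annulus (E d) R := fun k x hx z hz hzA => by
    refine hx ?_
    have h1 : dist z x < e := hz.trans_le ((hrk k).trans (min_le_left _ _))
    rw [dist_eq_norm] at h1
    have h2 : ‖z‖ ≤ ‖x‖ + ‖z - x‖ := by
      have := norm_add_le x (z - x); rwa [add_sub_cancel] at this
    have h3 : ‖x‖ ≤ ‖z‖ + ‖z - x‖ := by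
      have := norm_sub_le z (z - x); rwa [sub_sub_cancel] at this
    have h4 : Real.exp (-R) = Real.exp (-(R + 1)) * Real.exp 1 := by
      rw [← Real.exp_add]; congr 1; ring
    have h5 : Real.exp (R + 1) = Real.exp R * Real.exp 1 := Real.exp_add _ _
    have h6 : Real.exp (-(R + 1)) ≤ Real.exp R := Real.exp_le_exp.2 (by linarith)
    constructor
    · have := hzA.1
      rw [h4] at this
      rw [he] at h1
      linarith
    · have := hzA.2
      rw [h5]
      have h7 : e ≤ Real.exp R * (Real.exp 1 - 1) := mul_le_mul_of_nonneg_right h6 he1.le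
      linarith
  have hu0 : ∀ k, ∀ x ∉ annulus (E d) (R + 1), mollify (φ k) f x = 0 := fun k x hx =>
    mollify_eq_zero (φ k) fun z hz => hf0 z (hdist k x hx z hz)
  have hg0 : ∀ k, ∀ x ∉ annulus (E d) (R + 1), mollify (φ k) G x = 0 := fun k x hx =>
    mollify_eq_zero (φ k) fun z hz => hG0 z (hdist k x hx z hz)
  have hsub : annulus (E d) R ⊆ annulus (E d) (R + 1) := fun x hx =>
    ⟨(Real.exp_le_exp.2 (by linarith)).trans hx.1, hx.2.trans (Real.exp_le_exp.2 (by linarith))⟩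
  refine ⟨fun k => mollify (φ k) f, fun k => contDiff_mollify (φ k) hfl, fun k => ?_, ?_, ?_⟩
  · refine closure_minimal (fun x hx => ?_) (isClosed_annulus _)
    by_contra hn
    exact hx (hu0 k x hn)
  · obtain ⟨C, hC⟩ := exists_integral_mu_le hd hab hα (R + 1)
    have hl := (tendsto_mollify hφlim hφ1 hf).const_mul C
    rw [mul_zero] at hl
    refine squeeze_zero (fun k => integral_nonneg fun x => sq_nonneg _) (fun k => ?_) hl
    have h1 := (hC (fun x => ‖mollify (φ k) f x - f x‖ ^ 2)
      (fun x hx => by rw [hu0 k x hx, hf0 x fun hn => hx (hsub hn)]; simp)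
      (fun x => by positivity) ((memLp_mollify (φ k) hf).sub hf).integrable_norm_sq).2
    simpa only [Real.norm_eq_abs, sq_abs] using h1
  · obtain ⟨C, hC⟩ := exists_integral_carre_le hd hab hα (R + 1)
    have hl := (tendsto_mollify hφlim hφ1 hG).const_mul C
    rw [mul_zero] at hl
    refine squeeze_zero (fun k => integral_nonneg fun x => carre_nonneg _ x) (fun k => ?_) hl
    simp only [hgrad]
    exact (hC (fun x => mollify (φ k) G x - G x)
      (fun x hx => by rw [hg0 k x hx, hG0 x fun hn => hx (hsub hn), sub_zero])
      ((memLp_mollify (φ k) hG).sub hG)).2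

end Localization

/-! ### A Hardy inequality -/

/-- Integrates the derivative of cosh^(2-N) tanh u². The boundary terms at ±T are both nonnegative
because tanh is odd, so no condition on u at the ends is needed. The cross term is absorbed by
Young's inequality, which is possible because N > 2. -/
lemma hardy_interval {N : ℝ} (hN : 2 < N) {u u' : ℝ → ℝ} (hu : ∀ t, HasDerivAt u (u' t) t)
    (hc' : Continuous u') {T : ℝ} (hT : 0 ≤ T) :
    0 ≤ ∫ t in Set.Icc (-T) T, ((N - 1) * (wt N t * u t ^ 2) - (N - 2) / 2 * (wt (N - 2) t * u t ^ 2)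
      + 2 / (N - 2) * (wt (N - 2) t * u' t ^ 2)) := by
  have hc : Continuous u := continuous_iff_continuousAt.2 fun t => (hu t).continuousAt
  have hcw := continuous_wt N
  have hcw2 := continuous_wt (N - 2)
  have hth := continuous_tanh
  have h1 : ∀ t, HasDerivAt (fun t => wt (N - 2) t * Real.tanh t * u t ^ 2)
      ((N - 1) * (wt N t * u t ^ 2) - (N - 2) * (wt (N - 2) t * u t ^ 2)
        + 2 * (wt (N - 2) t * Real.tanh t * u t * u' t)) t := fun t => by
    refine (((hasDerivAt_wt (N - 2) t).mul (hasDerivAt_tanh t)).mul ((hu t).pow 2)).congr_deriv ?_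
    simp only [Pi.mul_apply, Pi.pow_apply]
    rw [wt_eq_sub_two N]
    ring
  have h2 := intervalIntegral.integral_eq_sub_of_hasDerivAt (a := -T) (b := T)
    (fun t _ => h1 t) (Continuous.intervalIntegrable (by fun_prop) _ _)
  have hle : -T ≤ T := by linarith
  rw [integral_Icc_eq_integral_Ioc, ← intervalIntegral.integral_of_le hle]
  have h3 : 0 ≤ wt (N - 2) T * Real.tanh T * u T ^ 2
      - wt (N - 2) (-T) * Real.tanh (-T) * u (-T) ^ 2 := by
    have ht : 0 ≤ Real.tanh T := by
      rw [Real.tanh_eq_sinh_div_cosh]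
      exact div_nonneg (Real.sinh_nonneg_iff.2 hT) (Real.cosh_pos T).le
    have a1 := wt_pos (N - 2) T
    have a2 := wt_pos (N - 2) (-T)
    rw [Real.tanh_neg]
    have b1 : 0 ≤ wt (N - 2) T * Real.tanh T * u T ^ 2 := by positivity
    have b2 : 0 ≤ wt (N - 2) (-T) * Real.tanh T * u (-T) ^ 2 := by positivity
    linarith
  rw [← h2] at h3
  refine h3.trans (intervalIntegral.integral_mono_on hle (Continuous.intervalIntegrable
    (by fun_prop) _ _) (Continuous.intervalIntegrable (by fun_prop) _ _) fun t _ => ?_)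
  have hN2 : 0 < N - 2 := by linarith
  have h4 : 2 * (Real.tanh t * u t * u' t) ≤ (N - 2) / 2 * u t ^ 2 + 2 / (N - 2) * u' t ^ 2 := by
    have e : (N - 2) / 2 * u t ^ 2 + 2 / (N - 2) * u' t ^ 2 - 2 * (Real.tanh t * u t * u' t)
        = (N - 2) / 2 * (1 - Real.tanh t ^ 2) * u t ^ 2
          + 2 / (N - 2) * (u' t - (N - 2) / 2 * Real.tanh t * u t) ^ 2 := by
      field_simp; ring
    have h5 := tanh_sq_le t
    have h6 : 0 ≤ (N - 2) / 2 * (1 - Real.tanh t ^ 2) * u t ^ 2 :=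
      mul_nonneg (mul_nonneg (by linarith) (by linarith)) (sq_nonneg _)
    have h7 : 0 ≤ 2 / (N - 2) * (u' t - (N - 2) / 2 * Real.tanh t * u t) ^ 2 := by positivity
    linarith
  have h8 := mul_le_mul_of_nonneg_left h4 (wt_pos (N - 2) t).le
  linarith

section Hardy

variable {d : ℕ} {a b : ℝ}

lemma polarPt_mem_annulus {α : ℝ} (hα : 0 < α) {R : ℝ} (p : ℝ × Sph d) :
    polarPt α p ∈ annulus (E d) R ↔ p.1 ∈ Set.Icc (-(α * R)) (α * R) := by
  rw [mem_annulus_iff (polarPt_ne_zero α p), norm_polarPt, Real.log_exp, abs_div, abs_of_pos hα,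
    div_le_iff₀ hα, Set.mem_Icc, ← abs_le, mul_comm]

/-- A local Hardy inequality for test functions. -/
lemma hardy_annulus (hd : 3 ≤ d) (hab : (a, b) ∈ Theta d) (hα : 0 < alpha d a b) {f : E d → ℝ}
    (hf : ContDiff ℝ 1 f) (hs : HasCompactSupport f) (h0 : tsupport f ⊆ {0}ᶜ) {R : ℝ} (hR : 0 ≤ R) :
    0 ≤ ∫ x in annulus (E d) R, ((nDim d a b - 1) * f x ^ 2
      - (nDim d a b - 2) / 2 * (Real.cosh (alpha d a b * Real.log ‖x‖) * f x) ^ 2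
      + 2 / (nDim d a b - 2) * ((alpha d a b)⁻¹ ^ 2 * carre d a b (gradient f) x)) ∂(mu d a b) := by
  have hn : 2 < nDim d a b := by linarith [nDim_ge hd hab hα]
  obtain ⟨R', hR'⟩ := exists_vanish_polarPt hs h0 hα
  have hm : MeasurableSet (annulus (E d) R) := (isClosed_annulus R).measurableSet
  set α := alpha d a b with hαdef
  set n := nDim d a b with hndef
  set pt : ℝ × Sph d → E d := polarPt α with hpt
  have hptc : Continuous pt := continuous_polarPt α
  have hgc : Continuous (gradient f) := continuous_gradient hf
  have hg0 : ∀ p : ℝ × Sph d, R' < |p.1| → gradient f (pt p) = 0 := fun p hp => by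
    rw [gradient, fderiv_of_notMem_tsupport ℝ (hR' p hp), map_zero]
  have hF : IsCc R' fun p => f (pt p) :=
    ⟨hf.continuous.comp hptc, fun p hp => image_eq_zero_of_notMem_tsupport (hR' p hp)⟩
  have hD : IsCc R' fun p => ‖pt p‖ ^ 2 * ‖gradient f (pt p)‖ ^ 2 :=
    ⟨by fun_prop, fun p hp => by rw [hg0 p hp]; simp⟩
  have hcw := continuous_wt n
  have hcw2 := continuous_wt (n - 2)
  have hder : ∀ t y, HasDerivAt (fun s => f (pt (s, y)))
      (α⁻¹ * inner ℝ (gradient f (pt (t, y))) (pt (t, y))) t := fun t y => by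
    have h1 := (hf.differentiable one_ne_zero (pt (t, y))).hasFDerivAt
    have := h1.comp_hasDerivAt t (hasDerivAt_polarPt α t y)
    refine this.congr_deriv ?_
    rw [map_smul, inner_gradient_left, smul_eq_mul]
  set Φ : ℝ × Sph d → ℝ := fun p => (n - 1) * (wt n p.1 * f (pt p) ^ 2)
    - (n - 2) / 2 * (wt (n - 2) p.1 * f (pt p) ^ 2)
    + 2 / (n - 2) * (wt (n - 2) p.1 * (α⁻¹ ^ 2 * (‖pt p‖ ^ 2 * ‖gradient f (pt p)‖ ^ 2))) with hΦ
  have hΦi : IsCc R' Φ := by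
    refine ⟨by have := hF.cont; have := hD.cont; fun_prop, fun p hp => ?_⟩
    have e1 := hF.vanish p hp
    have e2 := hD.vanish p hp
    change f (pt p) = 0 at e1
    change ‖pt p‖ ^ 2 * ‖gradient f (pt p)‖ ^ 2 = 0 at e2
    simp only [hΦ, e1, e2]
    ring
  rw [← integral_indicator hm, integral_mu hd hab hα]
  have e : ∀ p, wt n p.1 • (annulus (E d) R).indicator (fun x => (n - 1) * f x ^ 2
      - (n - 2) / 2 * (Real.cosh (α * Real.log ‖x‖) * f x) ^ 2
      + 2 / (n - 2) * (α⁻¹ ^ 2 * carre d a b (gradient f) x)) (pt p)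
      = (Set.Icc (-(α * R)) (α * R) ×ˢ (Set.univ : Set (Sph d))).indicator Φ p := fun p => by
    by_cases hp : p.1 ∈ Set.Icc (-(α * R)) (α * R)
    · rw [Set.indicator_of_mem ((polarPt_mem_annulus hα p).2 hp), Set.indicator_of_mem
        (show p ∈ Set.Icc (-(α * R)) (α * R) ×ˢ (Set.univ : Set (Sph d)) from ⟨hp, trivial⟩)]
      have e3 := carre_polarPt hα (gradient f) p
      rw [← hndef, ← hαdef, ← hpt] at e3
      have e4 : α * Real.log ‖pt p‖ = p.1 := alpha_mul_log_polarPt hα p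
      have e5 : wt n p.1 * Real.cosh p.1 ^ 2 = wt (n - 2) p.1 := by
        rw [wt_eq_sub_two n, one_sub_tanh_sq]
        have := (Real.cosh_pos p.1).ne'
        field_simp
      change wt n p.1 * ((n - 1) * f (pt p) ^ 2
        - (n - 2) / 2 * (Real.cosh (α * Real.log ‖pt p‖) * f (pt p)) ^ 2
        + 2 / (n - 2) * (α⁻¹ ^ 2 * carre d a b (gradient f) (pt p))) = Φ p
      rw [e4]
      linear_combination (-(n - 2) / 2 * f (pt p) ^ 2) * e5 + (2 / (n - 2) * α⁻¹ ^ 2) * e3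
    · rw [Set.indicator_of_notMem fun h => hp ((polarPt_mem_annulus hα p).1 h),
        Set.indicator_of_notMem fun h => hp h.1, smul_zero]
  simp only [← hndef, ← hαdef, ← hpt, e]
  refine smul_nonneg (inv_nonneg.2 (area_mul_pos hd hab hα).le) ?_
  rw [integral_indicator (measurableSet_Icc.prod MeasurableSet.univ)]
  have hrest : (cyl d).restrict (Set.Icc (-(α * R)) (α * R) ×ˢ (Set.univ : Set (Sph d)))
      = ((volume : Measure ℝ).restrict (Set.Icc (-(α * R)) (α * R))).prod (surf d) := by
    rw [cyl, ← Measure.prod_restrict, Measure.restrict_univ]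
  have hi := hΦi.integrable.restrict (s := Set.Icc (-(α * R)) (α * R) ×ˢ (Set.univ : Set (Sph d)))
  rw [hrest] at hi ⊢
  rw [integral_prod_symm _ hi]
  -- The one-dimensional inequality is applied along each ray, with y fixed.
  refine integral_nonneg fun y => ?_
  have hT : 0 ≤ α * R := by positivity
  refine (hardy_interval hn (fun t => hder t y) (by fun_prop) hT).trans ?_
  have hPy : Continuous fun t => pt (t, y) := by fun_prop
  have hFy : Continuous fun t => f (pt (t, y)) := hf.continuous.comp hPy
  have hgy : Continuous fun t => gradient f (pt (t, y)) := hgc.comp hPy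
  -- The derivative along the ray is bounded by the full gradient, by Cauchy–Schwarz.
  refine integral_mono (Continuous.integrableOn_Icc (by fun_prop))
    (Continuous.integrableOn_Icc (by have := hΦi.cont; fun_prop)) fun t => ?_
  simp only [hΦ]
  have h1 : (α⁻¹ * inner ℝ (gradient f (pt (t, y))) (pt (t, y))) ^ 2
      ≤ α⁻¹ ^ 2 * (‖pt (t, y)‖ ^ 2 * ‖gradient f (pt (t, y))‖ ^ 2) := by
    rw [mul_pow]
    refine mul_le_mul_of_nonneg_left ?_ (by positivity)
    rw [← mul_pow, ← sq_abs, mul_comm]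
    exact pow_le_pow_left₀ (abs_nonneg _) (abs_real_inner_le_norm _ _) 2
  have h2 := mul_le_mul_of_nonneg_left h1 (wt_pos (n - 2) t).le
  have h3 := mul_le_mul_of_nonneg_left h2
    (show 0 ≤ 2 / (n - 2) from div_nonneg two_pos.le (by linarith))
  linarith

end Hardy

/-! ### The energy norm and the Hardy inequality in H¹. -/

section Density

variable {d : ℕ} {a b : ℝ}

lemma aestronglyMeasurable_of_locallyIntegrableOn (hd : 0 < d) {F : Type*} [NormedAddCommGroup F]
    {f : E d → F} (hf : LocallyIntegrableOn f {0}ᶜ) : AEStronglyMeasurable f volume := by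
  have := nontrivial_euclidean hd
  have h := hf.aestronglyMeasurable
  rwa [Measure.restrict_eq_self_of_ae_mem (by
    filter_upwards [ae_ne_zero (E d)] with x hx using hx)] at h

/-- The vector field with squared norm `carre`. -/
lemma norm_sq_sqrt_carreWt_smul (G : E d → E d) (x : E d) :
    ‖Real.sqrt (carreWt d a b x) • G x‖ ^ 2 = carre d a b G x := by
  rw [norm_smul, mul_pow, Real.norm_of_nonneg (Real.sqrt_nonneg _), Real.sq_sqrt (carreWt_nonneg x),
    carre_eq]

lemma memLp_sqrt_carreWt_smul {G : E d → E d} (hm : AEStronglyMeasurable G volume)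
    (hi : Integrable (carre d a b G) (mu d a b)) :
    MemLp (fun x => Real.sqrt (carreWt d a b x) • G x) 2 (mu d a b) := by
  have hm' : AEStronglyMeasurable (fun x => Real.sqrt (carreWt d a b x) • G x) (mu d a b) :=
    measurable_carreWt.sqrt.aestronglyMeasurable.smul (hm.mono_ac mu_absolutelyContinuous)
  rw [memLp_two_iff_integrable_sq_norm hm']
  simpa only [norm_sq_sqrt_carreWt_smul] using hi

lemma carre_sub (G H : E d → E d) (x : E d) :
    carre d a b (fun x => G x - H x) x = ‖Real.sqrt (carreWt d a b x) • G x
      - Real.sqrt (carreWt d a b x) • H x‖ ^ 2 := by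
  rw [← smul_sub, ← norm_sq_sqrt_carreWt_smul]

/-- The energy is continuous. -/
lemma tendsto_integral_carre {ν : Measure (E d)} (hν : ν ≤ mu d a b) {G : ℕ → E d → E d}
    {H : E d → E d} (hG : ∀ k, MemLp (fun x => Real.sqrt (carreWt d a b x) • G k x) 2 (mu d a b))
    (hH : MemLp (fun x => Real.sqrt (carreWt d a b x) • H x) 2 (mu d a b))
    (hlim : Tendsto (fun k => ∫ x, carre d a b (fun x => G k x - H x) x ∂(mu d a b)) atTop (𝓝 0)) :
    Tendsto (fun k => ∫ x, carre d a b (G k) x ∂ν) atTop (𝓝 (∫ x, carre d a b H x ∂ν)) := by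
  have h := tendsto_integral_norm_sq (fun k => (hG k).mono_measure hν) (hH.mono_measure hν)
    (squeeze_zero (fun k => integral_nonneg fun x => by positivity) (fun k =>
      integral_mono_measure hν (Eventually.of_forall fun x => by positivity)
        ((hG k).sub hH).integrable_norm_sq) (by
          simpa only [carre_sub, Pi.sub_apply] using hlim))
  simpa only [norm_sq_sqrt_carreWt_smul] using h

lemma cut_mul_eq_zero {f : E d → ℝ} (j : ℕ) : ∀ x ∉ annulus (E d) (2 * ((j : ℝ) + 1)),
    cut j x * f x = 0 := fun x hx => by rw [cut_eq_zero hx, zero_mul]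

lemma cut_grad_eq_zero {f : E d → ℝ} {G : E d → E d} (j : ℕ) :
    ∀ x ∉ annulus (E d) (2 * ((j : ℝ) + 1)), cut j x • G x + f x • gradient (cut j) x = 0 :=
  fun x hx => by
    rw [cut_eq_zero hx, gradient_cut_eq_zero_of_notMem hx, zero_smul, smul_zero, add_zero]

lemma continuous_gradient_cut (j : ℕ) : Continuous (gradient (cut (V := E d) j)) :=
  continuous_gradient ((contDiff_cut j).of_le (by norm_cast))

/-- The product with a cutoff function of an element of `H¹`. -/
theorem IsH1.cut_mul (hd : 3 ≤ d) (hab : (a, b) ∈ Theta d) (hα : 0 < alpha d a b) {f : E d → ℝ}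
    {G : E d → E d} (h : IsH1 d a b f G) (j : ℕ) :
    MemLp (fun x => cut j x * f x) 2 (mu d a b) ∧ MemLp (fun x => cut j x * f x) 2 volume ∧
    MemLp (fun x => cut j x • G x + f x • gradient (cut j) x) 2 volume := by
  have hc := (contDiff_cut (V := E d) j).continuous
  have hgc := continuous_gradient_cut (d := d) j
  have hGm := aestronglyMeasurable_of_locallyIntegrableOn (by omega) h.weakGradient.locInt_grad
  have h1 : MemLp (fun x => cut j x * f x) 2 (mu d a b) :=
    h.memLp.of_le (hc.aestronglyMeasurable.mul h.memLp.1) (Eventually.of_forall fun x => by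
      rw [norm_mul, Real.norm_of_nonneg (cut_nonneg j x)]
      exact mul_le_of_le_one_left (norm_nonneg _) (cut_le_one j x))
  refine ⟨h1, memLp_volume_of_annulus hd hab hα (cut_mul_eq_zero j) h1, ?_⟩
  have h2 : MemLp (fun x => cut j x • G x) 2 volume := by
    refine memLp_volume_of_carre hd hab hα (R := 2 * ((j : ℝ) + 1))
      (fun x hx => by rw [cut_eq_zero hx, zero_smul]) (hc.aestronglyMeasurable.smul hGm) ?_
    refine h.integrable_carre.mono' ?_ (Eventually.of_forall fun x => ?_)
    · exact (measurable_carreWt.aestronglyMeasurable).mul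
        (((hc.aestronglyMeasurable.smul hGm).mono_ac mu_absolutelyContinuous).norm.pow 2)
    · rw [Real.norm_of_nonneg (carre_nonneg _ x), carre_eq, carre_eq, norm_smul,
        Real.norm_of_nonneg (cut_nonneg j x)]
      refine mul_le_mul_of_nonneg_left (pow_le_pow_left₀ (mul_nonneg (cut_nonneg j x)
        (norm_nonneg _)) (mul_le_of_le_one_left (norm_nonneg _) (cut_le_one j x)) 2)
        (carreWt_nonneg x)
  obtain ⟨B, hB⟩ := hgc.bounded_above_of_compact_support
    (hasCompactSupport_gradient (hasCompactSupport_cut (V := E d) j))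
  have h3 : MemLp (fun x => f x • gradient (cut j) x) 2 volume := by
    refine memLp_volume_of_annulus hd hab hα (R := 2 * ((j : ℝ) + 1))
      (fun x hx => by rw [gradient_cut_eq_zero_of_notMem hx, smul_zero])
      (h.memLp.of_le_mul (c := B) (h.memLp.1.smul hgc.aestronglyMeasurable)
        (Eventually.of_forall fun x => ?_))
    rw [norm_smul, mul_comm]
    exact mul_le_mul_of_nonneg_right (hB x) (norm_nonneg _)
  exact h2.add h3

lemma hasCompactSupport_of_tsupport_annulus {f : E d → ℝ} {R : ℝ}
    (h : tsupport f ⊆ annulus (E d) R) : HasCompactSupport f :=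
  (isCompact_annulus R).of_isClosed_subset (isClosed_tsupport f) h

/-- Test functions are in the energy space. -/
lemma memLp_of_tsupport_annulus (hd : 3 ≤ d) (hab : (a, b) ∈ Theta d) (hα : 0 < alpha d a b)
    {u : E d → ℝ} (hu : ContDiff ℝ ∞ u) {R : ℝ} (hR : tsupport u ⊆ annulus (E d) R) :
    MemLp u 2 (mu d a b) ∧
      MemLp (fun x => Real.sqrt (carreWt d a b x) • gradient u x) 2 (mu d a b) := by
  have hs := hasCompactSupport_of_tsupport_annulus hR
  have hgc := continuous_gradient (hu.of_le (by norm_cast : (1 : WithTop ℕ∞) ≤ ∞))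
  have hgs := hasCompactSupport_gradient hs
  refine ⟨memLp_mu_of_annulus hd hab hα (fun x hx => image_eq_zero_of_notMem_tsupport
    fun h => hx (hR h)) (hu.continuous.memLp_of_hasCompactSupport hs), ?_⟩
  obtain ⟨C, hC⟩ := exists_integral_carre_le hd hab hα R
  refine memLp_sqrt_carreWt_smul hgc.aestronglyMeasurable (hC _ (fun x hx => ?_)
    (hgc.memLp_of_hasCompactSupport hgs)).1
  exact image_eq_zero_of_notMem_tsupport fun h => hx (hR (tsupport_gradient_subset u h))

/-- The Hardy inequality on annuli for elements of `H¹`. -/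
lemma IsH1.hardy_annulus (hd : 3 ≤ d) (hab : (a, b) ∈ Theta d) (hα : 0 < alpha d a b) {f : E d → ℝ}
    {G : E d → E d} (h : IsH1 d a b f G) (j : ℕ) :
    IntegrableOn (fun x => (Real.cosh (alpha d a b * Real.log ‖x‖) * f x) ^ 2)
      (annulus (E d) (j + 1)) (mu d a b) ∧
    (nDim d a b - 2) / 2 * ∫ x in annulus (E d) (j + 1),
        (Real.cosh (alpha d a b * Real.log ‖x‖) * f x) ^ 2 ∂(mu d a b)
      ≤ (nDim d a b - 1) * (∫ x, f x ^ 2 ∂(mu d a b))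
        + 2 / (nDim d a b - 2) * ((alpha d a b)⁻¹ ^ 2 * ∫ x, carre d a b G x ∂(mu d a b)) := by
  have hn : 2 < nDim d a b := by linarith [nDim_ge hd hab hα]
  set A := annulus (E d) ((j : ℝ) + 1) with hA
  have hm : MeasurableSet A := (isClosed_annulus _).measurableSet
  have hGm := aestronglyMeasurable_of_locallyIntegrableOn (by omega) h.weakGradient.locInt_grad
  obtain ⟨h1, h2, h3⟩ := h.cut_mul hd hab hα j
  -- On `A` the cutoff is 1 with vanishing gradient. Since the inequality on `A` involves no
  -- boundary contribution, nothing has to be known about the transition region of the cutoff, and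
  -- there is no circularity in using cutoffs to prove the Hardy inequality.
  set f' : E d → ℝ := fun x => cut j x * f x with hf'
  set G' : E d → E d := fun x => cut j x • G x + f x • gradient (cut j) x with hG'
  have hfA : ∀ x ∈ A, f' x = f x := fun x hx => by rw [hf']; simp only; rw [cut_eq_one hx, one_mul]
  have hGA : ∀ x ∈ A, G' x = G x := fun x hx => by
    rw [hG']; simp only
    rw [cut_eq_one hx, gradient, fderiv_cut_eq_zero hx, map_zero, smul_zero, add_zero, one_smul]
  obtain ⟨u, huC, hus, hu1, hu2⟩ := (h.weakGradient.cut_mul j).exists_approx_of_annulus hd hab hα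
    (by positivity) (cut_mul_eq_zero j) (cut_grad_eq_zero j) h2 h3
  have hT := fun k => memLp_of_tsupport_annulus hd hab hα (huC k) (hus k)
  obtain ⟨C, hC⟩ := exists_integral_carre_le hd hab hα (2 * ((j : ℝ) + 1))
  have hG'e := memLp_sqrt_carreWt_smul (a := a) (b := b) h3.1 (hC G' (cut_grad_eq_zero j) h3).1
  set ν := (mu d a b).restrict A with hν
  have hνle : ν ≤ mu d a b := Measure.restrict_le_self
  have sq_eq : ∀ x : ℝ, ‖x‖ ^ 2 = x ^ 2 := fun x => by rw [Real.norm_eq_abs, sq_abs]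
  -- the three limits
  have l1 : Tendsto (fun k => ∫ x, u k x ^ 2 ∂ν) atTop (𝓝 (∫ x, f' x ^ 2 ∂ν)) := by
    have := tendsto_integral_norm_sq (ν := ν) (u := u) (h := f')
      (fun k => (hT k).1.mono_measure hνle) (h1.mono_measure hνle)
      (squeeze_zero (fun k => integral_nonneg fun x => by positivity) (fun k =>
        integral_mono_measure hνle (Eventually.of_forall fun x => by positivity)
          ((hT k).1.sub h1).integrable_norm_sq) (by
            simpa only [sq_eq, Pi.sub_apply] using hu1))
    simpa only [sq_eq] using this
  have l2 := tendsto_integral_carre hνle (fun k => (hT k).2) hG'e hu2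
  have hcosh : ContinuousOn (fun x : E d => Real.cosh (alpha d a b * Real.log ‖x‖)) A :=
    Real.continuous_cosh.comp_continuousOn (continuousOn_const.mul
      (continuous_norm.continuousOn.log fun x hx => norm_ne_zero_iff.2 (annulus_subset _ hx)))
  obtain ⟨K, hK⟩ := (isCompact_annulus (V := E d) ((j : ℝ) + 1)).exists_bound_of_continuousOn hcosh
  have hmc : AEStronglyMeasurable (fun x : E d => Real.cosh (alpha d a b * Real.log ‖x‖)) ν :=
    Measurable.aestronglyMeasurable (by fun_prop)
  have hcm : ∀ {w : E d → ℝ}, MemLp w 2 (mu d a b) →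
      MemLp (fun x => Real.cosh (alpha d a b * Real.log ‖x‖) * w x) 2 ν := fun {w} hw => by
    have hw' := hw.mono_measure hνle
    refine hw'.of_le_mul (c := K) (hmc.mul hw'.1) ?_
    filter_upwards [ae_restrict_mem hm] with x hx
    rw [norm_mul]
    exact mul_le_mul_of_nonneg_right (hK x hx) (norm_nonneg _)
  have l3 : Tendsto (fun k => ∫ x, (Real.cosh (alpha d a b * Real.log ‖x‖) * u k x) ^ 2 ∂ν) atTop
      (𝓝 (∫ x, (Real.cosh (alpha d a b * Real.log ‖x‖) * f' x) ^ 2 ∂ν)) := by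
    have hl := hu1.const_mul (K ^ 2)
    rw [mul_zero] at hl
    have := tendsto_integral_norm_sq (ν := ν) (fun k => hcm (hT k).1) (hcm h1)
      (squeeze_zero (fun k => integral_nonneg fun x => by positivity) (fun k => ?_) hl)
    · simpa only [sq_eq] using this
    have i1 : Integrable (fun x => (u k x - f' x) ^ 2) (mu d a b) := by
      have := ((hT k).1.sub h1).integrable_norm_sq
      simpa only [sq_eq, Pi.sub_apply] using this
    rw [← integral_const_mul]
    refine (integral_mono_ae ((hcm (hT k).1).sub (hcm h1)).integrable_norm_sq
      ((i1.mono_measure hνle).const_mul (K ^ 2)) ?_).trans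
      (integral_mono_measure hνle (Eventually.of_forall fun x => by positivity) (i1.const_mul _))
    filter_upwards [ae_restrict_mem hm] with x hx
    rw [Pi.sub_apply, ← mul_sub, norm_mul, mul_pow, sq_eq (_ - _)]
    exact mul_le_mul_of_nonneg_right (pow_le_pow_left₀ (norm_nonneg _) (hK x hx) 2) (sq_nonneg _)
  have i1 : ∀ {w : E d → ℝ}, MemLp w 2 (mu d a b) → Integrable (fun x => w x ^ 2) ν := fun hw => by
    simpa only [sq_eq] using (hw.mono_measure hνle).integrable_norm_sq
  have i2 : ∀ {w : E d → ℝ}, MemLp w 2 (mu d a b) →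
      Integrable (fun x => (Real.cosh (alpha d a b * Real.log ‖x‖) * w x) ^ 2) ν := fun hw => by
    simpa only [sq_eq] using (hcm hw).integrable_norm_sq
  have i3 : ∀ k, Integrable (carre d a b (gradient (u k))) ν := fun k => by
    have := ((hT k).2.mono_measure hνle).integrable_norm_sq
    simpa only [norm_sq_sqrt_carreWt_smul] using this
  have hk : ∀ k, (nDim d a b - 2) / 2
        * (∫ x, (Real.cosh (alpha d a b * Real.log ‖x‖) * u k x) ^ 2 ∂ν)
      ≤ (nDim d a b - 1) * (∫ x, u k x ^ 2 ∂ν)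
        + 2 / (nDim d a b - 2) * ((alpha d a b)⁻¹ ^ 2 * ∫ x, carre d a b (gradient (u k)) x ∂ν) :=
    fun k => by
      have := CKN.hardy_annulus hd hab hα ((huC k).of_le (by norm_cast))
        (hasCompactSupport_of_tsupport_annulus (hus k)) ((hus k).trans (annulus_subset _))
        (R := (j : ℝ) + 1) (by positivity)
      rw [integral_add (by exact ((i1 (hT k).1).const_mul _).sub ((i2 (hT k).1).const_mul _))
        (by exact ((i3 k).const_mul _).const_mul _),
        integral_sub (by exact (i1 (hT k).1).const_mul _) (by exact (i2 (hT k).1).const_mul _)] at this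
      simp only [integral_const_mul] at this
      linarith
  have hlim := le_of_tendsto_of_tendsto' (l3.const_mul ((nDim d a b - 2) / 2))
    ((l1.const_mul (nDim d a b - 1)).add ((l2.const_mul ((alpha d a b)⁻¹ ^ 2)).const_mul
      (2 / (nDim d a b - 2)))) hk
  have c3 : ∫ x, (Real.cosh (alpha d a b * Real.log ‖x‖) * f' x) ^ 2 ∂ν
      = ∫ x in A, (Real.cosh (alpha d a b * Real.log ‖x‖) * f x) ^ 2 ∂(mu d a b) :=
    setIntegral_congr_fun hm fun x hx => by simp only [hfA x hx]
  have c1 : ∫ x, f' x ^ 2 ∂ν ≤ ∫ x, f x ^ 2 ∂(mu d a b) := by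
    rw [hν, setIntegral_congr_fun (g := fun x => f x ^ 2) hm fun x hx => by
      simp only [hfA x hx]]
    exact setIntegral_le_integral (by simpa only [sq_eq] using h.memLp.integrable_norm_sq)
      (Eventually.of_forall fun x => sq_nonneg _)
  have c2 : ∫ x, carre d a b G' x ∂ν ≤ ∫ x, carre d a b G x ∂(mu d a b) := by
    rw [hν, setIntegral_congr_fun (g := carre d a b G) hm fun x hx => by
      rw [carre_eq, carre_eq, hGA x hx]]
    exact setIntegral_le_integral h.integrable_carre
      (Eventually.of_forall fun x => carre_nonneg G x)
  constructor
  · refine (i2 h1).congr ?_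
    filter_upwards [ae_restrict_mem hm] with x hx
    rw [hfA x hx]
  · rw [← c3]
    refine hlim.trans (add_le_add ?_ ?_)
    · exact mul_le_mul_of_nonneg_left c1 (by linarith)
    · refine mul_le_mul_of_nonneg_left (mul_le_mul_of_nonneg_left c2 (by positivity)) ?_
      exact div_nonneg two_pos.le (by linarith)

/-- The Hardy inequality. -/
theorem IsH1.integrable_cosh_sq (hd : 3 ≤ d) (hab : (a, b) ∈ Theta d) (hα : 0 < alpha d a b)
    {f : E d → ℝ} {G : E d → E d} (h : IsH1 d a b f G) :
    Integrable (fun x => (Real.cosh (alpha d a b * Real.log ‖x‖) * f x) ^ 2) (mu d a b) := by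
  have := nontrivial_euclidean (d := d) (by omega)
  have hn : 2 < nDim d a b := by linarith [nDim_ge hd hab hα]
  have hcov : AECover (mu d a b) atTop fun j : ℕ => annulus (E d) ((j : ℝ) + 1) := by
    refine ⟨?_, fun j => (isClosed_annulus _).measurableSet⟩
    filter_upwards [mu_absolutelyContinuous.ae_le (ae_ne_zero (E d))] with x hx
    obtain ⟨N, hN⟩ := exists_nat_ge |Real.log ‖x‖|
    filter_upwards [eventually_ge_atTop N] with j hj
    rw [mem_annulus_iff hx]
    have : (N : ℝ) ≤ j := by exact_mod_cast hj
    linarith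
  refine hcov.integrable_of_integral_bounded_of_nonneg_ae
    (((nDim d a b - 2) / 2)⁻¹ * ((nDim d a b - 1) * (∫ x, f x ^ 2 ∂(mu d a b))
        + 2 / (nDim d a b - 2) * ((alpha d a b)⁻¹ ^ 2 * ∫ x, carre d a b G x ∂(mu d a b))))
    (fun j => (h.hardy_annulus hd hab hα j).1) (Eventually.of_forall fun x => sq_nonneg _)
    (Eventually.of_forall fun j => ?_)
  rw [← div_eq_inv_mul, le_div_iff₀' (by linarith)]
  exact (h.hardy_annulus hd hab hα j).2

end Density

/-! ### Density of test functions in H¹. -/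

section Density

variable {d : ℕ} {a b : ℝ}

lemma carreWt_eq {x : E d} (hx : x ≠ 0) :
    carreWt d a b x = ‖x‖ ^ 2 * Real.cosh (alpha d a b * Real.log ‖x‖) ^ 2 := by
  have h := norm_pos_iff.2 hx
  have e1 : ‖x‖ ^ (2 * alpha d a b) = Real.exp (2 * (alpha d a b * Real.log ‖x‖)) := by
    rw [Real.rpow_def_of_pos h]; congr 1; ring
  have e2 : ‖x‖ ^ (2 * (1 - alpha d a b))
      = ‖x‖ ^ 2 * (Real.exp (2 * (alpha d a b * Real.log ‖x‖)))⁻¹ := by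
    rw [← e1, ← Real.rpow_natCast, ← Real.rpow_neg h.le, ← Real.rpow_add h]
    congr 1; push_cast; ring
  rw [carreWt, e2, e1, one_add_exp_two_mul, two_mul (alpha d a b * _), Real.exp_add]
  have := (Real.exp_pos (alpha d a b * Real.log ‖x‖)).ne'
  field_simp
  ring

lemma norm_smul_add_smul_sub_sq_le {F : Type*} [NormedAddCommGroup F] [NormedSpace ℝ F] (c t : ℝ)
    (v w : F) :
    ‖(c • v + t • w) - v‖ ^ 2 ≤ 2 * ((1 - c) ^ 2 * ‖v‖ ^ 2) + 2 * (t ^ 2 * ‖w‖ ^ 2) := by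
  have e : (c • v + t • w) - v = t • w - (1 - c) • v := by
    rw [sub_smul, one_smul]; abel
  rw [e]
  have h2 := pow_le_pow_left₀ (norm_nonneg _) (norm_sub_le (t • w) ((1 - c) • v)) 2
  have e1 : (1 - c) ^ 2 * ‖v‖ ^ 2 = ‖(1 - c) • v‖ ^ 2 := by
    rw [norm_smul, mul_pow, Real.norm_eq_abs, sq_abs]
  have e2 : t ^ 2 * ‖w‖ ^ 2 = ‖t • w‖ ^ 2 := by
    rw [norm_smul, mul_pow, Real.norm_eq_abs, sq_abs]
  rw [e1, e2]
  nlinarith [sq_nonneg (‖t • w‖ - ‖(1 - c) • v‖)]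

/-- The weight is |x|² cosh²(α ln |x|): the |x|² is consumed by the scale-invariant bound on the
cutoff gradient, and what is left is the integrand controlled by the Hardy inequality. -/
lemma carre_cut_mul_sub_le {C : ℝ}
    (hC : ∀ (j : ℕ) (x : E d), ‖x‖ * ‖fderiv ℝ (cut j) x‖ ≤ C / (j + 1)) (f : E d → ℝ)
    (G : E d → E d) (j : ℕ) {x : E d} (hx : x ≠ 0) :
    carre d a b (fun x => (cut j x • G x + f x • gradient (cut j) x) - G x) x
      ≤ 2 * ((1 - cut j x) ^ 2 * carre d a b G x)
        + 2 * ((C / (j + 1)) ^ 2 * (Real.cosh (alpha d a b * Real.log ‖x‖) * f x) ^ 2) := by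
  have h1 := mul_le_mul_of_nonneg_left
    (norm_smul_add_smul_sub_sq_le (cut j x) (f x) (G x) (gradient (cut j) x))
    (carreWt_nonneg (a := a) (b := b) x)
  have h3 := mul_le_mul_of_nonneg_right (pow_le_pow_left₀ (by positivity) (hC j x) 2)
    (sq_nonneg (Real.cosh (alpha d a b * Real.log ‖x‖) * f x))
  rw [carre_eq, carre_eq]
  refine h1.trans ?_
  rw [norm_gradient, mul_add]
  refine add_le_add (le_of_eq (by ring)) ?_
  refine le_trans (le_of_eq ?_) (mul_le_mul_of_nonneg_left h3 two_pos.le)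
  rw [carreWt_eq hx]
  ring

/-- Cutoff functions approximate the elements of `H¹`. -/
theorem IsH1.tendsto_cut_mul (hd : 3 ≤ d) (hab : (a, b) ∈ Theta d) (hα : 0 < alpha d a b)
    {f : E d → ℝ} {G : E d → E d} (h : IsH1 d a b f G) :
    Tendsto (fun j : ℕ => ∫ x, (cut j x * f x - f x) ^ 2 ∂(mu d a b)) atTop (𝓝 0) ∧
    Tendsto (fun j : ℕ => ∫ x, carre d a b (fun x => (cut j x • G x + f x • gradient (cut j) x) - G x)
      x ∂(mu d a b)) atTop (𝓝 0) := by
  have := nontrivial_euclidean (d := d) (by omega)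
  have hae : ∀ᵐ x ∂(mu d a b), x ≠ 0 := mu_absolutelyContinuous.ae_le (ae_ne_zero (E d))
  have hfm := h.memLp.1
  have hGm := (aestronglyMeasurable_of_locallyIntegrableOn (by omega)
    h.weakGradient.locInt_grad).mono_ac (mu_absolutelyContinuous (a := a) (b := b))
  have hc := fun j : ℕ => (contDiff_cut (V := E d) j).continuous
  have hgc := fun j : ℕ => continuous_gradient_cut (d := d) j
  have hf2 : Integrable (fun x => f x ^ 2) (mu d a b) := by
    simpa only [Real.norm_eq_abs, sq_abs] using h.memLp.integrable_norm_sq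
  obtain ⟨C, hC0, hC⟩ := exists_norm_fderiv_cut_le (V := E d)
  constructor
  · have : Tendsto (fun j : ℕ => ∫ x, (cut j x * f x - f x) ^ 2 ∂(mu d a b)) atTop
        (𝓝 (∫ x : E d, (0 : ℝ) ∂(mu d a b))) := by
      refine tendsto_integral_of_dominated_convergence (fun x => f x ^ 2)
        (fun j => (((hc j).aestronglyMeasurable.mul hfm).sub hfm).pow 2) hf2
        (fun j => Eventually.of_forall fun x => ?_) (hae.mono fun x hx => ?_)
      · have e : (cut j x * f x - f x) ^ 2 = (1 - cut j x) ^ 2 * f x ^ 2 := by ring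
        rw [Real.norm_of_nonneg (sq_nonneg _), e]
        refine mul_le_of_le_one_left (sq_nonneg _) (pow_le_one₀ ?_ ?_)
        · linarith [cut_le_one j x]
        · linarith [cut_nonneg j x]
      · refine tendsto_const_nhds.congr' ((eventually_cut_eq_one hx).mono fun j hj => ?_)
        change 0 = (cut j x * f x - f x) ^ 2
        rw [hj]; ring
    simpa using this
  · have : Tendsto (fun j : ℕ => ∫ x, carre d a b
        (fun x => (cut j x • G x + f x • gradient (cut j) x) - G x) x ∂(mu d a b)) atTop
        (𝓝 (∫ x : E d, (0 : ℝ) ∂(mu d a b))) := by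
      have hbd := fun j x hx => carre_cut_mul_sub_le (a := a) (b := b) hC f G j (x := x) hx
      set F : ℕ → E d → ℝ := fun j => carre d a b
        (fun x => (cut j x • G x + f x • gradient (cut j) x) - G x) with hF
      -- An integrable majorant independent of j, the second summand being integrable by
      -- `IsH1.integrable_cosh_sq`.
      set B : E d → ℝ := fun x => 2 * carre d a b G x
        + 2 * (C ^ 2 * (Real.cosh (alpha d a b * Real.log ‖x‖) * f x) ^ 2) with hB
      have hFm : ∀ j, AEStronglyMeasurable (F j) (mu d a b) := fun j =>
        measurable_carreWt.aestronglyMeasurable.mul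
          (((((hc j).aestronglyMeasurable.smul hGm).add
            (hfm.smul (hgc j).aestronglyMeasurable)).sub hGm).norm.pow 2)
      have hBi : Integrable B (mu d a b) := (h.integrable_carre.const_mul 2).add
          (((h.integrable_cosh_sq hd hab hα).const_mul _).const_mul 2)
      have hF0 : ∀ j x, 0 ≤ F j x := fun j x => carre_nonneg _ x
      have hFB : ∀ j x, x ≠ 0 → F j x ≤ B x := fun j x hx => by
        refine (hbd j x hx).trans (add_le_add ?_ ?_)
        · refine mul_le_mul_of_nonneg_left (mul_le_of_le_one_left (carre_nonneg G x)
            (pow_le_one₀ ?_ ?_)) two_pos.le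
          · linarith [cut_le_one j x]
          · linarith [cut_nonneg j x]
        · refine mul_le_mul_of_nonneg_left (mul_le_mul_of_nonneg_right
            (pow_le_pow_left₀ (by positivity) ?_ 2) (sq_nonneg _)) two_pos.le
          exact div_le_self hC0 (by linarith [(Nat.cast_nonneg j : (0 : ℝ) ≤ j)])
      have hlim : ∀ x, x ≠ 0 → Tendsto (fun j => F j x) atTop (𝓝 0) := fun x hx => by
        refine squeeze_zero (fun j => hF0 j x) (fun j => hbd j x hx) ?_
        have l1 : Tendsto (fun j : ℕ => (1 - cut j x) ^ 2 * carre d a b G x) atTop (𝓝 0) :=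
          tendsto_const_nhds.congr' ((eventually_cut_eq_one hx).mono fun j hj => by
            change 0 = (1 - cut j x) ^ 2 * _
            rw [hj]; ring)
        have l2 : Tendsto (fun j : ℕ => C / ((j : ℝ) + 1)) atTop (𝓝 0) := by
          simpa [div_eq_mul_inv] using
            (tendsto_one_div_add_atTop_nhds_zero_nat (𝕜 := ℝ)).const_mul C
        have := (l1.const_mul 2).add (((l2.pow 2).mul_const
          ((Real.cosh (alpha d a b * Real.log ‖x‖) * f x) ^ 2)).const_mul 2)
        simpa using this
      have key : Tendsto (fun j => ∫ x, F j x ∂(mu d a b)) atTop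
          (𝓝 (∫ x : E d, (0 : ℝ) ∂(mu d a b))) := by
        clear_value F B
        exact tendsto_integral_of_dominated_convergence B hFm hBi
          (fun j => hae.mono fun x hx => by
            rw [Real.norm_of_nonneg (hF0 j x)]; exact hFB j x hx) (hae.mono hlim)
      exact key
    simpa using this

/-- Test functions are dense in `H¹`. -/
theorem IsH1.exists_approx (hd : 3 ≤ d) (hab : (a, b) ∈ Theta d) (hα : 0 < alpha d a b)
    {f : E d → ℝ} {G : E d → E d} (h : IsH1 d a b f G) :
    ∃ u : ℕ → E d → ℝ, (∀ k, ContDiff ℝ ∞ (u k)) ∧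
      (∀ k, ∃ R, tsupport (u k) ⊆ annulus (E d) R) ∧
      Tendsto (fun k => ∫ x, (u k x - f x) ^ 2 ∂(mu d a b)) atTop (𝓝 0) ∧
      Tendsto (fun k => ∫ x, carre d a b (fun x => gradient (u k) x - G x) x ∂(mu d a b)) atTop
        (𝓝 0) := by
  obtain ⟨t1, t2⟩ := h.tendsto_cut_mul hd hab hα
  have hGm := aestronglyMeasurable_of_locallyIntegrableOn (by omega) h.weakGradient.locInt_grad
  have hGe := memLp_sqrt_carreWt_smul (a := a) (b := b) hGm h.integrable_carre
  have hstep : ∀ j : ℕ, ∃ w : E d → ℝ, ContDiff ℝ ∞ w ∧ (∃ R, tsupport w ⊆ annulus (E d) R) ∧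
      ∫ x, (w x - f x) ^ 2 ∂(mu d a b)
        ≤ 2 * (1 / ((j : ℝ) + 1)) + 2 * ∫ x, (cut j x * f x - f x) ^ 2 ∂(mu d a b) ∧
      ∫ x, carre d a b (fun x => gradient w x - G x) x ∂(mu d a b)
        ≤ 2 * (1 / ((j : ℝ) + 1)) + 2 * ∫ x, carre d a b
          (fun x => (cut j x • G x + f x • gradient (cut j) x) - G x) x ∂(mu d a b) := by
    intro j
    obtain ⟨h1, h2, h3⟩ := h.cut_mul hd hab hα j
    obtain ⟨u, huC, hus, hu1, hu2⟩ := (h.weakGradient.cut_mul j).exists_approx_of_annulus hd hab hα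
      (by positivity) (cut_mul_eq_zero j) (cut_grad_eq_zero j) h2 h3
    have hj : (0 : ℝ) < 1 / ((j : ℝ) + 1) := by positivity
    -- Diagonal choice: the j-th cutoff is mollified finely enough for an error below 1/(j+1) in
    -- both norms.
    obtain ⟨k, hk1, hk2⟩ := ((hu1.eventually (gt_mem_nhds hj)).and
      (hu2.eventually (gt_mem_nhds hj))).exists
    obtain ⟨m1, m2⟩ := memLp_of_tsupport_annulus hd hab hα (huC k) (hus k)
    obtain ⟨C, hC⟩ := exists_integral_carre_le hd hab hα (2 * ((j : ℝ) + 1))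
    have m3 := memLp_sqrt_carreWt_smul (a := a) (b := b) h3.1 (hC _ (cut_grad_eq_zero j) h3).1
    have key : ∀ {F : Type} [NormedAddCommGroup F] {u v w : E d → F}, MemLp u 2 (mu d a b) →
        MemLp v 2 (mu d a b) → MemLp w 2 (mu d a b) → ∫ x, ‖u x - w x‖ ^ 2 ∂(mu d a b)
        ≤ 2 * (∫ x, ‖u x - v x‖ ^ 2 ∂(mu d a b)) + 2 * ∫ x, ‖v x - w x‖ ^ 2 ∂(mu d a b) := by
      intro F _ u v w hu hv hw
      rw [← integral_const_mul, ← integral_const_mul,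
        ← integral_add (by exact (hu.sub hv).integrable_norm_sq.const_mul 2)
          (by exact (hv.sub hw).integrable_norm_sq.const_mul 2)]
      refine integral_mono (hu.sub hw).integrable_norm_sq
        (((hu.sub hv).integrable_norm_sq.const_mul 2).add
          ((hv.sub hw).integrable_norm_sq.const_mul 2)) fun x => ?_
      have h1 := pow_le_pow_left₀ (norm_nonneg _) (norm_add_le (u x - v x) (v x - w x)) 2
      rw [sub_add_sub_cancel] at h1
      change ‖u x - w x‖ ^ 2 ≤ 2 * ‖u x - v x‖ ^ 2 + 2 * ‖v x - w x‖ ^ 2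
      nlinarith [sq_nonneg (‖u x - v x‖ - ‖v x - w x‖)]
    refine ⟨u k, huC k, ⟨_, hus k⟩, ?_, ?_⟩
    · have := key m1 h1 h.memLp
      simp only [Real.norm_eq_abs, sq_abs] at this
      linarith
    · have := key m2 m3 hGe
      have e1 := fun x => carre_sub (a := a) (b := b) (gradient (u k)) G x
      have e2 := fun x => carre_sub (a := a) (b := b) (gradient (u k))
        (fun x => cut j x • G x + f x • gradient (cut j) x) x
      have e3 := fun x => carre_sub (a := a) (b := b)
        (fun x => cut j x • G x + f x • gradient (cut j) x) G x
      simp only [← e1, ← e2, ← e3] at this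
      linarith
  choose w hw1 hw2 hw3 hw4 using hstep
  have l0 := (tendsto_one_div_add_atTop_nhds_zero_nat (𝕜 := ℝ)).const_mul 2
  refine ⟨w, hw1, hw2, squeeze_zero (fun k => integral_nonneg fun x => sq_nonneg _) hw3 ?_,
    squeeze_zero (fun k => integral_nonneg fun x => carre_nonneg _ x) hw4 ?_⟩
  · simpa using l0.add (t1.const_mul 2)
  · simpa using l0.add (t2.const_mul 2)

end Density

/-! ### Moments of the model functions under μ. -/

section Moments

variable {d : ℕ} {a b : ℝ}

lemma tanhLog_polarPt (hα : 0 < alpha d a b) (p : ℝ × Sph d) :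
    tanhLog d a b (polarPt (alpha d a b) p) = Real.tanh p.1 := by
  rw [tanhLog, alpha_mul_log_polarPt hα]

lemma sechLog_polarPt (hα : 0 < alpha d a b) (p : ℝ × Sph d) :
    sechLog d a b (polarPt (alpha d a b) p) = (Real.cosh p.1)⁻¹ := by
  rw [sechLog, alpha_mul_log_polarPt hα]

lemma abs_tanhLog_le (x : E d) : ‖tanhLog d a b x‖ ≤ 1 := abs_tanh_le _

lemma sechLog_nonneg (x : E d) : 0 ≤ sechLog d a b x := inv_nonneg.2 (Real.cosh_pos _).le

lemma norm_sechLog_le (x : E d) : ‖sechLog d a b x‖ ≤ 1 := by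
  rw [Real.norm_of_nonneg (sechLog_nonneg x)]
  exact inv_le_one_of_one_le₀ (Real.one_le_cosh _)

lemma norm_normalize_le (x : E d) : ‖‖x‖⁻¹ • x‖ ≤ 1 := by
  rw [norm_smul, norm_inv, norm_norm]
  exact inv_mul_le_one

lemma measurable_tanhLog : Measurable (tanhLog d a b) := by
  unfold tanhLog
  exact continuous_tanh.measurable.comp (by fun_prop)

lemma measurable_sechLog : Measurable (sechLog d a b) := by
  unfold sechLog; fun_prop

lemma integral_mu_of_prod (hd : 3 ≤ d) (hab : (a, b) ∈ Theta d) (hα : 0 < alpha d a b)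
    {h : E d → ℝ} (g : ℝ → ℝ) (k : Sph d → ℝ)
    (hgk : ∀ p, h (polarPt (alpha d a b) p) = g p.1 * k p.2) :
    ∫ x, h x ∂(mu d a b) = (area d * ∫ t, wt (nDim d a b) t)⁻¹
      * ((∫ t, wt (nDim d a b) t * g t) * ∫ y, k y ∂(surf d)) := by
  rw [integral_mu hd hab hα, smul_eq_mul, ← integral_prod_mul]
  congr 1
  refine integral_congr_ae (Eventually.of_forall fun p => ?_)
  simp only [hgk, smul_eq_mul, mul_assoc]

variable (hd : 3 ≤ d) (hab : (a, b) ∈ Theta d) (hα : 0 < alpha d a b)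
include hd hab hα

lemma integral_wt_nDim_pos : 0 < ∫ t, wt (nDim d a b) t :=
  integral_wt_pos (by linarith [nDim_ge hd hab hα])

/-- The moments Y = ∫ cosh^(-n) tanh² and ∫ cosh^(-n-2) satisfy two relations, one by parts and one
from 1 - tanh² = 1/cosh²; they give (n+1) Y = ∫ cosh^(-n). -/
lemma tanhNorm_eq : tanhNorm d a b = (nDim d a b + 1)⁻¹ := by
  have hn := nDim_ge hd hab hα
  have h0 := integral_wt_nDim_pos hd hab hα
  have h1 := integral_wt_add_two (N := nDim d a b) (by linarith)
  have h2 := integral_wt_tanh_sq_eq (N := nDim d a b) (by linarith)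
  rw [tanhNorm, div_eq_iff h0.ne', inv_mul_eq_div, eq_div_iff (by linarith)]
  linarith

lemma sechNorm_eq : sechNorm d a b = nDim d a b / (d * (nDim d a b + 1)) := by
  have hn := nDim_ge hd hab hα
  have h0 := integral_wt_nDim_pos hd hab hα
  have h1 := integral_wt_add_two (N := nDim d a b) (by linarith)
  have h2 := tanhNorm_eq hd hab hα
  have hd' : (0 : ℝ) < d := by exact_mod_cast (by omega : 0 < d)
  rw [tanhNorm, div_eq_iff h0.ne'] at h2
  rw [sechNorm, h1, h2]
  field_simp

lemma tanhNorm_pos : 0 < tanhNorm d a b := by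
  have hn := nDim_ge hd hab hα
  rw [tanhNorm_eq hd hab hα]; positivity

lemma sechNorm_pos : 0 < sechNorm d a b := by
  have hn := nDim_ge hd hab hα
  have hd' : (0 : ℝ) < d := by exact_mod_cast (by omega : 0 < d)
  rw [sechNorm_eq hd hab hα]; positivity

lemma integral_tanhLog : ∫ x, tanhLog d a b x ∂(mu d a b) = 0 := by
  rw [integral_mu_of_prod hd hab hα Real.tanh (fun _ => 1)
    (fun p => by rw [tanhLog_polarPt hα, mul_one]), integral_wt_mul_tanh (by linarith [nDim_ge hd hab hα]), zero_mul, mul_zero]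

lemma integral_tanhLog_sq : ∫ x, tanhLog d a b x ^ 2 ∂(mu d a b) = tanhNorm d a b := by
  have h0 := integral_wt_nDim_pos hd hab hα
  have ha := area_pos (d := d) (by omega)
  rw [integral_mu_of_prod hd hab hα (fun t => Real.tanh t ^ 2) (fun _ => 1)
    (fun p => by rw [tanhLog_polarPt hα, mul_one]), tanhNorm, integral_const]
  change _ * (_ * (area d * 1)) = _
  field_simp

lemma integral_inner_normalize_mul (w : E d) {g : ℝ → ℝ} {h : E d → ℝ}
    (hg : ∀ p, h (polarPt (alpha d a b) p) = g p.1) :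
    ∫ x, inner ℝ (‖x‖⁻¹ • x) w * h x ∂(mu d a b) = 0 := by
  rw [integral_mu_of_prod hd hab hα g (fun y => inner ℝ (y : E d) w)
    (fun p => by rw [normalize_polarPt, hg, mul_comm]), integral_surf_inner (by omega)]
  simp

/-- Radial functions and angular variables are independent under μ, and the second moments of the
uniform law on the sphere are those of the identity matrix over d. -/
lemma integral_inner_normalize_mul_inner_normalize_mul (q w : E d) {g : ℝ → ℝ} {h : E d → ℝ}
    (hg : ∀ p, h (polarPt (alpha d a b) p) = g p.1) :
    ∫ x, inner ℝ (‖x‖⁻¹ • x) q * inner ℝ (‖x‖⁻¹ • x) w * h x ∂(mu d a b)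
      = inner ℝ q w / d * ∫ x, h x ∂(mu d a b) := by
  rw [integral_mu_of_prod hd hab hα g (fun y => inner ℝ (y : E d) q * inner ℝ (y : E d) w)
    (fun p => by rw [normalize_polarPt, hg, mul_comm]), integral_surf_inner_mul_inner (by omega),
    integral_mu_of_prod hd hab hα g (fun _ => 1) (fun p => by rw [hg, mul_one]), integral_const]
  change _ = _ * (_ * (_ * (area d * 1)))
  ring

lemma integral_sechLog_sq : ∫ x, sechLog d a b x ^ 2 ∂(mu d a b) = d * sechNorm d a b := by
  have h0 := integral_wt_nDim_pos hd hab hα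
  have ha := area_pos (d := d) (by omega)
  have hd' : (0 : ℝ) < d := by exact_mod_cast (by omega : 0 < d)
  rw [integral_mu_of_prod hd hab hα (fun t => ((Real.cosh t)⁻¹) ^ 2) (fun _ => 1)
    (fun p => by rw [sechLog_polarPt hα, mul_one]), sechNorm, integral_const]
  have e : ∀ t, wt (nDim d a b) t * ((Real.cosh t)⁻¹) ^ 2 = wt (nDim d a b + 2) t := fun t => by
    rw [wt_add_two, inv_pow, one_sub_tanh_sq]
  simp only [e]
  change _ * (_ * (area d * 1)) = _
  field_simp

end Moments

/-- Bounded measurable functions. -/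
structure IsBddMeas {X : Type*} [MeasurableSpace X] (h : X → ℝ) : Prop where
  meas : Measurable h
  bdd : ∃ B, ∀ x, ‖h x‖ ≤ B

namespace IsBddMeas

variable {X : Type*} [MeasurableSpace X] {g h : X → ℝ} {μ : Measure X}

lemma const (c : ℝ) : IsBddMeas fun _ : X => c := ⟨measurable_const, ‖c‖, fun _ => le_rfl⟩

lemma mul (hg : IsBddMeas g) (hh : IsBddMeas h) : IsBddMeas fun x => g x * h x := by
  obtain ⟨B, hB⟩ := hg.bdd
  obtain ⟨C, hC⟩ := hh.bdd
  refine ⟨hg.meas.mul hh.meas, B * C, fun x => ?_⟩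
  rw [norm_mul]
  exact mul_le_mul (hB x) (hC x) (norm_nonneg _) ((norm_nonneg _).trans (hB x))

lemma add (hg : IsBddMeas g) (hh : IsBddMeas h) : IsBddMeas fun x => g x + h x := by
  obtain ⟨B, hB⟩ := hg.bdd
  obtain ⟨C, hC⟩ := hh.bdd
  exact ⟨hg.meas.add hh.meas, B + C, fun x => norm_add_le_of_le (hB x) (hC x)⟩

lemma sq (hg : IsBddMeas g) : IsBddMeas fun x => g x ^ 2 := by
  simpa only [pow_two] using hg.mul hg

lemma memLp [IsFiniteMeasure μ] (hg : IsBddMeas g) {p : ENNReal} : MemLp g p μ := by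
  obtain ⟨B, hB⟩ := hg.bdd
  exact MemLp.of_bound hg.meas.aestronglyMeasurable B (Eventually.of_forall hB)

lemma integrable [IsFiniteMeasure μ] (hg : IsBddMeas g) : Integrable g μ :=
  memLp_one_iff_integrable.1 hg.memLp

lemma mul_integrable (hg : IsBddMeas g) {f : X → ℝ} (hf : Integrable f μ) :
    Integrable (fun x => f x * g x) μ := by
  obtain ⟨B, hB⟩ := hg.bdd
  exact hf.mul_bdd (c := B) hg.meas.aestronglyMeasurable (Eventually.of_forall hB)

end IsBddMeas

/-! ### Projections onto the span of the candidate extremals. -/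

section Extremal

variable {d : ℕ} {a b : ℝ}

/-- The functions `l + m tanh (α ln |x|) + ⟨q, x / |x|⟩ / cosh (α ln |x|)`. -/
def extremalFn (d : ℕ) (a b l m : ℝ) (q x : E d) : ℝ :=
  l + m * tanhLog d a b x + inner ℝ (‖x‖⁻¹ • x) q * sechLog d a b x

lemma isBddMeas_tanhLog : IsBddMeas (tanhLog d a b) := ⟨measurable_tanhLog, 1, abs_tanhLog_le⟩

lemma isBddMeas_sechLog : IsBddMeas (sechLog d a b) := ⟨measurable_sechLog, 1, norm_sechLog_le⟩

lemma isBddMeas_inner_normalize (q : E d) : IsBddMeas fun x : E d => inner ℝ (‖x‖⁻¹ • x) q := by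
  refine ⟨by fun_prop, ‖q‖, fun x => (norm_inner_le_norm _ _).trans ?_⟩
  exact mul_le_of_le_one_left (norm_nonneg _) (norm_normalize_le x)

lemma isBddMeas_extremalFn (l m : ℝ) (q : E d) : IsBddMeas (extremalFn d a b l m q) :=
  ((IsBddMeas.const l).add ((IsBddMeas.const m).mul isBddMeas_tanhLog)).add
    ((isBddMeas_inner_normalize q).mul isBddMeas_sechLog)

lemma integral_mul_extremalFn {f : E d → ℝ} (hf : Integrable f (mu d a b)) (l m : ℝ) (q : E d) :
    ∫ x, f x * extremalFn d a b l m q x ∂(mu d a b)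
      = l * (∫ x, f x ∂(mu d a b)) + m * tanhMoment d a b f + inner ℝ (sechMoment d a b f) q := by
  have hT := (isBddMeas_tanhLog (a := a) (b := b)).mul_integrable hf
  have hS := (isBddMeas_sechLog (a := a) (b := b)).mul_integrable hf
  have hv : Integrable (fun x => (f x * sechLog d a b x) • (‖x‖⁻¹ • x)) (mu d a b) :=
    hS.smul_bdd 1 (Measurable.aestronglyMeasurable (by fun_prop))
      (Eventually.of_forall norm_normalize_le)
  have e : ∀ x, f x * extremalFn d a b l m q x = l * f x + m * (f x * tanhLog d a b x)
      + inner ℝ q ((f x * sechLog d a b x) • (‖x‖⁻¹ • x)) := fun x => by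
    rw [extremalFn, real_inner_smul_right, real_inner_comm]; ring
  simp only [e]
  rw [integral_add (by exact (hf.const_mul l).add (hT.const_mul m)) (by exact hv.const_inner q),
    integral_add (by exact hf.const_mul l) (by exact hT.const_mul m), integral_const_mul,
    integral_const_mul, integral_inner hv, real_inner_comm, tanhMoment, sechMoment]

variable (hd : 3 ≤ d) (hab : (a, b) ∈ Theta d) (hα : 0 < alpha d a b)
include hd hab hα

lemma integral_extremalFn (l m : ℝ) (q : E d) :
    ∫ x, extremalFn d a b l m q x ∂(mu d a b) = l := by
  have := isProbabilityMeasure_mu hd hab hα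
  simp only [extremalFn]
  rw [integral_add
      (by exact ((IsBddMeas.const l).add ((IsBddMeas.const m).mul isBddMeas_tanhLog)).integrable)
      (by exact ((isBddMeas_inner_normalize q).mul isBddMeas_sechLog).integrable),
    integral_add (by exact (IsBddMeas.const l).integrable)
      (by exact ((IsBddMeas.const m).mul isBddMeas_tanhLog).integrable), integral_const_mul,
    integral_tanhLog hd hab hα,
    integral_inner_normalize_mul hd hab hα q (g := fun t => (Real.cosh t)⁻¹) (sechLog_polarPt hα)]
  simp

lemma integral_extremalFn_sq (l m : ℝ) (q : E d) :
    ∫ x, extremalFn d a b l m q x ^ 2 ∂(mu d a b)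
      = l ^ 2 + m ^ 2 * tanhNorm d a b + sechNorm d a b * ‖q‖ ^ 2 := by
  have := isProbabilityMeasure_mu hd hab hα
  have hd' : (0 : ℝ) < d := by exact_mod_cast (by omega : 0 < d)
  have e : ∀ x, extremalFn d a b l m q x ^ 2 = l ^ 2 + (2 * l * m) * tanhLog d a b x
      + m ^ 2 * tanhLog d a b x ^ 2
      + inner ℝ (‖x‖⁻¹ • x) q * (2 * l * sechLog d a b x + 2 * m * (tanhLog d a b x * sechLog d a b x))
      + inner ℝ (‖x‖⁻¹ • x) q * inner ℝ (‖x‖⁻¹ • x) q * sechLog d a b x ^ 2 := fun x => by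
    rw [extremalFn]; ring
  have hT := isBddMeas_tanhLog (d := d) (a := a) (b := b)
  have hS := isBddMeas_sechLog (d := d) (a := a) (b := b)
  have hq := isBddMeas_inner_normalize q
  have h1 := (IsBddMeas.const (X := E d) (l ^ 2))
  have h2 := (IsBddMeas.const (2 * l * m)).mul hT
  have h3 := (IsBddMeas.const (m ^ 2)).mul hT.sq
  have h4 := hq.mul (((IsBddMeas.const (2 * l)).mul hS).add ((IsBddMeas.const (2 * m)).mul (hT.mul hS)))
  have h5 := (hq.mul hq).mul hS.sq
  simp only [e]
  rw [integral_add (by exact (((h1.add h2).add h3).add h4).integrable) (by exact h5.integrable),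
    integral_add (by exact ((h1.add h2).add h3).integrable) (by exact h4.integrable),
    integral_add (by exact (h1.add h2).integrable) (by exact h3.integrable),
    integral_add (by exact h1.integrable) (by exact h2.integrable), integral_const_mul,
    integral_const_mul, integral_tanhLog hd hab hα, integral_tanhLog_sq hd hab hα,
    integral_inner_normalize_mul hd hab hα q
      (g := fun t => 2 * l * (Real.cosh t)⁻¹ + 2 * m * (Real.tanh t * (Real.cosh t)⁻¹))
      (fun p => by rw [sechLog_polarPt hα, tanhLog_polarPt hα]),
    integral_inner_normalize_mul_inner_normalize_mul hd hab hα q q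
      (g := fun t => (Real.cosh t)⁻¹ ^ 2) (fun p => by rw [sechLog_polarPt hα]),
    integral_sechLog_sq hd hab hα, real_inner_self_eq_norm_sq]
  simp only [integral_const, probReal_univ, smul_eq_mul]
  field_simp
  ring

lemma var_extremalFn (l m : ℝ) (q : E d) :
    var d a b (extremalFn d a b l m q) = m ^ 2 * tanhNorm d a b + sechNorm d a b * ‖q‖ ^ 2 := by
  rw [var, integral_extremalFn hd hab hα, integral_extremalFn_sq hd hab hα]
  ring

lemma integral_sub_extremalFn_sq {f : E d → ℝ} (hf : MemLp f 2 (mu d a b)) (l m : ℝ) (q : E d) :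
    ∫ x, (f x - extremalFn d a b l m q x) ^ 2 ∂(mu d a b)
      = (∫ x, f x ^ 2 ∂(mu d a b)) - 2 * (l * (∫ x, f x ∂(mu d a b)) + m * tanhMoment d a b f
          + inner ℝ (sechMoment d a b f) q)
        + (l ^ 2 + m ^ 2 * tanhNorm d a b + sechNorm d a b * ‖q‖ ^ 2) := by
  have := isProbabilityMeasure_mu hd hab hα
  have hi := hf.integrable one_le_two
  have hf2 : Integrable (fun x => f x ^ 2) (mu d a b) := by
    simpa only [Real.norm_eq_abs, sq_abs] using hf.integrable_norm_sq
  have hg := isBddMeas_extremalFn (a := a) (b := b) l m q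
  have e : ∀ x, (f x - extremalFn d a b l m q x) ^ 2 = f x ^ 2
      - 2 * (f x * extremalFn d a b l m q x) + extremalFn d a b l m q x ^ 2 := fun x => by ring
  simp only [e]
  rw [integral_add (by exact hf2.sub ((hg.mul_integrable hi).const_mul 2)) (by exact hg.sq.integrable),
    integral_sub hf2 (by exact (hg.mul_integrable hi).const_mul 2), integral_const_mul,
    integral_mul_extremalFn hi, integral_extremalFn_sq hd hab hα]

lemma integral_sub_projection_sq {f : E d → ℝ} (hf : MemLp f 2 (mu d a b)) :
    ∫ x, (f x - extremalFn d a b (∫ x, f x ∂(mu d a b)) (tanhMoment d a b f / tanhNorm d a b)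
      0 x) ^ 2 ∂(mu d a b) = residual d a b f := by
  have h1 := tanhNorm_pos hd hab hα
  rw [integral_sub_extremalFn_sq hd hab hα hf, residual, var, inner_zero_right, norm_zero]
  field_simp
  ring

/-- The functions 1, tanh and ⟨e_i, x/|x|⟩/cosh are orthogonal in L²(μ), with norms 1, `tanhNorm`
and `sechNorm`. Moments divided by norms are thus the coefficients of the projection, which makes
`residual'` a genuine squared distance. -/
lemma integral_sub_projection'_sq {f : E d → ℝ} (hf : MemLp f 2 (mu d a b)) :
    ∫ x, (f x - extremalFn d a b (∫ x, f x ∂(mu d a b)) (tanhMoment d a b f / tanhNorm d a b)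
      ((sechNorm d a b)⁻¹ • sechMoment d a b f) x) ^ 2 ∂(mu d a b) = residual' d a b f := by
  have h1 := tanhNorm_pos hd hab hα
  have h2 := sechNorm_pos hd hab hα
  rw [integral_sub_extremalFn_sq hd hab hα hf, residual', residual, var, real_inner_smul_right,
    real_inner_self_eq_norm_sq, norm_smul, Real.norm_of_nonneg (inv_nonneg.2 h2.le)]
  field_simp
  ring

lemma residual_nonneg {f : E d → ℝ} (hf : MemLp f 2 (mu d a b)) : 0 ≤ residual d a b f := by
  rw [← integral_sub_projection_sq hd hab hα hf]
  exact integral_nonneg fun x => sq_nonneg _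

lemma residual'_nonneg {f : E d → ℝ} (hf : MemLp f 2 (mu d a b)) : 0 ≤ residual' d a b f := by
  rw [← integral_sub_projection'_sq hd hab hα hf]
  exact integral_nonneg fun x => sq_nonneg _

lemma ae_eq_extremalFn_of_integral_eq_zero {f : E d → ℝ} (hf : MemLp f 2 (mu d a b)) {l m : ℝ}
    {q : E d} (h : ∫ x, (f x - extremalFn d a b l m q x) ^ 2 ∂(mu d a b) = 0) :
    f =ᵐ[volume] extremalFn d a b l m q := by
  have := isProbabilityMeasure_mu hd hab hα
  have hs := hf.sub (isBddMeas_extremalFn (a := a) (b := b) l m q).memLp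
  have hi : Integrable (fun x => (f x - extremalFn d a b l m q x) ^ 2) (mu d a b) := by
    simpa only [Real.norm_eq_abs, sq_abs, Pi.sub_apply] using hs.integrable_norm_sq
  rw [integral_eq_zero_iff_of_nonneg (fun x => sq_nonneg _) hi] at h
  refine (absolutelyContinuous_mu hd hab hα).ae_le (h.mono fun x hx => ?_)
  exact sub_eq_zero.1 (pow_eq_zero_iff two_ne_zero |>.1 hx)

end Extremal

/-! ### From test functions to H¹: inequality and equality cases. -/

section Limit

variable {d : ℕ} {a b : ℝ} (hd : 3 ≤ d) (hab : (a, b) ∈ Theta d) (hα : 0 < alpha d a b)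
include hd hab hα

lemma tendsto_functionals {f : E d → ℝ} {u : ℕ → E d → ℝ} (hu : ∀ k, MemLp (u k) 2 (mu d a b))
    (hf : MemLp f 2 (mu d a b))
    (hlim : Tendsto (fun k => ∫ x, (u k x - f x) ^ 2 ∂(mu d a b)) atTop (𝓝 0)) :
    Tendsto (fun k => var d a b (u k)) atTop (𝓝 (var d a b f)) ∧
    Tendsto (fun k => tanhMoment d a b (u k)) atTop (𝓝 (tanhMoment d a b f)) ∧
    Tendsto (fun k => sechMoment d a b (u k)) atTop (𝓝 (sechMoment d a b f)) := by
  have := isProbabilityMeasure_mu hd hab hα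
  have sq_eq : ∀ x : ℝ, ‖x‖ ^ 2 = x ^ 2 := fun x => by rw [Real.norm_eq_abs, sq_abs]
  refine ⟨?_, ?_, ?_⟩
  · have h1 := tendsto_integral_norm_sq hu hf (by simpa only [sq_eq] using hlim)
    have h2 := tendsto_integral_smul_of_norm_le_one hu hf hlim (g := fun _ => (1 : ℝ))
      aestronglyMeasurable_const (fun _ => by simp)
    simp only [sq_eq] at h1
    simp only [smul_eq_mul, mul_one] at h2
    exact h1.sub (h2.pow 2)
  · exact tendsto_integral_smul_of_norm_le_one hu hf hlim
      measurable_tanhLog.aestronglyMeasurable abs_tanhLog_le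
  · have h := tendsto_integral_smul_of_norm_le_one hu hf hlim
      (g := fun x => sechLog d a b x • (‖x‖⁻¹ • x))
      (measurable_sechLog.aestronglyMeasurable.smul
        (Measurable.aestronglyMeasurable (by fun_prop))) (fun x => by
        rw [norm_smul]
        exact mul_le_one₀ (norm_sechLog_le x) (norm_nonneg _) (norm_normalize_le x))
    simpa only [sechMoment, mul_smul] using h

/-- The spectral gap in `H¹`. -/
theorem IsH1.residual_le_deficit (hFS : alpha d a b ^ 2 * (nDim d a b - 1) ≤ d - 1) {f : E d → ℝ}
    {G : E d → E d} (h : IsH1 d a b f G) :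
    min (alpha d a b ^ 2 * (nDim d a b + 2)) ((d : ℝ) / 8) * residual' d a b f
      ≤ deficit d a b f G ∧
    min (alpha d a b ^ 2 * (nDim d a b + 2)) ((d : ℝ) - 1 - alpha d a b ^ 2 * (nDim d a b - 1))
        * residual d a b f
      ≤ deficit d a b f G := by
  obtain ⟨u, hu, hR, h1, h2⟩ := h.exists_approx hd hab hα
  choose R hR using hR
  have hm := fun k => memLp_of_tsupport_annulus hd hab hα (hu k) (hR k)
  have hGm := aestronglyMeasurable_of_locallyIntegrableOn (by omega) h.weakGradient.locInt_grad
  obtain ⟨t1, t2, t3⟩ := tendsto_functionals hd hab hα (fun k => (hm k).1) h.memLp h1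
  have t4 := tendsto_integral_carre le_rfl (fun k => (hm k).2)
    (memLp_sqrt_carreWt_smul hGm h.integrable_carre) h2
  have td : Tendsto (fun k => deficit d a b (u k) (gradient (u k))) atTop (𝓝 (deficit d a b f G)) :=
    t4.sub (t1.const_mul _)
  have tr : Tendsto (fun k => residual d a b (u k)) atTop (𝓝 (residual d a b f)) :=
    t1.sub ((t2.pow 2).div_const _)
  have tr' : Tendsto (fun k => residual' d a b (u k)) atTop (𝓝 (residual' d a b f)) :=
    tr.sub ((t3.norm.pow 2).div_const _)
  have hk := fun k => CKN.residual_le_deficit hd hab hα hFS ((hu k).of_le (by norm_cast))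
    (hasCompactSupport_of_tsupport_annulus (hR k)) ((hR k).trans (annulus_subset _))
  exact ⟨le_of_tendsto_of_tendsto' (tr'.const_mul _) td fun k => (hk k).1,
    le_of_tendsto_of_tendsto' (tr.const_mul _) td fun k => (hk k).2⟩

lemma alpha_sq_mul_le_iff :
    alpha d a b ^ 2 ≤ ((d : ℝ) - 1) / (nDim d a b - 1)
      ↔ alpha d a b ^ 2 * (nDim d a b - 1) ≤ d - 1 :=
  le_div_iff₀ (by linarith [nDim_ge hd hab hα])

lemma deficit_eq_zero_iff {f : E d → ℝ} {G : E d → E d} :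
    deficit d a b f G = 0 ↔ var d a b f
      = 1 / (nDim d a b * alpha d a b ^ 2) * ∫ x, carre d a b G x ∂(mu d a b) := by
  have hn : 0 < nDim d a b := by linarith [nDim_ge hd hab hα]
  rw [deficit, one_div, inv_mul_eq_div, eq_div_iff (by positivity), sub_eq_zero, eq_comm,
    mul_comm (var d a b f)]

lemma deficit_nonneg_iff {f : E d → ℝ} {G : E d → E d} :
    0 ≤ deficit d a b f G ↔ var d a b f
      ≤ 1 / (nDim d a b * alpha d a b ^ 2) * ∫ x, carre d a b G x ∂(mu d a b) := by
  have hn : 0 < nDim d a b := by linarith [nDim_ge hd hab hα]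
  rw [deficit, one_div, inv_mul_eq_div, le_div_iff₀ (by positivity), sub_nonneg,
    mul_comm (var d a b f)]

/-- In the bound on the deficit, a positive constant multiplies the squared distance `residual'`. -/
theorem poincare_of_alpha_sq_le (hFS : alpha d a b ^ 2 * (nDim d a b - 1) ≤ d - 1) :
    Poincare d a b (1 / (nDim d a b * alpha d a b ^ 2)) := fun f G h => by
  have hn : 0 < nDim d a b := by linarith [nDim_ge hd hab hα]
  rw [← deficit_nonneg_iff hd hab hα]
  refine le_trans (mul_nonneg (le_min (by positivity) (by positivity))
    (residual'_nonneg hd hab hα h.memLp)) (h.residual_le_deficit hd hab hα hFS).1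

theorem IsExtremal.exists_extremalFn (hFS : alpha d a b ^ 2 * (nDim d a b - 1) ≤ d - 1)
    {f : E d → ℝ} (h : IsExtremal d a b (1 / (nDim d a b * alpha d a b ^ 2)) f) :
    ∃ l m q, f =ᵐ[volume] extremalFn d a b l m q := by
  obtain ⟨G, h, he⟩ := h
  have hn : 0 < nDim d a b := by linarith [nDim_ge hd hab hα]
  have hd' : (0 : ℝ) < d := by exact_mod_cast (by omega : 0 < d)
  rw [← deficit_eq_zero_iff hd hab hα] at he
  have h1 := (h.residual_le_deficit hd hab hα hFS).1
  rw [he] at h1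
  -- Zero deficit forces the squared distance to vanish, the minimum being positive under the
  -- non-strict condition.
  have h2 := nonpos_of_mul_nonpos_right h1 (lt_min (by positivity) (by positivity))
  have h3 := h2.antisymm (residual'_nonneg hd hab hα h.memLp)
  rw [← integral_sub_projection'_sq hd hab hα h.memLp] at h3
  exact ⟨_, _, _, ae_eq_extremalFn_of_integral_eq_zero hd hab hα h.memLp h3⟩

theorem IsExtremal.exists_extremalFn_zero (hFS : alpha d a b ^ 2 * (nDim d a b - 1) < d - 1)
    {f : E d → ℝ} (h : IsExtremal d a b (1 / (nDim d a b * alpha d a b ^ 2)) f) :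
    ∃ l m, f =ᵐ[volume] extremalFn d a b l m 0 := by
  obtain ⟨G, h, he⟩ := h
  have hn : 0 < nDim d a b := by linarith [nDim_ge hd hab hα]
  rw [← deficit_eq_zero_iff hd hab hα] at he
  have h1 := (h.residual_le_deficit hd hab hα hFS.le).2
  rw [he] at h1
  -- The minimum is positive precisely thanks to the strict inequality, which excludes the angular
  -- functions.
  have h2 := nonpos_of_mul_nonpos_right h1 (lt_min (by positivity) (by linarith))
  have h3 := h2.antisymm (residual_nonneg hd hab hα h.memLp)
  rw [← integral_sub_projection_sq hd hab hα h.memLp] at h3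
  exact ⟨_, _, ae_eq_extremalFn_of_integral_eq_zero hd hab hα h.memLp h3⟩

end Limit

/-! ### Weak gradients and energy of the explicit functions. -/

section Classical

variable {d : ℕ} {a b : ℝ}

lemma integral_fderiv_eq_zero {p : E d → ℝ} (hp : ContDiff ℝ 1 p) (hs : HasCompactSupport p)
    (v : E d) : ∫ x, fderiv ℝ p x v = 0 := by
  have hc : Continuous fun x => fderiv ℝ p x v :=
    (hp.continuous_fderiv one_ne_zero).clm_apply continuous_const
  have h := integral_mul_fderiv_eq_neg_fderiv_mul_of_integrable (μ := (volume : Measure (E d)))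
    (f := fun _ : E d => (1 : ℝ)) (g := p) (v := v) (by simp)
    (by simpa using hc.integrable_of_hasCompactSupport (hs.fderiv_apply (𝕜 := ℝ) v))
    (by simpa using hp.continuous.integrable_of_hasCompactSupport hs)
    (fun x _ => differentiableAt_const _) (fun x _ => hp.differentiable one_ne_zero x)
  simpa using h

/-- Classical gradients are weak gradients. -/
theorem isWeakGradient_gradient (hd : 0 < d) {f : E d → ℝ} (hf : ContDiffOn ℝ 1 f {0}ᶜ) :
    IsWeakGradient f (gradient f) := by
  have := nontrivial_euclidean hd
  have hm : MeasurableSet ({0}ᶜ : Set (E d)) := (measurableSet_singleton 0).compl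
  refine ⟨hf.continuousOn.locallyIntegrableOn hm, (continuousOn_gradient hf).locallyIntegrableOn hm,
    fun ψ hψ hs h0 v => ?_⟩
  have hψ1 : ContDiff ℝ 1 ψ := hψ.of_le (by norm_cast)
  have hp : ContDiff ℝ 1 fun x => ψ x * f x :=
    contDiff_mul_of_tsupport isOpen_compl_singleton hψ1 h0 hf
  have hl1 := hf.continuousOn.locallyIntegrableOn (μ := volume) hm
  have hl2 := (continuousOn_gradient hf).locallyIntegrableOn (μ := volume) hm
  have i1 : Integrable fun x => f x * fderiv ℝ ψ x v :=
    integrable_smul_of_tsupport' hl1 ((hψ1.continuous_fderiv one_ne_zero).clm_apply continuous_const)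
      (hs.fderiv_apply (𝕜 := ℝ) v) ((tsupport_fderiv_apply_subset ℝ v).trans h0)
  have i2 : Integrable fun x => inner ℝ (gradient f x) v * ψ x := by
    have := (integrable_smul_of_tsupport hl2 hψ.continuous hs h0).inner_const (𝕜 := ℝ) v
    refine this.congr (Eventually.of_forall fun x => ?_)
    simp only [real_inner_smul_left, mul_comm]
  have h := integral_fderiv_eq_zero hp hs.mul_right v
  have e : ∀ᵐ x : E d, fderiv ℝ (fun x => ψ x * f x) x v
      = f x * fderiv ℝ ψ x v + inner ℝ (gradient f x) v * ψ x := by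
    filter_upwards [ae_ne_zero (E d)] with x hx
    have hfx := (hf.differentiableOn one_ne_zero).differentiableAt
      (isOpen_compl_singleton.mem_nhds hx)
    rw [fderiv_fun_mul (hψ1.differentiable one_ne_zero x) hfx, inner_gradient_left]
    simp [add_apply, smul_apply]
    ring
  rw [integral_congr_ae e, integral_add i1 i2] at h
  linarith

lemma IsWeakGradient.congr_ae {f g : E d → ℝ} {G : E d → E d} (h : IsWeakGradient f G)
    (hfg : f =ᵐ[volume] g) : IsWeakGradient g G := by
  refine ⟨h.locInt.congr (ae_restrict_of_ae hfg), h.locInt_grad, fun ψ hψ hs h0 v => ?_⟩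
  rw [← h.by_parts ψ hψ hs h0 v]
  refine integral_congr_ae (hfg.mono fun x hx => ?_)
  simp only [hx]

lemma IsH1.congr_ae {f g : E d → ℝ} {G : E d → E d} (h : IsH1 d a b f G)
    (hfg : f =ᵐ[volume] g) : IsH1 d a b g G :=
  ⟨(memLp_congr_ae (mu_absolutelyContinuous.ae_le hfg)).1 h.memLp, h.weakGradient.congr_ae hfg,
    h.integrable_carre⟩

lemma var_congr_ae {f g : E d → ℝ} (hfg : f =ᵐ[volume] g) : var d a b f = var d a b g := by
  have h : f =ᵐ[mu d a b] g := mu_absolutelyContinuous.ae_le hfg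
  rw [var, var, integral_congr_ae h]
  congr 1
  exact integral_congr_ae (h.mono fun x hx => by simp only [hx])

lemma IsExtremal.congr_ae {C : ℝ} {f g : E d → ℝ} (h : IsExtremal d a b C f)
    (hfg : f =ᵐ[volume] g) : IsExtremal d a b C g := by
  obtain ⟨G, hG, he⟩ := h
  exact ⟨G, hG.congr_ae hfg, by rw [← var_congr_ae hfg, he]⟩

lemma contDiffOn_alpha_mul_log : ContDiffOn ℝ ∞ (fun x : E d => alpha d a b * Real.log ‖x‖) {0}ᶜ :=
  fun _ hx => (contDiffAt_const.mul ((contDiffAt_norm ℝ hx).log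
    (norm_ne_zero_iff.2 hx))).contDiffWithinAt

lemma contDiffOn_extremalFn (l m : ℝ) (q : E d) :
    ContDiffOn ℝ ∞ (extremalFn d a b l m q) {0}ᶜ := by
  have h := contDiffOn_alpha_mul_log (d := d) (a := a) (b := b)
  have hc : ContDiffOn ℝ ∞ (sechLog d a b) {0}ᶜ :=
    (Real.contDiff_cosh.comp_contDiffOn h).inv fun x _ => (Real.cosh_pos _).ne'
  have ht : ContDiffOn ℝ ∞ (tanhLog d a b) {0}ᶜ := by
    have : tanhLog d a b = fun x => Real.sinh (alpha d a b * Real.log ‖x‖)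
        / Real.cosh (alpha d a b * Real.log ‖x‖) :=
      funext fun x => Real.tanh_eq_sinh_div_cosh _
    rw [this]
    exact (Real.contDiff_sinh.comp_contDiffOn h).div (Real.contDiff_cosh.comp_contDiffOn h)
      fun x _ => (Real.cosh_pos _).ne'
  have hi : ContDiffOn ℝ ∞ (fun x : E d => (inner ℝ (‖x‖⁻¹ • x) q : ℝ)) {0}ᶜ := fun x hx =>
    ((((contDiffAt_norm ℝ hx).inv (norm_ne_zero_iff.2 hx)).smul contDiffAt_id).inner ℝ
      contDiffAt_const).contDiffWithinAt
  exact (contDiffOn_const.add (contDiffOn_const.mul ht)).add (hi.mul hc)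

lemma hasFDerivAt_tanhLog {x : E d} (hx : x ≠ 0) :
    HasFDerivAt (tanhLog d a b)
      ((sechLog d a b x ^ 2 * alpha d a b * (‖x‖ ^ 2)⁻¹) • innerSL ℝ x) x := by
  have h := (hasDerivAt_tanh (alpha d a b * Real.log ‖x‖)).comp_hasFDerivAt x
    ((hasFDerivAt_log_norm hx).const_mul (alpha d a b))
  refine h.congr_fderiv ?_
  rw [smul_smul, smul_smul, one_sub_tanh_sq, sechLog, inv_pow]

lemma hasFDerivAt_sechLog {x : E d} (hx : x ≠ 0) :
    HasFDerivAt (sechLog d a b)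
      ((-(tanhLog d a b x * sechLog d a b x * alpha d a b * (‖x‖ ^ 2)⁻¹)) • innerSL ℝ x) x := by
  have h := ((Real.hasDerivAt_cosh (alpha d a b * Real.log ‖x‖)).inv
    (Real.cosh_pos _).ne').comp_hasFDerivAt x
    ((hasFDerivAt_log_norm hx).const_mul (alpha d a b))
  refine h.congr_fderiv ?_
  rw [smul_smul, smul_smul, sechLog, tanhLog, Real.tanh_eq_sinh_div_cosh]
  congr 1
  have := (Real.cosh_pos (alpha d a b * Real.log ‖x‖)).ne'
  field_simp

lemma hasFDerivAt_inner_normalize {x : E d} (hx : x ≠ 0) (q : E d) :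
    HasFDerivAt (fun z : E d => (inner ℝ (‖z‖⁻¹ • z) q : ℝ))
      (‖x‖⁻¹ • innerSL ℝ q - (inner ℝ (‖x‖⁻¹ • x) q * (‖x‖ ^ 2)⁻¹) • innerSL ℝ x) x := by
  have hn := norm_ne_zero_iff.2 hx
  have h1 := (hasDerivAt_inv hn).comp_hasFDerivAt x (hasFDerivAt_norm hx)
  have h2 := HasFDerivAt.mul h1 (innerSL ℝ q).hasFDerivAt
  have e : (fun z : E d => (inner ℝ (‖z‖⁻¹ • z) q : ℝ))
      = fun z => ((fun y => y⁻¹) ∘ fun z => ‖z‖) z * innerSL ℝ q z := by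
    funext z
    rw [real_inner_smul_left, innerSL_apply_apply, real_inner_comm]; rfl
  rw [e]
  refine h2.congr_fderiv ?_
  ext v
  simp only [Function.comp_apply, add_apply, sub_apply, smul_apply, innerSL_apply_apply, smul_eq_mul,
    real_inner_smul_left, real_inner_comm x q]
  ring

lemma gradient_extremalFn {x : E d} (hx : x ≠ 0) (l m : ℝ) (q : E d) :
    gradient (extremalFn d a b l m q) x = ‖x‖⁻¹ •
      ((alpha d a b * (m * sechLog d a b x ^ 2
          - inner ℝ (‖x‖⁻¹ • x) q * (tanhLog d a b x * sechLog d a b x))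
        - sechLog d a b x * inner ℝ (‖x‖⁻¹ • x) q) • (‖x‖⁻¹ • x) + sechLog d a b x • q) := by
  have h : HasFDerivAt (extremalFn d a b l m q) _ x :=
    ((hasFDerivAt_tanhLog (a := a) (b := b) hx).const_mul m |>.const_add l).add
    ((hasFDerivAt_inner_normalize hx q).mul (hasFDerivAt_sechLog (a := a) (b := b) hx))
  refine ext_inner_right ℝ fun v => ?_
  rw [inner_gradient_left, h.fderiv]
  simp only [add_apply, sub_apply, smul_apply, innerSL_apply_apply, smul_eq_mul,
    real_inner_smul_left, inner_add_left]
  field_simp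
  ring

/-- The three pieces are α² cosh² f_t² and the squared tangential component of q; multiplied by
cosh², everything becomes a bounded function, which puts the extremals in H¹. -/
lemma carre_gradient_extremalFn {x : E d} (hx : x ≠ 0) (l m : ℝ) (q : E d) :
    carre d a b (gradient (extremalFn d a b l m q)) x
      = alpha d a b ^ 2 * (m * sechLog d a b x - inner ℝ (‖x‖⁻¹ • x) q * tanhLog d a b x) ^ 2
        + ‖q‖ ^ 2 - inner ℝ (‖x‖⁻¹ • x) q ^ 2 := by
  have hn := norm_ne_zero_iff.2 hx
  have hθ : ‖‖x‖⁻¹ • x‖ = 1 := by rw [norm_smul, norm_inv, norm_norm, inv_mul_cancel₀ hn]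
  have hS : Real.cosh (alpha d a b * Real.log ‖x‖) = (sechLog d a b x)⁻¹ := by
    rw [sechLog, inv_inv]
  have hS0 : sechLog d a b x ≠ 0 := inv_ne_zero (Real.cosh_pos _).ne'
  rw [carre_eq, carreWt_eq hx, gradient_extremalFn hx, norm_smul, hS]
  set θ := ‖x‖⁻¹ • x with hθdef
  clear_value θ
  rw [mul_pow, norm_add_sq_real, norm_smul, norm_smul, hθ, real_inner_smul_left,
    real_inner_smul_right, mul_pow, mul_pow, Real.norm_eq_abs, Real.norm_eq_abs, Real.norm_eq_abs,
    sq_abs, sq_abs, sq_abs]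
  field_simp
  ring

variable (hd : 3 ≤ d) (hab : (a, b) ∈ Theta d) (hα : 0 < alpha d a b)
include hd hab hα

lemma isH1_extremalFn (l m : ℝ) (q : E d) :
    IsH1 d a b (extremalFn d a b l m q) (gradient (extremalFn d a b l m q)) ∧
    ∫ x, carre d a b (gradient (extremalFn d a b l m q)) x ∂(mu d a b)
      = alpha d a b ^ 2 * (m ^ 2 * (d * sechNorm d a b) + ‖q‖ ^ 2 / d * tanhNorm d a b)
        + (1 - 1 / d) * ‖q‖ ^ 2 := by
  have := isProbabilityMeasure_mu hd hab hα
  have := nontrivial_euclidean (d := d) (by omega)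
  have hd' : (0 : ℝ) < d := by exact_mod_cast (by omega : 0 < d)
  have hae : ∀ᵐ x ∂(mu d a b), x ≠ 0 := mu_absolutelyContinuous.ae_le (ae_ne_zero (E d))
  have hT := isBddMeas_tanhLog (d := d) (a := a) (b := b)
  have hS := isBddMeas_sechLog (d := d) (a := a) (b := b)
  have hq := isBddMeas_inner_normalize q
  have h1 := (IsBddMeas.const (alpha d a b ^ 2 * m ^ 2)).mul hS.sq
  have h2 := (IsBddMeas.const (-2 * alpha d a b ^ 2 * m)).mul (hq.mul (hT.mul hS))
  have h3 := (IsBddMeas.const (alpha d a b ^ 2)).mul ((hq.mul hq).mul hT.sq)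
  have h4 := IsBddMeas.const (X := E d) (‖q‖ ^ 2)
  have h5 := (IsBddMeas.const (-1)).mul ((hq.mul hq).mul (IsBddMeas.const (1 : ℝ)))
  have e : (fun x => alpha d a b ^ 2 * m ^ 2 * sechLog d a b x ^ 2
      + -2 * alpha d a b ^ 2 * m * (inner ℝ (‖x‖⁻¹ • x) q * (tanhLog d a b x * sechLog d a b x))
      + alpha d a b ^ 2 * (inner ℝ (‖x‖⁻¹ • x) q * inner ℝ (‖x‖⁻¹ • x) q * tanhLog d a b x ^ 2)
      + ‖q‖ ^ 2 + -1 * (inner ℝ (‖x‖⁻¹ • x) q * inner ℝ (‖x‖⁻¹ • x) q * 1))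
      =ᵐ[mu d a b] carre d a b (gradient (extremalFn d a b l m q)) :=
    hae.mono fun x hx => by
      rw [carre_gradient_extremalFn hx]; ring
  refine ⟨⟨(isBddMeas_extremalFn l m q).memLp, isWeakGradient_gradient (by omega)
    ((contDiffOn_extremalFn l m q).of_le (by norm_cast)),
    ((((h1.add h2).add h3).add h4).add h5).integrable.congr e⟩, ?_⟩
  rw [← integral_congr_ae e,
    integral_add (by exact (((h1.add h2).add h3).add h4).integrable) (by exact h5.integrable),
    integral_add (by exact ((h1.add h2).add h3).integrable) (by exact h4.integrable),
    integral_add (by exact (h1.add h2).integrable) (by exact h3.integrable),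
    integral_add (by exact h1.integrable) (by exact h2.integrable), integral_const_mul,
    integral_const_mul, integral_const_mul, integral_const_mul, integral_sechLog_sq hd hab hα,
    integral_inner_normalize_mul hd hab hα q (g := fun t => Real.tanh t * (Real.cosh t)⁻¹)
      (fun p => by rw [sechLog_polarPt hα, tanhLog_polarPt hα]),
    integral_inner_normalize_mul_inner_normalize_mul hd hab hα q q
      (g := fun t => Real.tanh t ^ 2) (fun p => by rw [tanhLog_polarPt hα]),
    integral_inner_normalize_mul_inner_normalize_mul hd hab hα q q
      (h := fun _ => 1) (g := fun _ => 1) (fun _ => rfl),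
    integral_tanhLog_sq hd hab hα, real_inner_self_eq_norm_sq]
  simp only [integral_const, probReal_univ, smul_eq_mul]
  field_simp
  ring

/-- The contribution of `m` cancels because tanh attains the constant for all α. The factor left to
`q` is the Felli–Schneider gap, so this single formula yields the extremals and the failure outside
the region. -/
lemma deficit_extremalFn (l m : ℝ) (q : E d) :
    deficit d a b (extremalFn d a b l m q) (gradient (extremalFn d a b l m q))
      = ‖q‖ ^ 2 / d * (d - 1 - alpha d a b ^ 2 * (nDim d a b - 1)) := by
  have hn := nDim_ge hd hab hα
  have hd' : (0 : ℝ) < d := by exact_mod_cast (by omega : 0 < d)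
  rw [deficit, (isH1_extremalFn hd hab hα l m q).2, var_extremalFn hd hab hα,
    tanhNorm_eq hd hab hα, sechNorm_eq hd hab hα]
  field_simp
  ring

end Classical

/-! ### The divergence of homogeneous tangential vector fields -/

section Divergence

variable {d : ℕ}

/-- The standard basis of `ℝ^d`. -/
abbrev stdVec (d : ℕ) (i : Fin d) : E d := EuclideanSpace.basisFun (Fin d) ℝ i

lemma stdVec_inner (x : E d) (i : Fin d) : inner ℝ x (stdVec d i) = x i := by
  simp [stdVec, EuclideanSpace.inner_single_right]

lemma sum_smul_stdVec (x : E d) : ∑ i, x i • stdVec d i = x := by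
  simpa using (EuclideanSpace.basisFun (Fin d) ℝ).sum_repr x

lemma exists_fderiv_cut_eq (j : ℕ) {x : E d} (hx : x ≠ 0) :
    ∃ c : ℝ, fderiv ℝ (cut j) x = c • innerSL ℝ x := by
  have h1 : HasFDerivAt (fun x : E d => Real.log ‖x‖ / (j + 1))
      (((j : ℝ) + 1)⁻¹ • ((‖x‖ ^ 2)⁻¹ • innerSL ℝ x)) x := by
    simpa only [div_eq_inv_mul] using (hasFDerivAt_log_norm hx).const_mul ((j : ℝ) + 1)⁻¹
  have h2 : HasDerivAt logBump (deriv logBump (Real.log ‖x‖ / (j + 1))) (Real.log ‖x‖ / (j + 1)) :=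
    ((logBump.contDiff (n := 1)).differentiable one_ne_zero _).hasDerivAt
  have h3 := (h2.comp_hasFDerivAt x h1).congr_of_eventuallyEq (cut_eventuallyEq hx)
  rw [h3.fderiv, smul_smul, smul_smul]
  exact ⟨_, rfl⟩

/-- The gradient of the radial cutoff is orthogonal to a tangential field, so div(cut · W) = cut ·
div W, and the integral of a compactly supported divergence vanishes. -/
lemma integral_cut_mul_div (hd : 0 < d) {W : Fin d → E d → ℝ}
    (hW : ∀ i, ContDiffOn ℝ 1 (W i) {0}ᶜ) (ht : ∀ x ≠ 0, ∑ i, x i * W i x = 0) (j : ℕ) :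
    ∫ x, cut j x * ∑ i, fderiv ℝ (W i) x (stdVec d i) = 0 := by
  have := nontrivial_euclidean hd
  have hc : ContDiff ℝ 1 (cut (V := E d) j) := (contDiff_cut j).of_le (by norm_cast)
  have hp : ∀ i, ContDiff ℝ 1 fun x => cut j x * W i x := fun i =>
    contDiff_mul_of_tsupport isOpen_compl_singleton hc
      ((tsupport_cut_subset j).trans (annulus_subset _)) (hW i)
  have hs : ∀ i, HasCompactSupport fun x => cut j x * W i x := fun i =>
    (hasCompactSupport_cut j).mul_right
  have h0 : ∫ x, ∑ i, fderiv ℝ (fun x => cut j x * W i x) x (stdVec d i) = 0 := by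
    rw [integral_finsetSum _ fun i _ => (((hp i).continuous_fderiv one_ne_zero).clm_apply
      continuous_const).integrable_of_hasCompactSupport ((hs i).fderiv_apply (𝕜 := ℝ) _)]
    exact Finset.sum_eq_zero fun i _ => integral_fderiv_eq_zero (hp i) (hs i) _
  rw [← h0]
  refine integral_congr_ae ?_
  filter_upwards [ae_ne_zero (E d)] with x hx
  obtain ⟨c, hcx⟩ := exists_fderiv_cut_eq j hx
  have e : ∀ i, fderiv ℝ (fun x => cut j x * W i x) x (stdVec d i)
      = cut j x * fderiv ℝ (W i) x (stdVec d i) + c * (x i * W i x) := fun i => by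
    rw [fderiv_fun_mul (hc.differentiable one_ne_zero x) (((hW i).differentiableOn
      one_ne_zero).differentiableAt (isOpen_compl_singleton.mem_nhds hx)), hcx]
    simp only [add_apply, smul_apply, innerSL_apply_apply, stdVec_inner, smul_eq_mul]
    ring
  rw [Finset.sum_congr rfl fun i _ => e i, Finset.sum_add_distrib, ← Finset.mul_sum,
    ← Finset.mul_sum, ht x hx, mul_zero, add_zero]

/-- In polar coordinates the integral is a product, and its radial factor is positive. Combined with
`integral_cut_mul_div` this is the divergence theorem on the sphere. -/
lemma integral_surf_eq_zero (hd : 0 < d) {D : E d → ℝ} {k : Sph d → ℝ} {s : ℝ}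
    (hD : ∀ p, D (polarPt 1 p) = Real.exp (s * p.1) * k p.2) {j : ℕ}
    (h : ∫ x, cut j x * D x = 0) : ∫ y, k y ∂(surf d) = 0 := by
  set g : ℝ → ℝ := fun t => Real.exp (d * t) * logBump (t / (j + 1)) * Real.exp (s * t) with hg
  have hj : (0 : ℝ) < (j : ℝ) + 1 := by positivity
  have hgc : Continuous g := by
    have := logBump.continuous
    fun_prop
  have hgs : HasCompactSupport g := by
    refine HasCompactSupport.of_support_subset_isCompact
      (isCompact_closedBall (0 : ℝ) (2 * ((j : ℝ) + 1))) fun t ht => ?_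
    by_contra hn
    rw [mem_closedBall_zero_iff, not_le] at hn
    refine ht ?_
    have : logBump (t / ((j : ℝ) + 1)) = 0 := by
      apply logBump.zero_of_le_dist
      rw [dist_zero_right, norm_div, Real.norm_of_nonneg hj.le]
      exact (le_div_iff₀ hj).2 hn.le
    rw [hg]; simp only [this, mul_zero, zero_mul]
  have hpos : 0 < ∫ t, g t := by
    refine hgc.integral_pos_of_hasCompactSupport_nonneg_nonzero hgs
      (fun t => mul_nonneg (mul_nonneg (Real.exp_pos _).le logBump.nonneg) (Real.exp_pos _).le)
      (x := 0) ?_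
    have : logBump ((0 : ℝ) / ((j : ℝ) + 1)) = 1 := by
      apply logBump.one_of_mem_closedBall
      rw [zero_div]
      exact Metric.mem_closedBall_self zero_le_one
    rw [hg]; simp only [this]; positivity
  rw [integral_polar one_pos hd] at h
  have e : ∀ p : ℝ × Sph d, ((1 : ℝ)⁻¹ * Real.exp (d * (p.1 / 1)))
      • (cut j (polarPt 1 p) * D (polarPt 1 p)) = g p.1 * k p.2 := fun p => by
    rw [hD, cut, if_neg (polarPt_ne_zero _ _), norm_polarPt, Real.log_exp, hg, smul_eq_mul, div_one,
      inv_one]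
    ring
  rw [integral_congr_ae (Eventually.of_forall e), integral_prod_mul] at h
  exact (mul_eq_zero.1 h).resolve_left hpos.ne'

lemma laplacian_eq_sum (u : E d → ℝ) (x : E d) :
    Laplacian.laplacian u x = ∑ i, fderiv ℝ (fderiv ℝ u) x (stdVec d i) (stdVec d i) := by
  rw [InnerProductSpace.laplacian_eq_iteratedFDeriv_orthonormalBasis u
    (EuclideanSpace.basisFun (Fin d) ℝ)]
  simp only [iteratedFDeriv_two_apply]
  rfl

lemma sum_sq_fderiv (u : E d → ℝ) (x : E d) :
    ∑ i, fderiv ℝ u x (stdVec d i) ^ 2 = ‖gradient u x‖ ^ 2 := by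
  rw [EuclideanSpace.norm_sq_eq]
  refine Finset.sum_congr rfl fun i _ => ?_
  rw [← inner_gradient_left, stdVec_inner, Real.norm_eq_abs, sq_abs]

variable {u : E d → ℝ} (hu : ContDiffOn ℝ ∞ u {0}ᶜ) (hom : ∀ r : ℝ, 0 < r → ∀ x, u (r • x) = u x)

include hu in
lemma contDiffOn_fderiv_compl : ContDiffOn ℝ ∞ (fderiv ℝ u) {0}ᶜ :=
  hu.fderiv_of_isOpen isOpen_compl_singleton (by simp)

lemma differentiableAt_of_contDiffOn_compl {F : Type*} [NormedAddCommGroup F] [NormedSpace ℝ F]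
    {g : E d → F} (hg : ContDiffOn ℝ ∞ g {0}ᶜ) {x : E d} (hx : x ≠ 0) : DifferentiableAt ℝ g x :=
  (hg.differentiableOn (by simp)).differentiableAt (isOpen_compl_singleton.mem_nhds hx)

include hu hom in
lemma laplacian_of_homogeneous {r : ℝ} (hr : 0 < r) {x : E d} (hx : x ≠ 0) :
    Laplacian.laplacian u x = r ^ 2 * Laplacian.laplacian u (r • x) := by
  have hrx : r • x ≠ 0 := smul_ne_zero hr.ne' hx
  have e : fderiv ℝ u =ᶠ[𝓝 x] fun z => r • fderiv ℝ u (r • z) := by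
    filter_upwards [isOpen_compl_singleton.mem_nhds hx] with z hz
    exact fderiv_smul_of_homogeneous hom hr
      (differentiableAt_of_contDiffOn_compl hu (smul_ne_zero hr.ne' hz))
  have h1 : HasFDerivAt (fun z : E d => r • z) (r • ContinuousLinearMap.id ℝ (E d)) x :=
    (hasFDerivAt_id x).const_smul r
  have h2 := (differentiableAt_of_contDiffOn_compl (contDiffOn_fderiv_compl hu) hrx).hasFDerivAt
  have h3 := ((h2.comp x h1).const_smul r).congr_of_eventuallyEq e
  rw [laplacian_eq_sum, laplacian_eq_sum, h3.fderiv, Finset.mul_sum]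
  refine Finset.sum_congr rfl fun i _ => ?_
  simp only [smul_apply, ContinuousLinearMap.comp_apply, ContinuousLinearMap.id_apply, map_smul,
    smul_eq_mul]
  ring

end Divergence

/-! ### First order spherical harmonics -/

section Harmonics

variable {d : ℕ} {φ : Sph d → ℝ}

lemma homExt_coe (φ : Sph d → ℝ) (y : Sph d) : homExt φ (y : E d) = φ y := by
  rw [homExt, dif_pos (sphere_ne_zero y)]
  congr 1
  ext1
  simp

lemma homExt_smul (φ : Sph d → ℝ) (r : ℝ) (hr : 0 < r) (x : E d) :
    homExt φ (r • x) = homExt φ x := by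
  by_cases hx : x = 0
  · rw [hx, smul_zero]
  · rw [homExt, homExt, dif_pos hx, dif_pos (smul_ne_zero hr.ne' hx)]
    congr 1
    ext1
    simp only
    rw [norm_smul, Real.norm_of_nonneg hr.le, smul_smul, mul_inv, mul_right_comm,
      inv_mul_cancel₀ hr.ne', one_mul]

lemma homExt_eq (φ : Sph d → ℝ) {x : E d} (hx : x ≠ 0) :
    ∃ y : Sph d, (y : E d) = ‖x‖⁻¹ • x ∧ homExt φ x = φ y :=
  ⟨⟨‖x‖⁻¹ • x, by simp [norm_smul, hx]⟩, rfl, by rw [homExt, dif_pos hx]⟩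

lemma homExt_inner (q : E d) (x : E d) :
    homExt (fun y : Sph d => inner ℝ (y : E d) q) x = inner ℝ (‖x‖⁻¹ • x) q := by
  by_cases hx : x = 0
  · rw [homExt, dif_neg (by simpa using hx), hx, smul_zero, inner_zero_left]
  · obtain ⟨y, hy, h⟩ := homExt_eq (fun y : Sph d => inner ℝ (y : E d) q) hx
    rw [h, hy]

/-- An eigenfunction with eigenvalue `l ≠ 0` has mean zero, and its energy is `l` times its squared
norm. -/
lemma IsSphereEigenfunction.integrals (hd : 0 < d) {l : ℝ} (h : IsSphereEigenfunction φ l)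
    (hl : l ≠ 0) :
    ∫ y, φ y ∂(surf d) = 0 ∧
    ∫ y : Sph d, ‖gradient (homExt φ) (y : E d)‖ ^ 2 ∂(surf d) = l * ∫ y, φ y ^ 2 ∂(surf d) := by
  set u := homExt φ with hu
  have hs : ContDiffOn ℝ ∞ u {0}ᶜ := h.smooth
  have hom := homExt_smul φ
  have hfd := contDiffOn_fderiv_compl hs
  have hW : ∀ i, ContDiffOn ℝ ∞ (fun x => fderiv ℝ u x (stdVec d i)) {0}ᶜ := fun i =>
    hfd.clm_apply contDiffOn_const
  have hfW : ∀ x ≠ 0, ∀ i, fderiv ℝ (fun x => fderiv ℝ u x (stdVec d i)) x (stdVec d i)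
      = fderiv ℝ (fderiv ℝ u) x (stdVec d i) (stdVec d i) := fun x hx i => by
    rw [fderiv_clm_apply (differentiableAt_of_contDiffOn_compl hfd hx)
      (differentiableAt_const _)]
    simp
  have ht : ∀ x ≠ 0, ∑ i, x i * fderiv ℝ u x (stdVec d i) = 0 := fun x hx => by
    have h1 := fderiv_apply_self_of_homogeneous hom (differentiableAt_of_contDiffOn_compl hs hx)
    have h2 : fderiv ℝ u x (∑ i, x i • stdVec d i) = 0 := by rw [sum_smul_stdVec]; exact h1
    rw [map_sum] at h2
    simpa only [map_smul, smul_eq_mul] using h2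
  have hlap : ∀ p : ℝ × Sph d, Laplacian.laplacian u (polarPt 1 p)
      = Real.exp (-2 * p.1) * (-(l * φ p.2)) := fun p => by
    have h0 := polarPt_ne_zero 1 p
    have h1 := laplacian_of_homogeneous hs hom (inv_pos.2 (norm_pos_iff.2 h0)) h0
    rw [normalize_polarPt] at h1
    have h2 := h.eigen p.2
    rw [sphereLaplacian] at h2
    rw [h1, ← h2, norm_polarPt, neg_neg, div_one, ← Real.exp_neg, ← Real.exp_nat_mul]
    congr 2; push_cast; ring
  have hu' : ∀ p : ℝ × Sph d, u (polarPt 1 p) = φ p.2 := fun p => by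
    rw [polarPt]; exact (hom _ (Real.exp_pos _) _).trans (homExt_coe φ p.2)
  have hgrad : ∀ p : ℝ × Sph d, ‖gradient u (polarPt 1 p)‖ ^ 2
      = Real.exp (-2 * p.1) * ‖gradient u (p.2 : E d)‖ ^ 2 := fun p => by
    have h0 := polarPt_ne_zero 1 p
    have hr := inv_pos.2 (norm_pos_iff.2 h0)
    have h1 := fderiv_smul_of_homogeneous hom hr (x := polarPt 1 p)
      (differentiableAt_of_contDiffOn_compl hs (smul_ne_zero hr.ne' h0))
    rw [normalize_polarPt, norm_polarPt, div_one, ← Real.exp_neg] at h1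
    rw [norm_gradient, norm_gradient, h1, norm_smul, mul_pow, Real.norm_of_nonneg (Real.exp_pos _).le,
      ← Real.exp_nat_mul]
    congr 2; push_cast; ring
  have hcφ : Continuous φ := by
    have := hs.continuousOn.comp_sphere
    simpa only [hu, homExt_coe] using this
  have hcg : Continuous fun y : Sph d => gradient u (y : E d) :=
    (continuousOn_gradient (hs.of_le (by norm_cast))).comp_sphere
  constructor
  · have h1 := integral_cut_mul_div hd (fun i => (hW i).of_le (by norm_cast)) ht 0
    have h2 := integral_surf_eq_zero hd (D := fun x => Laplacian.laplacian u x)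
      (k := fun y => -(l * φ y)) (s := -2) hlap (j := 0) (by
      rw [← h1]
      refine integral_congr_ae ?_
      have := nontrivial_euclidean hd
      filter_upwards [ae_ne_zero (E d)] with x hx
      rw [laplacian_eq_sum, Finset.sum_congr rfl fun i _ => (hfW x hx i).symm])
    rw [integral_neg, integral_const_mul, neg_eq_zero] at h2
    exact (mul_eq_zero.1 h2).resolve_left hl
  -- The field u ∇u is tangential, and its divergence is |∇u|² + u Δu.
  · have h1 := integral_cut_mul_div hd (W := fun i x => u x * fderiv ℝ u x (stdVec d i))
      (fun i => (hs.mul (hW i)).of_le (by norm_cast)) (fun x hx => by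
        have := ht x hx
        calc _ = u x * ∑ i, x i * fderiv ℝ u x (stdVec d i) := by
              rw [Finset.mul_sum]; exact Finset.sum_congr rfl fun i _ => by ring
          _ = 0 := by rw [this, mul_zero]) 0
    have h2 := integral_surf_eq_zero hd
      (D := fun x => ‖gradient u x‖ ^ 2 + u x * Laplacian.laplacian u x)
      (k := fun y => ‖gradient u (y : E d)‖ ^ 2 - l * φ y ^ 2) (s := -2) (fun p => by
        rw [hgrad, hlap, hu']; ring) (j := 0) (by
      rw [← h1]
      refine integral_congr_ae ?_
      have := nontrivial_euclidean hd
      filter_upwards [ae_ne_zero (E d)] with x hx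
      congr 1
      rw [laplacian_eq_sum, ← sum_sq_fderiv, Finset.mul_sum, ← Finset.sum_add_distrib]
      refine Finset.sum_congr rfl fun i _ => ?_
      rw [fderiv_fun_mul (differentiableAt_of_contDiffOn_compl hs hx)
        (differentiableAt_of_contDiffOn_compl (hW i) hx)]
      simp only [add_apply, smul_apply, smul_eq_mul]
      rw [hfW x hx i]
      ring)
    rw [integral_sub (by exact Continuous.integrable_surf (hcg.norm.pow 2))
      (by exact Continuous.integrable_surf ((hcφ.pow 2).const_mul l)), integral_const_mul] at h2
    linarith

/-- The eigenfunctions with eigenvalue `d - 1` are linear. -/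
theorem IsSphereEigenfunction.exists_eq_inner (hd : 1 < d)
    (h : IsSphereEigenfunction φ ((d : ℝ) - 1)) :
    ∃ q : E d, ∀ y : Sph d, φ y = inner ℝ (y : E d) q := by
  have hd1 : (1 : ℝ) < d := by exact_mod_cast hd
  have hd0 : 0 < d := by omega
  have ha := area_pos hd0
  obtain ⟨h1, h2⟩ := h.integrals hd0 (by linarith)
  have h3 := sphere_poincare hd0 (h.smooth.of_le (by norm_cast)) (homExt_smul φ)
  have hcφ : Continuous φ := by
    have := h.smooth.continuousOn.comp_sphere
    simpa only [homExt_coe] using this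
  simp only [homExt_coe] at h3
  rw [h1, h2] at h3
  set P := ∫ y : Sph d, φ y • (y : E d) ∂(surf d) with hP
  -- The L² projection of φ onto linear functions, since ∫ ⟨y, q⟩⟨y, w⟩ = (area/d) ⟨q, w⟩.
  obtain ⟨q, hq⟩ : ∃ q, q = (d / area d) • P := ⟨_, rfl⟩
  have hi : Integrable (fun y : Sph d => φ y • (y : E d)) (surf d) :=
    Continuous.integrable_surf (by fun_prop)
  have e : ∀ y : Sph d, (φ y - inner ℝ (y : E d) q) ^ 2 = φ y ^ 2
      - 2 * inner ℝ q (φ y • (y : E d)) + inner ℝ (y : E d) q * inner ℝ (y : E d) q := fun y => by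
    rw [real_inner_smul_right, real_inner_comm q]; ring
  have h4 : ∫ y : Sph d, (φ y - inner ℝ (y : E d) q) ^ 2 ∂(surf d)
      = (∫ y, φ y ^ 2 ∂(surf d)) - d / area d * ‖P‖ ^ 2 := by
    simp only [e]
    rw [integral_add (Continuous.integrable_surf (by fun_prop))
        (Continuous.integrable_surf (by fun_prop)),
      integral_sub (Continuous.integrable_surf (by fun_prop))
        (Continuous.integrable_surf (by fun_prop)), integral_const_mul, integral_inner hi, ← hP,
      integral_surf_inner_mul_inner hd0, hq, real_inner_smul_left, real_inner_smul_right,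
      real_inner_self_eq_norm_sq]
    simp only [real_inner_smul_left, real_inner_self_eq_norm_sq]
    field_simp
    ring
  have h5 : ∫ y : Sph d, (φ y - inner ℝ (y : E d) q) ^ 2 ∂(surf d) = 0 := by
    refine le_antisymm ?_ (integral_nonneg fun y => sq_nonneg _)
    rw [h4]
    generalize (∫ y, φ y ^ 2 ∂(surf d)) = A at *
    -- The energy of φ equals (d-1) times its squared norm, so the main terms of `sphere_poincare`
    -- cancel and only the remainder is left.
    have : (d : ℝ) / 8 * (A - d / area d * ‖P‖ ^ 2) ≤ 0 := by
      have e : (0 : ℝ) ^ 2 / area d = 0 := by simp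
      rw [e, sub_zero] at h3
      linarith
    exact nonpos_of_mul_nonpos_right this (by positivity)
  have hc : Continuous fun y : Sph d => (φ y - inner ℝ (y : E d) q) ^ 2 := by fun_prop
  -- Equality almost everywhere of continuous functions then holds at every point.
  have : (surf d).IsOpenPosMeasure := by unfold surf; infer_instance
  rw [integral_eq_zero_iff_of_nonneg (fun y => sq_nonneg _) (Continuous.integrable_surf hc)] at h5
  have h6 := hc.ae_eq_iff_eq (surf d) continuous_const |>.1 h5
  exact ⟨q, fun y => sub_eq_zero.1 (pow_eq_zero_iff two_ne_zero |>.1 (congrFun h6 y))⟩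

/-- The nonzero linear functions are eigenfunctions with eigenvalue `d - 1`. -/
theorem isSphereEigenfunction_inner {q : E d} (hq : q ≠ 0) :
    IsSphereEigenfunction (fun y : Sph d => inner ℝ (y : E d) q) ((d : ℝ) - 1) := by
  have hu : homExt (fun y : Sph d => inner ℝ (y : E d) q)
      = fun x => (inner ℝ (‖x‖⁻¹ • x) q : ℝ) := funext (homExt_inner q)
  have hs : ContDiffOn ℝ ∞ (fun x : E d => (inner ℝ (‖x‖⁻¹ • x) q : ℝ)) {0}ᶜ := fun x hx =>
    ((((contDiffAt_norm ℝ hx).inv (norm_ne_zero_iff.2 hx)).smul contDiffAt_id).inner ℝ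
      contDiffAt_const).contDiffWithinAt
  refine ⟨by rw [hu]; exact hs, fun h0 => ?_, fun y => ?_⟩
  · obtain ⟨y, hy⟩ := exists_sphere_eq hq
    have := congrFun h0 y
    simp only [Pi.zero_apply] at this
    rw [hy, real_inner_smul_left, real_inner_self_eq_norm_sq] at this
    have := norm_ne_zero_iff.2 hq
    simp_all
  · rw [sphereLaplacian, hu, laplacian_eq_sum]
    have hy0 := sphere_ne_zero y
    have hy1 := Sph.norm_eq y
    have hfd := contDiffOn_fderiv_compl hs
    have key : ∀ i, fderiv ℝ (fderiv ℝ (fun x : E d => (inner ℝ (‖x‖⁻¹ • x) q : ℝ))) (y : E d)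
        (stdVec d i) (stdVec d i)
        = 3 * inner ℝ (y : E d) q * (y : E d) i ^ 2 - 2 * ((y : E d) i * q i)
          - inner ℝ (y : E d) q := fun i => by
      have e1 : fderiv ℝ (fderiv ℝ (fun x : E d => (inner ℝ (‖x‖⁻¹ • x) q : ℝ))) (y : E d)
          (stdVec d i) (stdVec d i)
          = fderiv ℝ (fun z => fderiv ℝ (fun x : E d => (inner ℝ (‖x‖⁻¹ • x) q : ℝ)) z
            (stdVec d i)) (y : E d) (stdVec d i) := by
        rw [fderiv_clm_apply (differentiableAt_of_contDiffOn_compl hfd hy0)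
          (differentiableAt_const _)]
        simp
      have e2 : (fun z => fderiv ℝ (fun x : E d => (inner ℝ (‖x‖⁻¹ • x) q : ℝ)) z (stdVec d i))
          =ᶠ[𝓝 (y : E d)] fun z => ‖z‖⁻¹ * q i
            - inner ℝ (‖z‖⁻¹ • z) q * (‖z‖⁻¹ * inner ℝ (‖z‖⁻¹ • z) (stdVec d i)) := by
        filter_upwards [isOpen_compl_singleton.mem_nhds hy0] with z hz
        rw [(hasFDerivAt_inner_normalize hz q).fderiv]
        simp only [sub_apply, smul_apply, innerSL_apply_apply, stdVec_inner, smul_eq_mul,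
          real_inner_smul_left]
        ring
      have h1 : HasFDerivAt (fun z : E d => ‖z‖⁻¹) _ (y : E d) :=
        (hasDerivAt_inv (norm_ne_zero_iff.2 hy0)).comp_hasFDerivAt _ (hasFDerivAt_norm hy0)
      have h2 := (h1.mul_const (q i)).sub ((hasFDerivAt_inner_normalize hy0 q).mul
        (h1.mul (hasFDerivAt_inner_normalize hy0 (stdVec d i))))
      rw [e1, (h2.congr_of_eventuallyEq e2).fderiv]
      have e3 : inner ℝ q (stdVec d i) = q i := stdVec_inner q i
      have e4 : inner ℝ (stdVec d i) (stdVec d i) = (1 : ℝ) := by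
        rw [real_inner_self_eq_norm_sq]; simp [stdVec]
      simp only [add_apply, sub_apply, smul_apply, innerSL_apply_apply, stdVec_inner, smul_eq_mul,
        real_inner_smul_left, hy1, e4]
      simp
      ring
    simp only [key]
    rw [Finset.sum_sub_distrib, Finset.sum_sub_distrib, ← Finset.mul_sum, ← Finset.mul_sum]
    have s1 : ∑ i, (y : E d) i ^ 2 = 1 := by
      have := EuclideanSpace.norm_sq_eq (y : E d)
      rw [hy1] at this
      simpa using this.symm
    have s2 : ∑ i, (y : E d) i * q i = inner ℝ (y : E d) q := by
      rw [PiLp.inner_apply]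
      exact Finset.sum_congr rfl fun i _ => by simp [mul_comm]
    rw [s1, s2]
    simp
    ring

end Harmonics

/-! ### Optimality, sharpness of the condition, and characterization of the extremals. -/

section Main

variable {d : ℕ} {a b : ℝ} (hd : 3 ≤ d) (hab : (a, b) ∈ Theta d) (hα : 0 < alpha d a b)
include hd hab hα

/-- The function `tanh (α ln |x|)` bounds the Poincaré constants from below. -/
theorem le_of_poincare {C : ℝ} (h : Poincare d a b C) :
    1 / (nDim d a b * alpha d a b ^ 2) ≤ C := by
  have hn := nDim_ge hd hab hα
  have hd' : (0 : ℝ) < d := by exact_mod_cast (by omega : 0 < d)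
  obtain ⟨h1, h2⟩ := isH1_extremalFn hd hab hα 0 1 0
  have h3 := h _ _ h1
  rw [h2, var_extremalFn hd hab hα, tanhNorm_eq hd hab hα, sechNorm_eq hd hab hα, norm_zero] at h3
  rw [div_le_iff₀ (by positivity)]
  have e1 : (1 : ℝ) ^ 2 * (nDim d a b + 1)⁻¹
      + nDim d a b / (d * (nDim d a b + 1)) * 0 ^ 2 = (nDim d a b + 1)⁻¹ := by ring
  have e2 : C * (alpha d a b ^ 2 * (1 ^ 2 * (d * (nDim d a b / (d * (nDim d a b + 1))))
      + 0 ^ 2 / d * (nDim d a b + 1)⁻¹) + (1 - 1 / d) * 0 ^ 2)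
      = C * (nDim d a b * alpha d a b ^ 2) * (nDim d a b + 1)⁻¹ := by
    field_simp
    ring
  rw [e1, e2] at h3
  exact (le_mul_iff_one_le_left (by positivity)).1 h3

/-- The functions `⟨q, x / |x|⟩ / cosh (α ln |x|)` violate the Poincaré inequality outside of the
Felli-Schneider region. -/
theorem alpha_sq_le_of_poincare (h : Poincare d a b (1 / (nDim d a b * alpha d a b ^ 2))) :
    alpha d a b ^ 2 * (nDim d a b - 1) ≤ d - 1 := by
  have hd' : (0 : ℝ) < d := by exact_mod_cast (by omega : 0 < d)
  have := nontrivial_euclidean (d := d) (by omega)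
  obtain ⟨q, hq⟩ := exists_ne (0 : E d)
  have h1 := h _ _ (isH1_extremalFn hd hab hα 0 0 q).1
  rw [← deficit_nonneg_iff hd hab hα, deficit_extremalFn hd hab hα] at h1
  have hq' := norm_pos_iff.2 hq
  have h2 := nonneg_of_mul_nonneg_right h1 (by positivity)
  linarith

theorem poincare_iff : Poincare d a b (1 / (nDim d a b * alpha d a b ^ 2)) ↔ (a, b) ∈ ThetaFS d := by
  rw [mem_ThetaFS_iff hd hab hα, alpha_sq_mul_le_iff hd hab hα]
  exact ⟨alpha_sq_le_of_poincare hd hab hα, poincare_of_alpha_sq_le hd hab hα⟩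

lemma isExtremal_extremalFn {l m : ℝ} {q : E d}
    (h : q = 0 ∨ alpha d a b ^ 2 * (nDim d a b - 1) = d - 1) :
    IsExtremal d a b (1 / (nDim d a b * alpha d a b ^ 2)) (extremalFn d a b l m q) := by
  refine ⟨_, (isH1_extremalFn hd hab hα l m q).1, ?_⟩
  rw [← deficit_eq_zero_iff hd hab hα, deficit_extremalFn hd hab hα]
  rcases h with h | h
  · rw [h, norm_zero]; ring
  · rw [h]; ring

theorem isExtremal_iff_of_lt (h : alpha d a b ^ 2 < ((d : ℝ) - 1) / (nDim d a b - 1))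
    (f : E d → ℝ) : IsExtremal d a b (1 / (nDim d a b * alpha d a b ^ 2)) f ↔
      ∃ l m : ℝ, f =ᵐ[volume] fun x => l + m * Real.tanh (alpha d a b * Real.log ‖x‖) := by
  have h' : alpha d a b ^ 2 * (nDim d a b - 1) < d - 1 :=
    (lt_div_iff₀ (by linarith [nDim_ge hd hab hα])).1 h
  have e : ∀ l m : ℝ, (fun x : E d => l + m * Real.tanh (alpha d a b * Real.log ‖x‖))
      = extremalFn d a b l m 0 := fun l m => by
    funext x
    rw [extremalFn, inner_zero_right, zero_mul, add_zero, tanhLog]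
  simp only [e]
  constructor
  · exact fun hf => hf.exists_extremalFn_zero hd hab hα h'
  · rintro ⟨l, m, hf⟩
    exact (isExtremal_extremalFn hd hab hα (Or.inl rfl)).congr_ae hf.symm

theorem isExtremal_iff_of_eq (h : alpha d a b ^ 2 = ((d : ℝ) - 1) / (nDim d a b - 1))
    (f : E d → ℝ) : IsExtremal d a b (1 / (nDim d a b * alpha d a b ^ 2)) f ↔
      ∃ (l m ν : ℝ) (φ : Sph d → ℝ), IsSphereEigenfunction φ ((d : ℝ) - 1) ∧
        f =ᵐ[volume] fun x => l + m * Real.tanh (alpha d a b * Real.log ‖x‖)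
          + ν * (homExt φ x / Real.cosh (alpha d a b * Real.log ‖x‖)) := by
  have h' : alpha d a b ^ 2 * (nDim d a b - 1) = d - 1 :=
    (eq_div_iff (by linarith [nDim_ge hd hab hα])).1 h
  have e : ∀ (l m ν : ℝ) (q : E d), (fun x => l + m * Real.tanh (alpha d a b * Real.log ‖x‖)
      + ν * (homExt (fun y : Sph d => inner ℝ (y : E d) q) x
        / Real.cosh (alpha d a b * Real.log ‖x‖))) = extremalFn d a b l m (ν • q) := fun l m ν q => by
    funext x
    rw [extremalFn, homExt_inner, real_inner_smul_right, sechLog, tanhLog]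
    ring
  constructor
  · intro hf
    obtain ⟨l, m, q, hq⟩ := hf.exists_extremalFn hd hab hα h'.le
    -- Eigenfunctions are nonzero by definition, so for q = 0 any eigenfunction is taken, with ν =
    -- 0.
    by_cases hq0 : q = 0
    · have := nontrivial_euclidean (d := d) (by omega)
      obtain ⟨q', hq'⟩ := exists_ne (0 : E d)
      refine ⟨l, m, 0, _, isSphereEigenfunction_inner hq', ?_⟩
      rwa [e, zero_smul, ← hq0]
    · refine ⟨l, m, 1, _, isSphereEigenfunction_inner hq0, ?_⟩
      rwa [e, one_smul]
  · rintro ⟨l, m, ν, φ, hφ, hf⟩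
    obtain ⟨q, hq⟩ := hφ.exists_eq_inner (by omega)
    rw [funext hq, e] at hf
    exact (isExtremal_extremalFn hd hab hα (Or.inr h')).congr_ae hf.symm

end Main

end CKN

end

theorem proposition2 (d : ℕ) (hd : 3 ≤ d) (a b : ℝ) (hab : (a, b) ∈ CKN.Theta d)
    (hα : 0 < CKN.alpha d a b) :
    -- the Poincaré inequality holds, with this constant as the optimal one,
    -- exactly under the Felli-Schneider condition
    (IsLeast {C : ℝ | CKN.Poincare d a b C} (1 / (CKN.nDim d a b * CKN.alpha d a b ^ 2)) ↔
      (a, b) ∈ CKN.ThetaFS d) ∧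
    (CKN.Poincare d a b (1 / (CKN.nDim d a b * CKN.alpha d a b ^ 2)) ↔
      (a, b) ∈ CKN.ThetaFS d) ∧
    -- the Felli-Schneider condition in terms of `α` and `n`
    ((a, b) ∈ CKN.ThetaFS d ↔
      CKN.alpha d a b ^ 2 ≤ ((d : ℝ) - 1) / (CKN.nDim d a b - 1)) ∧
    -- extremals in the strict case
    (CKN.alpha d a b ^ 2 < ((d : ℝ) - 1) / (CKN.nDim d a b - 1) →
      ∀ f : CKN.E d → ℝ,
        CKN.IsExtremal d a b (1 / (CKN.nDim d a b * CKN.alpha d a b ^ 2)) f ↔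
          ∃ l m : ℝ, f =ᵐ[MeasureTheory.volume]
            fun x => l + m * Real.tanh (CKN.alpha d a b * Real.log ‖x‖)) ∧
    -- extremals in the limiting case
    (CKN.alpha d a b ^ 2 = ((d : ℝ) - 1) / (CKN.nDim d a b - 1) →
      ∀ f : CKN.E d → ℝ,
        CKN.IsExtremal d a b (1 / (CKN.nDim d a b * CKN.alpha d a b ^ 2)) f ↔
          ∃ (l m ν : ℝ) (φ : Metric.sphere (0 : CKN.E d) 1 → ℝ),
            CKN.IsSphereEigenfunction φ ((d : ℝ) - 1) ∧
            f =ᵐ[MeasureTheory.volume]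
              fun x => l + m * Real.tanh (CKN.alpha d a b * Real.log ‖x‖)
                + ν * (CKN.homExt φ x / Real.cosh (CKN.alpha d a b * Real.log ‖x‖))) := by
  -- The lower bound on admissible constants holds for all parameters, so being least amounts to
  -- being admissible.
  refine ⟨⟨fun h => (CKN.poincare_iff hd hab hα).1 h.1, fun h =>
      ⟨(CKN.poincare_iff hd hab hα).2 h, fun C hC => CKN.le_of_poincare hd hab hα hC⟩⟩,
    CKN.poincare_iff hd hab hα, CKN.mem_ThetaFS_iff hd hab hα,
    CKN.isExtremal_iff_of_lt hd hab hα, CKN.isExtremal_iff_of_eq hd hab hα⟩
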